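/- Let $(M^n,g)$ be a connected smooth $n$-dimensional Riemannian manifold without boundary (not necessarily complete), with Riemannian distance $d$ and volume measure $\mu$; let $V$ be a neighbourhood of a point $p\in M$ and let $x^1,\dots,x^n$ be geodesic normal coordinates centred at $p$. Write $\mathrm{Rm}$, $\mathrm{Rc}$, $\mathrm{Sc}$ for the curvature tensor, the Ricci tensor and the scalar curvature (positive on round spheres), $|\mathrm{Rm}|^2=R_{ijkl}R^{ijkl}$, and $\Delta$ for the Laplace–Beltrami operator (the trace of the Hessian). For a function $u$ on $M$ and $t>0$ put $$\mathcal L(V,g,u,t)=4t\int_V|\nabla u|^2d\mu-\int_V u^2\log u^2\,d\mu+\Big(\int_V u^2d\mu\Big)\log\Big(\int_V u^2d\mu\Big)-\Big(n+\frac n2\log(4\pi t)\Big)\int_V u^2d\mu,$$ $$\mathcal W(V,g,u,t)=\mathcal L(V,g,u,t)+t\int_V \mathrm{Sc}\,u^2\,d\mu .$$ Consider $u(x,t)=(4\pi t)^{-n/4}e^{-d(p,x)^2/(8t)}\eta(x,t)$, where $\eta$ satisfies, for some $T>0$: 1. There is a compact set $K\subset V$ such that, for $0<t<T$, the function $\eta(\cdot,t)$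 is differentiable on $M$ and vanishes outside $K$; moreover $|\eta|$ and $|\nabla\eta|$ are bounded on $M\times(0,T)$. 2. There are functions $\phi_0,\phi_1,\phi_2$ on $M$ such that, as $(x,t)\to(p,0)$ with $t>0$, $$\eta(x,t)^2=\phi_0(x)+\phi_1(x)t+\phi_2(x)t^2+o(t^2),\qquad |\nabla(\eta^2)(x,t)-\nabla\phi_0(x)|=O(t),$$ where $\phi_0$ is four times differentiable at $p$, $\phi_1$ is twice differentiable at $p$, and $\phi_2$ is continuous at $p$. 3. There is a symmetric matrix $a=(a_{ij})$ such that $\phi_0(x)=1+\sum_{i,j}a_{ij}x^ix^j+o(d(p,x)^2)$ as $x\to p$. Let $\alpha=\phi_1(p)$, and let $|a-\frac13\mathrm{Rc}(p)|^2=\sum_{i,j}(a_{ij}-\frac13R_{ij}(p))^2$, with the components of $\mathrm{Rc}(p)$ in the coordinates $x^i$. Then, for all sufficiently small $t>0$, all integrals in $\mathcal L(V,g,u,t)$ and $\mathcal W(V,g,u,t)$ converge, and as $t\to0^+$ $$\mathcal L(V,g,u,t)=-\mathrm{Sc}(p)\,t-\Big(\Delta\mathrm{Sc}(p)-\tfrac13\mathrm{Sc}(p)^2+2\,\mathrm{tr}(a)\,\mathrm{Sc}(p)+\alpha\,\mathrm{Sc}(p)+\tfrac16|\mathrm{Rm}|^2(p)-4\big|a-\tfrac13\mathrm{Rc}(p)\big|^2\Big)t^2+o(t^2),$$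 $$\mathcal W(V,g,u,t)=-\Big(\tfrac16|\mathrm{Rm}|^2(p)-4\big|a-\tfrac13\mathrm{Rc}(p)\big|^2\Big)t^2+o(t^2).$$ -/

import Mathlib

open MeasureTheory Filter Asymptotics Set Bundle
open scoped Manifold ContDiff Topology Bundle

/-- The coordinate space `ℝⁿ`. -/
abbrev Coord (n : ℕ) : Type := EuclideanSpace ℝ (Fin n)

/-! ### Coordinate formulas for a metric `G = (g_ij)` on (an open subset of) `ℝⁿ` -/

namespace CoordMetric

noncomputable section

variable {n : ℕ}

/-- The partial derivative `∂_i f`. -/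
def pderiv (i : Fin n) (f : Coord n → ℝ) (y : Coord n) : ℝ :=
  fderiv ℝ f y (EuclideanSpace.single i 1)

/-- `Γ^k_ij = ½ g^{kl} (∂_i g_jl + ∂_j g_il - ∂_l g_ij)`. -/
def christoffel (G : Coord n → Matrix (Fin n) (Fin n) ℝ) (k i j : Fin n) (y : Coord n) : ℝ :=
  (1 / 2) * ∑ l, (G y)⁻¹ k l *
    (pderiv i (fun z => G z j l) y + pderiv j (fun z => G z i l) y - pderiv l (fun z => G z i j) y)

/-- `R^l_ijk`, where `R(∂_i, ∂_j) ∂_k = R^l_ijk ∂_l` and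
`R(X, Y) Z = ∇_X ∇_Y Z - ∇_Y ∇_X Z - ∇_[X,Y] Z`. -/
def riemannUp (G : Coord n → Matrix (Fin n) (Fin n) ℝ) (l i j k : Fin n) (y : Coord n) : ℝ :=
  pderiv i (christoffel G l j k) y - pderiv j (christoffel G l i k) y +
    ∑ m, (christoffel G l i m y * christoffel G m j k y -
      christoffel G l j m y * christoffel G m i k y)

/-- `R_ijkl = g(R(∂_i, ∂_j) ∂_k, ∂_l)`. -/
def riemann (G : Coord n → Matrix (Fin n) (Fin n) ℝ) (i j k l : Fin n) (y : Coord n) : ℝ :=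
  ∑ m, G y l m * riemannUp G m i j k y

/-- The Ricci tensor `R_jk`: the trace of `X ↦ R(X, ∂_j) ∂_k` (positive on round spheres). -/
def ricci (G : Coord n → Matrix (Fin n) (Fin n) ℝ) (j k : Fin n) (y : Coord n) : ℝ :=
  ∑ i, riemannUp G i i j k y

/-- The scalar curvature `g^{jk} R_jk`. -/
def scalar (G : Coord n → Matrix (Fin n) (Fin n) ℝ) (y : Coord n) : ℝ :=
  ∑ j, ∑ k, (G y)⁻¹ j k * ricci G j k y

/-- `|Rm|² = R_ijkl R^ijkl`. -/
def riemannNormSq (G : Coord n → Matrix (Fin n) (Fin n) ℝ) (y : Coord n) : ℝ :=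
  ∑ i, ∑ j, ∑ k, ∑ l, ∑ i', ∑ j', ∑ k', ∑ l',
    (G y)⁻¹ i i' * (G y)⁻¹ j j' * (G y)⁻¹ k k' * (G y)⁻¹ l l' *
      riemann G i j k l y * riemann G i' j' k' l' y

/-- The Laplace–Beltrami operator `Δ f = g^{ij} (∂_i ∂_j f - Γ^k_ij ∂_k f)`. -/
def laplace (G : Coord n → Matrix (Fin n) (Fin n) ℝ) (f : Coord n → ℝ) (y : Coord n) : ℝ :=
  ∑ i, ∑ j, (G y)⁻¹ i j *
    (pderiv i (pderiv j f) y - ∑ k, christoffel G k i j y * pderiv k f y)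

/-- The geodesic equation `c''^k + Γ^k_ij(c) c'^i c'^j = 0` at the parameter `s`. -/
def GeodesicEqAt (G : Coord n → Matrix (Fin n) (Fin n) ℝ) (c : ℝ → Coord n) (s : ℝ) : Prop :=
  ∀ k, deriv (deriv fun r => c r k) s +
    ∑ i, ∑ j, christoffel G k i j (c s) * deriv (fun r => c r i) s * deriv (fun r => c r j) s = 0

/-- `f` is `k` times differentiable at `y` (in the Fréchet sense): the derivatives of order `< k - 1`
are differentiable near `y`, and those of order `< k` are differentiable at `y`. -/
def TimesDifferentiableAt (k : ℕ) (f : Coord n → ℝ) (y : Coord n) : Prop :=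
  (∀ m, m + 1 < k → ∀ᶠ z in 𝓝 y, DifferentiableAt ℝ (iteratedFDeriv ℝ m f) z) ∧
    ∀ m, m < k → DifferentiableAt ℝ (iteratedFDeriv ℝ m f) y

end

end CoordMetric

/-! ### Riemannian manifolds -/

namespace Riem

noncomputable section

open CoordMetric

variable {n : ℕ} {M : Type*} [TopologicalSpace M] [ChartedSpace (Coord n) M]

/-- The differential `df_x : T_x M → ℝ` of a real function. -/
def differential (n : ℕ) {M : Type*} [TopologicalSpace M] [ChartedSpace (Coord n) M]
    (f : M → ℝ) (x : M) : TangentSpace (𝓡 n) x →L[ℝ] ℝ :=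
  mfderiv (𝓡 n) 𝓘(ℝ, ℝ) f x

/-- The coordinate vector field `∂_i` of the chart `e`, at the point with coordinates `y`. -/
def coordVector (e : OpenPartialHomeomorph M (Coord n)) (y : Coord n) (i : Fin n) :
    TangentSpace (𝓡 n) (e.symm y) :=
  mfderiv (𝓡 n) (𝓡 n) e.symm y (EuclideanSpace.single i 1 : Coord n)

variable [RiemannianBundle (fun x : M => TangentSpace (𝓡 n) x)] [IsManifold (𝓡 n) ∞ M]

/-- The components `g_ij = g(∂_i, ∂_j)` of the metric in the chart `e`, as functions of the
coordinates. -/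
def gram (e : OpenPartialHomeomorph M (Coord n)) (y : Coord n) : Matrix (Fin n) (Fin n) ℝ :=
  Matrix.of fun i j => inner ℝ (coordVector e y i) (coordVector e y j)

/-- The length `|∇f|(x)` of the gradient, i.e. the norm of `df_x` dual to the norm of `T_x M`. -/
def gradNorm (n : ℕ) {M : Type*} [TopologicalSpace M] [ChartedSpace (Coord n) M]
    [RiemannianBundle (fun x : M => TangentSpace (𝓡 n) x)] [IsManifold (𝓡 n) ∞ M]
    (f : M → ℝ) (x : M) : ℝ :=
  ‖differential n f x‖

/-- The scalar curvature `Sc(x)`, computed in the preferred chart at `x`. -/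
def scalarCurvature (n : ℕ) {M : Type*} [TopologicalSpace M] [ChartedSpace (Coord n) M]
    [RiemannianBundle (fun x : M => TangentSpace (𝓡 n) x)] [IsManifold (𝓡 n) ∞ M] (x : M) : ℝ :=
  scalar (gram (chartAt (Coord n) x)) (chartAt (Coord n) x x)

/-- `|Rm|²(x)`, computed in the preferred chart at `x`. -/
def curvatureNormSq (n : ℕ) {M : Type*} [TopologicalSpace M] [ChartedSpace (Coord n) M]
    [RiemannianBundle (fun x : M => TangentSpace (𝓡 n) x)] [IsManifold (𝓡 n) ∞ M] (x : M) : ℝ :=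
  riemannNormSq (gram (chartAt (Coord n) x)) (chartAt (Coord n) x x)

/-- `Δ f (x)`, computed in the preferred chart at `x`. -/
def laplacian (n : ℕ) {M : Type*} [TopologicalSpace M] [ChartedSpace (Coord n) M]
    [RiemannianBundle (fun x : M => TangentSpace (𝓡 n) x)] [IsManifold (𝓡 n) ∞ M]
    (f : M → ℝ) (x : M) : ℝ :=
  laplace (gram (chartAt (Coord n) x)) (f ∘ (chartAt (Coord n) x).symm) (chartAt (Coord n) x x)

/-- `e` is a chart of geodesic normal coordinates centred at `p`: a smooth chart with `e p = 0`
whose coordinate frame is orthonormal at `p` and for which every ray `s ↦ s v` (`0 ≤ s ≤ 1`) in the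
star-shaped image is a geodesic. In other words `e.symm v = exp_p (v^i E_i)` for an orthonormal
basis `(E_i)` of `T_p M`. -/
structure IsNormalChart (e : OpenPartialHomeomorph M (Coord n)) (p : M) : Prop where
  mem_maximalAtlas : e ∈ IsManifold.maximalAtlas (𝓡 n) ∞ M
  mem_source : p ∈ e.source
  map_center : e p = 0
  starConvex : StarConvex ℝ 0 e.target
  orthonormal : gram e 0 = 1
  geodesic : ∀ v ∈ e.target, ∀ s ∈ Icc (0 : ℝ) 1, GeodesicEqAt (gram e) (fun r => r • v) s

/-- The measure `√det(g_ij) dy` on the domain of the chart `e`, extended by zero to `M`. -/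
def chartVolume [MeasurableSpace M] (e : OpenPartialHomeomorph M (Coord n)) : Measure M :=
  ((volume.restrict e.target).withDensity
    fun y => ENNReal.ofReal (Real.sqrt (gram e y).det)).map e.symm

/-- The Riemannian volume measure. The measures `√det(g_ij) dy` of two charts agree on the overlap
of the chart domains; the volume is their common extension, i.e. the least measure that dominates
all of them. -/
def volumeMeasure (n : ℕ) (M : Type*) [TopologicalSpace M] [ChartedSpace (Coord n) M]
    [RiemannianBundle (fun x : M => TangentSpace (𝓡 n) x)] [IsManifold (𝓡 n) ∞ M]
    [MeasurableSpace M] : Measure M :=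
  ⨆ x : M, chartVolume (chartAt (Coord n) x)

/-- The logarithmic Sobolev functional `𝓛(V, g, u, t)`. -/
def logSobolev (n : ℕ) {M : Type*} [TopologicalSpace M] [ChartedSpace (Coord n) M]
    [RiemannianBundle (fun x : M => TangentSpace (𝓡 n) x)] [IsManifold (𝓡 n) ∞ M]
    [MeasurableSpace M] (V : Set M) (u : M → ℝ) (t : ℝ) : ℝ :=
  4 * t * (∫ x in V, gradNorm n u x ^ 2 ∂volumeMeasure n M)
    - (∫ x in V, u x ^ 2 * Real.log (u x ^ 2) ∂volumeMeasure n M)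
    + (∫ x in V, u x ^ 2 ∂volumeMeasure n M) * Real.log (∫ x in V, u x ^ 2 ∂volumeMeasure n M)
    - (n + n / 2 * Real.log (4 * Real.pi * t)) * ∫ x in V, u x ^ 2 ∂volumeMeasure n M

/-- Perelman's functional `𝓦(V, g, u, t)`. -/
def perelmanW (n : ℕ) {M : Type*} [TopologicalSpace M] [ChartedSpace (Coord n) M]
    [RiemannianBundle (fun x : M => TangentSpace (𝓡 n) x)] [IsManifold (𝓡 n) ∞ M]
    [MeasurableSpace M] (V : Set M) (u : M → ℝ) (t : ℝ) : ℝ :=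
  logSobolev n V u t + t * ∫ x in V, scalarCurvature n x * u x ^ 2 ∂volumeMeasure n M

/-- All the integrals that occur in `𝓛(V, g, u, t)` and `𝓦(V, g, u, t)` converge. -/
structure HasFiniteEnergy (n : ℕ) {M : Type*} [TopologicalSpace M] [ChartedSpace (Coord n) M]
    [RiemannianBundle (fun x : M => TangentSpace (𝓡 n) x)] [IsManifold (𝓡 n) ∞ M]
    [MeasurableSpace M] (V : Set M) (u : M → ℝ) : Prop where
  grad : IntegrableOn (fun x => gradNorm n u x ^ 2) V (volumeMeasure n M)
  entropy : IntegrableOn (fun x => u x ^ 2 * Real.log (u x ^ 2)) V (volumeMeasure n M)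
  mass : IntegrableOn (fun x => u x ^ 2) V (volumeMeasure n M)
  scalar : IntegrableOn (fun x => scalarCurvature n x * u x ^ 2) V (volumeMeasure n M)

/-- The test function `u(x, t) = (4πt)^{-n/4} e^{-d(p,x)²/(8t)} η(x, t)`. -/
def testFunction (n : ℕ) {M : Type*} [MetricSpace M] (p : M) (η : M → ℝ → ℝ) (t : ℝ) (x : M) : ℝ :=
  (4 * Real.pi * t) ^ (-(n : ℝ) / 4) * Real.exp (-(dist p x ^ 2 / (8 * t))) * η x t

end

end Riem

/-! In normal coordinates the distance to `p` is the Euclidean norm. Near `p` the measure `u² dμ` is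
therefore `H_t(y) θ(y, t) k(y) dy`, where `H_t` is the Euclidean heat kernel, `θ = η²`, and `k` is
the density `√det g`, cut off away from the origin. Outside any neighbourhood of `p` all integrands
are bounded by a Gaussian tail, hence smaller than every power of `t` (`IsCutoff.localization`).
Everything reduces to averages against `H_t`. For smooth compactly supported `f` such an average is
`f(0) + t Δf(0) + t²/2 Δ²f(0) + o(t²)`, by the heat equation and L'Hôpital's rule.

By the Gauss lemma the energy density is `H_t (t P - y·∂θ + θ|y|²/(2t) - nθ - θ log θ)` with `P =
4|∇η|²` (`IsNormalChart.energyDensity_symm`). Since `∂_i H_t = -(y_i/2t) H_t`, integration by parts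
turns the three middle terms into the average of `(y·∂k) θ` (`avg_radial_parts`). Now `k` is
critical at the origin, so `y·∂k` is quadratically small, and `t P` carries its own factor `t`. In
`θ log θ = (θ - 1) + (θ - 1)²/2 + ...` the linear part cancels against the linear part of `m log m`,
where `m` is the total mass; what remains is the average of `k`, minus one. Consequently only `θ = 1
+ a(y,y) + α t + o(|y|² + t)` matters: `φ₂` and the higher Taylor coefficients of `φ₀` and `φ₁` drop
out (`IsAmplitude.energy_expansion`).

The geometry enters through the fourth-order jet of `k`. Differentiating the Gauss lemma `g_ij y^j =
y^i` at the origin gives symmetrization identities for the second and fourth derivatives of the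
metric. They express curvature through the second derivatives and yield `∂_i∂_j k = -R_ij/3`. The
fourth derivatives of the metric enter both `Δ²√det g` and `ΔSc` only through one contraction;
eliminating it gives `Δ²k = 2/5 (-ΔSc + 5/18 Sc² - |Rm|²/6 + 4/9 |Rc|²)` at the origin
(`IsGaussMetric.bilaplacian_density_zero`).

In the sum, `4/9 |Rc|² - 8/3 ⟨Rc, a⟩ + 4|a|²` is the complete square `4|a - Rc/3|²`, and the
quadratic term of `m log m` removes `(tr a)²`, `α tr a` and `α²`. For `𝓦`, the expansion of `t ∫ Sc
u²` cancels all remaining terms that contain the scalar curvature.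

The scalar invariants are defined through preferred charts and the volume as a supremum over such
charts, so their values in the normal chart rest on the transformation laws (`IsPullback`) and on
the agreement of chart volumes on overlaps. -/

/-! ### Gaussian averages on `ℝⁿ` -/

namespace GaussianAverage

noncomputable section

open CoordMetric

variable {n : ℕ}

/-- The Euclidean heat kernel `(4πt)^{-n/2} e^{-|y|²/(4t)}`. -/
def heatKernel (t : ℝ) (y : Coord n) : ℝ :=
  (4 * Real.pi * t) ^ (-(n : ℝ) / 2) * Real.exp (-(‖y‖ ^ 2 / (4 * t)))

/-- The Euclidean Laplacian. -/
def flatLaplacian (f : Coord n → ℝ) (y : Coord n) : ℝ := ∑ i, pderiv i (pderiv i f) y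

theorem heatKernel_nonneg {t : ℝ} (ht : 0 < t) (y : Coord n) : 0 ≤ heatKernel t y := by
  unfold heatKernel; positivity

theorem continuous_heatKernel (t : ℝ) : Continuous (heatKernel t : Coord n → ℝ) := by
  unfold heatKernel; fun_prop

/-- The substitution `y = √t z` replaces the weight by the fixed Gaussian `heatKernel 1`; the
dependence on `t` moves into the argument of `f`, where it can be differentiated. -/
theorem integral_heatKernel_scale {t : ℝ} (ht : 0 < t) (f : Coord n → ℝ) :
    ∫ y, heatKernel t y * f y = ∫ z, heatKernel 1 z * f (√t • z) := by
  have hs : 0 < √t := Real.sqrt_pos.2 ht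
  have h1 : ∀ z : Coord n, heatKernel 1 z = √t ^ n * heatKernel t (√t • z) := by
    intro z
    unfold heatKernel
    rw [norm_smul, mul_pow, Real.norm_of_nonneg hs.le, Real.sq_sqrt ht.le, mul_one, mul_one,
      Real.mul_rpow (x := 4 * Real.pi) (by positivity) ht.le, ← mul_assoc, ← mul_assoc,
      mul_comm (√t ^ n), mul_assoc _ (√t ^ n)]
    have : √t ^ n * t ^ (-(n : ℝ) / 2) = 1 := by
      rw [Real.sqrt_eq_rpow, ← Real.rpow_natCast, ← Real.rpow_mul ht.le, ← Real.rpow_add ht]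
      rw [show (1 / 2 * (n : ℝ) + -n / 2) = 0 by ring, Real.rpow_zero]
    rw [this, mul_one]
    congr 3
    field_simp
  have h2 := Measure.integral_comp_smul (volume : Measure (Coord n))
    (fun y => heatKernel t y * f y) (√t)
  simp only [finrank_euclideanSpace, Fintype.card_fin] at h2
  simp_rw [h1, mul_assoc]
  rw [integral_const_mul, h2, abs_of_pos (by positivity), smul_eq_mul, ← mul_assoc,
    mul_inv_cancel₀ (by positivity), one_mul]

theorem integrable_exp_neg_mul_norm_sq {b : ℝ} (hb : 0 < b) :
    Integrable fun z : Coord n => Real.exp (-b * ‖z‖ ^ 2) := by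
  have := (GaussianFourier.integrable_cexp_neg_mul_sq_norm_add (V := Coord n) (b := b)
    (by simpa using hb) 0 0).norm
  refine this.congr (Eventually.of_forall fun z => ?_)
  simp only [Complex.norm_exp]
  congr 1
  simp [← Complex.ofReal_pow]

theorem integrable_heatKernel_one_mul_norm_pow (m : ℕ) :
    Integrable fun z : Coord n => heatKernel 1 z * ‖z‖ ^ m := by
  -- For large `s`, half of the Gaussian exponent absorbs the power. Below the threshold the
  -- integrand is bounded, hence dominated by a constant multiple of the same slower Gaussian.
  have h : ∀ᶠ s : ℝ in atTop, s ^ m * Real.exp (-(s ^ 2 / 4)) ≤ Real.exp (-(1 / 8) * s ^ 2) := by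
    have h1 := (Real.tendsto_pow_mul_exp_neg_atTop_nhds_zero m)
    filter_upwards [h1.eventually (gt_mem_nhds one_pos), eventually_ge_atTop 8] with s hs h8
    have h2 : Real.exp (-(s ^ 2 / 4)) ≤ Real.exp (-s) * Real.exp (-(1 / 8) * s ^ 2) := by
      rw [← Real.exp_add]; apply Real.exp_le_exp.2; nlinarith
    calc _ ≤ s ^ m * (Real.exp (-s) * Real.exp (-(1 / 8) * s ^ 2)) := by gcongr
      _ = (s ^ m * Real.exp (-s)) * Real.exp (-(1 / 8) * s ^ 2) := by ring
      _ ≤ 1 * Real.exp (-(1 / 8) * s ^ 2) := by gcongr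
      _ = _ := one_mul _
  obtain ⟨S, hS⟩ := eventually_atTop.1 h
  set S' := max S 0
  set c : ℝ := (4 * Real.pi * 1) ^ (-(n : ℝ) / 2)
  have hc : 0 ≤ c := by positivity
  refine Integrable.mono' (g := fun z => c * (1 + S' ^ m * Real.exp ((1/8) * S' ^ 2)) *
    Real.exp (-(1 / 8) * ‖z‖ ^ 2)) ((integrable_exp_neg_mul_norm_sq (by norm_num)).const_mul _)
    ((continuous_heatKernel 1).mul (by fun_prop)).aestronglyMeasurable
    (Eventually.of_forall fun z => ?_)
  rw [Real.norm_of_nonneg (mul_nonneg (heatKernel_nonneg one_pos z) (by positivity))]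
  change c * _ * _ ≤ _
  rw [mul_assoc c, mul_assoc c]
  refine mul_le_mul_of_nonneg_left ?_ hc
  rw [mul_one, mul_comm]
  have e1 := Real.exp_pos (-(1 / 8) * ‖z‖ ^ 2)
  rcases le_total S ‖z‖ with hz | hz
  · refine (hS _ hz).trans ?_
    have : 0 ≤ S' ^ m * Real.exp ((1/8) * S' ^ 2) := by positivity
    nlinarith
  · have hz' : ‖z‖ ≤ S' := hz.trans (le_max_left _ _)
    have h3 : 1 ≤ Real.exp ((1/8) * S' ^ 2) * Real.exp (-(1 / 8) * ‖z‖ ^ 2) := by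
      rw [← Real.exp_add]
      apply Real.one_le_exp
      nlinarith [norm_nonneg z]
    calc ‖z‖ ^ m * Real.exp (-(‖z‖ ^ 2 / 4)) ≤ S' ^ m * 1 := by
          gcongr
          rw [Real.exp_le_one_iff]
          have := sq_nonneg ‖z‖
          linarith
      _ ≤ S' ^ m * (Real.exp ((1/8) * S' ^ 2) * Real.exp (-(1 / 8) * ‖z‖ ^ 2)) := by
          gcongr
      _ ≤ _ := by nlinarith

theorem integral_heatKernel_one : ∫ z : Coord n, heatKernel 1 z = 1 := by
  unfold heatKernel
  rw [integral_const_mul]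
  have := GaussianFourier.integral_rexp_neg_mul_sq_norm (V := Coord n) (b := 1 / 4) (by norm_num)
  simp only [finrank_euclideanSpace, Fintype.card_fin] at this
  have h2 : ∀ z : Coord n, -(‖z‖ ^ 2 / (4 * 1)) = -(1/4) * ‖z‖ ^ 2 := fun z => by ring
  simp_rw [h2, this]
  rw [show (4 * Real.pi * 1) = Real.pi / (1/4) by ring, ← Real.rpow_add (by positivity)]
  rw [show (-(n : ℝ) / 2 + n / 2) = 0 by ring, Real.rpow_zero]

theorem integrable_heatKernel_one : Integrable (heatKernel 1 : Coord n → ℝ) := by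
  simpa using integrable_heatKernel_one_mul_norm_pow (n := n) 0

theorem integrable_heatKernel_one_mul_pow (k : ℕ) :
    Integrable fun z : Coord n => heatKernel 1 z * (‖z‖ ^ 2 + 1) ^ k := by
  simp_rw [add_pow, Finset.mul_sum]
  refine integrable_finsetSum _ fun i _ => ?_
  have := (integrable_heatKernel_one_mul_norm_pow (n := n) (2 * i)).mul_const (k.choose i : ℝ)
  refine this.congr (Eventually.of_forall fun z => ?_)
  simp [pow_mul, mul_assoc]

theorem integrable_heatKernel_mul_iff {t : ℝ} (ht : 0 < t) (f : Coord n → ℝ) :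
    Integrable (fun y => heatKernel t y * f y) ↔
      Integrable (fun z => heatKernel 1 z * f (√t • z)) := by
  have hs : 0 < √t := Real.sqrt_pos.2 ht
  have h1 : ∀ z : Coord n, heatKernel 1 z * f (√t • z) =
      ((4 * Real.pi * 1) ^ (-(n : ℝ) / 2) / (4 * Real.pi * t) ^ (-(n : ℝ) / 2)) *
        (heatKernel t (√t • z) * f (√t • z)) := by
    intro z
    unfold heatKernel
    rw [norm_smul, mul_pow, Real.norm_of_nonneg hs.le, Real.sq_sqrt ht.le]
    have : (4 * Real.pi * t) ^ (-(n : ℝ) / 2) ≠ 0 := by positivity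
    have h3 : t * ‖z‖ ^ 2 / (4 * t) = ‖z‖ ^ 2 / (4 * 1) := by field_simp
    rw [h3]
    field_simp
  simp_rw [h1]
  rw [integrable_const_mul_iff (by apply Ne.isUnit; positivity)]
  exact (integrable_comp_smul_iff (volume : Measure (Coord n))
    (fun y => heatKernel t y * f y) hs.ne').symm

/-- Gaussian averages of a function that is `o((|y|² + t)^k)` at the origin. -/
theorem integral_heatKernel_isLittleO {F : ℝ → Coord n → ℝ} {k N : ℕ} {C : ℝ}
    (hF : (fun q : Coord n × ℝ => F q.2 q.1) =o[𝓝 0 ×ˢ 𝓝[>] 0] fun q => (‖q.1‖ ^ 2 + q.2) ^ k)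
    (hC : ∀ᶠ t in 𝓝[>] (0 : ℝ), ∀ y, |F t y| ≤ C * (1 + ‖y‖ ^ N)) :
    (fun t => ∫ y, heatKernel t y * F t y) =o[𝓝[>] 0] fun t => t ^ k := by
  set c₁ := ∫ z : Coord n, heatKernel 1 z * (‖z‖ ^ 2 + 1) ^ k
  -- Outside a ball of radius `δ`, where only polynomial growth is known, `F` is bounded by `D ‖y‖ ^
  -- m`. The exponent exceeds `N + 2k`, so after scaling this contributes `√t ^ m ≤ √t * t ^ k`,
  -- which is negligible.
  set m := N + 2 * k + 2
  set c₂ := ∫ z : Coord n, heatKernel 1 z * ‖z‖ ^ m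
  have hc₁ : 0 ≤ c₁ := integral_nonneg fun z =>
    mul_nonneg (heatKernel_nonneg one_pos z) (by positivity)
  have hc₂ : 0 ≤ c₂ := integral_nonneg fun z =>
    mul_nonneg (heatKernel_nonneg one_pos z) (by positivity)
  rw [isLittleO_iff]
  intro ε hε
  have hε' : 0 < ε / (2 * (c₁ + 1)) := by positivity
  have h1 := isLittleO_iff.1 hF hε'
  obtain ⟨s, hs, t', ht', hst⟩ := Filter.eventually_prod_iff.1 h1
  obtain ⟨δ, hδ, hδs⟩ := Metric.eventually_nhds_iff.1 hs
  set D : ℝ := |C| * (1 / δ ^ m + 1 / δ ^ (2 * k + 2))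
  have hD : 0 ≤ D := by positivity
  have hsmall : ∀ᶠ t in 𝓝[>] (0 : ℝ), D * c₂ * √t ≤ ε / 2 := by
    have : Tendsto (fun t : ℝ => D * c₂ * √t) (𝓝[>] 0) (𝓝 (D * c₂ * √0)) :=
      ((Real.continuous_sqrt.tendsto 0).const_mul _).mono_left nhdsWithin_le_nhds
    rw [Real.sqrt_zero, mul_zero] at this
    exact (this.eventually (gt_mem_nhds (by positivity : (0:ℝ) < ε / 2))).mono fun t h => h.le
  filter_upwards [ht', hC, hsmall, self_mem_nhdsWithin, nhdsWithin_le_nhds (Iio_mem_nhds one_pos)]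
    with t ht hCt hst' htpos htone
  have htpos : 0 < t := htpos
  have htone : t < 1 := htone
  have hbound : ∀ y : Coord n, |F t y| ≤ ε / (2 * (c₁ + 1)) * (‖y‖ ^ 2 + t) ^ k + D * ‖y‖ ^ m := by
    intro y
    by_cases hy : ‖y‖ < δ
    · have h2 := hst (hδs (by simpa using hy) : s y) ht
      simp only [Real.norm_eq_abs] at h2
      rw [abs_of_nonneg (by positivity : (0:ℝ) ≤ (‖y‖ ^ 2 + t) ^ k)] at h2
      have : 0 ≤ D * ‖y‖ ^ m := by positivity
      linarith
    · push Not at hy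
      have hy1 : 1 ≤ ‖y‖ ^ m / δ ^ m := by
        rw [le_div_iff₀ (by positivity), one_mul]; gcongr
      have hy2 : ‖y‖ ^ N ≤ ‖y‖ ^ m / δ ^ (2 * k + 2) := by
        rw [le_div_iff₀ (by positivity)]
        calc _ ≤ ‖y‖ ^ N * ‖y‖ ^ (2 * k + 2) := by gcongr
          _ = ‖y‖ ^ m := by rw [← pow_add]; rfl
      calc |F t y| ≤ C * (1 + ‖y‖ ^ N) := hCt y
        _ ≤ |C| * (1 + ‖y‖ ^ N) := by gcongr; exact le_abs_self C
        _ ≤ |C| * (‖y‖ ^ m / δ ^ m + ‖y‖ ^ m / δ ^ (2 * k + 2)) := by gcongr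
        _ = D * ‖y‖ ^ m := by simp only [D]; ring
        _ ≤ _ := by
          have : 0 ≤ ε / (2 * (c₁ + 1)) * (‖y‖ ^ 2 + t) ^ k := by positivity
          linarith
  have hst2 : √t ^ 2 = t := Real.sq_sqrt htpos.le
  have hsp := Real.sqrt_pos.2 htpos
  rw [integral_heatKernel_scale htpos]
  have hint := ((integrable_heatKernel_one_mul_pow (n := n) k).const_mul
    (ε / (2 * (c₁ + 1)) * t ^ k)).add
    ((integrable_heatKernel_one_mul_norm_pow (n := n) m).const_mul (D * √t ^ m))
  have hle := norm_integral_le_of_norm_le (f := fun z => heatKernel 1 z * F t (√t • z)) hint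
    (Eventually.of_forall fun z => ?_)
  · rw [integral_add' ((integrable_heatKernel_one_mul_pow (n := n) k).const_mul _)
      ((integrable_heatKernel_one_mul_norm_pow (n := n) m).const_mul _), integral_const_mul,
      integral_const_mul] at hle
    refine hle.trans ?_
    rw [Real.norm_of_nonneg (by positivity)]
    have e1 : √t ^ m ≤ √t * t ^ k := by
      have : √t ^ m = (√t ^ (N + 1)) * (√t * t ^ k) := by
        rw [← hst2, ← pow_mul]; simp only [m]; rw [hst2]; ring
      rw [this]
      have : √t ^ (N + 1) ≤ 1 := pow_le_one₀ hsp.le (Real.sqrt_le_one.2 htone.le)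
      have h5 : 0 ≤ √t * t ^ k := by positivity
      nlinarith
    have e2 : ε / (2 * (c₁ + 1)) * t ^ k * c₁ ≤ ε / 2 * t ^ k := by
      rw [show ε / (2 * (c₁ + 1)) * t ^ k * c₁ = (ε / 2 * t ^ k) * (c₁ / (c₁ + 1)) by field_simp]
      have : c₁ / (c₁ + 1) ≤ 1 := by rw [div_le_one (by positivity)]; linarith
      have h5 : 0 ≤ ε / 2 * t ^ k := by positivity
      nlinarith
    have e3 : D * √t ^ m * c₂ ≤ ε / 2 * t ^ k := by
      calc D * √t ^ m * c₂ ≤ D * (√t * t ^ k) * c₂ := by gcongr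
        _ = (D * c₂ * √t) * t ^ k := by ring
        _ ≤ _ := by gcongr
    calc _ ≤ ε / 2 * t ^ k + ε / 2 * t ^ k := add_le_add e2 e3
      _ = _ := by ring
  · rw [norm_mul, Real.norm_of_nonneg (heatKernel_nonneg one_pos z)]
    have h6 := hbound (√t • z)
    rw [norm_smul, Real.norm_of_nonneg hsp.le, mul_pow, hst2, mul_pow] at h6
    rw [show t * ‖z‖ ^ 2 + t = t * (‖z‖ ^ 2 + 1) by ring, mul_pow] at h6
    calc _ ≤ heatKernel 1 z * (ε / (2 * (c₁ + 1)) * (t ^ k * (‖z‖ ^ 2 + 1) ^ k) +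
          D * (√t ^ m * ‖z‖ ^ m)) := by
          gcongr
          · exact heatKernel_nonneg one_pos z
          · exact h6
      _ = _ := by simp only [Pi.add_apply]; ring

theorem contDiff_pderiv {f : Coord n → ℝ} (hf : ContDiff ℝ ∞ f) (i : Fin n) :
    ContDiff ℝ ∞ (pderiv i f) :=
  (hf.fderiv_right (m := ∞) (by simp)).clm_apply contDiff_const

theorem hasCompactSupport_pderiv {f : Coord n → ℝ} (hf : HasCompactSupport f) (i : Fin n) :
    HasCompactSupport (pderiv i f) :=
  hf.fderiv_apply ℝ _

theorem contDiff_flatLaplacian {f : Coord n → ℝ} (hf : ContDiff ℝ ∞ f) :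
    ContDiff ℝ ∞ (flatLaplacian f) :=
  ContDiff.sum fun i _ => contDiff_pderiv (contDiff_pderiv hf i) i

theorem hasCompactSupport_flatLaplacian {f : Coord n → ℝ} (hf : HasCompactSupport f) :
    HasCompactSupport (flatLaplacian f) := by
  refine hf.mono' fun x hx => ?_
  by_contra h
  apply hx
  refine Finset.sum_eq_zero fun i _ => ?_
  have h1 : tsupport (pderiv i (pderiv i f)) ⊆ tsupport f :=
    (tsupport_fderiv_apply_subset ℝ _).trans (tsupport_fderiv_apply_subset ℝ _)
  exact image_eq_zero_of_notMem_tsupport fun hx' => h (h1 hx')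

theorem exists_bound_of_hasCompactSupport {f : Coord n → ℝ} (hf : ContDiff ℝ ∞ f)
    (hc : HasCompactSupport f) : ∃ C, 0 ≤ C ∧ ∀ x, |f x| ≤ C := by
  obtain ⟨C, hC⟩ := hc.exists_bound_of_continuous hf.continuous
  exact ⟨C, (norm_nonneg _).trans (hC 0), hC⟩

theorem integrable_heatKernel_one_mul {f : Coord n → ℝ} (hf : Continuous f) {C : ℝ}
    (hC : ∀ x, |f x| ≤ C) : Integrable fun z => heatKernel 1 z * f z := by
  refine (integrable_heatKernel_one.mul_const C).mono'
    ((continuous_heatKernel 1).mul hf).aestronglyMeasurable (Eventually.of_forall fun z => ?_)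
  rw [norm_mul, Real.norm_of_nonneg (heatKernel_nonneg one_pos z)]
  exact mul_le_mul_of_nonneg_left (hC z) (heatKernel_nonneg one_pos z)

theorem hasFDerivAt_heatKernel (t : ℝ) (z : Coord n) :
    HasFDerivAt (heatKernel t) ((-(heatKernel t z / (2 * t))) • (innerSL ℝ z)) z := by
  have h1 : HasFDerivAt (fun y : Coord n => -(‖y‖ ^ 2 / (4 * t)))
      (-((4 * t)⁻¹ • (2 • (innerSL ℝ z)))) z := by
    have := ((hasStrictFDerivAt_norm_sq z).hasFDerivAt.const_mul ((4 * t)⁻¹)).neg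
    refine this.congr_of_eventuallyEq (Eventually.of_forall fun y => ?_)
    simp [div_eq_inv_mul]
  refine (h1.exp.const_mul ((4 * Real.pi * t) ^ (-(n : ℝ) / 2))).congr_fderiv ?_
  ext w
  by_cases ht : t = 0
  · simp [ht]
  simp only [heatKernel, smul_neg, neg_apply,
    smul_apply, smul_eq_mul, nsmul_eq_mul, neg_mul, Nat.cast_ofNat, neg_inj]
  field_simp
  norm_num

/-- Gaussian integration by parts: `∂_i` of `heatKernel 1` is `-(z i / 2)` times the kernel, and the
compact support of `h` gives the integrability that is needed. -/
theorem integral_coord_mul_heatKernel_one {h : Coord n → ℝ} (hh : ContDiff ℝ ∞ h)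
    (hc : HasCompactSupport h) (i : Fin n) :
    ∫ z, heatKernel 1 z * (z i * h z) = 2 * ∫ z, heatKernel 1 z * pderiv i h z := by
  have hder : ∀ z : Coord n, fderiv ℝ (heatKernel 1) z (EuclideanSpace.single i 1) =
      -(heatKernel 1 z / 2) * z i := by
    intro z
    rw [(hasFDerivAt_heatKernel 1 z).fderiv]
    simp [EuclideanSpace.inner_single_right]
  have hcomp : ∀ g : Coord n → ℝ, Continuous g → HasCompactSupport g → Integrable g :=
    fun g h1 h2 => h1.integrable_of_hasCompactSupport h2
  have key := integral_mul_fderiv_eq_neg_fderiv_mul_of_integrable (μ := volume) (f := h)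
    (g := heatKernel 1) (v := EuclideanSpace.single i (1 : ℝ)) ?_ ?_ ?_ ?_ ?_
  · simp_rw [hder] at key
    have e1 : ∀ x : Coord n, h x * (-(heatKernel 1 x / 2) * x i) =
        -(1/2) * (heatKernel 1 x * (x i * h x)) := fun x => by ring
    simp_rw [e1] at key
    rw [integral_const_mul] at key
    have e2 : ∫ x, fderiv ℝ h x (EuclideanSpace.single i 1) * heatKernel 1 x =
        ∫ z, heatKernel 1 z * pderiv i h z := by
      congr 1; ext x; rw [mul_comm]; rfl
    rw [e2] at key
    linarith
  · exact hcomp _ ((contDiff_pderiv hh i).continuous.mul (continuous_heatKernel 1))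
      (hasCompactSupport_pderiv hc i).mul_right
  · simp_rw [hder]
    refine hcomp _ (hh.continuous.mul (((continuous_heatKernel 1).div_const 2).neg.mul
      (by fun_prop))) hc.mul_right
  · exact hcomp _ (hh.continuous.mul (continuous_heatKernel 1)) hc.mul_right
  · exact fun x _ => (hh.differentiable (by simp)).differentiableAt
  · exact fun x _ => (hasFDerivAt_heatKernel 1 x).differentiableAt

theorem fderiv_apply_eq_sum (f : Coord n → ℝ) (y v : Coord n) :
    fderiv ℝ f y v = ∑ i, v i * pderiv i f y := by
  have : v = ∑ i, v i • EuclideanSpace.single i (1 : ℝ) := by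
    simpa using ((EuclideanSpace.basisFun (Fin n) ℝ).sum_repr v).symm
  conv_lhs => rw [this]
  simp [pderiv]

theorem pderiv_comp_smul (f : Coord n → ℝ) (hf : ContDiff ℝ ∞ f) (c : ℝ) (i : Fin n)
    (z : Coord n) : pderiv i (fun z => f (c • z)) z = c * pderiv i f (c • z) := by
  unfold pderiv
  have h1 : HasFDerivAt (fun z : Coord n => c • z) (c • ContinuousLinearMap.id ℝ (Coord n)) z :=
    (hasFDerivAt_id z).const_smul c
  have h2 := ((hf.differentiable (by simp)) (c • z)).hasFDerivAt
  have h3 : HasFDerivAt (fun z => f (c • z)) _ z := h2.comp z h1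
  rw [h3.fderiv]
  simp

/-- The heat equation for Gaussian averages. -/
theorem hasDerivAt_integral_heatKernel {f : Coord n → ℝ} (hf : ContDiff ℝ ∞ f)
    (hc : HasCompactSupport f) {t : ℝ} (ht : 0 < t) :
    HasDerivAt (fun t => ∫ z, heatKernel 1 z * f (√t • z))
      (∫ z, heatKernel 1 z * flatLaplacian f (√t • z)) t := by
  have hs : 0 < √t := Real.sqrt_pos.2 ht
  obtain ⟨C, hC0, hC⟩ := exists_bound_of_hasCompactSupport hf hc
  obtain ⟨C', hC'⟩ := (hc.fderiv ℝ).exists_bound_of_continuous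
    (hf.continuous_fderiv (by simp))
  have hsc : ∀ s : ℝ, Continuous fun z : Coord n => s • z := fun s => continuous_const_smul s
  have key := hasDerivAt_integral_of_dominated_loc_of_deriv_le (μ := (volume : Measure (Coord n)))
    (F := fun t z => heatKernel 1 z * f (√t • z))
    (F' := fun t z => heatKernel 1 z * ((1 / (2 * √t)) * fderiv ℝ f (√t • z) z))
    (bound := fun z => (1 / (2 * √(t/2)) * C') * (heatKernel 1 z * ‖z‖ ^ 1))
    (x₀ := t) (s := Ioi (t/2)) (Ioi_mem_nhds (by linarith)) ?_ ?_ ?_ ?_ ?_ ?_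
  · refine key.2.congr_deriv (Eq.symm ?_)
    -- Differentiating `√t` inside `f` gives `z · ∇f / (2√t)`. Integrating each factor `z i` by
    -- parts produces a second derivative of `f` and a factor `2√t`, which cancels the prefactor.
    have e1 : ∀ z : Coord n, heatKernel 1 z * ((1 / (2 * √t)) * fderiv ℝ f (√t • z) z) =
        ∑ i, (1 / (2 * √t)) * (heatKernel 1 z * (z i * pderiv i f (√t • z))) := by
      intro z
      rw [fderiv_apply_eq_sum, Finset.mul_sum, Finset.mul_sum]
      exact Finset.sum_congr rfl fun i _ => by ring
    have hsm : ∀ i, ContDiff ℝ ∞ fun z : Coord n => pderiv i f (√t • z) := fun i =>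
      (contDiff_pderiv hf i).comp (contDiff_const_smul _)
    have hcs : ∀ i, HasCompactSupport fun z : Coord n => pderiv i f (√t • z) := fun i =>
      (hasCompactSupport_pderiv hc i).comp_smul hs.ne'
    have hint : ∀ g : Coord n → ℝ, Continuous g → HasCompactSupport g → Integrable g :=
      fun g h1 h2 => h1.integrable_of_hasCompactSupport h2
    refine Eq.trans ?_ (integral_congr_ae (Eventually.of_forall e1)).symm
    simp_rw [flatLaplacian, Finset.mul_sum]
    rw [integral_finsetSum, integral_finsetSum]
    · refine Finset.sum_congr rfl fun i _ => ?_
      rw [integral_const_mul, integral_coord_mul_heatKernel_one (hsm i) (hcs i)]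
      simp_rw [pderiv_comp_smul _ (contDiff_pderiv hf i)]
      have e2 : ∀ z : Coord n, heatKernel 1 z * (√t * pderiv i (pderiv i f) (√t • z)) =
        √t * (heatKernel 1 z * pderiv i (pderiv i f) (√t • z)) := fun z => by ring
      simp_rw [e2]
      rw [integral_const_mul]
      field_simp
    · intro i _
      refine (hint _ ((continuous_heatKernel 1).mul ((show Continuous fun z : Coord n => z i by
        fun_prop).mul (hsm i).continuous)) ?_).const_mul _
      exact (hcs i).mul_left.mul_left
    · intro i _
      refine hint _ ((continuous_heatKernel 1).mul
        ((contDiff_pderiv (contDiff_pderiv hf i) i).continuous.comp (hsc _))) ?_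
      exact ((hasCompactSupport_pderiv (hasCompactSupport_pderiv hc i) i).comp_smul hs.ne').mul_left
  · exact Eventually.of_forall fun s =>
      ((continuous_heatKernel 1).mul (hf.continuous.comp (hsc _))).aestronglyMeasurable
  · exact integrable_heatKernel_one_mul (hf.continuous.comp (hsc _)) fun x => hC _
  · refine ((continuous_heatKernel 1).mul (continuous_const.mul ?_)).aestronglyMeasurable
    exact ((hf.continuous_fderiv (by simp)).comp (hsc _)).clm_apply continuous_id
  · refine Eventually.of_forall fun z s hs' => ?_
    have hs2 : √(t/2) ≤ √s := Real.sqrt_le_sqrt (le_of_lt hs')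
    have hs3 : 0 < √(t/2) := Real.sqrt_pos.2 (by linarith)
    have hs4 : 0 < √s := hs3.trans_le hs2
    rw [norm_mul, Real.norm_of_nonneg (heatKernel_nonneg one_pos z), norm_mul,
      Real.norm_of_nonneg (by positivity)]
    have h1 : ‖fderiv ℝ f (√s • z) z‖ ≤ C' * ‖z‖ :=
      (ContinuousLinearMap.le_opNorm _ _).trans (by gcongr; exact hC' _)
    have h2 : 1 / (2 * √s) ≤ 1 / (2 * √(t/2)) := by gcongr
    calc _ ≤ heatKernel 1 z * (1 / (2 * √(t/2)) * (C' * ‖z‖)) := by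
          gcongr
          exact heatKernel_nonneg one_pos z
      _ = _ := by ring
  · exact (integrable_heatKernel_one_mul_norm_pow 1).const_mul _
  · refine Eventually.of_forall fun z s hs' => ?_
    have hs1 : 0 < s := lt_trans (by linarith) (show t / 2 < s from hs')
    have h1 : HasDerivAt (fun s : ℝ => √s • z) ((1 / (2 * √s)) • z) s :=
      (Real.hasDerivAt_sqrt hs1.ne').smul_const z
    have h2 := ((hf.differentiable (by simp)) (√s • z)).hasFDerivAt.comp_hasDerivAt s h1
    simpa using h2.const_mul (heatKernel 1 z)

theorem tendsto_integral_heatKernel {f : Coord n → ℝ} (hf : ContDiff ℝ ∞ f)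
    (hc : HasCompactSupport f) :
    Tendsto (fun t => ∫ z, heatKernel 1 z * f (√t • z)) (𝓝[>] 0) (𝓝 (f 0)) := by
  obtain ⟨C, hC0, hC⟩ := exists_bound_of_hasCompactSupport hf hc
  have h0 : f 0 = ∫ z : Coord n, heatKernel 1 z * f 0 := by
    rw [integral_mul_const, integral_heatKernel_one, one_mul]
  rw [h0]
  refine tendsto_integral_filter_of_dominated_convergence (fun z => heatKernel 1 z * C) ?_ ?_
    (integrable_heatKernel_one.mul_const _) ?_
  · exact Eventually.of_forall fun s => ((continuous_heatKernel 1).mul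
      (hf.continuous.comp (continuous_const_smul _))).aestronglyMeasurable
  · refine Eventually.of_forall fun s => Eventually.of_forall fun z => ?_
    rw [norm_mul, Real.norm_of_nonneg (heatKernel_nonneg one_pos z)]
    exact mul_le_mul_of_nonneg_left (hC _) (heatKernel_nonneg one_pos z)
  · refine Eventually.of_forall fun z => Tendsto.const_mul _ ?_
    have : Continuous fun t : ℝ => f (√t • z) :=
      hf.continuous.comp (Real.continuous_sqrt.smul continuous_const)
    have h2 := this.tendsto 0
    simp only [Real.sqrt_zero, zero_smul] at h2
    exact h2.mono_left nhdsWithin_le_nhds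

/-- L'Hôpital: by the heat equation the numerator has as derivative the average of the Laplacian
minus its value at the origin, which tends to zero. -/
theorem integral_heatKernel_first_order {f : Coord n → ℝ} (hf : ContDiff ℝ ∞ f)
    (hc : HasCompactSupport f) :
    (fun t => (∫ y, heatKernel t y * f y) - (f 0 + t * flatLaplacian f 0))
      =o[𝓝[>] 0] fun t => t ^ 1 := by
  have key : Tendsto (fun t => ((∫ z, heatKernel 1 z * f (√t • z)) - (f 0 + t * flatLaplacian f 0))
      / t) (𝓝[>] 0) (𝓝 0) := by
    refine HasDerivAt.lhopital_zero_nhdsGT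
      (f' := fun t => (∫ z, heatKernel 1 z * flatLaplacian f (√t • z)) - flatLaplacian f 0)
      (g' := fun _ => 1) ?_ (Eventually.of_forall fun t => hasDerivAt_id t) (by simp) ?_ ?_ ?_
    · filter_upwards [self_mem_nhdsWithin] with t ht
      have := ((hasDerivAt_id t).mul_const (flatLaplacian f 0)).const_add (f 0)
      exact ((hasDerivAt_integral_heatKernel hf hc ht).fun_sub this).congr_deriv (by simp)
    · have h1 := tendsto_integral_heatKernel hf hc
      have h2 : Tendsto (fun t : ℝ => f 0 + t * flatLaplacian f 0) (𝓝[>] 0)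
          (𝓝 (f 0 + 0 * flatLaplacian f 0)) :=
        (Continuous.tendsto (by fun_prop) 0).mono_left nhdsWithin_le_nhds
      simpa using h1.sub h2
    · exact tendsto_id.mono_left nhdsWithin_le_nhds
    · have h1 := (tendsto_integral_heatKernel (contDiff_flatLaplacian hf)
        (hasCompactSupport_flatLaplacian hc)).sub_const (flatLaplacian f 0)
      simpa using h1
  refine (isLittleO_iff_tendsto' ?_).2 ?_
  · filter_upwards [self_mem_nhdsWithin] with t ht h
    simp at h
    exact absurd h (ne_of_gt ht)
  · refine key.congr' ?_
    filter_upwards [self_mem_nhdsWithin] with t ht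
    rw [integral_heatKernel_scale ht, pow_one]

/-- L'Hôpital again: the quotient of the derivatives is half of the first-order remainder for
`flatLaplacian f`. -/
theorem integral_heatKernel_second_order {f : Coord n → ℝ} (hf : ContDiff ℝ ∞ f)
    (hc : HasCompactSupport f) :
    (fun t => (∫ y, heatKernel t y * f y) -
      (f 0 + t * flatLaplacian f 0 + t ^ 2 / 2 * flatLaplacian (flatLaplacian f) 0))
      =o[𝓝[>] 0] fun t => t ^ 2 := by
  have hf' := contDiff_flatLaplacian hf
  have hc' := hasCompactSupport_flatLaplacian hc
  have key : Tendsto (fun t => ((∫ z, heatKernel 1 z * f (√t • z)) -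
      (f 0 + t * flatLaplacian f 0 + t ^ 2 / 2 * flatLaplacian (flatLaplacian f) 0))
      / t ^ 2) (𝓝[>] 0) (𝓝 0) := by
    refine HasDerivAt.lhopital_zero_nhdsGT
      (f' := fun t => (∫ z, heatKernel 1 z * flatLaplacian f (√t • z)) -
        (flatLaplacian f 0 + t * flatLaplacian (flatLaplacian f) 0))
      (g' := fun t => 2 * t) ?_ (Eventually.of_forall fun t => by simpa using hasDerivAt_pow 2 t)
      ?_ ?_ ?_ ?_
    · filter_upwards [self_mem_nhdsWithin] with t ht
      have h1 := ((hasDerivAt_id t).mul_const (flatLaplacian f 0)).const_add (f 0)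
      have h2 := ((hasDerivAt_pow 2 t).div_const 2).mul_const (flatLaplacian (flatLaplacian f) 0)
      exact ((hasDerivAt_integral_heatKernel hf hc ht).fun_sub (h1.fun_add h2)).congr_deriv
        (by simp)
    · filter_upwards [self_mem_nhdsWithin] with t ht
      have : (0:ℝ) < t := ht
      positivity
    · have h1 := tendsto_integral_heatKernel hf hc
      have h2 : Tendsto (fun t : ℝ => f 0 + t * flatLaplacian f 0 +
          t ^ 2 / 2 * flatLaplacian (flatLaplacian f) 0) (𝓝[>] 0)
          (𝓝 (f 0 + 0 * flatLaplacian f 0 + 0 ^ 2 / 2 * flatLaplacian (flatLaplacian f) 0)) :=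
        (Continuous.tendsto (by fun_prop) 0).mono_left nhdsWithin_le_nhds
      simpa using h1.sub h2
    · have : Tendsto (fun t : ℝ => t ^ 2) (𝓝[>] 0) (𝓝 (0 ^ 2)) :=
        (Continuous.tendsto (by fun_prop) 0).mono_left nhdsWithin_le_nhds
      simpa using this
    · have h1 := (integral_heatKernel_first_order hf' hc').tendsto_div_nhds_zero.div_const 2
      rw [zero_div] at h1
      refine h1.congr' ?_
      filter_upwards [self_mem_nhdsWithin] with t ht
      rw [integral_heatKernel_scale ht, pow_one, div_div, mul_comm t 2]
  refine (isLittleO_iff_tendsto' ?_).2 ?_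
  · filter_upwards [self_mem_nhdsWithin] with t ht h
    simp at h
    exact absurd h (ne_of_gt ht)
  · refine key.congr' ?_
    filter_upwards [self_mem_nhdsWithin] with t ht
    rw [integral_heatKernel_scale ht]

end

end GaussianAverage

/-! ### Jets of a metric in normal coordinates

The computations take place in a commutative `ℝ`-algebra `R` with commuting derivations `D i` and an
evaluation `ev`; the example to keep in mind is the algebra of smooth functions on `ℝⁿ`, with the
partial derivatives and the evaluation at the origin. -/

/-- Jacobi's formula for the derivative of a determinant. -/
theorem Derivation.map_det {R ι : Type*} [CommRing R] [Algebra ℝ R] [Fintype ι] [DecidableEq ι]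
    (d : Derivation ℝ R R) (A : Matrix ι ι R) :
    d A.det = ∑ i, ∑ j, A.adjugate i j * d (A j i) := by
  have h1 : ∀ i, ∑ j, A.adjugate i j * d (A j i) = (A.updateCol i fun j => d (A j i)).det := by
    intro i
    rw [← Matrix.cramer_apply, Matrix.cramer_eq_adjugate_mulVec]
    rfl
  have hprod : ∀ (s : Finset ι) (f : ι → R),
      d (∏ i ∈ s, f i) = ∑ i ∈ s, (∏ j ∈ s.erase i, f j) * d (f i) := by
    intro s f
    induction s using Finset.induction_on with
    | empty => simp
    | insert a s ha ih =>
      rw [Finset.prod_insert ha, d.leibniz, ih, Finset.sum_insert ha, Finset.erase_insert ha,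
        smul_eq_mul, smul_eq_mul, add_comm, Finset.mul_sum]
      congr 1
      refine Finset.sum_congr rfl fun i hi => ?_
      have hne : a ≠ i := fun h => ha (h ▸ hi)
      rw [Finset.erase_insert_of_ne hne, Finset.prod_insert (by simp [ha])]
      ring
  simp_rw [h1, Matrix.det_apply', map_sum]
  rw [Finset.sum_comm]
  refine Finset.sum_congr rfl fun σ _ => ?_
  rw [d.leibniz, hprod]
  have : d ((Equiv.Perm.sign σ : ℤ) : R) = 0 := by simp
  rw [this, smul_zero, add_zero, smul_eq_mul, Finset.mul_sum]
  refine Finset.sum_congr rfl fun i _ => ?_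
  rw [← Finset.prod_erase_mul _ _ (Finset.mem_univ i)]
  congr 2
  · refine Finset.prod_congr rfl fun j hj => ?_
    rw [Matrix.updateCol_ne (Finset.ne_of_mem_erase hj)]
  · simp

namespace MetricJet

/-! #### Contractions of a tensor with the symmetries of the second derivatives of a metric -/

section Contraction

variable {n : ℕ} {A : Fin n → Fin n → Fin n → Fin n → ℝ}

/-- The symmetries of the second derivatives `g_ij,kl` at the centre of normal coordinates. -/
structure IsNormalJet (A : Fin n → Fin n → Fin n → Fin n → ℝ) : Prop where
  swap_left : ∀ i j k l, A i j k l = A j i k l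
  swap_right : ∀ i j k l, A i j k l = A i j l k
  cyclic : ∀ i j k l, A i j k l + A i k l j + A i l j k = 0

/-- The classical argument for the pair symmetry of a curvature tensor: write the cyclic identity
with each of the four indices held fixed, add those for `i` and `j`, and subtract those for `k` and
`l`. -/
theorem IsNormalJet.pair (h : IsNormalJet A) (i j k l : Fin n) : A i j k l = A k l i j := by
  have := h.cyclic
  have s := h.swap_left
  have t := h.swap_right
  linarith [this i j k l, this j k l i, this k l i j, this l i j k, s i j k l, t i j k l,
    s i k l j, s i l j k, s j k l i, s j l i k, s j i k l, s k l i j, s k i j l, s k j l i,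
    s l i j k, s l j k i, s l k i j, t i k l j, t i l j k, t j k l i, t j l i k, t j i k l,
    t k l i j, t k i j l, t k j l i, t l i j k, t l j k i, t l k i j]

/-- The contraction `∑_p A_ijpp`. -/
def trace (A : Fin n → Fin n → Fin n → Fin n → ℝ) (i j : Fin n) : ℝ := ∑ p, A i j p p

/-- The full square `∑ A_ijkl²`. -/
def normSq (A : Fin n → Fin n → Fin n → Fin n → ℝ) : ℝ := ∑ i, ∑ j, ∑ k, ∑ l, A i j k l ^ 2

theorem IsNormalJet.sum_left (h : IsNormalJet A) (j k : Fin n) :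
    ∑ i, A i i j k = trace A j k :=
  Finset.sum_congr rfl fun i _ => h.pair i i j k

/-- Trace of the cyclic identity: the two mixed traces coincide by symmetry, so each is minus one
half of the pure trace. -/
theorem IsNormalJet.sum_cross (h : IsNormalJet A) (j k : Fin n) :
    ∑ i, A i j i k = -(1 / 2) * trace A j k := by
  have h1 : ∑ i, (A i i j k + A i j k i + A i k i j) = 0 :=
    Finset.sum_eq_zero fun i _ => h.cyclic i i j k
  rw [Finset.sum_add_distrib, Finset.sum_add_distrib, h.sum_left] at h1
  have h2 : ∑ i, A i j k i = ∑ i, A i j i k :=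
    Finset.sum_congr rfl fun i _ => h.swap_right i j k i
  have h3 : ∑ i, A i k i j = ∑ i, A i j i k :=
    Finset.sum_congr rfl fun i _ => h.pair i k i j
  rw [h2, h3] at h1
  linarith

theorem IsNormalJet.trace_symm (h : IsNormalJet A) (j k : Fin n) : trace A j k = trace A k j :=
  Finset.sum_congr rfl fun i _ => h.swap_left j k i i

/-- Contract the cyclic identity with the tensor itself; its last two terms give the same sum after
relabelling. -/
theorem IsNormalJet.sum_mul_cross (h : IsNormalJet A) :
    ∑ i, ∑ j, ∑ k, ∑ l, A i j k l * A i k j l = -(1 / 2) * normSq A := by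
  have h1 : ∑ i, ∑ j, ∑ k, ∑ l, A i j k l * (A i j k l + A i k l j + A i l j k) = 0 := by
    simp [h.cyclic]
  simp_rw [mul_add, Finset.sum_add_distrib] at h1
  have h2 : ∑ i, ∑ j, ∑ k, ∑ l, A i j k l * A i k l j =
      ∑ i, ∑ j, ∑ k, ∑ l, A i j k l * A i k j l := by
    simp_rw [fun i k l j => h.swap_right i k l j]
  have h3 : ∑ i, ∑ j, ∑ k, ∑ l, A i j k l * A i l j k =
      ∑ i, ∑ j, ∑ k, ∑ l, A i j k l * A i k j l := by
    refine Finset.sum_congr rfl fun i _ => Finset.sum_congr rfl fun j _ => ?_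
    rw [Finset.sum_comm]
    refine Finset.sum_congr rfl fun k _ => Finset.sum_congr rfl fun l _ => ?_
    rw [h.swap_right i j l k]
  rw [h2, h3] at h1
  unfold normSq
  simp_rw [pow_two]
  linarith

/-- The summand is the square of the curvature component `R_ijkl` at the centre, so this computes
`|Rm|²`. Expanding gives two full squares and twice a cross term equal to `-1/2` of a full square,
hence the factor `2 + 1`. -/
theorem IsNormalJet.sum_riemann_sq (h : IsNormalJet A) :
    ∑ i, ∑ j, ∑ k, ∑ l, (A i k l j - A j k l i) ^ 2 = 3 * normSq A := by
  have e : ∀ i j k l, (A i k l j - A j k l i) ^ 2 =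
      A i k l j ^ 2 + A j k l i ^ 2 - 2 * (A i k l j * A j k l i) := fun i j k l => by ring
  simp_rw [e, Finset.sum_sub_distrib, Finset.sum_add_distrib, ← Finset.mul_sum]
  have h1 : ∑ i, ∑ j, ∑ k, ∑ l, A i k l j ^ 2 = normSq A := by
    refine Finset.sum_congr rfl fun i _ => ?_
    rw [Finset.sum_comm]
    refine Finset.sum_congr rfl fun k _ => ?_
    rw [Finset.sum_comm]
  have h2 : ∑ i, ∑ j, ∑ k, ∑ l, A j k l i ^ 2 = normSq A := by
    rw [Finset.sum_comm, ← h1]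
  have h3 : ∑ i, ∑ j, ∑ k, ∑ l, A i k l j * A j k l i =
      ∑ i, ∑ j, ∑ k, ∑ l, A i j k l * A i k j l := by
    calc ∑ i, ∑ j, ∑ k, ∑ l, A i k l j * A j k l i
        = ∑ k, ∑ i, ∑ j, ∑ l, A i k l j * A j k l i := by
          rw [Finset.sum_comm_cycle]
      _ = ∑ i, ∑ j, ∑ k, ∑ l, A i j k l * A i k j l := by
          refine Finset.sum_congr rfl fun k _ => Finset.sum_congr rfl fun i _ =>
            Finset.sum_congr rfl fun j _ => Finset.sum_congr rfl fun l _ => ?_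
          rw [h.swap_left i k, h.swap_left j k, h.swap_right k i, h.swap_right k j]
  rw [h1, h2, h3, h.sum_mul_cross]
  ring

end Contraction

end MetricJet

/-! ### Curvature and density at the centre of normal coordinates in terms of the jets of the metric
-/

namespace MetricJet

section Algebraic

variable {n : ℕ} {R : Type*} [CommRing R] [Algebra ℝ R]

/-- A metric `g` with inverse `gi`, whose jets at the evaluation point are those of a metric in
normal coordinates. -/
structure NormalMetric (D : Fin n → Derivation ℝ R R) (ev : R →ₐ[ℝ] ℝ)
    (g gi : Fin n → Fin n → R) : Prop where
  comm : ∀ i j f, D i (D j f) = D j (D i f)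
  symm : ∀ i j, g i j = g j i
  inv_mul : ∀ i j, ∑ l, gi i l * g l j = if i = j then 1 else 0
  ev_metric : ∀ i j, ev (g i j) = if i = j then 1 else 0
  ev_deriv : ∀ k i j, ev (D k (g i j)) = 0
  cyclic : ∀ i j k l, ev (D k (D l (g i j))) + ev (D l (D j (g i k))) + ev (D j (D k (g i l))) = 0
  fifth : ∀ i a b c d f, ev (D b (D c (D d (D f (g i a))))) + ev (D a (D c (D d (D f (g i b))))) +
    ev (D a (D b (D d (D f (g i c))))) + ev (D a (D b (D c (D f (g i d))))) +
    ev (D a (D b (D c (D d (g i f))))) = 0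

/-- The Christoffel symbols. -/
noncomputable def chr (D : Fin n → Derivation ℝ R R) (g gi : Fin n → Fin n → R)
    (k i j : Fin n) : R :=
  (1 / 2 : ℝ) • ∑ l, gi k l * (D i (g j l) + D j (g i l) - D l (g i j))

/-- The curvature tensor `R^l_ijk`. -/
noncomputable def riem (D : Fin n → Derivation ℝ R R) (g gi : Fin n → Fin n → R)
    (l i j k : Fin n) : R :=
  D i (chr D g gi l j k) - D j (chr D g gi l i k) +
    ∑ m, (chr D g gi l i m * chr D g gi m j k - chr D g gi l j m * chr D g gi m i k)

/-- The Ricci tensor. -/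
noncomputable def ric (D : Fin n → Derivation ℝ R R) (g gi : Fin n → Fin n → R)
    (j k : Fin n) : R := ∑ i, riem D g gi i i j k

/-- The scalar curvature. -/
noncomputable def scal (D : Fin n → Derivation ℝ R R) (g gi : Fin n → Fin n → R) : R :=
  ∑ j, ∑ k, gi j k * ric D g gi j k

/-- The second derivatives of the metric. -/
def jet2 (D : Fin n → Derivation ℝ R R) (ev : R →ₐ[ℝ] ℝ) (g : Fin n → Fin n → R)
    (i j k l : Fin n) : ℝ := ev (D k (D l (g i j)))

/-- The contracted fourth derivative `g_ii,jjkk`. -/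
def bitrace (D : Fin n → Derivation ℝ R R) (ev : R →ₐ[ℝ] ℝ) (g : Fin n → Fin n → R) : ℝ :=
  ∑ i, ∑ j, ∑ k, ev (D j (D j (D k (D k (g i i)))))

variable {D : Fin n → Derivation ℝ R R} {ev : R →ₐ[ℝ] ℝ} {g gi : Fin n → Fin n → R}

theorem ev_deriv_deriv_mul (a b : R) (p q : Fin n) :
    ev (D p (D q (a * b))) = ev a * ev (D p (D q b)) + ev (D p a) * ev (D q b) +
      ev (D q a) * ev (D p b) + ev (D p (D q a)) * ev b := by
  simp only [Derivation.leibniz, map_add, smul_eq_mul, map_mul]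
  ring

/-- Of the eight Leibniz terms four survive when `a` is critical and `b` vanishes at the evaluation
point. In the applications `a` is a coefficient of the inverse metric and `b` is linear in the first
derivatives of the metric. -/
theorem ev_deriv3_mul (hD : ∀ i j f, D i (D j f) = D j (D i f)) {a b : R}
    (ha : ∀ p, ev (D p a) = 0) (hb : ev b = 0)
    (p q s : Fin n) :
    ev (D p (D q (D s (a * b)))) = ev a * ev (D p (D q (D s b))) +
      ev (D p (D q a)) * ev (D s b) + ev (D p (D s a)) * ev (D q b) +
      ev (D q (D s a)) * ev (D p b) := by
  simp only [Derivation.leibniz, map_add, smul_eq_mul, map_mul, ha, hb]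
  rw [hD p s]
  ring

namespace NormalMetric

theorem isNormalJet (h : NormalMetric D ev g gi) : IsNormalJet (jet2 D ev g) where
  swap_left i j k l := by unfold jet2; rw [h.symm]
  swap_right i j k l := by unfold jet2; rw [h.comm]
  cyclic i j k l := h.cyclic i j k l

theorem ev_inv (h : NormalMetric D ev g gi) (i j : Fin n) :
    ev (gi i j) = if i = j then 1 else 0 := by
  have := congrArg ev (h.inv_mul i j)
  simp only [map_sum, map_mul, h.ev_metric, mul_ite, mul_one, mul_zero, Finset.sum_ite_eq',
    Finset.mem_univ, if_true] at this
  rw [this]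
  split_ifs <;> simp

theorem ev_deriv_inv (h : NormalMetric D ev g gi) (p i j : Fin n) : ev (D p (gi i j)) = 0 := by
  have := congrArg (fun f => ev (D p f)) (h.inv_mul i j)
  simp only [map_sum, Derivation.leibniz, map_add, smul_eq_mul, map_mul, h.ev_metric, h.ev_deriv,
    mul_zero, zero_add, ite_mul, one_mul, zero_mul, Finset.sum_ite_eq', Finset.mem_univ,
    if_true] at this
  rw [this]
  split_ifs <;> simp

/-- Second derivative of `gi * g = 1`: the mixed terms vanish because the metric is critical at the
centre. -/
theorem ev_deriv_deriv_inv (h : NormalMetric D ev g gi) (p q i j : Fin n) :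
    ev (D p (D q (gi i j))) = -jet2 D ev g i j p q := by
  have := congrArg (fun f => ev (D p (D q f))) (h.inv_mul i j)
  simp only [map_sum, ev_deriv_deriv_mul, h.ev_metric, h.ev_deriv, h.ev_inv,
    mul_zero, ite_mul, one_mul, zero_mul, mul_ite, mul_one, add_zero, Finset.sum_add_distrib,
    Finset.sum_ite_eq', Finset.sum_ite_eq, Finset.mem_univ, if_true] at this
  have h2 : ev (D p (D q (if i = j then (1 : R) else 0))) = 0 := by split_ifs <;> simp
  rw [h2] at this
  unfold jet2
  linarith

theorem ev_chr (h : NormalMetric D ev g gi) (k i j : Fin n) : ev (chr D g gi k i j) = 0 := by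
  simp [chr, h.ev_deriv]

/-- The cyclic identity and the pair symmetry collapse the three second derivatives into a single
one. Hence a first derivative of a Christoffel symbol at the centre is one jet coefficient. -/
theorem ev_lowered (h : NormalMetric D ev g gi) (p k i j : Fin n) :
    ev (D p (D i (g j k) + D j (g i k) - D k (g i j))) = -2 * jet2 D ev g i j k p := by
  have hA := h.isNormalJet
  simp only [map_add, map_sub]
  change jet2 D ev g j k p i + jet2 D ev g i k p j - jet2 D ev g i j p k = _
  have h1 := hA.cyclic k j p i
  have h2 := hA.swap_left k j p i
  have h3 := hA.swap_left k i j p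
  have h4 := hA.swap_right i k j p
  have h5 := hA.pair k p i j
  have h6 := hA.swap_right i j k p
  linarith

theorem ev_deriv_chr (h : NormalMetric D ev g gi) (p k i j : Fin n) :
    ev (D p (chr D g gi k i j)) = -jet2 D ev g i j k p := by
  simp only [chr, Derivation.map_smul, map_smul, map_sum, Derivation.leibniz, map_add ev,
    smul_eq_mul, map_mul, h.ev_deriv_inv, h.ev_inv, h.ev_lowered, mul_zero,
    add_zero, ite_mul, one_mul, zero_mul,
    Finset.sum_ite_eq, Finset.mem_univ, if_true]
  ring

/-- Three derivatives either all fall on the lowered symbol, giving fourth derivatives of the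
metric, or two fall on the inverse metric and one on the lowered symbol, giving the quadratic terms.
-/
theorem ev_deriv3_chr (h : NormalMetric D ev g gi) (p q s k i j : Fin n) :
    ev (D p (D q (D s (chr D g gi k i j)))) =
      (1 / 2) * (ev (D p (D q (D s (D i (g j k))))) + ev (D p (D q (D s (D j (g i k))))) -
        ev (D p (D q (D s (D k (g i j)))))) +
      ∑ l, (jet2 D ev g k l p q * jet2 D ev g i j l s + jet2 D ev g k l p s * jet2 D ev g i j l q +
        jet2 D ev g k l q s * jet2 D ev g i j l p) := by
  have hb : ∀ l, ev (D i (g j l) + D j (g i l) - D l (g i j)) = 0 := by simp [h.ev_deriv]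
  simp only [chr, Derivation.map_smul, map_smul, map_sum]
  simp_rw [ev_deriv3_mul h.comm (fun p => h.ev_deriv_inv p k _) (hb _), h.ev_lowered,
    h.ev_deriv_deriv_inv, h.ev_inv]
  simp only [smul_eq_mul, Finset.sum_add_distrib, ite_mul, one_mul, zero_mul, Finset.sum_ite_eq,
    Finset.mem_univ, if_true, map_add, map_sub]
  have e : ∀ x y : ℝ, -x * (-2 * y) = 2 * (x * y) := fun x y => by ring
  simp_rw [e, ← Finset.mul_sum]
  ring

theorem ev_riem (h : NormalMetric D ev g gi) (l i j k : Fin n) :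
    ev (riem D g gi l i j k) = jet2 D ev g i k l j - jet2 D ev g j k l i := by
  simp only [riem, map_add, map_sub, map_sum, map_mul, h.ev_chr, h.ev_deriv_chr]
  simp
  ring

theorem ev_ric (h : NormalMetric D ev g gi) (j k : Fin n) :
    ev (ric D g gi j k) = -(3 / 2) * trace (jet2 D ev g) j k := by
  simp only [ric, map_sum, h.ev_riem, Finset.sum_sub_distrib]
  rw [h.isNormalJet.sum_cross, h.isNormalJet.trace_symm k j]
  unfold trace
  ring

theorem ev_deriv_deriv_riem (h : NormalMetric D ev g gi) (p i j k : Fin n) :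
    ev (D p (D p (riem D g gi i i j k))) =
      ev (D p (D p (D i (chr D g gi i j k)))) - ev (D p (D p (D j (chr D g gi i i k)))) +
      2 * ∑ m, (jet2 D ev g i m i p * jet2 D ev g j k m p -
        jet2 D ev g j m i p * jet2 D ev g i k m p) := by
  simp only [riem, map_add, map_sub, map_sum, ev_deriv_deriv_mul, h.ev_chr, h.ev_deriv_chr,
    zero_mul, mul_zero, Finset.mul_sum]
  congr 1
  exact Finset.sum_congr rfl fun m _ => by ring

/-- Contract the six indices of `fifth` in three pairs: one of its five terms becomes `bitrace`, and
the other four coincide after the derivatives are commuted. -/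
theorem sum_fourth (h : NormalMetric D ev g gi) :
    ∑ i, ∑ j, ∑ p, ev (D p (D p (D i (D j (g j i))))) = -(1 / 4) * bitrace D ev g := by
  have h1 : ∑ i, ∑ j, ∑ p, (ev (D j (D j (D p (D p (g i i))))) +
      4 * ev (D p (D p (D i (D j (g j i)))))) = 0 +
      3 * ((∑ i, ∑ j, ∑ p, ev (D p (D p (D i (D j (g j i)))))) -
        ∑ i, ∑ j, ∑ p, ev (D p (D p (D i (D j (g j i)))))) := by
    rw [sub_self, mul_zero, add_zero]
    have e1 : ∑ i, ∑ j, ∑ p, (ev (D j (D j (D p (D p (g i i))))) +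
        ev (D i (D j (D p (D p (g i j))))) + ev (D i (D j (D p (D p (g i j))))) +
        ev (D i (D j (D j (D p (g i p))))) + ev (D i (D j (D j (D p (g i p)))))) = 0 :=
      Finset.sum_eq_zero fun i _ => Finset.sum_eq_zero fun j _ => Finset.sum_eq_zero fun p _ =>
        h.fifth i i j j p p
    have e2 : ∀ i j p, ev (D p (D p (D i (D j (g j i))))) = ev (D i (D j (D p (D p (g i j))))) := by
      intro i j p
      rw [h.symm j i, h.comm p i, h.comm p j, h.comm p i, h.comm p j]
    have e3 : ∑ i, ∑ j, ∑ p, ev (D i (D j (D j (D p (g i p))))) =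
        ∑ i, ∑ j, ∑ p, ev (D i (D j (D p (D p (g i j))))) := by
      refine Finset.sum_congr rfl fun i _ => ?_
      rw [Finset.sum_comm]
      refine Finset.sum_congr rfl fun j _ => Finset.sum_congr rfl fun p _ => ?_
      rw [h.comm p j, h.comm p j]
    simp_rw [e2]
    simp only [Finset.sum_add_distrib, e3, ← Finset.mul_sum] at e1 ⊢
    linarith
  simp only [Finset.sum_add_distrib, ← Finset.mul_sum] at h1
  unfold bitrace
  linarith

/-- The inverse metric is critical at the centre, so both derivatives of `g^{jk} R_jk` fall on the
same factor. On the inverse metric they give `3/2 ∑ trace²`. On the Ricci tensor they give quadratic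
contractions and fourth derivatives, the latter with total coefficient `-1/4 - 1/2 - 1/2 = -5/4` of
`bitrace`. -/
theorem laplacian_scal (h : NormalMetric D ev g gi) :
    ∑ p, ev (D p (D p (scal D g gi))) =
      ∑ i, ∑ j, trace (jet2 D ev g) i j ^ 2 + 2 * normSq (jet2 D ev g) -
        5 / 4 * bitrace D ev g := by
  have hA := h.isNormalJet
  set A := jet2 D ev g with hAdef
  set rr := ∑ i, ∑ j, trace A i j ^ 2 with hrr
  have e1 : ∑ p, ev (D p (D p (scal D g gi))) =
      3 / 2 * rr + ∑ p, ∑ j, ∑ i, ev (D p (D p (riem D g gi i i j j))) := by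
    have : ∀ p, ev (D p (D p (scal D g gi))) = ∑ j, ∑ k, (3 / 2) * (A j k p p * trace A j k) +
        ∑ j, ∑ i, ev (D p (D p (riem D g gi i i j j))) := by
      intro p
      simp only [scal, map_sum, ev_deriv_deriv_mul, h.ev_deriv_inv, h.ev_deriv_deriv_inv, h.ev_inv,
        h.ev_ric, zero_mul, add_zero, ite_mul, one_mul, Finset.sum_add_distrib,
        Finset.sum_ite_eq, Finset.mem_univ, if_true]
      rw [add_comm]
      congr 1
      swap
      · simp only [ric, map_sum]
      exact Finset.sum_congr rfl fun j _ => Finset.sum_congr rfl fun k _ => by ring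
    simp_rw [this, Finset.sum_add_distrib, ← Finset.mul_sum]
    congr 2
    rw [Finset.sum_comm_cycle, Finset.sum_comm_cycle]
    refine Finset.sum_congr rfl fun i _ => Finset.sum_congr rfl fun j _ => ?_
    rw [← Finset.sum_mul, pow_two]
    rfl
  have e2 : ∑ p, ∑ j, ∑ i, ev (D p (D p (riem D g gi i i j j))) =
      ∑ i, ∑ j, ∑ p, ev (D p (D p (riem D g gi i i j j))) := by
    rw [Finset.sum_comm_cycle, Finset.sum_congr rfl fun i _ => Finset.sum_comm]
  have e3 : ∀ i j p, ev (D p (D p (riem D g gi i i j j))) =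
      ev (D p (D p (D i (D j (g j i))))) - 1 / 2 * ev (D p (D p (D i (D i (g j j))))) -
      1 / 2 * ev (D p (D p (D j (D j (g i i))))) + ∑ l, A i l p p * A j j l i
      + 2 * ∑ l, A i l p i * A j j l p - ∑ l, A i l p p * A i j l j
      - 2 * ∑ l, A i l p j * A i j l p + 2 * ∑ m, A i m i p * A j j m p
      - 2 * ∑ m, A j m i p * A i j m p := by
    intro i j p
    rw [h.ev_deriv_deriv_riem, h.ev_deriv3_chr, h.ev_deriv3_chr]
    simp only [Finset.sum_add_distrib, Finset.sum_sub_distrib, ← hAdef]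
    rw [h.symm j i]
    ring
  -- Each quadratic contraction is a multiple of one of the two invariants `rr` and `normSq A`, by
  -- the trace identities or by `sum_mul_cross`.
  have t1 : ∑ i, ∑ j, ∑ p, ∑ l, A i l p p * A j j l i = rr := by
    refine Finset.sum_congr rfl fun i _ => ?_
    rw [Finset.sum_comm_cycle]
    refine Finset.sum_congr rfl fun l _ => ?_
    rw [Finset.sum_comm, ← Finset.sum_mul_sum, hA.sum_left, hA.trace_symm l i, pow_two]
    rfl
  have t2 : ∑ i, ∑ j, ∑ p, ∑ l, A i l p i * A j j l p = -(1 / 2) * rr := by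
    calc _ = ∑ l, ∑ p, ∑ i, ∑ j, A i l i p * A j j l p := by
          rw [Finset.sum_congr rfl fun i _ => Finset.sum_comm_cycle, Finset.sum_comm]
          refine Finset.sum_congr rfl fun l _ => ?_
          rw [Finset.sum_comm_cycle]
          simp_rw [hA.swap_right _ l _ _]
      _ = _ := by
          simp_rw [← Finset.sum_mul_sum, hA.sum_left, hA.sum_cross, hrr, Finset.mul_sum]
          exact Finset.sum_congr rfl fun l _ => Finset.sum_congr rfl fun p _ => by ring
  have t3 : ∑ i, ∑ j, ∑ p, ∑ l, A i l p p * A i j l j = -(1 / 2) * rr := by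
    have hx : ∀ i l, ∑ j, A i j l j = -(1 / 2) * trace A i l := fun i l => by
      rw [← hA.sum_cross]
      exact Finset.sum_congr rfl fun j _ => by rw [hA.swap_left, hA.swap_right]
    rw [hrr, Finset.mul_sum]
    refine Finset.sum_congr rfl fun i _ => ?_
    rw [Finset.sum_comm_cycle, Finset.mul_sum]
    refine Finset.sum_congr rfl fun l _ => ?_
    rw [Finset.sum_comm, ← Finset.sum_mul_sum, hx]
    unfold trace
    ring
  have t4 : ∑ i, ∑ j, ∑ p, ∑ l, A i l p j * A i j l p = -(1 / 2) * normSq A := by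
    rw [← hA.sum_mul_cross]
    refine Finset.sum_congr rfl fun i _ => ?_
    rw [Finset.sum_comm_cycle]
    refine Finset.sum_congr rfl fun l _ => Finset.sum_congr rfl fun j _ =>
      Finset.sum_congr rfl fun p _ => ?_
    rw [hA.swap_right i l]
  have t5 : ∑ i, ∑ j, ∑ p, ∑ l, A i l i p * A j j l p = -(1 / 2) * rr := by
    rw [← t2]
    refine Finset.sum_congr rfl fun i _ => Finset.sum_congr rfl fun j _ =>
      Finset.sum_congr rfl fun p _ => Finset.sum_congr rfl fun l _ => ?_
    rw [hA.swap_right i l]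
  have t6 : ∑ i, ∑ j, ∑ p, ∑ l, A j l i p * A i j l p = -(1 / 2) * normSq A := by
    rw [← hA.sum_mul_cross, Finset.sum_comm]
    refine Finset.sum_congr rfl fun j _ => ?_
    rw [Finset.sum_comm_cycle]
    refine Finset.sum_congr rfl fun l _ => Finset.sum_congr rfl fun i _ =>
      Finset.sum_congr rfl fun p _ => ?_
    rw [hA.swap_left i j]
  have t7 : ∑ i, ∑ j, ∑ p, ev (D p (D p (D i (D i (g j j))))) = bitrace D ev g := by
    rw [Finset.sum_comm]
    refine Finset.sum_congr rfl fun j _ => ?_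
    rw [Finset.sum_comm]
  have t8 : ∑ i, ∑ j, ∑ p, ev (D p (D p (D j (D j (g i i))))) = bitrace D ev g := by
    refine Finset.sum_congr rfl fun j _ => ?_
    rw [Finset.sum_comm]
  rw [e1, e2]
  simp only [e3, Finset.sum_add_distrib, Finset.sum_sub_distrib, ← Finset.mul_sum,
    t1, t2, t3, t4, t5, t6, t7, t8, h.sum_fourth]
  ring

/-! #### The Riemannian density -/

variable {J : R}

theorem ev_deriv_density (h : NormalMetric D ev g gi)
    (hJ : ∀ i, D i J = J * ((1 / 2 : ℝ) • ∑ j, ∑ k, gi j k * D i (g j k))) (i : Fin n) :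
    ev (D i J) = 0 := by
  rw [hJ]
  simp [h.ev_deriv]

theorem ev_logDeriv (h : NormalMetric D ev g gi) (p i : Fin n) :
    ev (D p ((1 / 2 : ℝ) • ∑ j, ∑ k, gi j k * D i (g j k))) = 1 / 2 * trace (jet2 D ev g) p i := by
  simp only [Derivation.map_smul, map_smul, map_sum, Derivation.leibniz, map_add ev,
    smul_eq_mul, map_mul, h.ev_deriv_inv, h.ev_inv, h.ev_deriv, mul_zero, zero_mul, add_zero,
    ite_mul, one_mul, Finset.sum_ite_eq, Finset.mem_univ, if_true]
  rw [← h.isNormalJet.sum_left]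
  rfl

theorem ev_deriv_deriv_density (h : NormalMetric D ev g gi)
    (hJ : ∀ i, D i J = J * ((1 / 2 : ℝ) • ∑ j, ∑ k, gi j k * D i (g j k))) (hJ1 : ev J = 1)
    (p i : Fin n) : ev (D p (D i J)) = 1 / 2 * trace (jet2 D ev g) p i := by
  rw [hJ, Derivation.leibniz, map_add, smul_eq_mul, smul_eq_mul, map_mul, map_mul,
    h.ev_logDeriv, hJ1, h.ev_deriv_density hJ, one_mul, mul_zero, add_zero]

/-- With `w i = ∂_i log J` one has `∂_i J = J * w i`, and `w` vanishes at the centre. So a fourth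
derivative of `J` there consists of products of two first derivatives of `w` and one third
derivative of `w`; only the latter involves fourth derivatives of the metric. -/
theorem bilaplacian_density (h : NormalMetric D ev g gi)
    (hJ : ∀ i, D i J = J * ((1 / 2 : ℝ) • ∑ j, ∑ k, gi j k * D i (g j k))) (hJ1 : ev J = 1) :
    ∑ p, ∑ i, ev (D p (D p (D i (D i J)))) =
      1 / 4 * (∑ i, trace (jet2 D ev g) i i) ^ 2 + 1 / 2 * bitrace D ev g -
        normSq (jet2 D ev g) := by
  have hA := h.isNormalJet
  set w : Fin n → R := fun i => (1 / 2 : ℝ) • ∑ j, ∑ k, gi j k * D i (g j k) with hw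
  have hJ' : ∀ i, D i J = J * w i := hJ
  have hw0 : ∀ i, ev (w i) = 0 := fun i => by simp [hw, h.ev_deriv]
  have hw1 : ∀ p i, ev (D p (w i)) = 1 / 2 * trace (jet2 D ev g) p i := fun p i =>
    h.ev_logDeriv p i
  have hw3 : ∀ p i, ev (D p (D p (D i (w i)))) = 1 / 2 * ∑ j, ev (D p (D p (D i (D i (g j j))))) -
      1 / 2 * ∑ j, ∑ k, jet2 D ev g j k p p * jet2 D ev g j k i i -
      ∑ j, ∑ k, jet2 D ev g j k p i ^ 2 := by
    intro p i
    simp only [hw, Derivation.map_smul, map_smul, map_sum]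
    simp_rw [ev_deriv3_mul h.comm (fun p => h.ev_deriv_inv p _ _) (h.ev_deriv i _ _),
      h.ev_deriv_deriv_inv, h.ev_inv]
    simp only [smul_eq_mul, Finset.sum_add_distrib, ite_mul, one_mul, zero_mul, Finset.sum_ite_eq,
      Finset.mem_univ, if_true, neg_mul, Finset.sum_neg_distrib]
    have e : ∑ j, ∑ k, jet2 D ev g j k p i * ev (D p (D i (g j k))) =
      ∑ j, ∑ k, jet2 D ev g j k p i ^ 2 := by simp_rw [pow_two]; rfl
    rw [e]
    unfold jet2
    ring
  have key : ∀ p i, ev (D p (D p (D i (D i J)))) =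
      1 / 4 * (trace (jet2 D ev g) p p * trace (jet2 D ev g) i i) +
      1 / 2 * trace (jet2 D ev g) p i ^ 2 + ev (D p (D p (D i (w i)))) := by
    intro p i
    simp only [hJ', Derivation.leibniz, map_add, smul_eq_mul, map_mul, hw0, hw1, hJ1]
    ring
  simp_rw [key, hw3]
  simp only [Finset.sum_add_distrib, Finset.sum_sub_distrib, ← Finset.mul_sum]
  have s1 : ∑ p, ∑ i, ∑ j, ev (D p (D p (D i (D i (g j j))))) = bitrace D ev g := by
    rw [Finset.sum_comm_cycle]
    rfl
  have s2 : ∑ p, ∑ i, ∑ j, ∑ k, jet2 D ev g j k p p * jet2 D ev g j k i i =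
      ∑ p, ∑ i, trace (jet2 D ev g) p i ^ 2 := by
    rw [Finset.sum_comm_cycle]
    refine Finset.sum_congr rfl fun j _ => ?_
    rw [Finset.sum_comm_cycle]
    refine Finset.sum_congr rfl fun k _ => ?_
    rw [← Finset.sum_mul_sum, pow_two]
    rfl
  have s3 : ∑ p, ∑ i, ∑ j, ∑ k, jet2 D ev g j k p i ^ 2 = normSq (jet2 D ev g) := by
    simp_rw [fun j k p i => hA.pair j k p i]
    rfl
  have s4 : ∑ p, ∑ i, trace (jet2 D ev g) p p * trace (jet2 D ev g) i i =
      (∑ i, trace (jet2 D ev g) i i) ^ 2 := by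
    rw [pow_two, Finset.sum_mul_sum]
  simp_rw [← Finset.mul_sum] at s4
  rw [s1, s2, s3, s4]
  ring

end NormalMetric

end Algebraic

end MetricJet

namespace CoordMetric

noncomputable section

open GaussianAverage MetricJet

variable {n : ℕ}

/-! ### Locality and smoothness of the coordinate formulas -/

theorem pderiv_congr {f f' : Coord n → ℝ} {y : Coord n} (h : f =ᶠ[𝓝 y] f') (i : Fin n) :
    pderiv i f =ᶠ[𝓝 y] pderiv i f' :=
  h.fderiv.mono fun z hz => by unfold pderiv; rw [hz]

variable {G G' : Coord n → Matrix (Fin n) (Fin n) ℝ} {y : Coord n}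

theorem christoffel_congr (h : G =ᶠ[𝓝 y] G') (k i j : Fin n) :
    christoffel G k i j =ᶠ[𝓝 y] christoffel G' k i j := by
  have h1 : ∀ l i j, pderiv l (fun z => G z i j) =ᶠ[𝓝 y] pderiv l (fun z => G' z i j) :=
    fun l i j => pderiv_congr (h.mono fun z hz => by simp only [hz]) l
  have h2 : ∀ᶠ z in 𝓝 y, ∀ l i j,
      pderiv l (fun z => G z i j) z = pderiv l (fun z => G' z i j) z :=
    eventually_all.2 fun l => eventually_all.2 fun i => eventually_all.2 fun j => h1 l i j
  filter_upwards [h, h2] with z hz hz2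
  simp only [christoffel, hz, hz2]

theorem riemannUp_congr (h : G =ᶠ[𝓝 y] G') (l i j k : Fin n) :
    riemannUp G l i j k =ᶠ[𝓝 y] riemannUp G' l i j k := by
  have h1 : ∀ᶠ z in 𝓝 y, ∀ k i j, christoffel G k i j z = christoffel G' k i j z :=
    eventually_all.2 fun l => eventually_all.2 fun i => eventually_all.2 fun j =>
      christoffel_congr h l i j
  filter_upwards [h1, pderiv_congr (christoffel_congr h l j k) i,
    pderiv_congr (christoffel_congr h l i k) j] with z h1 h2 h3
  simp only [riemannUp, h1, h2, h3]

theorem ricci_congr (h : G =ᶠ[𝓝 y] G') (j k : Fin n) : ricci G j k =ᶠ[𝓝 y] ricci G' j k := by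
  have h1 : ∀ᶠ z in 𝓝 y, ∀ i, riemannUp G i i j k z = riemannUp G' i i j k z :=
    eventually_all.2 fun i => riemannUp_congr h i i j k
  filter_upwards [h1] with z h1
  simp only [ricci, h1]

theorem scalar_congr (h : G =ᶠ[𝓝 y] G') : scalar G =ᶠ[𝓝 y] scalar G' := by
  have h1 : ∀ᶠ z in 𝓝 y, ∀ j k, ricci G j k z = ricci G' j k z :=
    eventually_all.2 fun j => eventually_all.2 fun k => ricci_congr h j k
  filter_upwards [h, h1] with z hz h1
  simp only [scalar, hz, h1]

theorem riemannNormSq_congr (h : G =ᶠ[𝓝 y] G') : riemannNormSq G y = riemannNormSq G' y := by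
  have h1 : ∀ i j k l, riemannUp G i j k l y = riemannUp G' i j k l y :=
    fun i j k l => (riemannUp_congr h i j k l).self_of_nhds
  simp only [riemannNormSq, riemann, h.self_of_nhds, h1]

theorem laplace_congr (h : G =ᶠ[𝓝 y] G') {f f' : Coord n → ℝ} (hf : f =ᶠ[𝓝 y] f') :
    laplace G f y = laplace G' f' y := by
  have h1 : ∀ k i j, christoffel G k i j y = christoffel G' k i j y :=
    fun k i j => (christoffel_congr h k i j).self_of_nhds
  have h2 : ∀ i, pderiv i f y = pderiv i f' y := fun i => (pderiv_congr hf i).self_of_nhds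
  have h3 : ∀ i j, pderiv i (pderiv j f) y = pderiv i (pderiv j f') y :=
    fun i j => (pderiv_congr (pderiv_congr hf j) i).self_of_nhds
  simp only [laplace, h.self_of_nhds, h1, h2, h3]

theorem flatLaplacian_congr {f f' : Coord n → ℝ} (h : f =ᶠ[𝓝 y] f') :
    flatLaplacian f =ᶠ[𝓝 y] flatLaplacian f' := by
  have h1 : ∀ᶠ z in 𝓝 y, ∀ i, pderiv i (pderiv i f) z = pderiv i (pderiv i f') z :=
    eventually_all.2 fun i => pderiv_congr (pderiv_congr h i) i
  filter_upwards [h1] with z h1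
  simp only [flatLaplacian, h1]

theorem contDiffAt_pderiv {f : Coord n → ℝ} (hf : ContDiffAt ℝ ∞ f y) (i : Fin n) :
    ContDiffAt ℝ ∞ (pderiv i f) y :=
  (hf.fderiv_right (m := ∞) (by simp)).clm_apply contDiffAt_const

theorem contDiffAt_det {M : Coord n → Matrix (Fin n) (Fin n) ℝ}
    (hM : ∀ i j, ContDiffAt ℝ ∞ (fun z => M z i j) y) : ContDiffAt ℝ ∞ (fun z => (M z).det) y := by
  simp only [Matrix.det_apply']
  exact ContDiffAt.sum fun σ _ => contDiffAt_const.mul (contDiffAt_prod fun i _ => hM _ _)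

theorem contDiffAt_inv_apply (hG : ∀ i j, ContDiffAt ℝ ∞ (fun z => G z i j) y)
    (hdet : (G y).det ≠ 0) (i j : Fin n) : ContDiffAt ℝ ∞ (fun z => (G z)⁻¹ i j) y := by
  simp only [Matrix.inv_def, Matrix.smul_apply, Ring.inverse_eq_inv', smul_eq_mul,
    Matrix.adjugate_apply]
  refine ((contDiffAt_det hG).inv hdet).mul (contDiffAt_det fun k l => ?_)
  by_cases hk : k = j
  · subst hk
    simp only [Matrix.updateRow_self]
    exact contDiffAt_const
  · simp only [Matrix.updateRow_ne hk]
    exact hG k l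

theorem contDiffAt_christoffel (hG : ∀ i j, ContDiffAt ℝ ∞ (fun z => G z i j) y)
    (hdet : (G y).det ≠ 0) (k i j : Fin n) : ContDiffAt ℝ ∞ (christoffel G k i j) y :=
  contDiffAt_const.mul (ContDiffAt.sum fun l _ => (contDiffAt_inv_apply hG hdet k l).mul
    (((contDiffAt_pderiv (hG j l) i).add (contDiffAt_pderiv (hG i l) j)).sub
      (contDiffAt_pderiv (hG i j) l)))

theorem contDiffAt_riemannUp (hG : ∀ i j, ContDiffAt ℝ ∞ (fun z => G z i j) y)
    (hdet : (G y).det ≠ 0) (l i j k : Fin n) : ContDiffAt ℝ ∞ (riemannUp G l i j k) y := by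
  have h := fun k i j => contDiffAt_christoffel hG hdet k i j
  exact ((contDiffAt_pderiv (h l j k) i).sub (contDiffAt_pderiv (h l i k) j)).add
    (ContDiffAt.sum fun m _ => ((h l i m).mul (h m j k)).sub ((h l j m).mul (h m i k)))

theorem contDiffAt_scalar (hG : ∀ i j, ContDiffAt ℝ ∞ (fun z => G z i j) y)
    (hdet : (G y).det ≠ 0) : ContDiffAt ℝ ∞ (scalar G) y :=
  ContDiffAt.sum fun j _ => ContDiffAt.sum fun k _ => (contDiffAt_inv_apply hG hdet j k).mul
    (ContDiffAt.sum fun i _ => contDiffAt_riemannUp hG hdet i i j k)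

theorem pderiv_pderiv_comm {f : Coord n → ℝ} (hf : ContDiffAt ℝ ∞ f y) (i j : Fin n) :
    pderiv i (pderiv j f) y = pderiv j (pderiv i f) y := by
  have hd : DifferentiableAt ℝ (fderiv ℝ f) y :=
    (hf.fderiv_right (m := ∞) (by simp)).differentiableAt (by simp)
  have h1 : ∀ i j, pderiv i (pderiv j f) y =
      fderiv ℝ (fderiv ℝ f) y (EuclideanSpace.single i 1) (EuclideanSpace.single j 1) := by
    intro i j
    unfold pderiv
    rw [fderiv_clm_apply hd (differentiableAt_const _)]
    simp
  rw [h1, h1]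
  exact (hf.isSymmSndFDerivAt (by simp; exact WithTop.coe_le_coe.2 le_top)).eq _ _

/-! ### The algebra of smooth functions -/

variable (n) in
/-- The algebra of smooth functions on `ℝⁿ`. -/
def smoothFun : Subalgebra ℝ (Coord n → ℝ) where
  carrier := {f | ContDiff ℝ ∞ f}
  mul_mem' := fun hf hg => Set.mem_ofPred.2 ((Set.mem_ofPred.1 hf).mul (Set.mem_ofPred.1 hg))
  add_mem' := fun hf hg => Set.mem_ofPred.2 ((Set.mem_ofPred.1 hf).add (Set.mem_ofPred.1 hg))
  algebraMap_mem' := fun c => Set.mem_ofPred.2 (contDiff_const (c := c))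

theorem mem_smoothFun {f : Coord n → ℝ} : f ∈ smoothFun n ↔ ContDiff ℝ ∞ f := Set.mem_ofPred

theorem contDiff_val (f : smoothFun n) : ContDiff ℝ ∞ f.1 := mem_smoothFun.1 f.2

/-- The partial derivatives, as derivations of the algebra of smooth functions. -/
def dfun (i : Fin n) : Derivation ℝ (smoothFun n) (smoothFun n) :=
  Derivation.mk'
    { toFun := fun f => ⟨pderiv i f.1, mem_smoothFun.2 (contDiff_pderiv (contDiff_val f) i)⟩
      map_add' := fun f g => Subtype.ext <| funext fun y => by
        have hf := (contDiff_val f).differentiable (by simp) y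
        have hg := (contDiff_val g).differentiable (by simp) y
        change fderiv ℝ (f.1 + g.1) y _ = fderiv ℝ f.1 y _ + fderiv ℝ g.1 y _
        rw [fderiv_add hf hg]; rfl
      map_smul' := fun c f => Subtype.ext <| funext fun y => by
        have hf := (contDiff_val f).differentiable (by simp) y
        change fderiv ℝ (c • f.1) y _ = c * fderiv ℝ f.1 y _
        rw [fderiv_const_smul hf]; rfl }
    fun f g => Subtype.ext <| funext fun y => by
      have hf := (contDiff_val f).differentiable (by simp) y
      have hg := (contDiff_val g).differentiable (by simp) y
      change fderiv ℝ (f.1 * g.1) y _ = f.1 y * fderiv ℝ g.1 y _ + g.1 y * fderiv ℝ f.1 y _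
      rw [fderiv_mul hf hg]; rfl

variable (n) in
/-- The evaluation at the origin. -/
def evalZero : smoothFun n →ₐ[ℝ] ℝ :=
  (Pi.evalAlgHom ℝ (fun _ : Coord n => ℝ) 0).comp (smoothFun n).val

/-- A coordinate function. -/
def coordFun (j : Fin n) : smoothFun n := ⟨fun y => y j, by
  have : ContDiff ℝ ∞ (fun y : Coord n => y j) := by fun_prop
  exact mem_smoothFun.2 this⟩

theorem val_dfun (i : Fin n) (f : smoothFun n) : (dfun i f).1 = pderiv i f.1 := rfl

theorem val_add (f g : smoothFun n) (y : Coord n) : (f + g).1 y = f.1 y + g.1 y := rfl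

theorem val_sub (f g : smoothFun n) (y : Coord n) : (f - g).1 y = f.1 y - g.1 y := rfl

theorem val_mul (f g : smoothFun n) (y : Coord n) : (f * g).1 y = f.1 y * g.1 y := rfl

theorem val_smul (c : ℝ) (f : smoothFun n) (y : Coord n) : (c • f).1 y = c * f.1 y := rfl

theorem evalZero_apply (f : smoothFun n) : evalZero n f = f.1 0 := rfl

theorem dfun_coordFun (i j : Fin n) : dfun i (coordFun j) = if i = j then 1 else 0 := by
  refine Subtype.ext <| funext fun y => ?_
  change fderiv ℝ (fun y : Coord n => y j) y (EuclideanSpace.single i 1) = _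
  have : HasFDerivAt (fun y : Coord n => y j)
      (EuclideanSpace.proj j : Coord n →L[ℝ] ℝ) y :=
    (EuclideanSpace.proj j : Coord n →L[ℝ] ℝ).hasFDerivAt
  rw [this.fderiv]
  by_cases h : i = j
  · simp [h]
  · simp [h, Ne.symm h]

theorem dfun_comm (i j : Fin n) (f : smoothFun n) : dfun i (dfun j f) = dfun j (dfun i f) :=
  Subtype.ext <| funext fun _ => pderiv_pderiv_comm (contDiff_val f).contDiffAt i j

theorem coe_sum {ι : Type*} (s : Finset ι) (f : ι → smoothFun n) (y : Coord n) :
    (∑ i ∈ s, f i : smoothFun n).1 y = ∑ i ∈ s, (f i).1 y := by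
  have : (∑ i ∈ s, f i : smoothFun n).1 = ∑ i ∈ s, (f i).1 := by
    exact map_sum (smoothFun n).val f s
  rw [this, Finset.sum_apply]

/-- A derivative of `∑ f_j y_j` either passes to the coefficients or consumes the linear factor.
After iteration and evaluation at the origin, the Gauss lemma becomes a family of relations among
derivatives of the metric of one order less. -/
theorem dfun_sum_mul_coordFun (a : Fin n) (f : Fin n → smoothFun n) :
    dfun a (∑ j, f j * coordFun j) = ∑ j, dfun a (f j) * coordFun j + f a := by
  simp only [map_sum, Derivation.leibniz, dfun_coordFun, smul_eq_mul, mul_ite, mul_one, mul_zero,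
    Finset.sum_add_distrib, Finset.sum_ite_eq, Finset.mem_univ, if_true]
  rw [add_comm]
  simp_rw [mul_comm]

theorem evalZero_sum_mul_coordFun (f : Fin n → smoothFun n) :
    evalZero n (∑ j, f j * coordFun j) = 0 := by
  have : ∀ j : Fin n, evalZero n (coordFun j) = 0 := fun j => rfl
  simp [this]

/-- A globally defined smooth metric that satisfies the Gauss lemma near the origin. -/
structure IsGaussMetric (G : Coord n → Matrix (Fin n) (Fin n) ℝ) : Prop where
  smooth : ∀ i j, ContDiff ℝ ∞ fun y => G y i j
  symm : ∀ y i j, G y i j = G y j i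
  det_pos : ∀ y, 0 < (G y).det
  zero : G 0 = 1
  gauss : ∀ᶠ y in 𝓝 0, ∀ i, ∑ j, G y i j * y j = y i

/-! ### Curvature and volume density at the origin of a metric that satisfies the Gauss lemma -/

namespace IsGaussMetric

/-- The metric coefficients as elements of the algebra of smooth functions. -/
def metric (h : IsGaussMetric G) (i j : Fin n) : smoothFun n :=
  ⟨fun y => G y i j, mem_smoothFun.2 (h.smooth i j)⟩

/-- The coefficients of the inverse metric. -/
def inv (h : IsGaussMetric G) (i j : Fin n) : smoothFun n := ⟨fun y => (G y)⁻¹ i j,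
  mem_smoothFun.2 <| contDiff_iff_contDiffAt.2 fun y =>
    contDiffAt_inv_apply (fun i j => (h.smooth i j).contDiffAt) (h.det_pos y).ne' i j⟩

/-- The Riemannian density. -/
def density (h : IsGaussMetric G) : smoothFun n := ⟨fun y => √(G y).det,
  mem_smoothFun.2 <| contDiff_iff_contDiffAt.2 fun y =>
    (contDiffAt_det fun i j => (h.smooth i j).contDiffAt).sqrt (h.det_pos y).ne'⟩

theorem evalZero_eq_zero {f : smoothFun n} (hf : f.1 =ᶠ[𝓝 0] 0) : evalZero n f = 0 :=
  hf.self_of_nhds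

theorem dfun_eventually {f : smoothFun n} (hf : f.1 =ᶠ[𝓝 0] 0) (i : Fin n) :
    (dfun i f).1 =ᶠ[𝓝 0] 0 := by
  have h1 := pderiv_congr hf i
  refine h1.trans (Eventually.of_forall fun y => ?_)
  simp [pderiv]

theorem gauss_eventually (h : IsGaussMetric G) (i : Fin n) :
    (∑ j, h.metric i j * coordFun j - coordFun i).1 =ᶠ[𝓝 0] 0 := by
  filter_upwards [h.gauss] with y hy
  have h1 : (∑ j, h.metric i j * coordFun j - coordFun i).1 y =
    (∑ j, h.metric i j * coordFun j).1 y - y i := rfl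
  rw [h1, coe_sum]
  exact sub_eq_zero.2 (hy i)

/-- Differentiating `∑ g_ij y_j = y_i` at the origin `m + 1` times shows that the `m`-th derivatives
of `g_ij`, symmetrized over `j` and the derivative indices, vanish. The values `m = 1, 2, 4` give
the three families of relations required. -/
theorem normalMetric (h : IsGaussMetric G) : NormalMetric dfun (evalZero n) h.metric h.inv where
  comm := dfun_comm
  symm i j := Subtype.ext <| funext fun y => h.symm y i j
  inv_mul i j := Subtype.ext <| funext fun y => by
    rw [coe_sum]
    have h1 := congrFun (congrFun (Matrix.nonsing_inv_mul (G y) (h.det_pos y).ne'.isUnit) i) j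
    rw [Matrix.mul_apply] at h1
    refine h1.trans ?_
    rw [Matrix.one_apply]
    split_ifs <;> rfl
  ev_metric i j := by
    change G 0 i j = _
    rw [h.zero, Matrix.one_apply]
  ev_deriv k i j := by
    have hs : ∀ k i j, evalZero n (dfun k (h.metric i j)) = evalZero n (dfun k (h.metric j i)) := by
      intro k i j
      congr 2
      exact Subtype.ext <| funext fun y => h.symm y i j
    -- The first derivatives are symmetric in the metric indices and antisymmetric in the derivative
    -- index and one metric index; such an array is zero.
    have ha : ∀ a b i, evalZero n (dfun a (h.metric i b)) + evalZero n (dfun b (h.metric i a)) = 0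
        := by
      intro a b i
      have := evalZero_eq_zero (dfun_eventually (dfun_eventually (h.gauss_eventually i) b) a)
      simp only [map_sub, dfun_sum_mul_coordFun, map_add, evalZero_sum_mul_coordFun, dfun_coordFun]
        at this
      have h0 : evalZero n (dfun a (if b = i then 1 else 0)) = 0 := by split_ifs <;> simp
      rw [h0] at this
      linarith
    linarith [hs k i j, hs k j i, ha k j i, ha j i k, ha i k j, hs j i k, hs i j k, hs k i j,
      hs i k j, hs j k i]
  cyclic i j k l := by
    have := evalZero_eq_zero (dfun_eventually (dfun_eventually (dfun_eventually
      (h.gauss_eventually i) j) k) l)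
    simp only [map_sub, dfun_sum_mul_coordFun, map_add, evalZero_sum_mul_coordFun, dfun_coordFun]
        at this
    have h0 : evalZero n (dfun l (dfun k (if j = i then 1 else 0))) = 0 := by split_ifs <;> simp
    rw [h0] at this
    rw [dfun_comm k l, dfun_comm j k]
    linarith
  fifth i a b c d f := by
    have := evalZero_eq_zero (dfun_eventually (dfun_eventually (dfun_eventually (dfun_eventually
      (dfun_eventually (h.gauss_eventually i) f) d) c) b) a)
    simp only [map_sub, dfun_sum_mul_coordFun, map_add, evalZero_sum_mul_coordFun, dfun_coordFun]
        at this
    have h0 : evalZero n (dfun a (dfun b (dfun c (dfun d (if f = i then 1 else 0))))) = 0 := by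
      split_ifs <;> simp
    rw [h0] at this
    linarith

theorem density_zero (h : IsGaussMetric G) : evalZero n h.density = 1 := by
  change √(G 0).det = 1
  simp [h.zero]

/-- Apply Jacobi's formula to `density² = det` instead of differentiating the square root. The
adjugate is `density²` times the inverse, and one factor of the positive density cancels. -/
theorem dfun_density (h : IsGaussMetric G) (i : Fin n) : dfun i h.density =
    h.density * ((1 / 2 : ℝ) • ∑ j, ∑ k, h.inv j k * dfun i (h.metric j k)) := by
  have hsq : h.density * h.density = (Matrix.of h.metric).det := by
    refine Subtype.ext <| funext fun y => ?_
    have h1 : (Matrix.of h.metric).det.1 y = (G y).det := by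
      have := RingHom.map_det ((Pi.evalRingHom (fun _ : Coord n => ℝ) y).comp
        (smoothFun n).val.toRingHom) (Matrix.of h.metric)
      exact this
    rw [h1]
    exact Real.mul_self_sqrt (h.det_pos y).le
  have hder := congrArg (dfun i) hsq
  rw [Derivation.map_det, Derivation.leibniz] at hder
  refine Subtype.ext <| funext fun y => ?_
  have hpos : 0 < h.density.1 y := Real.sqrt_pos.2 (h.det_pos y)
  have hadj : ∀ j k, ((Matrix.of h.metric).adjugate j k).1 y =
      h.density.1 y * h.density.1 y * (h.inv j k).1 y := by
    intro j k
    have h1 : ((Matrix.of h.metric).adjugate j k).1 y = (G y).adjugate j k := by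
      have := RingHom.map_adjugate ((Pi.evalRingHom (fun _ : Coord n => ℝ) y).comp
        (smoothFun n).val.toRingHom) (Matrix.of h.metric)
      exact congrFun (congrFun this j) k
    rw [h1]
    change _ = √(G y).det * √(G y).det * (G y)⁻¹ j k
    rw [Real.mul_self_sqrt (h.det_pos y).le, Matrix.inv_def, Ring.inverse_eq_inv']
    simp [(h.det_pos y).ne']
  have h2 : h.density.1 y * (dfun i h.density).1 y + h.density.1 y * (dfun i h.density).1 y =
      ∑ j, ∑ k, h.density.1 y * h.density.1 y * (h.inv j k).1 y * (dfun i (h.metric k j)).1 y := by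
    have := congrFun (congrArg Subtype.val hder) y
    refine this.trans ?_
    rw [coe_sum]
    refine Finset.sum_congr rfl fun j _ => ?_
    rw [coe_sum]
    refine Finset.sum_congr rfl fun k _ => ?_
    rw [← hadj]
    rfl
  have h3 : (h.density * ((1 / 2 : ℝ) • ∑ j, ∑ k, h.inv j k * dfun i (h.metric j k))).1 y =
      h.density.1 y * (1 / 2 * ∑ j, ∑ k, (h.inv j k).1 y * (dfun i (h.metric k j)).1 y) := by
    have hs : ∀ j k, h.metric k j = h.metric j k := fun j k =>
      Subtype.ext <| funext fun y => h.symm y k j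
    simp_rw [hs]
    have : (h.density * ((1 / 2 : ℝ) • ∑ j, ∑ k, h.inv j k * dfun i (h.metric j k))).1 y =
      h.density.1 y * (1 / 2 * (∑ j, ∑ k, h.inv j k * dfun i (h.metric j k)).1 y) := rfl
    rw [this, coe_sum]
    simp_rw [coe_sum]
    rfl
  rw [h3]
  have h4 : ∑ j, ∑ k, h.density.1 y * h.density.1 y * (h.inv j k).1 y *
      (dfun i (h.metric k j)).1 y = h.density.1 y * (h.density.1 y *
        ∑ j, ∑ k, (h.inv j k).1 y * (dfun i (h.metric k j)).1 y) := by
    simp_rw [Finset.mul_sum]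
    exact Finset.sum_congr rfl fun j _ => Finset.sum_congr rfl fun k _ => by ring
  rw [h4, ← mul_add] at h2
  have h5 := mul_left_cancel₀ hpos.ne' h2
  linarith

theorem coe_chr (h : IsGaussMetric G) (k i j : Fin n) :
    (chr dfun h.metric h.inv k i j).1 = christoffel G k i j := by
  funext y
  unfold chr christoffel
  rw [val_smul, coe_sum]
  rfl

theorem coe_riem (h : IsGaussMetric G) (l i j k : Fin n) :
    (riem dfun h.metric h.inv l i j k).1 = riemannUp G l i j k := by
  funext y
  unfold riem riemannUp
  simp only [val_add, val_sub, coe_sum, val_mul, val_dfun, h.coe_chr]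

theorem coe_ric (h : IsGaussMetric G) (j k : Fin n) :
    (ric dfun h.metric h.inv j k).1 = ricci G j k := by
  funext y
  unfold ric ricci
  simp only [coe_sum, h.coe_riem]

theorem coe_scal (h : IsGaussMetric G) : (scal dfun h.metric h.inv).1 = scalar G := by
  funext y
  unfold scal scalar
  simp only [coe_sum, val_mul, h.coe_ric]
  rfl

theorem ricci_zero (h : IsGaussMetric G) (j k : Fin n) :
    ricci G j k 0 = -(3 / 2) * trace (jet2 dfun (evalZero n) h.metric) j k := by
  rw [← h.normalMetric.ev_ric, ← h.coe_ric, evalZero_apply]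

theorem scalar_zero (h : IsGaussMetric G) : scalar G 0 = ∑ i, ricci G i i 0 := by
  simp [scalar, h.zero, Matrix.one_apply]

theorem christoffel_zero (h : IsGaussMetric G) (k i j : Fin n) : christoffel G k i j 0 = 0 := by
  rw [← h.coe_chr, ← evalZero_apply]
  exact h.normalMetric.ev_chr k i j

theorem riemannNormSq_zero (h : IsGaussMetric G) :
    riemannNormSq G 0 = 3 * normSq (jet2 dfun (evalZero n) h.metric) := by
  rw [← h.normalMetric.isNormalJet.sum_riemann_sq]
  have h1 : ∀ i j k l, riemann G i j k l 0 = jet2 dfun (evalZero n) h.metric i k l j -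
      jet2 dfun (evalZero n) h.metric j k l i := by
    intro i j k l
    rw [← h.normalMetric.ev_riem]
    simp only [riemann, h.zero, Matrix.one_apply, ite_mul, one_mul, zero_mul, Finset.sum_ite_eq,
      Finset.mem_univ, if_true]
    rw [← h.coe_riem, evalZero_apply]
  simp only [riemannNormSq, h.zero, inv_one, Matrix.one_apply, h1, ite_mul, one_mul, zero_mul,
    mul_ite, mul_one, mul_zero, Finset.sum_ite_eq, Finset.mem_univ, if_true, pow_two]

theorem laplace_zero (h : IsGaussMetric G) (f : Coord n → ℝ) :
    laplace G f 0 = flatLaplacian f 0 := by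
  simp [laplace, flatLaplacian, h.zero, h.christoffel_zero, Matrix.one_apply]

theorem pderiv_density_zero (h : IsGaussMetric G) (i : Fin n) :
    pderiv i (fun y => √(G y).det) 0 = 0 :=
  h.normalMetric.ev_deriv_density h.dfun_density i

theorem pderiv_pderiv_density_zero (h : IsGaussMetric G) (i j : Fin n) :
    pderiv i (pderiv j fun y => √(G y).det) 0 = -(1 / 3) * ricci G i j 0 := by
  have := h.normalMetric.ev_deriv_deriv_density h.dfun_density h.density_zero i j
  rw [h.ricci_zero]
  refine Eq.trans this ?_
  ring

theorem flatLaplacian_flatLaplacian (f : smoothFun n) :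
    flatLaplacian (flatLaplacian f.1) 0 = ∑ p, ∑ i, evalZero n (dfun p (dfun p (dfun i (dfun i f))))
    := by
  have h1 : flatLaplacian f.1 = (∑ i, dfun i (dfun i f)).1 := by
    funext y
    simp only [coe_sum, val_dfun, flatLaplacian]
  have h2 : flatLaplacian (∑ i, dfun i (dfun i f)).1 0 =
      ∑ p, evalZero n (dfun p (dfun p (∑ i, dfun i (dfun i f)))) := by
    simp only [evalZero_apply, val_dfun, flatLaplacian]
  rw [h1, h2]
  simp only [map_sum]

/-- Fourth derivatives of the metric occur here and in the Laplacian of the scalar curvature only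
through `bitrace`, which is eliminated between the two formulas. The rest is translated by `Rc =
-3/2 trace` and `|Rm|² = 3 normSq`. -/
theorem bilaplacian_density_zero (h : IsGaussMetric G) :
    flatLaplacian (flatLaplacian fun y => √(G y).det) 0 =
      2 / 5 * (-laplace G (scalar G) 0 + 5 / 18 * scalar G 0 ^ 2 - 1 / 6 * riemannNormSq G 0 +
        4 / 9 * ∑ i, ∑ j, ricci G i j 0 ^ 2) := by
  have h1 := h.normalMetric.bilaplacian_density h.dfun_density h.density_zero
  rw [← flatLaplacian_flatLaplacian] at h1
  have h2 := h.normalMetric.laplacian_scal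
  have h3 : ∑ p, evalZero n (dfun p (dfun p (scal dfun h.metric h.inv))) =
      laplace G (scalar G) 0 := by
    rw [h.laplace_zero, ← h.coe_scal, flatLaplacian]
    simp only [evalZero_apply, val_dfun]
  rw [h3] at h2
  refine Eq.trans h1 ?_
  rw [h.scalar_zero, h.riemannNormSq_zero]
  simp_rw [h.ricci_zero, ← Finset.mul_sum, mul_pow, ← Finset.mul_sum]
  linarith

end IsGaussMetric

end

end CoordMetric

namespace CoordMetric

noncomputable section

variable {n : ℕ}

/-! ### Invariant form of the coordinate formulas -/

/-- The standard basis vector `∂_i`. -/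
abbrev basisVec (i : Fin n) : Coord n := EuclideanSpace.single i 1

theorem eq_sum_basisVec (v : Coord n) : v = ∑ i, v i • basisVec i := by
  simpa using ((EuclideanSpace.basisFun (Fin n) ℝ).sum_repr v).symm

/-- The bilinear form with coefficients `c`. -/
def bil (c : Fin n → Fin n → ℝ) : Coord n →ₗ[ℝ] Coord n →ₗ[ℝ] ℝ :=
  LinearMap.mk₂ ℝ (fun u v => ∑ i, ∑ j, c i j * u i * v j)
    (fun u u' v => by
      simp only [PiLp.add_apply, mul_add, add_mul, Finset.sum_add_distrib])
    (fun a u v => by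
      simp only [PiLp.smul_apply, smul_eq_mul, Finset.mul_sum]
      exact Finset.sum_congr rfl fun i _ => Finset.sum_congr rfl fun j _ => by ring)
    (fun u v v' => by
      simp only [PiLp.add_apply, mul_add, add_mul, Finset.sum_add_distrib])
    (fun a u v => by
      simp only [PiLp.smul_apply, smul_eq_mul, Finset.mul_sum]
      exact Finset.sum_congr rfl fun i _ => Finset.sum_congr rfl fun j _ => by ring)

/-- The vector-valued bilinear map with coefficients `c`. -/
def vbil (c : Fin n → Fin n → Fin n → ℝ) : Coord n →ₗ[ℝ] Coord n →ₗ[ℝ] Coord n :=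
  LinearMap.mk₂ ℝ (fun u v => WithLp.toLp 2 fun k => bil (c k) u v)
    (fun u u' v => PiLp.ext fun k => by simp)
    (fun a u v => PiLp.ext fun k => by simp)
    (fun u v v' => PiLp.ext fun k => by simp)
    (fun a u v => PiLp.ext fun k => by simp)

theorem bil_apply (c : Fin n → Fin n → ℝ) (u v : Coord n) :
    bil c u v = ∑ i, ∑ j, c i j * u i * v j := rfl

theorem vbil_apply (c : Fin n → Fin n → Fin n → ℝ) (u v : Coord n) (k : Fin n) :
    vbil c u v k = bil (c k) u v := rfl

theorem bil_basisVec (c : Fin n → Fin n → ℝ) (i j : Fin n) :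
    bil c (basisVec i) (basisVec j) = c i j := by
  simp [bil_apply, Pi.single_apply]

theorem bil_basisVec_left (c : Fin n → Fin n → ℝ) (i : Fin n) (v : Coord n) :
    bil c (basisVec i) v = ∑ j, c i j * v j := by
  simp [bil_apply, Pi.single_apply]

theorem bil_symm {c : Fin n → Fin n → ℝ} (h : ∀ i j, c i j = c j i) (u v : Coord n) :
    bil c u v = bil c v u := by
  rw [bil_apply, bil_apply, Finset.sum_comm]
  exact Finset.sum_congr rfl fun i _ => Finset.sum_congr rfl fun j _ => by rw [h j i]; ring

theorem hasDerivAt_apply {a : ℝ → Coord n} {a' : Coord n} {t : ℝ} (ha : HasDerivAt a a' t)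
    (i : Fin n) : HasDerivAt (fun s => a s i) (a' i) t :=
  (EuclideanSpace.proj i : Coord n →L[ℝ] ℝ).hasFDerivAt.comp_hasDerivAt t ha

theorem hasDerivAt_bil {c : ℝ → Fin n → Fin n → ℝ} {c' : Fin n → Fin n → ℝ} {a b : ℝ → Coord n}
    {a' b' : Coord n} {t : ℝ} (hc : ∀ i j, HasDerivAt (fun s => c s i j) (c' i j) t)
    (ha : HasDerivAt a a' t) (hb : HasDerivAt b b' t) :
    HasDerivAt (fun s => bil (c s) (a s) (b s))
      (bil c' (a t) (b t) + bil (c t) a' (b t) + bil (c t) (a t) b') t := by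
  have h : HasDerivAt (fun s => ∑ i, ∑ j, c s i j * a s i * b s j)
      (∑ i, ∑ j, ((c' i j * a t i + c t i j * a' i) * b t j + c t i j * a t i * b' j)) t :=
    HasDerivAt.fun_sum fun i _ => HasDerivAt.fun_sum fun j _ =>
      ((hc i j).mul (hasDerivAt_apply ha i)).mul (hasDerivAt_apply hb j)
  refine h.congr_deriv ?_
  simp only [bil_apply, ← Finset.sum_add_distrib]
  exact Finset.sum_congr rfl fun i _ => Finset.sum_congr rfl fun j _ => by ring

/-- The metric as a bilinear form. -/
def met (G : Coord n → Matrix (Fin n) (Fin n) ℝ) (y : Coord n) : Coord n →ₗ[ℝ] Coord n →ₗ[ℝ] ℝ :=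
  bil fun i j => G y i j

/-- The derivative of the metric in the direction `x`. -/
def dmet (G : Coord n → Matrix (Fin n) (Fin n) ℝ) (y x : Coord n) :
    Coord n →ₗ[ℝ] Coord n →ₗ[ℝ] ℝ :=
  bil fun i j => fderiv ℝ (fun z => G z i j) y x

/-- The Christoffel symbols as a bilinear map. -/
def chrMap (G : Coord n → Matrix (Fin n) (Fin n) ℝ) (y : Coord n) :
    Coord n →ₗ[ℝ] Coord n →ₗ[ℝ] Coord n :=
  vbil fun k i j => christoffel G k i j y

/-- The derivative of the Christoffel symbols in the direction `x`. -/
def dchrMap (G : Coord n → Matrix (Fin n) (Fin n) ℝ) (y x : Coord n) :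
    Coord n →ₗ[ℝ] Coord n →ₗ[ℝ] Coord n :=
  vbil fun k i j => fderiv ℝ (christoffel G k i j) y x

/-- The curvature `R(x, u) v`. -/
def curv (G : Coord n → Matrix (Fin n) (Fin n) ℝ) (y x u v : Coord n) : Coord n :=
  dchrMap G y x u v - dchrMap G y u x v +
    (chrMap G y x (chrMap G y u v) - chrMap G y u (chrMap G y x v))

variable {G G' : Coord n → Matrix (Fin n) (Fin n) ℝ} {y : Coord n}

theorem met_nondegenerate (hdet : (G y).det ≠ 0) {a b : Coord n}
    (h : ∀ w, met G y w a = met G y w b) : a = b := by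
  have h1 : (G y).mulVec a = (G y).mulVec b := by
    funext i
    have := h (basisVec i)
    rw [met, bil_basisVec_left, bil_basisVec_left] at this
    exact this
  have h2 := Matrix.mulVec_injective_of_isUnit ((Matrix.isUnit_iff_isUnit_det _).2 hdet.isUnit) h1
  exact PiLp.ext fun i => congrFun h2 i

theorem curv_apply (x u v : Coord n) (l : Fin n) :
    curv G y x u v l = ∑ i, ∑ j, ∑ k, riemannUp G l i j k y * x i * u j * v k := by
  have h1 : ∀ x u v : Coord n, dchrMap G y x u v l =
      ∑ i, ∑ j, ∑ k, pderiv i (christoffel G l j k) y * x i * u j * v k := by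
    intro x u v
    have : ∀ j k, fderiv ℝ (christoffel G l j k) y x * u j * v k =
        ∑ i, pderiv i (christoffel G l j k) y * x i * u j * v k := by
      intro j k
      rw [GaussianAverage.fderiv_apply_eq_sum, Finset.sum_mul, Finset.sum_mul]
      exact Finset.sum_congr rfl fun i _ => by ring
    rw [dchrMap, vbil_apply, bil_apply]
    simp_rw [this]
    exact Finset.sum_comm_cycle
  have h2 : ∀ x u v : Coord n, chrMap G y x (chrMap G y u v) l = ∑ i, ∑ j, ∑ k,
      (∑ m, christoffel G l i m y * christoffel G m j k y) * x i * u j * v k := by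
    intro x u v
    rw [chrMap, vbil_apply, bil_apply]
    refine Finset.sum_congr rfl fun i _ => ?_
    simp_rw [vbil_apply, bil_apply, Finset.mul_sum, Finset.sum_mul]
    rw [Finset.sum_comm]
    refine Finset.sum_congr rfl fun j _ => ?_
    rw [Finset.sum_comm]
    exact Finset.sum_congr rfl fun k _ => Finset.sum_congr rfl fun m _ => by ring
  have h3 : ∀ f : Fin n → Fin n → Fin n → ℝ, ∑ i, ∑ j, ∑ k, f i j k * u i * x j * v k =
      ∑ i, ∑ j, ∑ k, f j i k * x i * u j * v k := by
    intro f
    rw [Finset.sum_comm]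
    exact Finset.sum_congr rfl fun i _ => Finset.sum_congr rfl fun j _ =>
      Finset.sum_congr rfl fun k _ => by ring
  unfold curv
  simp only [PiLp.add_apply, PiLp.sub_apply]
  rw [h1, h1, h2, h2, h3, h3]
  simp only [← Finset.sum_sub_distrib, ← Finset.sum_add_distrib]
  refine Finset.sum_congr rfl fun i _ => Finset.sum_congr rfl fun j _ =>
    Finset.sum_congr rfl fun k _ => ?_
  rw [riemannUp, Finset.sum_sub_distrib]
  ring

/-- The Koszul formula. -/
theorem met_chrMap (hdet : (G y).det ≠ 0) (u v w : Coord n) :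
    met G y w (chrMap G y u v) =
      1 / 2 * (dmet G y u v w + dmet G y v u w - dmet G y w u v) := by
  have hinv : ∀ a l, ∑ k, G y a k * (G y)⁻¹ k l = if a = l then 1 else 0 := by
    intro a l
    rw [← Matrix.mul_apply, Matrix.mul_nonsing_inv _ hdet.isUnit, Matrix.one_apply]
  have hlow : ∀ a i j, ∑ k, G y a k * christoffel G k i j y = 1 / 2 *
      (pderiv i (fun z => G z j a) y + pderiv j (fun z => G z i a) y -
        pderiv a (fun z => G z i j) y) := by
    intro a i j
    unfold christoffel
    simp_rw [Finset.mul_sum]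
    rw [Finset.sum_comm]
    have : ∀ l, ∑ k, G y a k * (1 / 2 * ((G y)⁻¹ k l * (pderiv i (fun z => G z j l) y +
        pderiv j (fun z => G z i l) y - pderiv l (fun z => G z i j) y))) =
        (if a = l then 1 else 0) * (1 / 2 * (pderiv i (fun z => G z j l) y +
        pderiv j (fun z => G z i l) y - pderiv l (fun z => G z i j) y)) := by
      intro l
      rw [← hinv, Finset.sum_mul]
      exact Finset.sum_congr rfl fun k _ => by ring
    simp_rw [this]
    simp
  have hd : ∀ x u v : Coord n, dmet G y x u v =
      ∑ i, ∑ j, ∑ k, pderiv i (fun z => G z j k) y * x i * u j * v k := by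
    intro x u v
    have : ∀ j k, fderiv ℝ (fun z => G z j k) y x * u j * v k =
        ∑ i, pderiv i (fun z => G z j k) y * x i * u j * v k := by
      intro j k
      rw [GaussianAverage.fderiv_apply_eq_sum, Finset.sum_mul, Finset.sum_mul]
      exact Finset.sum_congr rfl fun i _ => by ring
    rw [dmet, bil_apply]
    simp_rw [this]
    exact Finset.sum_comm_cycle
  have hL : met G y w (chrMap G y u v) = ∑ i, ∑ j, ∑ a,
      (∑ k, G y a k * christoffel G k i j y) * u i * v j * w a := by
    rw [met, bil_apply]
    simp_rw [chrMap, vbil_apply, bil_apply, Finset.mul_sum, Finset.sum_mul]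
    rw [Finset.sum_congr rfl fun a _ => Finset.sum_comm, Finset.sum_comm]
    refine Finset.sum_congr rfl fun i _ => ?_
    rw [Finset.sum_congr rfl fun a _ => Finset.sum_comm, Finset.sum_comm]
    exact Finset.sum_congr rfl fun j _ => Finset.sum_congr rfl fun a _ =>
      Finset.sum_congr rfl fun k _ => by ring
  have h1 : dmet G y v u w = ∑ i, ∑ j, ∑ a, pderiv j (fun z => G z i a) y * u i * v j * w a := by
    rw [hd, Finset.sum_comm]
    exact Finset.sum_congr rfl fun i _ => Finset.sum_congr rfl fun j _ =>
      Finset.sum_congr rfl fun k _ => by ring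
  have h2 : dmet G y w u v = ∑ i, ∑ j, ∑ a, pderiv a (fun z => G z i j) y * u i * v j * w a := by
    rw [hd]
    rw [← Finset.sum_comm_cycle]
    exact Finset.sum_congr rfl fun i _ => Finset.sum_congr rfl fun j _ =>
      Finset.sum_congr rfl fun k _ => by ring
  rw [hL, h1, h2, hd]
  simp only [← Finset.sum_sub_distrib, ← Finset.sum_add_distrib, Finset.mul_sum, hlow]
  exact Finset.sum_congr rfl fun i _ => Finset.sum_congr rfl fun j _ =>
      Finset.sum_congr rfl fun k _ => by ring

/-! ### Change of coordinates -/

section Line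

variable {X Y W Z : Type*} [NormedAddCommGroup X] [NormedSpace ℝ X] [NormedAddCommGroup Y]
  [NormedSpace ℝ Y] [NormedAddCommGroup W] [NormedSpace ℝ W] [NormedAddCommGroup Z]
  [NormedSpace ℝ Z]

theorem hasDerivAt_line_of_differentiableAt {f : X → Z} {z : X} (hf : DifferentiableAt ℝ f z)
    (x : X) : HasDerivAt (fun t : ℝ => f (z + t • x)) (fderiv ℝ f z x) 0 := by
  have h2 : HasDerivAt (fun t : ℝ => z + t • x) x 0 := by
    simpa using ((hasDerivAt_id (0 : ℝ)).smul_const x).const_add z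
  have h0 : HasFDerivAt f (fderiv ℝ f z) (z + (0 : ℝ) • x) := by
    rw [zero_smul, add_zero]
    exact hf.hasFDerivAt
  exact h0.comp_hasDerivAt (0 : ℝ) h2

theorem hasDerivAt_line_apply {A : X → Y →L[ℝ] Z} {z : X} (hA : DifferentiableAt ℝ A z)
    (x : X) (u : Y) : HasDerivAt (fun t : ℝ => A (z + t • x) u) (fderiv ℝ A z x u) 0 := by
  simpa using (hasDerivAt_line_of_differentiableAt hA x).clm_apply (hasDerivAt_const (0 : ℝ) u)

theorem hasDerivAt_line_apply_apply {A : X → Y →L[ℝ] W →L[ℝ] Z} {z : X}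
    (hA : DifferentiableAt ℝ A z) (x : X) (u : Y) (v : W) :
    HasDerivAt (fun t : ℝ => A (z + t • x) u v) (fderiv ℝ A z x u v) 0 := by
  simpa using (hasDerivAt_line_apply hA x u).clm_apply (hasDerivAt_const (0 : ℝ) v)

theorem hasDerivAt_line_apply_of_hasDerivAt {A : X → Y →L[ℝ] Z} {z : X}
    (hA : DifferentiableAt ℝ A z) (x : X) {u : ℝ → Y} {u' : Y} (hu : HasDerivAt u u' 0) :
    HasDerivAt (fun t : ℝ => A (z + t • x) (u t)) (fderiv ℝ A z x (u 0) + A z u') 0 := by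
  simpa using (hasDerivAt_line_of_differentiableAt hA x).clm_apply hu

theorem differentiableAt_fderiv_of_contDiffAt {f : X → Z} {z : X} (hf : ContDiffAt ℝ ∞ f z) :
    DifferentiableAt ℝ (fderiv ℝ f) z :=
  (hf.fderiv_right (m := ∞) (by simp)).differentiableAt (by simp)

theorem differentiableAt_fderiv_fderiv_of_contDiffAt {f : X → Z} {z : X}
    (hf : ContDiffAt ℝ ∞ f z) : DifferentiableAt ℝ (fderiv ℝ (fderiv ℝ f)) z :=
  ((hf.fderiv_right (m := ∞) (by simp)).fderiv_right (m := ∞) (by simp)).differentiableAt (by simp)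

theorem fderiv_fderiv_symm {f : X → Z} {z : X} (hf : ContDiffAt ℝ ∞ f z) (x u : X) :
    fderiv ℝ (fderiv ℝ f) z x u = fderiv ℝ (fderiv ℝ f) z u x :=
  (hf.isSymmSndFDerivAt (by simp; exact WithTop.coe_le_coe.2 le_top)).eq _ _

theorem fderiv_fderiv_fderiv_symm {f : X → Z} {z : X} (hf : ContDiffAt ℝ ∞ f z) (x u v : X) :
    fderiv ℝ (fderiv ℝ (fderiv ℝ f)) z x u v = fderiv ℝ (fderiv ℝ (fderiv ℝ f)) z u x v := by
  rw [fderiv_fderiv_symm (hf.fderiv_right (m := ∞) (by simp)) x u]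

end Line

/-- On the open set `S`, the metric `G'` is the pull-back of the metric `G` by the smooth map `φ`. -/
structure IsPullback (φ : Coord n → Coord n) (G G' : Coord n → Matrix (Fin n) (Fin n) ℝ)
    (S : Set (Coord n)) : Prop where
  isOpen : IsOpen S
  smooth : ∀ z ∈ S, ContDiffAt ℝ ∞ φ z
  surjective : ∀ z ∈ S, Function.Surjective (fderiv ℝ φ z)
  smooth_left : ∀ z ∈ S, ∀ i j, ContDiffAt ℝ ∞ (fun z => G z i j) (φ z)
  smooth_right : ∀ z ∈ S, ∀ i j, ContDiffAt ℝ ∞ (fun z => G' z i j) z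
  det_left : ∀ z ∈ S, (G (φ z)).det ≠ 0
  det_right : ∀ z ∈ S, (G' z).det ≠ 0
  symm_left : ∀ z ∈ S, ∀ i j, G (φ z) i j = G (φ z) j i
  met_eq : ∀ z ∈ S, ∀ u v, met G' z u v = met G (φ z) (fderiv ℝ φ z u) (fderiv ℝ φ z v)

namespace IsPullback

variable {φ : Coord n → Coord n} {S : Set (Coord n)}

theorem hasDerivAt_fderiv (h : IsPullback φ G G' S) {z : Coord n} (hz : z ∈ S) (x u : Coord n) :
    HasDerivAt (fun t : ℝ => fderiv ℝ φ (z + t • x) u) (fderiv ℝ (fderiv ℝ φ) z x u) 0 :=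
  hasDerivAt_line_apply (differentiableAt_fderiv_of_contDiffAt (h.smooth z hz)) x u

theorem hasDerivAt_comp (h : IsPullback φ G G' S) {z : Coord n} (hz : z ∈ S) (x : Coord n)
    {f : Coord n → ℝ} (hf : ContDiffAt ℝ ∞ f (φ z)) :
    HasDerivAt (fun t : ℝ => f (φ (z + t • x))) (fderiv ℝ f (φ z) (fderiv ℝ φ z x)) 0 := by
  have h2 : HasDerivAt (fun t : ℝ => z + t • x) x 0 := by
    simpa using ((hasDerivAt_id (0 : ℝ)).smul_const x).const_add z
  have h1 : HasFDerivAt φ (fderiv ℝ φ z) (z + (0 : ℝ) • x) := by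
    rw [zero_smul, add_zero]
    exact ((h.smooth z hz).differentiableAt (by simp)).hasFDerivAt
  have h0 : HasFDerivAt f (fderiv ℝ f (φ z)) (φ (z + (0 : ℝ) • x)) := by
    rw [zero_smul, add_zero]
    exact (hf.differentiableAt (by simp)).hasFDerivAt
  exact h0.comp_hasDerivAt (0 : ℝ) (h1.comp_hasDerivAt (0 : ℝ) h2)

theorem eventually_mem (h : IsPullback φ G G' S) {z : Coord n} (hz : z ∈ S) (x : Coord n) :
    ∀ᶠ t : ℝ in 𝓝 0, z + t • x ∈ S := by
  have : Continuous fun t : ℝ => z + t • x := by fun_prop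
  exact this.continuousAt.eventually_mem (h.isOpen.mem_nhds (by simpa using hz))

theorem hasDerivAt_line {f : Coord n → ℝ} {z : Coord n} (hf : ContDiffAt ℝ ∞ f z) (x : Coord n) :
    HasDerivAt (fun t : ℝ => f (z + t • x)) (fderiv ℝ f z x) 0 :=
  hasDerivAt_line_of_differentiableAt (hf.differentiableAt (by simp)) x

/-- Differentiate the pull-back identity along the line `z + t x`: the derivative falls on the
coefficients of `G` or on one of the two Jacobians. -/
theorem dmet_eq (h : IsPullback φ G G' S) {z : Coord n} (hz : z ∈ S) (x u v : Coord n) :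
    dmet G' z x u v = dmet G (φ z) (fderiv ℝ φ z x) (fderiv ℝ φ z u) (fderiv ℝ φ z v) +
      met G (φ z) (fderiv ℝ (fderiv ℝ φ) z x u) (fderiv ℝ φ z v) +
      met G (φ z) (fderiv ℝ φ z u) (fderiv ℝ (fderiv ℝ φ) z x v) := by
  have h1 := hasDerivAt_bil (c := fun t i j => G' (z + t • x) i j)
    (fun i j => hasDerivAt_line (h.smooth_right z hz i j) x) (hasDerivAt_const (0 : ℝ) u)
    (hasDerivAt_const (0 : ℝ) v)
  have h2 := hasDerivAt_bil (c := fun t i j => G (φ (z + t • x)) i j)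
    (fun i j => h.hasDerivAt_comp hz x (h.smooth_left z hz i j)) (h.hasDerivAt_fderiv hz x u)
    (h.hasDerivAt_fderiv hz x v)
  have h3 : (fun t : ℝ => bil (fun i j => G' (z + t • x) i j) u v) =ᶠ[𝓝 0]
      fun t => bil (fun i j => G (φ (z + t • x)) i j) (fderiv ℝ φ (z + t • x) u)
        (fderiv ℝ φ (z + t • x) v) :=
    (h.eventually_mem hz x).mono fun t ht => h.met_eq _ ht u v
  have := h1.unique (h2.congr_of_eventuallyEq h3)
  simpa [met, dmet] using this

theorem fderiv_symm (h : IsPullback φ G G' S) {z : Coord n} (hz : z ∈ S) (x u : Coord n) :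
    fderiv ℝ (fderiv ℝ φ) z x u = fderiv ℝ (fderiv ℝ φ) z u x :=
  fderiv_fderiv_symm (h.smooth z hz) x u

/-- The transformation law of the Christoffel symbols. -/
theorem chrMap_eq (h : IsPullback φ G G' S) {z : Coord n} (hz : z ∈ S) (u v : Coord n) :
    fderiv ℝ φ z (chrMap G' z u v) =
      chrMap G (φ z) (fderiv ℝ φ z u) (fderiv ℝ φ z v) + fderiv ℝ (fderiv ℝ φ) z u v := by
  -- The metric is nondegenerate and the differential of `φ` is onto, so it suffices to pair with
  -- images of vectors. The Koszul formula computes both sides, and of the second derivatives of `φ`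
  -- supplied by `dmet_eq` only the one in the directions `u`, `v` survives.
  refine met_nondegenerate (h.det_left z hz) fun w' => ?_
  obtain ⟨w, rfl⟩ := h.surjective z hz w'
  have hsG := h.symm_left z hz
  rw [← h.met_eq z hz, met_chrMap (h.det_right z hz), map_add,
    met_chrMap (h.det_left z hz), h.dmet_eq hz, h.dmet_eq hz, h.dmet_eq hz]
  have e1 : ∀ a b, met G (φ z) a b = met G (φ z) b a := fun a b => bil_symm hsG a b
  rw [h.fderiv_symm hz v u, h.fderiv_symm hz w u, h.fderiv_symm hz w v,
    e1 (fderiv ℝ (fderiv ℝ φ) z u v), e1 (fderiv ℝ φ z v) (fderiv ℝ (fderiv ℝ φ) z u w)]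
  ring

theorem hasDerivAt_vbil {c : ℝ → Fin n → Fin n → Fin n → ℝ} {c' : Fin n → Fin n → Fin n → ℝ}
    {a b : ℝ → Coord n} {a' b' : Coord n} {t : ℝ}
    (hc : ∀ k i j, HasDerivAt (fun s => c s k i j) (c' k i j) t)
    (ha : HasDerivAt a a' t) (hb : HasDerivAt b b' t) :
    HasDerivAt (fun s => vbil (c s) (a s) (b s))
      (vbil c' (a t) (b t) + vbil (c t) a' (b t) + vbil (c t) (a t) b') t := by
  have h1 : ∀ k, HasDerivAt (fun s => vbil (c s) (a s) (b s) k)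
      ((vbil c' (a t) (b t) + vbil (c t) a' (b t) + vbil (c t) (a t) b') k) t :=
    fun k => hasDerivAt_bil (hc k) ha hb
  have h2 : HasDerivAt (fun s => ∑ k, vbil (c s) (a s) (b s) k • basisVec k)
      (∑ k, (vbil c' (a t) (b t) + vbil (c t) a' (b t) + vbil (c t) (a t) b') k • basisVec k) t :=
    HasDerivAt.fun_sum fun k _ => (h1 k).smul_const _
  simp_rw [← eq_sum_basisVec] at h2
  exact h2

/-- The derivative of `chrMap_eq` in the direction `x`, found by differentiating both of its sides
along the same line. -/
theorem dchrMap_eq (h : IsPullback φ G G' S) {z : Coord n} (hz : z ∈ S) (x u v : Coord n) :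
    fderiv ℝ (fderiv ℝ φ) z x (chrMap G' z u v) + fderiv ℝ φ z (dchrMap G' z x u v) =
      dchrMap G (φ z) (fderiv ℝ φ z x) (fderiv ℝ φ z u) (fderiv ℝ φ z v) +
      chrMap G (φ z) (fderiv ℝ (fderiv ℝ φ) z x u) (fderiv ℝ φ z v) +
      chrMap G (φ z) (fderiv ℝ φ z u) (fderiv ℝ (fderiv ℝ φ) z x v) +
      fderiv ℝ (fderiv ℝ (fderiv ℝ φ)) z x u v := by
  have h1 := hasDerivAt_vbil (c := fun t k i j => christoffel G' k i j (z + t • x))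
    (fun k i j => hasDerivAt_line (contDiffAt_christoffel (h.smooth_right z hz)
      (h.det_right z hz) k i j) x) (hasDerivAt_const (0 : ℝ) u) (hasDerivAt_const (0 : ℝ) v)
  have h2 := hasDerivAt_vbil (c := fun t k i j => christoffel G k i j (φ (z + t • x)))
    (fun k i j => h.hasDerivAt_comp hz x (contDiffAt_christoffel (h.smooth_left z hz)
      (h.det_left z hz) k i j)) (h.hasDerivAt_fderiv hz x u) (h.hasDerivAt_fderiv hz x v)
  have h3 := hasDerivAt_line_apply_of_hasDerivAt
    (differentiableAt_fderiv_of_contDiffAt (h.smooth z hz)) x h1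
  have h4 := hasDerivAt_line_apply_apply
    (differentiableAt_fderiv_fderiv_of_contDiffAt (h.smooth z hz)) x u v
  have h5 := h3.unique ((h2.add h4).congr_of_eventuallyEq
    ((h.eventually_mem hz x).mono fun t ht => h.chrMap_eq ht u v))
  simpa [chrMap, dchrMap] using h5

/-- The curvature is a tensor. -/
theorem curv_eq (h : IsPullback φ G G' S) {z : Coord n} (hz : z ∈ S) (x u v : Coord n) :
    fderiv ℝ φ z (curv G' z x u v) =
      curv G (φ z) (fderiv ℝ φ z x) (fderiv ℝ φ z u) (fderiv ℝ φ z v) := by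
  have h1 := h.dchrMap_eq hz x u v
  have h2 := h.dchrMap_eq hz u x v
  have h3 := h.chrMap_eq hz x (chrMap G' z u v)
  have h4 := h.chrMap_eq hz u (chrMap G' z x v)
  rw [h.chrMap_eq hz u v, map_add] at h3
  rw [h.chrMap_eq hz x v, map_add] at h4
  -- Antisymmetrizing in `x` and `u` removes the third derivative of `φ`. The terms with second
  -- derivatives cancel against those from the products of Christoffel symbols.
  rw [fderiv_fderiv_fderiv_symm (h.smooth z hz) u x v, h.fderiv_symm hz u x] at h2
  unfold curv
  simp only [map_add, map_sub]
  rw [h3, h4]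
  have h1' := eq_sub_of_add_eq' h1
  have h2' := eq_sub_of_add_eq' h2
  rw [h1', h2']
  abel

end IsPullback

end

end CoordMetric

/-! ### Coordinate invariance of scalar curvature, `|Rm|²` and the Laplace–Beltrami operator -/

namespace CoordMetric

noncomputable section

open Matrix Kronecker

variable {n : ℕ}

/-- The contraction is the trace of `G⁻¹ Mᵀ`, and a simultaneous congruence of `G` and `M` only
conjugates this product by `P`. -/
theorem sum_inv_mul_congr {G P M : Matrix (Fin n) (Fin n) ℝ} (hP : IsUnit P.det) :
    ∑ i, ∑ j, (Pᵀ * G * P)⁻¹ i j * (Pᵀ * M * P) i j = ∑ i, ∑ j, G⁻¹ i j * M i j := by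
  have h1 : ∀ A B : Matrix (Fin n) (Fin n) ℝ, ∑ i, ∑ j, A i j * B i j = (A * Bᵀ).trace := by
    intro A B
    simp [Matrix.trace, Matrix.mul_apply]
  have hPt : IsUnit (Pᵀ).det := by rwa [Matrix.det_transpose]
  rw [h1, h1, Matrix.mul_inv_rev, Matrix.mul_inv_rev, Matrix.transpose_mul, Matrix.transpose_mul,
    Matrix.transpose_transpose]
  have : P⁻¹ * (G⁻¹ * Pᵀ⁻¹) * (Pᵀ * (Mᵀ * P)) = P⁻¹ * (G⁻¹ * Mᵀ * P) := by
    simp only [Matrix.mul_assoc]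
    rw [← Matrix.mul_assoc Pᵀ⁻¹ Pᵀ, Matrix.nonsing_inv_mul _ hPt, Matrix.one_mul]
  rw [this, Matrix.trace_mul_comm, Matrix.mul_assoc, Matrix.mul_nonsing_inv _ hP, Matrix.mul_one]

theorem quadForm_congr {ι : Type*} [Fintype ι] [DecidableEq ι] {K Q Qi : Matrix ι ι ℝ}
    (hQ : Q * Qi = 1) (v : ι → ℝ) :
    (Qᵀ *ᵥ v) ⬝ᵥ ((Qi * K * Qiᵀ) *ᵥ (Qᵀ *ᵥ v)) = v ⬝ᵥ (K *ᵥ v) := by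
  have h1 : Qiᵀ * Qᵀ = 1 := by rw [← Matrix.transpose_mul, hQ, Matrix.transpose_one]
  rw [Matrix.mulVec_mulVec, Matrix.mul_assoc, h1, Matrix.mul_one, Matrix.mulVec_transpose,
    ← Matrix.dotProduct_mulVec, Matrix.mulVec_mulVec, ← Matrix.mul_assoc, hQ, Matrix.one_mul]

/-- The fourth tensor power of a matrix. -/
def tensorPow (A : Matrix (Fin n) (Fin n) ℝ) :
    Matrix ((Fin n × Fin n) × Fin n × Fin n) ((Fin n × Fin n) × Fin n × Fin n) ℝ :=
  (A ⊗ₖ A) ⊗ₖ (A ⊗ₖ A)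

theorem tensorPow_mul (A B : Matrix (Fin n) (Fin n) ℝ) :
    tensorPow (A * B) = tensorPow A * tensorPow B := by
  simp only [tensorPow, Matrix.mul_kronecker_mul]

theorem tensorPow_one : tensorPow (1 : Matrix (Fin n) (Fin n) ℝ) = 1 := by
  simp only [tensorPow, Matrix.one_kronecker_one]

theorem tensorPow_transpose (A : Matrix (Fin n) (Fin n) ℝ) :
    tensorPow Aᵀ = (tensorPow A)ᵀ := rfl

/-- As a quadratic form of the fourth Kronecker power of the inverse metric, `|Rm|²` is handled by
matrix algebra instead of eightfold sums. -/
theorem riemannNormSq_eq_quadForm (G : Coord n → Matrix (Fin n) (Fin n) ℝ) (y : Coord n) :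
    riemannNormSq G y =
      (fun x : (Fin n × Fin n) × Fin n × Fin n => riemann G x.1.1 x.1.2 x.2.1 x.2.2 y) ⬝ᵥ
        (tensorPow (G y)⁻¹ *ᵥ
          fun x : (Fin n × Fin n) × Fin n × Fin n => riemann G x.1.1 x.1.2 x.2.1 x.2.2 y) := by
  simp only [riemannNormSq, dotProduct, Matrix.mulVec, Fintype.sum_prod_type, tensorPow,
    Matrix.kronecker_apply, Finset.mul_sum]
  refine Finset.sum_congr rfl fun i _ => Finset.sum_congr rfl fun j _ =>
    Finset.sum_congr rfl fun k _ => Finset.sum_congr rfl fun l _ => Finset.sum_congr rfl fun i' _ =>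
    Finset.sum_congr rfl fun j' _ => Finset.sum_congr rfl fun k' _ =>
    Finset.sum_congr rfl fun l' _ => by ring

namespace IsPullback

variable {G G' : Coord n → Matrix (Fin n) (Fin n) ℝ} {φ : Coord n → Coord n} {S : Set (Coord n)}

/-- The Jacobian matrix. -/
def jac (φ : Coord n → Coord n) (z : Coord n) : Matrix (Fin n) (Fin n) ℝ :=
  Matrix.of fun a i => fderiv ℝ φ z (basisVec i) a

theorem fderiv_apply_eq_jac (φ : Coord n → Coord n) (z v : Coord n) (a : Fin n) :
    fderiv ℝ φ z v a = ∑ m, jac φ z a m * v m := by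
  conv_lhs => rw [eq_sum_basisVec v]
  simp only [map_sum, map_smul, WithLp.ofLp_sum, Finset.sum_apply, PiLp.smul_apply, smul_eq_mul]
  exact Finset.sum_congr rfl fun m _ => mul_comm _ _

theorem isUnit_det_jac (h : IsPullback φ G G' S) {z : Coord n} (hz : z ∈ S) :
    IsUnit (jac φ z).det := by
  have hs : Function.Surjective (jac φ z).mulVec := by
    intro w
    obtain ⟨v, hv⟩ := h.surjective z hz (WithLp.toLp 2 w)
    refine ⟨v, funext fun a => ?_⟩
    have := congrArg (fun x : Coord n => x a) hv
    simp only [fderiv_apply_eq_jac] at this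
    exact this
  exact (Matrix.isUnit_iff_isUnit_det _).1 (Matrix.mulVec_surjective_iff_isUnit.1 hs)

theorem transpose_mul_mul_apply (P M : Matrix (Fin n) (Fin n) ℝ) (i j : Fin n) :
    (Pᵀ * M * P) i j = ∑ a, ∑ b, M a b * P a i * P b j := by
  simp only [Matrix.mul_apply, Matrix.transpose_apply, Finset.sum_mul]
  rw [Finset.sum_comm]
  exact Finset.sum_congr rfl fun a _ => Finset.sum_congr rfl fun b _ => by ring

theorem gram_eq (h : IsPullback φ G G' S) {z : Coord n} (hz : z ∈ S) :
    G' z = (jac φ z)ᵀ * G (φ z) * jac φ z := by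
  ext i j
  have := h.met_eq z hz (basisVec i) (basisVec j)
  rw [met, bil_basisVec, met, bil_apply] at this
  rw [this, transpose_mul_mul_apply]
  rfl

theorem riemannUp_eq (h : IsPullback φ G G' S) {z : Coord n} (hz : z ∈ S) (a i j k : Fin n) :
    ∑ m, jac φ z a m * riemannUp G' m i j k z = ∑ b, ∑ c, ∑ d, riemannUp G a b c d (φ z) *
      jac φ z b i * jac φ z c j * jac φ z d k := by
  have := congrArg (fun x : Coord n => x a)
    (h.curv_eq hz (basisVec i) (basisVec j) (basisVec k))
  simp only [fderiv_apply_eq_jac, curv_apply] at this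
  simpa [Pi.single_apply] using this

/-- In the contraction the upper index carries the inverse Jacobian and the lower one the Jacobian,
and the two cancel. -/
theorem ricci_eq (h : IsPullback φ G G' S) {z : Coord n} (hz : z ∈ S) :
    (Matrix.of fun j k => ricci G' j k z) =
      (jac φ z)ᵀ * (Matrix.of fun j k => ricci G j k (φ z)) * jac φ z := by
  ext j k
  set P := jac φ z with hPdef
  have hP : IsUnit P.det := h.isUnit_det_jac hz
  have hinv : ∀ m i, ∑ a, P⁻¹ m a * P a i = if m = i then 1 else 0 := by
    intro a l
    rw [← Matrix.mul_apply, Matrix.nonsing_inv_mul _ hP, Matrix.one_apply]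
  have hinv' : ∀ a b, ∑ i, P b i * P⁻¹ i a = if b = a then 1 else 0 := by
    intro a l
    rw [← Matrix.mul_apply, Matrix.mul_nonsing_inv _ hP, Matrix.one_apply]
  have h1 : ∀ m i, riemannUp G' m i j k z = ∑ a, P⁻¹ m a * ∑ b, ∑ c, ∑ d,
      riemannUp G a b c d (φ z) * P b i * P c j * P d k := by
    intro m i
    have hr : ∀ a, ∑ m, P a m * riemannUp G' m i j k z = ∑ b, ∑ c, ∑ d,
      riemannUp G a b c d (φ z) * P b i * P c j * P d k := fun a => h.riemannUp_eq hz a i j k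
    simp_rw [← hr, Finset.mul_sum, ← mul_assoc]
    rw [Finset.sum_comm]
    simp_rw [← Finset.sum_mul, hinv]
    simp
  rw [transpose_mul_mul_apply]
  simp only [Matrix.of_apply, ricci, h1]
  calc ∑ i, ∑ a, P⁻¹ i a * ∑ b, ∑ c, ∑ d, riemannUp G a b c d (φ z) * P b i * P c j * P d k
      = ∑ a, ∑ b, (∑ i, P b i * P⁻¹ i a) * ∑ c, ∑ d,
          riemannUp G a b c d (φ z) * P c j * P d k := by
        rw [Finset.sum_comm]
        refine Finset.sum_congr rfl fun a _ => ?_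
        simp_rw [Finset.sum_mul, Finset.mul_sum]
        rw [Finset.sum_comm]
        exact Finset.sum_congr rfl fun b _ => Finset.sum_congr rfl fun i _ =>
          Finset.sum_congr rfl fun c _ => Finset.sum_congr rfl fun d _ => by ring
    _ = ∑ a, ∑ c, ∑ d, riemannUp G a a c d (φ z) * P c j * P d k := by
        simp_rw [hinv']
        simp
    _ = _ := by
        simp_rw [Finset.sum_mul]
        rw [← Finset.sum_comm_cycle]

/-- The scalar curvature does not depend on the coordinates. -/
theorem scalar_eq (h : IsPullback φ G G' S) {z : Coord n} (hz : z ∈ S) :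
    scalar G' z = scalar G (φ z) := by
  have h1 := sum_inv_mul_congr (G := G (φ z)) (M := Matrix.of fun j k => ricci G j k (φ z))
    (h.isUnit_det_jac hz)
  rw [← h.gram_eq hz, ← h.ricci_eq hz] at h1
  exact h1

theorem riemann_eq (h : IsPullback φ G G' S) {z : Coord n} (hz : z ∈ S) (i j k l : Fin n) :
    riemann G' i j k l z = ∑ a, ∑ b, ∑ c, ∑ d, jac φ z a i * jac φ z b j * jac φ z c k *
      jac φ z d l * riemann G a b c d (φ z) := by
  have h1 : riemann G' i j k l z = ∑ d, ∑ e, G (φ z) d e * jac φ z d l *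
      ∑ m, jac φ z e m * riemannUp G' m i j k z := by
    unfold riemann
    rw [h.gram_eq hz]
    simp_rw [transpose_mul_mul_apply, Finset.sum_mul, Finset.mul_sum]
    rw [← Finset.sum_comm_cycle, Finset.sum_congr rfl fun d _ => Finset.sum_comm]
    rw [Finset.sum_congr rfl fun d _ => Finset.sum_comm]
    exact Finset.sum_congr rfl fun d _ => Finset.sum_congr rfl fun e _ =>
      Finset.sum_congr rfl fun m _ => by ring
  rw [h1]
  simp_rw [h.riemannUp_eq hz, riemann, Finset.mul_sum]
  calc _ = ∑ d, ∑ a, ∑ e, ∑ b, ∑ c, G (φ z) d e * jac φ z d l * (riemannUp G e a b c (φ z) *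
        jac φ z a i * jac φ z b j * jac φ z c k) := by
        exact Finset.sum_congr rfl fun d _ => Finset.sum_comm
    _ = ∑ d, ∑ a, ∑ b, ∑ e, ∑ c, G (φ z) d e * jac φ z d l * (riemannUp G e a b c (φ z) *
        jac φ z a i * jac φ z b j * jac φ z c k) := by
        exact Finset.sum_congr rfl fun d _ => Finset.sum_congr rfl fun a _ => Finset.sum_comm
    _ = ∑ d, ∑ a, ∑ b, ∑ c, ∑ e, G (φ z) d e * jac φ z d l * (riemannUp G e a b c (φ z) *
        jac φ z a i * jac φ z b j * jac φ z c k) := by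
        exact Finset.sum_congr rfl fun d _ => Finset.sum_congr rfl fun a _ =>
          Finset.sum_congr rfl fun b _ => Finset.sum_comm
    _ = ∑ a, ∑ b, ∑ c, ∑ d, ∑ e, G (φ z) d e * jac φ z d l * (riemannUp G e a b c (φ z) *
        jac φ z a i * jac φ z b j * jac φ z c k) := by
        rw [Finset.sum_comm]
        refine Finset.sum_congr rfl fun a _ => ?_
        rw [Finset.sum_comm]
        exact Finset.sum_congr rfl fun b _ => Finset.sum_comm
    _ = _ := by
        exact Finset.sum_congr rfl fun a _ => Finset.sum_congr rfl fun b _ =>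
          Finset.sum_congr rfl fun c _ => Finset.sum_congr rfl fun d _ =>
          Finset.sum_congr rfl fun e _ => by ring

/-- The norm of the curvature tensor does not depend on the coordinates. -/
theorem riemannNormSq_eq (h : IsPullback φ G G' S) {z : Coord n} (hz : z ∈ S) :
    riemannNormSq G' z = riemannNormSq G (φ z) := by
  set P := jac φ z with hPdef
  have hP : IsUnit P.det := h.isUnit_det_jac hz
  have hQ : tensorPow P * tensorPow P⁻¹ = 1 := by
    rw [← tensorPow_mul, Matrix.mul_nonsing_inv _ hP, tensorPow_one]
  have hv : (fun x : (Fin n × Fin n) × Fin n × Fin n => riemann G' x.1.1 x.1.2 x.2.1 x.2.2 z) =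
      (tensorPow P)ᵀ *ᵥ (fun x : (Fin n × Fin n) × Fin n × Fin n =>
        riemann G x.1.1 x.1.2 x.2.1 x.2.2 (φ z)) := by
    funext x
    rw [h.riemann_eq hz]
    simp only [Matrix.mulVec, dotProduct, Fintype.sum_prod_type, Matrix.transpose_apply, tensorPow,
      Matrix.kroneckerMap_apply, ← mul_assoc, ← hPdef]
  have hK : tensorPow (G' z)⁻¹ = tensorPow P⁻¹ * tensorPow (G (φ z))⁻¹ * (tensorPow P⁻¹)ᵀ := by
    rw [h.gram_eq hz, Matrix.mul_inv_rev, Matrix.mul_inv_rev, ← tensorPow_transpose,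
      ← tensorPow_mul, ← tensorPow_mul, Matrix.transpose_nonsing_inv, Matrix.mul_assoc]
  rw [riemannNormSq_eq_quadForm, riemannNormSq_eq_quadForm, hv, hK, quadForm_congr hQ]

theorem pderiv_pderiv_eq {f : Coord n → ℝ} {y : Coord n} (hf : ContDiffAt ℝ ∞ f y) (i j : Fin n) :
    pderiv i (pderiv j f) y = fderiv ℝ (fderiv ℝ f) y (basisVec i) (basisVec j) := by
  unfold pderiv
  rw [fderiv_clm_apply (differentiableAt_fderiv_of_contDiffAt hf) (differentiableAt_const _)]
  simp

theorem fderiv_fderiv_comp (h : IsPullback φ G G' S) {z : Coord n} (hz : z ∈ S)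
    {f : Coord n → ℝ} (hf : ContDiffAt ℝ ∞ f (φ z)) (u v : Coord n) :
    fderiv ℝ (fderiv ℝ (f ∘ φ)) z u v =
      fderiv ℝ (fderiv ℝ f) (φ z) (fderiv ℝ φ z u) (fderiv ℝ φ z v) +
        fderiv ℝ f (φ z) (fderiv ℝ (fderiv ℝ φ) z u v) := by
  have hfφ : ContDiffAt ℝ ∞ (f ∘ φ) z := hf.comp z (h.smooth z hz)
  have h1 := hasDerivAt_line_apply (differentiableAt_fderiv_of_contDiffAt hfφ) u v
  have hev : ∀ᶠ w in 𝓝 z, DifferentiableAt ℝ f (φ w) := by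
    have h2 : ∀ᶠ x in 𝓝 (φ z), DifferentiableAt ℝ f x :=
      ((hf.of_le (by simp) : ContDiffAt ℝ 1 f (φ z)).eventually (by simp)).mono
        fun x hx => hx.differentiableAt (by simp)
    exact (h.smooth z hz).continuousAt.eventually h2
  have hline : Tendsto (fun t : ℝ => z + t • u) (𝓝 0) (𝓝 z) := by
    have : Continuous fun t : ℝ => z + t • u := by fun_prop
    simpa using this.tendsto 0
  have h3 : (fun t : ℝ => fderiv ℝ (f ∘ φ) (z + t • u) v) =ᶠ[𝓝 0]
      fun t => fderiv ℝ f (φ (z + t • u)) (fderiv ℝ φ (z + t • u) v) := by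
    filter_upwards [h.eventually_mem hz u, hline.eventually hev] with t ht1 ht2
    rw [fderiv_comp _ ht2 ((h.smooth _ ht1).differentiableAt (by simp))]
    rfl
  have h4 : HasDerivAt (fun t : ℝ => fderiv ℝ f (φ (z + t • u)))
      (fderiv ℝ (fderiv ℝ f) (φ z) (fderiv ℝ φ z u)) 0 := by
    have h5 := hasDerivAt_line_of_differentiableAt
      ((h.smooth z hz).differentiableAt (by simp)) u
    have h6 : HasFDerivAt (fderiv ℝ f) (fderiv ℝ (fderiv ℝ f) (φ z)) (φ (z + (0 : ℝ) • u)) := by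
      rw [zero_smul, add_zero]
      exact (differentiableAt_fderiv_of_contDiffAt hf).hasFDerivAt
    exact h6.comp_hasDerivAt (0 : ℝ) h5
  have h7 := h1.unique ((h4.clm_apply (h.hasDerivAt_fderiv hz u v)).congr_of_eventuallyEq h3)
  simpa using h7

/-- The Laplace–Beltrami operator does not depend on the coordinates. -/
theorem laplace_eq (h : IsPullback φ G G' S) {z : Coord n} (hz : z ∈ S)
    {f : Coord n → ℝ} (hf : ContDiffAt ℝ ∞ f (φ z)) :
    laplace G' (f ∘ φ) z = laplace G f (φ z) := by
  have hfφ : ContDiffAt ℝ ∞ (f ∘ φ) z := hf.comp z (h.smooth z hz)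
  have hhess : ∀ {G : Coord n → Matrix (Fin n) (Fin n) ℝ} {f : Coord n → ℝ} {y : Coord n},
      ContDiffAt ℝ ∞ f y → ∀ i j, pderiv i (pderiv j f) y -
        ∑ k, christoffel G k i j y * pderiv k f y = fderiv ℝ (fderiv ℝ f) y (basisVec i)
          (basisVec j) - fderiv ℝ f y (chrMap G y (basisVec i) (basisVec j)) := by
    intro G f y hf i j
    rw [pderiv_pderiv_eq hf, GaussianAverage.fderiv_apply_eq_sum]
    simp_rw [chrMap, vbil_apply, bil_basisVec]
  -- The Hessian `∂∂f - Γ ∂f` transforms as a bilinear form: the second derivative of `φ` in the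
  -- chain rule cancels the inhomogeneous term of the Christoffel symbols. Invariance of its trace
  -- follows.
  have key : (Matrix.of fun i j => pderiv i (pderiv j (f ∘ φ)) z -
      ∑ k, christoffel G' k i j z * pderiv k (f ∘ φ) z) = (jac φ z)ᵀ *
      (Matrix.of fun i j => pderiv i (pderiv j f) (φ z) -
      ∑ k, christoffel G k i j (φ z) * pderiv k f (φ z)) * jac φ z := by
    ext i j
    rw [transpose_mul_mul_apply]
    simp only [Matrix.of_apply, hhess hf, hhess hfφ]
    rw [h.fderiv_fderiv_comp hz hf, fderiv_comp z (hf.differentiableAt (by simp))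
      ((h.smooth z hz).differentiableAt (by simp)), ContinuousLinearMap.comp_apply,
      h.chrMap_eq hz, map_add, add_sub_add_right_eq_sub]
    let L : Coord n →ₗ[ℝ] Coord n →ₗ[ℝ] ℝ := LinearMap.mk₂ ℝ
      (fun u v => fderiv ℝ (fderiv ℝ f) (φ z) u v - fderiv ℝ f (φ z) (chrMap G (φ z) u v))
      (fun a b c => by simp only [map_add, _root_.add_apply, LinearMap.add_apply]; ring)
      (fun a b c => by
        simp only [map_smul, _root_.smul_apply, LinearMap.smul_apply, smul_eq_mul]; ring)
      (fun a b c => by simp only [map_add]; ring)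
      (fun a b c => by simp only [map_smul, smul_eq_mul]; ring)
    change L _ _ = ∑ a, ∑ b, L (basisVec a) (basisVec b) * _ * _
    rw [eq_sum_basisVec (fderiv ℝ φ z (basisVec i)), eq_sum_basisVec (fderiv ℝ φ z (basisVec j))]
    simp only [map_sum, map_smul, LinearMap.sum_apply, LinearMap.smul_apply, smul_eq_mul]
    rw [Finset.sum_comm]
    refine Finset.sum_congr rfl fun a _ => ?_
    rw [Finset.mul_sum]
    refine Finset.sum_congr rfl fun b _ => ?_
    simp only [jac, Matrix.of_apply]
    ring
  have h1 := sum_inv_mul_congr (G := G (φ z)) (M := Matrix.of fun i j =>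
    pderiv i (pderiv j f) (φ z) - ∑ k, christoffel G k i j (φ z) * pderiv k f (φ z))
    (h.isUnit_det_jac hz)
  rw [← h.gram_eq hz, ← key] at h1
  exact h1

end IsPullback

end

end CoordMetric

/-! ### Charts, transition maps and the Gram matrix -/

namespace Riem

noncomputable section

open CoordMetric

variable {n : ℕ} {M : Type*} [TopologicalSpace M] [ChartedSpace (Coord n) M]

/-- The derivative of the inverse of a chart, as an endomorphism of `ℝⁿ`. -/
def dsymm (e : OpenPartialHomeomorph M (Coord n)) (y : Coord n) : Coord n →L[ℝ] Coord n :=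
  mfderiv (𝓡 n) (𝓡 n) e.symm y

/-- The derivative of a chart, as an endomorphism of `ℝⁿ`. -/
def dchart (e : OpenPartialHomeomorph M (Coord n)) (x : M) : Coord n →L[ℝ] Coord n :=
  mfderiv (𝓡 n) (𝓡 n) e x

section

variable [IsManifold (𝓡 n) ∞ M] {e e' : OpenPartialHomeomorph M (Coord n)}

theorem mdifferentiableAt_chart (he : e ∈ IsManifold.maximalAtlas (𝓡 n) ∞ M) {x : M}
    (hx : x ∈ e.source) : MDifferentiableAt (𝓡 n) (𝓡 n) e x :=
  (contMDiffAt_of_mem_maximalAtlas he hx).mdifferentiableAt (by simp)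

theorem mdifferentiableAt_symm (he : e ∈ IsManifold.maximalAtlas (𝓡 n) ∞ M) {y : Coord n}
    (hy : y ∈ e.target) : MDifferentiableAt (𝓡 n) (𝓡 n) e.symm y :=
  (contMDiffAt_symm_of_mem_maximalAtlas he hy).mdifferentiableAt (by simp)

theorem dchart_dsymm (he : e ∈ IsManifold.maximalAtlas (𝓡 n) ∞ M) {y : Coord n}
    (hy : y ∈ e.target) (v : Coord n) : dchart e (e.symm y) (dsymm e y v) = v := by
  have h1 := mfderiv_comp y (mdifferentiableAt_chart he (e.map_target hy))
    (mdifferentiableAt_symm he hy)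
  have h2 : (e ∘ e.symm) =ᶠ[𝓝 y] id :=
    (e.open_target.mem_nhds hy |> Filter.eventually_of_mem) fun z hz => e.right_inv hz
  rw [h2.mfderiv_eq, mfderiv_id] at h1
  exact (DFunLike.congr_fun h1 v).symm

/-- An injective endomorphism of `ℝⁿ` is surjective, so the one-sided inverse is two-sided. -/
theorem dsymm_dchart (he : e ∈ IsManifold.maximalAtlas (𝓡 n) ∞ M) {y : Coord n}
    (hy : y ∈ e.target) (v : Coord n) : dsymm e y (dchart e (e.symm y) v) = v := by
  have hinj : Function.Injective (dsymm e y : Coord n →ₗ[ℝ] Coord n) := fun a b hab => by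
    rw [← dchart_dsymm he hy a, ← dchart_dsymm he hy b]
    exact congrArg _ hab
  obtain ⟨w, rfl⟩ := LinearMap.surjective_of_injective hinj v
  change dsymm e y (dchart e (e.symm y) (dsymm e y w)) = dsymm e y w
  rw [dchart_dsymm he hy]

/-- The change of coordinates from `e` to `e'`. -/
def transition (e e' : OpenPartialHomeomorph M (Coord n)) : Coord n → Coord n := e' ∘ e.symm

/-- The domain of the change of coordinates from `e` to `e'`. -/
def overlap (e e' : OpenPartialHomeomorph M (Coord n)) : Set (Coord n) :=
  e.target ∩ e.symm ⁻¹' e'.source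

theorem isOpen_overlap (e e' : OpenPartialHomeomorph M (Coord n)) : IsOpen (overlap e e') :=
  e.isOpen_inter_preimage_symm e'.open_source

theorem transition_mem {y : Coord n} (hy : y ∈ overlap e e') :
    transition e e' y ∈ overlap e' e := by
  refine ⟨e'.map_source hy.2, ?_⟩
  simp only [transition, Function.comp_apply, Set.mem_preimage, e'.left_inv hy.2]
  exact e.map_target hy.1

theorem transition_transition {y : Coord n} (hy : y ∈ overlap e e') :
    transition e' e (transition e e' y) = y := by
  simp only [transition, Function.comp_apply, e'.left_inv hy.2]
  exact e.right_inv hy.1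

theorem symm_transition {y : Coord n} (hy : y ∈ overlap e e') :
    e'.symm (transition e e' y) = e.symm y := e'.left_inv hy.2

theorem contDiffAt_transition (he : e ∈ IsManifold.maximalAtlas (𝓡 n) ∞ M)
    (he' : e' ∈ IsManifold.maximalAtlas (𝓡 n) ∞ M) {y : Coord n} (hy : y ∈ overlap e e') :
    ContDiffAt ℝ ∞ (transition e e') y := by
  rw [← contMDiffAt_iff_contDiffAt]
  exact (contMDiffAt_of_mem_maximalAtlas he' hy.2).comp y
    (contMDiffAt_symm_of_mem_maximalAtlas he hy.1)

theorem dsymm_eq (he : e ∈ IsManifold.maximalAtlas (𝓡 n) ∞ M)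
    (he' : e' ∈ IsManifold.maximalAtlas (𝓡 n) ∞ M) {y : Coord n} (hy : y ∈ overlap e e')
    (v : Coord n) : dsymm e y v = dsymm e' (transition e e' y) (fderiv ℝ (transition e e') y v) := by
  have h0 : MDifferentiableAt (𝓡 n) (𝓡 n) (transition e e') y :=
    ((contDiffAt_transition he he' hy).differentiableAt (by simp)).mdifferentiableAt
  have h1 := mfderiv_comp y (mdifferentiableAt_symm he' (e'.map_source hy.2)) h0
  have h2 : (e'.symm ∘ transition e e') =ᶠ[𝓝 y] e.symm := by
    filter_upwards [(isOpen_overlap e e').mem_nhds hy] with z hz using symm_transition hz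
  rw [h2.mfderiv_eq, mfderiv_eq_fderiv] at h1
  exact DFunLike.congr_fun h1 v

theorem surjective_fderiv_transition (he : e ∈ IsManifold.maximalAtlas (𝓡 n) ∞ M)
    (he' : e' ∈ IsManifold.maximalAtlas (𝓡 n) ∞ M) {y : Coord n} (hy : y ∈ overlap e e') :
    Function.Surjective (fderiv ℝ (transition e e') y) := by
  have hinj : Function.Injective (fderiv ℝ (transition e e') y : Coord n →ₗ[ℝ] Coord n) := by
    intro a b hab
    rw [← dchart_dsymm he hy.1 a, ← dchart_dsymm he hy.1 b, dsymm_eq he he' hy,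
      dsymm_eq he he' hy]
    exact congrArg (fun v => dchart e (e.symm y) (dsymm e' (transition e e' y) v)) hab
  exact LinearMap.surjective_of_injective hinj

end

variable [RiemannianBundle (fun x : M => TangentSpace (𝓡 n) x)]

/-- The metric at the point `x`, as a bilinear form on `ℝⁿ`. -/
def innerAt (x : M) : Coord n →ₗ[ℝ] Coord n →ₗ[ℝ] ℝ :=
  LinearMap.mk₂ ℝ (fun v w => (inner ℝ (show TangentSpace (𝓡 n) x from v)
      (show TangentSpace (𝓡 n) x from w) : ℝ))
    (fun a b c => inner_add_left (𝕜 := ℝ) (E := TangentSpace (𝓡 n) x) a b c)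
    (fun a b c => real_inner_smul_left (F := TangentSpace (𝓡 n) x) b c a)
    (fun a b c => inner_add_right (𝕜 := ℝ) (E := TangentSpace (𝓡 n) x) a b c)
    (fun a b c => real_inner_smul_right (F := TangentSpace (𝓡 n) x) b c a)

theorem innerAt_comm (x : M) (v w : Coord n) : innerAt x v w = innerAt x w v :=
  real_inner_comm (F := TangentSpace (𝓡 n) x) _ _

theorem innerAt_self_pos (x : M) {v : Coord n} (hv : v ≠ 0) : 0 < innerAt x v v :=
  real_inner_self_pos (F := TangentSpace (𝓡 n) x) |>.2 hv

variable [IsManifold (𝓡 n) ∞ M] {e e' : OpenPartialHomeomorph M (Coord n)}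

theorem gram_apply (y : Coord n) (i j : Fin n) : gram e y i j =
    innerAt (e.symm y) (dsymm e y (basisVec i)) (dsymm e y (basisVec j)) := rfl

theorem met_gram (y u v : Coord n) :
    met (gram e) y u v = innerAt (e.symm y) (dsymm e y u) (dsymm e y v) := by
  rw [met, bil_apply]
  conv_rhs => rw [eq_sum_basisVec u, eq_sum_basisVec v]
  simp only [map_sum, map_smul, LinearMap.sum_apply, LinearMap.smul_apply, smul_eq_mul,
    Finset.mul_sum]
  rw [Finset.sum_comm]
  exact Finset.sum_congr rfl fun i _ => Finset.sum_congr rfl fun j _ => by rw [gram_apply]; ring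

theorem gram_symm (y : Coord n) (i j : Fin n) : gram e y i j = gram e y j i := by
  rw [gram_apply, gram_apply, innerAt_comm]

theorem met_gram_self_pos (he : e ∈ IsManifold.maximalAtlas (𝓡 n) ∞ M) {y : Coord n}
    (hy : y ∈ e.target) {v : Coord n} (hv : v ≠ 0) : 0 < met (gram e) y v v := by
  rw [met_gram]
  refine innerAt_self_pos _ fun h => hv ?_
  rw [← dchart_dsymm he hy v, h, map_zero]

theorem gram_posDef (he : e ∈ IsManifold.maximalAtlas (𝓡 n) ∞ M) {y : Coord n}
    (hy : y ∈ e.target) : (gram e y).PosDef := by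
  refine Matrix.PosDef.of_dotProduct_mulVec_pos ?_ fun x hx => ?_
  · ext i j
    simpa using gram_symm y j i
  · have h1 := met_gram_self_pos he hy (v := WithLp.toLp 2 x)
      (fun h => hx (by simpa using congrArg WithLp.ofLp h))
    rw [met, bil_apply] at h1
    simp only [dotProduct, Matrix.mulVec, Finset.mul_sum]
    refine lt_of_lt_of_eq h1
      (Finset.sum_congr rfl fun i _ => Finset.sum_congr rfl fun j _ => ?_)
    simp only [star_trivial]
    ring

theorem gram_det_pos (he : e ∈ IsManifold.maximalAtlas (𝓡 n) ∞ M) {y : Coord n}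
    (hy : y ∈ e.target) : 0 < (gram e y).det := (gram_posDef he hy).det_pos

variable [IsContMDiffRiemannianBundle (𝓡 n) ∞ (Coord n) (fun x : M => TangentSpace (𝓡 n) x)]

/-- Coordinate fields are images of constant fields under the tangent map of the smooth inverse
chart, hence smooth sections along it. Smoothness of the Riemannian bundle makes their inner
products smooth. -/
theorem contDiffAt_gram (he : e ∈ IsManifold.maximalAtlas (𝓡 n) ∞ M) {y : Coord n}
    (hy : y ∈ e.target) (i j : Fin n) : ContDiffAt ℝ ∞ (fun z => gram e z i j) y := by
  have hsec : ∀ i : Fin n, ContMDiffAt (𝓡 n) ((𝓡 n).prod 𝓘(ℝ, Coord n)) ∞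
      (fun z => (TotalSpace.mk' (Coord n) (e.symm z) (coordVector e z i) :
        TangentBundle (𝓡 n) M)) y := by
    intro i
    have h1 : ContMDiffOn (𝓡 n) (𝓡 n) ∞ e.symm e.target := contMDiffOn_symm_of_mem_maximalAtlas he
    have h2 := h1.contMDiffOn_tangentMapWithin (m := ∞) (by simp) e.open_target.uniqueMDiffOn
    have h3 : ContMDiff (𝓡 n) ((𝓡 n).prod 𝓘(ℝ, Coord n)) ∞
        (fun z : Coord n => (TotalSpace.mk' (Coord n) z (basisVec i) :
          TangentBundle (𝓡 n) (Coord n))) := by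
      intro z
      rw [contMDiffAt_totalSpace]
      refine ⟨contMDiffAt_id, ?_⟩
      simp
      exact contMDiffAt_const
    have h4 := h2.comp (h3.contMDiffOn (s := e.target)) (fun z hz => hz)
    refine (h4.contMDiffAt (e.open_target.mem_nhds hy)).congr_of_eventuallyEq ?_
    filter_upwards [e.open_target.mem_nhds hy] with z hz
    simp only [Function.comp_apply, tangentMapWithin, coordVector]
    rw [mfderivWithin_of_isOpen e.open_target hz]
  have := (hsec i).inner_bundle (hsec j)
  rw [contMDiffAt_iff_contDiffAt] at this
  exact this

/-- Two charts give isometric coordinate metrics. -/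
theorem isPullback_transition (he : e ∈ IsManifold.maximalAtlas (𝓡 n) ∞ M)
    (he' : e' ∈ IsManifold.maximalAtlas (𝓡 n) ∞ M) :
    IsPullback (transition e e') (gram e') (gram e) (overlap e e') where
  isOpen := isOpen_overlap e e'
  smooth _ hz := contDiffAt_transition he he' hz
  surjective _ hz := surjective_fderiv_transition he he' hz
  smooth_left _ hz i j := contDiffAt_gram he' (transition_mem hz).1 i j
  smooth_right _ hz i j := contDiffAt_gram he hz.1 i j
  det_left _ hz := (gram_det_pos he' (transition_mem hz).1).ne'
  det_right _ hz := (gram_det_pos he hz.1).ne'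
  symm_left _ _ i j := gram_symm _ i j
  met_eq z hz u v := by
    rw [met_gram, met_gram, symm_transition hz, ← dsymm_eq he he' hz, ← dsymm_eq he he' hz]

theorem chartAt_mem (x : M) : chartAt (Coord n) x ∈ IsManifold.maximalAtlas (𝓡 n) ∞ M :=
  IsManifold.chart_mem_maximalAtlas x

/-- The scalar curvature can be computed in any chart. -/
theorem scalarCurvature_eq (he : e ∈ IsManifold.maximalAtlas (𝓡 n) ∞ M) {y : Coord n}
    (hy : y ∈ e.target) : scalarCurvature n (e.symm y) = scalar (gram e) y := by
  have hy' : y ∈ overlap e (chartAt (Coord n) (e.symm y)) :=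
    ⟨hy, mem_chart_source (Coord n) (e.symm y)⟩
  exact ((isPullback_transition he (chartAt_mem (e.symm y))).scalar_eq hy').symm

theorem curvatureNormSq_eq (he : e ∈ IsManifold.maximalAtlas (𝓡 n) ∞ M) {y : Coord n}
    (hy : y ∈ e.target) : curvatureNormSq n (e.symm y) = riemannNormSq (gram e) y := by
  have hy' : y ∈ overlap e (chartAt (Coord n) (e.symm y)) :=
    ⟨hy, mem_chart_source (Coord n) (e.symm y)⟩
  exact ((isPullback_transition he (chartAt_mem (e.symm y))).riemannNormSq_eq hy').symm

theorem scalarCurvature_comp_symm (he : e ∈ IsManifold.maximalAtlas (𝓡 n) ∞ M) {y : Coord n}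
    (hy : y ∈ e.target) : scalarCurvature n ∘ e.symm =ᶠ[𝓝 y] scalar (gram e) := by
  filter_upwards [e.open_target.mem_nhds hy] with z hz using scalarCurvature_eq he hz

theorem contDiffAt_scalarCurvature (he : e ∈ IsManifold.maximalAtlas (𝓡 n) ∞ M) {y : Coord n}
    (hy : y ∈ e.target) : ContDiffAt ℝ ∞ (scalarCurvature n ∘ e.symm) y :=
  (contDiffAt_scalar (fun i j => contDiffAt_gram he hy i j)
    (gram_det_pos he hy).ne').congr_of_eventuallyEq (scalarCurvature_comp_symm he hy)

/-- Invariance is needed twice: for the operator, computed in the preferred chart at the base point,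
and for the function, whose defining chart varies from point to point. -/
theorem laplacian_scalarCurvature_eq (he : e ∈ IsManifold.maximalAtlas (𝓡 n) ∞ M) {y : Coord n}
    (hy : y ∈ e.target) : laplacian n (scalarCurvature n) (e.symm y) =
      laplace (gram e) (scalar (gram e)) y := by
  set e' := chartAt (Coord n) (e.symm y)
  have hy' : y ∈ overlap e e' := ⟨hy, mem_chart_source (Coord n) (e.symm y)⟩
  have h1 := (isPullback_transition he (chartAt_mem (e.symm y))).laplace_eq hy'
    (contDiffAt_scalarCurvature (chartAt_mem (e.symm y)) (transition_mem hy').1)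
  refine h1.symm.trans (laplace_congr EventuallyEq.rfl ?_)
  filter_upwards [(isOpen_overlap e e').mem_nhds hy'] with z hz
  rw [← scalarCurvature_eq he hz.1]
  exact congrArg (scalarCurvature n) (symm_transition hz)

end

end Riem

/-! ### The Riemannian volume and integration in a chart -/

namespace Riem

noncomputable section

open CoordMetric

/-- The intersection of an open set with the preimage of a measurable set under a map that is
continuous on the open set is measurable. -/
theorem measurableSet_inter_preimage_of_continuousOn {X Y : Type*} [TopologicalSpace X]
    [MeasurableSpace X] [BorelSpace X] [TopologicalSpace Y] [MeasurableSpace Y] [BorelSpace Y]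
    {f : X → Y} {U : Set X} (hU : IsOpen U) (hf : ContinuousOn f U) {s : Set Y}
    (hs : MeasurableSet s) : MeasurableSet (U ∩ f ⁻¹' s) := by
  have h1 : Measurable fun x : U => f x := (continuousOn_iff_continuous_domRestrict.1 hf).measurable
  have h2 := hU.measurableSet.subtype_image (h1 hs)
  convert h2 using 1
  ext x
  simp [and_comm]

variable {n : ℕ} {M : Type*} [TopologicalSpace M] [ChartedSpace (Coord n) M]
  [RiemannianBundle (fun x : M => TangentSpace (𝓡 n) x)] [IsManifold (𝓡 n) ∞ M]
  {e e' : OpenPartialHomeomorph M (Coord n)}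

section

variable [IsContMDiffRiemannianBundle (𝓡 n) ∞ (Coord n) (fun x : M => TangentSpace (𝓡 n) x)]

/-- The Riemannian density `√det g_ij` in the chart `e`. -/
def density (e : OpenPartialHomeomorph M (Coord n)) (y : Coord n) : ℝ :=
  Real.sqrt (gram e y).det

theorem contDiffAt_density (he : e ∈ IsManifold.maximalAtlas (𝓡 n) ∞ M) {y : Coord n}
    (hy : y ∈ e.target) : ContDiffAt ℝ ∞ (density e) y :=
  (contDiffAt_det fun i j => contDiffAt_gram he hy i j).sqrt (gram_det_pos he hy).ne'

theorem continuousOn_density (he : e ∈ IsManifold.maximalAtlas (𝓡 n) ∞ M) :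
    ContinuousOn (density e) e.target := fun _ hy =>
  (contDiffAt_density he hy).continuousAt.continuousWithinAt

/-- Square root of `det (Pᵀ G P)`: the densities differ by the absolute Jacobian, exactly the factor
in the change of variables formula. -/
theorem density_eq (he : e ∈ IsManifold.maximalAtlas (𝓡 n) ∞ M)
    (he' : e' ∈ IsManifold.maximalAtlas (𝓡 n) ∞ M) {y : Coord n} (hy : y ∈ overlap e e') :
    density e y = |(fderiv ℝ (transition e e') y).det| * density e' (transition e e' y) := by
  have h1 : (fderiv ℝ (transition e e') y).det = (IsPullback.jac (transition e e') y).det := by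
    rw [ContinuousLinearMap.det,
      ← LinearMap.det_toMatrix (EuclideanSpace.basisFun (Fin n) ℝ).toBasis]
    congr 1
  rw [density, (isPullback_transition he he').gram_eq hy, Matrix.det_mul, Matrix.det_mul,
    Matrix.det_transpose, h1, density, mul_comm _ (Matrix.det (gram e' _)), mul_assoc,
    ← sq, Real.sqrt_mul (gram_det_pos he' (transition_mem hy).1).le, Real.sqrt_sq_eq_abs, mul_comm]

end

variable [MeasurableSpace M] [BorelSpace M]

theorem aemeasurable_symm (e : OpenPartialHomeomorph M (Coord n)) :
    AEMeasurable e.symm (volume.restrict e.target) :=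
  e.continuousOn_symm.aemeasurable e.open_target.measurableSet

theorem chartVolume_apply {s : Set M} (hs : MeasurableSet s) : chartVolume e s =
    ∫⁻ y in e.target ∩ e.symm ⁻¹' s, ENNReal.ofReal (density e y) := by
  rw [chartVolume, Measure.map_apply_of_aemeasurable
    ((aemeasurable_symm e).mono_ac (withDensity_absolutelyContinuous _ _)) hs,
    withDensity_apply', Measure.restrict_restrict' e.open_target.measurableSet, inter_comm]
  rfl

theorem chartVolume_inter_source {s : Set M} (hs : MeasurableSet s) :
    chartVolume e (s ∩ e.source) = chartVolume e s := by
  rw [chartVolume_apply hs, chartVolume_apply (hs.inter e.open_source.measurableSet)]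
  congr 2
  ext y
  simp only [mem_inter_iff, mem_preimage]
  exact ⟨fun h => ⟨h.1, h.2.1⟩, fun h => ⟨h.1, h.2, e.map_target h.1⟩⟩

variable [IsContMDiffRiemannianBundle (𝓡 n) ∞ (Coord n) (fun x : M => TangentSpace (𝓡 n) x)]

/-- The volumes of two charts agree on the overlap of the chart domains. -/
theorem chartVolume_eq_of_subset (he : e ∈ IsManifold.maximalAtlas (𝓡 n) ∞ M)
    (he' : e' ∈ IsManifold.maximalAtlas (𝓡 n) ∞ M) {s : Set M} (hs : MeasurableSet s)
    (hse : s ⊆ e.source) (hse' : s ⊆ e'.source) : chartVolume e s = chartVolume e' s := by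
  have hA : e.target ∩ e.symm ⁻¹' s ⊆ overlap e e' := fun y hy => ⟨hy.1, hse' hy.2⟩
  have himage : e'.target ∩ e'.symm ⁻¹' s = (transition e e') '' (e.target ∩ e.symm ⁻¹' s) := by
    ext z
    constructor
    · rintro ⟨hz, hzs⟩
      have hz' : z ∈ overlap e' e := ⟨hz, hse hzs⟩
      refine ⟨transition e' e z, ⟨(transition_mem hz').1, ?_⟩, transition_transition hz'⟩
      rw [mem_preimage, symm_transition hz']
      exact hzs
    · rintro ⟨y, hy, rfl⟩
      refine ⟨(transition_mem (hA hy)).1, ?_⟩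
      rw [mem_preimage, symm_transition (hA hy)]
      exact hy.2
  have hmeas : MeasurableSet (e.target ∩ e.symm ⁻¹' s) :=
    measurableSet_inter_preimage_of_continuousOn e.open_target e.continuousOn_symm hs
  rw [chartVolume_apply hs, chartVolume_apply hs, himage,
    lintegral_image_eq_lintegral_abs_det_fderiv_mul volume hmeas
      (f' := fun y => fderiv ℝ (transition e e') y)
      (fun y hy => ((contDiffAt_transition he he' (hA hy)).differentiableAt
        (by simp)).hasFDerivAt.hasFDerivWithinAt)
      (fun y hy z hz h => by
        rw [← transition_transition (hA hy), h, transition_transition (hA hz)])]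
  refine setLIntegral_congr_fun hmeas fun y hy => ?_
  rw [density_eq he he' (hA hy), ENNReal.ofReal_mul (abs_nonneg _)]

/-- The supremum is compared with the measure that adds to `chartVolume e` infinite mass on every
nonempty set outside `e.source`. All chart volumes lie below it because they agree on overlaps, and
on subsets of `e.source` it reduces to `chartVolume e`. -/
theorem volumeMeasure_le_chartVolume (he : e ∈ IsManifold.maximalAtlas (𝓡 n) ∞ M) {s : Set M}
    (hs : s ⊆ e.source) : volumeMeasure n M s ≤ chartVolume e s := by
  set l : Measure M := chartVolume e + (⊤ : Measure M).restrict e.sourceᶜ with hl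
  have hle : volumeMeasure n M ≤ l := by
    refine iSup_le fun x => Measure.le_iff.2 fun A hA => ?_
    set c := chartAt (Coord n) x
    rw [← measure_inter_add_sdiff A e.open_source.measurableSet]
    rcases (A \ e.source).eq_empty_or_nonempty with h0 | h0
    · rw [h0, measure_empty, add_zero,
        ← chartVolume_inter_source (hA.inter e.open_source.measurableSet),
        chartVolume_eq_of_subset (chartAt_mem x) he
          ((hA.inter e.open_source.measurableSet).inter c.open_source.measurableSet)
          inter_subset_right (inter_subset_left.trans inter_subset_right)]
      exact (measure_mono (inter_subset_left.trans inter_subset_left)).trans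
        (Measure.le_iff'.1 (Measure.le_add_right le_rfl) A)
    · have : l A = ⊤ := by
        rw [hl, Measure.add_apply, Measure.restrict_apply hA, ← sdiff_eq,
          show (⊤ : Measure M) (A \ e.source) = ⊤ from ?_, add_top]
        rw [← Measure.coe_toOuterMeasure, Measure.toOuterMeasure_top, OuterMeasure.top_apply h0]
      rw [this]
      exact le_top
  refine (hle s).trans (le_of_eq ?_)
  have : (⊤ : Measure M).restrict e.sourceᶜ s = 0 := by
    rw [Measure.restrict_apply' e.open_source.measurableSet.compl, ← sdiff_eq,
      sdiff_eq_empty.2 hs, measure_empty]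
  rw [hl, Measure.add_apply, this, add_zero]

/-- On the domain of a chart of the atlas, the Riemannian volume is the volume of any chart. -/
theorem volumeMeasure_eq_chartVolume (he : e ∈ IsManifold.maximalAtlas (𝓡 n) ∞ M) {s : Set M}
    (hs : MeasurableSet s) (hse : s ⊆ e.source) {x : M}
    (hsx : s ⊆ (chartAt (Coord n) x).source) : volumeMeasure n M s = chartVolume e s := by
  -- The upper bound holds for every chart of the maximal atlas. The lower bound needs `s` inside a
  -- preferred chart, because only preferred charts enter the supremum.
  refine le_antisymm (volumeMeasure_le_chartVolume he hse) ?_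
  rw [chartVolume_eq_of_subset he (chartAt_mem x) hs hse hsx]
  exact Measure.le_iff'.1 (le_iSup (fun x : M => chartVolume (chartAt (Coord n) x)) x) s

theorem restrict_volumeMeasure (he : e ∈ IsManifold.maximalAtlas (𝓡 n) ∞ M) {N : Set M}
    (hN : MeasurableSet N) (hNe : N ⊆ e.source) {x : M}
    (hNx : N ⊆ (chartAt (Coord n) x).source) :
    (volumeMeasure n M).restrict N = (chartVolume e).restrict N := by
  ext s hs
  rw [Measure.restrict_apply hs, Measure.restrict_apply hs]
  exact volumeMeasure_eq_chartVolume he (hs.inter hN) (inter_subset_right.trans hNe)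
    (inter_subset_right.trans hNx)

/-- Integration in coordinates. -/
theorem setIntegral_volumeMeasure (he : e ∈ IsManifold.maximalAtlas (𝓡 n) ∞ M) {N : Set M}
    (hN : MeasurableSet N) (hNe : N ⊆ e.source) {x : M}
    (hNx : N ⊆ (chartAt (Coord n) x).source) {f : M → ℝ} (hf : Measurable f) :
    ∫ z in N, f z ∂volumeMeasure n M =
      ∫ y in e.target ∩ e.symm ⁻¹' N, density e y * f (e.symm y) := by
  have hmeas : MeasurableSet (e.target ∩ e.symm ⁻¹' N) :=
    measurableSet_inter_preimage_of_continuousOn e.open_target e.continuousOn_symm hN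
  have hsymm := (aemeasurable_symm e).mono_ac (withDensity_absolutelyContinuous
    (volume.restrict e.target) fun y => ENNReal.ofReal (Real.sqrt (gram e y).det))
  have hdens : AEMeasurable (fun y => ENNReal.ofReal (Real.sqrt (gram e y).det))
      (volume.restrict e.target) :=
    ((continuousOn_density he).aemeasurable e.open_target.measurableSet).ennreal_ofReal
  rw [restrict_volumeMeasure he hN hNe hNx, ← integral_indicator hN, chartVolume,
    integral_map hsymm (hf.indicator hN).aestronglyMeasurable,
    integral_withDensity_eq_integral_toReal_smul₀ hdens (by simp),
    ← integral_indicator e.open_target.measurableSet, ← integral_indicator hmeas]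
  congr 1
  ext y
  by_cases h1 : y ∈ e.target
  · by_cases h2 : e.symm y ∈ N
    · rw [indicator_of_mem h1, indicator_of_mem h2,
        indicator_of_mem (show y ∈ e.target ∩ e.symm ⁻¹' N from ⟨h1, h2⟩),
        ENNReal.toReal_ofReal (Real.sqrt_nonneg _)]
      rfl
    · rw [indicator_of_mem h1, indicator_of_notMem h2, indicator_of_notMem fun h => h2 h.2,
        smul_zero]
  · rw [indicator_of_notMem h1, indicator_of_notMem fun h => h1 h.1]

theorem volumeMeasure_isLocallyFinite : IsLocallyFiniteMeasure (volumeMeasure n M) := by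
  refine ⟨fun x => ?_⟩
  set c := chartAt (Coord n) x
  have hx : c x ∈ c.target := c.map_source (mem_chart_source _ x)
  have hcont : ContinuousAt (density c) (c x) :=
    (contDiffAt_density (chartAt_mem x) hx).continuousAt
  obtain ⟨r, hr, hB⟩ := Metric.nhds_basis_ball.mem_iff.1 (Filter.inter_mem
    (c.open_target.mem_nhds hx) (hcont.eventually (gt_mem_nhds (lt_add_one (density c (c x))))))
  have hopen : IsOpen (c.source ∩ c ⁻¹' Metric.ball (c x) r) :=
    c.isOpen_inter_preimage Metric.isOpen_ball
  refine ⟨_, hopen.mem_nhds ⟨mem_chart_source _ x, Metric.mem_ball_self hr⟩, ?_⟩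
  refine (volumeMeasure_le_chartVolume (chartAt_mem x) inter_subset_left).trans_lt ?_
  rw [chartVolume_apply hopen.measurableSet]
  have hsub : c.target ∩ c.symm ⁻¹' (c.source ∩ c ⁻¹' Metric.ball (c x) r) ⊆
      Metric.ball (c x) r := fun y hy => by
    have := hy.2.2
    rwa [mem_preimage, c.right_inv hy.1] at this
  calc _ ≤ ∫⁻ y in Metric.ball (c x) r, ENNReal.ofReal (density c y) :=
        lintegral_mono_set hsub
    _ ≤ ∫⁻ y in Metric.ball (c x) r, ENNReal.ofReal (density c (c x) + 1) :=
        setLIntegral_mono' Metric.isOpen_ball.measurableSet fun y hy =>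
          ENNReal.ofReal_le_ofReal (hB hy).2.le
    _ < ⊤ := by
        rw [setLIntegral_const]
        exact ENNReal.mul_lt_top ENNReal.ofReal_lt_top measure_ball_lt_top

/-! ### The gradient in coordinates and its measurability -/

section Gradient

variable {n : ℕ} {M : Type*} [TopologicalSpace M] [ChartedSpace (Coord n) M]
  [IsManifold (𝓡 n) ∞ M] {e : OpenPartialHomeomorph M (Coord n)}

theorem mdifferentiableAt_comp_symm_iff (he : e ∈ IsManifold.maximalAtlas (𝓡 n) ∞ M)
    {y : Coord n} (hy : y ∈ e.target) {f : M → ℝ} :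
    DifferentiableAt ℝ (f ∘ e.symm) y ↔ MDifferentiableAt (𝓡 n) 𝓘(ℝ, ℝ) f (e.symm y) := by
  rw [← mdifferentiableAt_iff_differentiableAt]
  refine ⟨fun h => ?_, fun h => h.comp y (mdifferentiableAt_symm he hy)⟩
  have hx := e.map_target hy
  have h' : MDifferentiableAt (𝓡 n) 𝓘(ℝ, ℝ) (f ∘ e.symm) (e (e.symm y)) := by
    rwa [e.right_inv hy]
  refine (h'.comp _ (mdifferentiableAt_chart he hx)).congr_of_eventuallyEq ?_
  filter_upwards [e.open_source.mem_nhds hx] with z hz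
  simp [e.left_inv hz]

theorem differential_dsymm (he : e ∈ IsManifold.maximalAtlas (𝓡 n) ∞ M) {y : Coord n}
    (hy : y ∈ e.target) {f : M → ℝ} (hf : MDifferentiableAt (𝓡 n) 𝓘(ℝ, ℝ) f (e.symm y))
    (v : Coord n) :
    differential n f (e.symm y) (dsymm e y v) = fderiv ℝ (f ∘ e.symm) y v := by
  have h1 := mfderiv_comp y hf (mdifferentiableAt_symm he hy)
  rw [mfderiv_eq_fderiv] at h1
  rw [h1]
  rfl

/-- The squared norm of a functional that is represented by the vector `w`. -/
theorem norm_sq_of_forall_inner {E : Type*} [NormedAddCommGroup E] [InnerProductSpace ℝ E]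
    (l : E →L[ℝ] ℝ) (w : E) (h : ∀ v, inner ℝ w v = l v) : ‖l‖ ^ 2 = l w := by
  have : l = innerSL ℝ w := by
    ext v
    rw [innerSL_apply_apply, h]
  rw [← h w, this, innerSL_apply_norm, real_inner_self_eq_norm_sq]

variable [RiemannianBundle (fun x : M => TangentSpace (𝓡 n) x)]

/-- Raising the index of `l` with the inverse Gram matrix gives the vector that represents it, and
the squared dual norm is the value of `l` there. -/
theorem norm_sq_functional (he : e ∈ IsManifold.maximalAtlas (𝓡 n) ∞ M) {y : Coord n}
    (hy : y ∈ e.target) (l : TangentSpace (𝓡 n) (e.symm y) →L[ℝ] ℝ) :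
    ‖l‖ ^ 2 = ∑ i, ∑ j, (gram e y)⁻¹ i j * l (coordVector e y i) * l (coordVector e y j) := by
  set w : TangentSpace (𝓡 n) (e.symm y) :=
    ∑ i, (∑ j, (gram e y)⁻¹ i j * l (coordVector e y j)) • coordVector e y i with hw
  have hbasis : ∀ k, inner ℝ w (coordVector e y k) = l (coordVector e y k) := by
    intro k
    rw [hw, sum_inner]
    simp only [real_inner_smul_left]
    have h1 : gram e y * (gram e y)⁻¹ = 1 :=
      Matrix.mul_nonsing_inv _ (gram_det_pos he hy).ne'.isUnit
    calc _ = ∑ j, (∑ i, gram e y k i * (gram e y)⁻¹ i j) * l (coordVector e y j) := by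
          simp only [Finset.sum_mul]
          rw [Finset.sum_comm]
          refine Finset.sum_congr rfl fun i _ => Finset.sum_congr rfl fun j _ => ?_
          rw [gram_symm y k j]
          change _ * gram e y j k = _
          ring
      _ = _ := by
          simp only [← Matrix.mul_apply, h1, Matrix.one_apply]
          simp
  have hrep : ∀ v, inner ℝ w v = l v := by
    intro v
    have hv : v = ∑ k, (dchart e (e.symm y) v k) • coordVector e y k := by
      conv_lhs => rw [← dsymm_dchart he hy v, eq_sum_basisVec (dchart e (e.symm y) v)]
      rw [map_sum]
      exact Finset.sum_congr rfl fun k _ => map_smul _ _ _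
    rw [hv, inner_sum, map_sum]
    refine Finset.sum_congr rfl fun k _ => ?_
    rw [real_inner_smul_right, hbasis, map_smul, smul_eq_mul]
  rw [norm_sq_of_forall_inner l w hrep, hw, map_sum]
  refine Finset.sum_congr rfl fun i _ => ?_
  rw [map_smul, smul_eq_mul, Finset.sum_mul]
  exact Finset.sum_congr rfl fun j _ => by ring

/-- The squared length of the gradient in coordinates. -/
theorem gradNorm_sq_eq (he : e ∈ IsManifold.maximalAtlas (𝓡 n) ∞ M) {y : Coord n}
    (hy : y ∈ e.target) (f : M → ℝ) : gradNorm n f (e.symm y) ^ 2 =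
      ∑ i, ∑ j, (gram e y)⁻¹ i j * pderiv i (f ∘ e.symm) y * pderiv j (f ∘ e.symm) y := by
  by_cases hf : MDifferentiableAt (𝓡 n) 𝓘(ℝ, ℝ) f (e.symm y)
  · rw [gradNorm, norm_sq_functional he hy]
    refine Finset.sum_congr rfl fun i _ => Finset.sum_congr rfl fun j _ => ?_
    rw [pderiv, pderiv, ← differential_dsymm he hy hf, ← differential_dsymm he hy hf]
    rfl
  -- Where `f` is not differentiable, both derivatives take the default value zero, so the formula
  -- persists.
  · have h1 : differential n f (e.symm y) = 0 := mfderiv_zero_of_not_mdifferentiableAt hf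
    have h2 : fderiv ℝ (f ∘ e.symm) y = 0 :=
      fderiv_zero_of_not_differentiableAt (mt (mdifferentiableAt_comp_symm_iff he hy).1 hf)
    have h3 : ∀ v, differential n f (e.symm y) v = 0 := fun v => DFunLike.congr_fun h1 v
    rw [gradNorm, norm_sq_functional he hy]
    simp [h2, h3, pderiv]

variable [IsContMDiffRiemannianBundle (𝓡 n) ∞ (Coord n) (fun x : M => TangentSpace (𝓡 n) x)]

theorem continuous_scalarCurvature : Continuous (scalarCurvature (n := n) (M := M)) := by
  refine continuous_iff_continuousAt.2 fun x => ?_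
  set c := chartAt (Coord n) x
  have hx : x ∈ c.source := mem_chart_source _ x
  have h1 : ContinuousAt (scalarCurvature n ∘ c.symm) (c x) :=
    (contDiffAt_scalarCurvature (chartAt_mem x) (c.map_source hx)).continuousAt
  refine (ContinuousAt.comp (f := c) h1 (c.continuousAt hx)).congr ?_
  filter_upwards [c.open_source.mem_nhds hx] with z hz
  simp [c.left_inv hz]

/-- In a chart the squared gradient is built from Fréchet derivatives, which depend measurably on
the point for an arbitrary function. Second countability reduces the cover by charts to a countable
one. -/
theorem measurable_gradNorm_sq [SecondCountableTopology M] [MeasurableSpace M] [BorelSpace M]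
    (f : M → ℝ) : Measurable fun x => gradNorm n f x ^ 2 := by
  obtain ⟨S, hS, hcover⟩ := TopologicalSpace.countable_cover_nhds fun x : M =>
    chart_source_mem_nhds (Coord n) x
  have hloc : ∀ x : M, Measurable fun z : (chartAt (Coord n) x).source =>
      gradNorm n f z ^ 2 := by
    intro x
    set c := chartAt (Coord n) x
    have hinv : ∀ i j, ContinuousOn (fun y => (gram c y)⁻¹ i j) c.target := fun i j y hy =>
      (contDiffAt_inv_apply (fun i j => contDiffAt_gram (chartAt_mem x) hy i j)
        (gram_det_pos (chartAt_mem x) hy).ne' i j).continuousAt.continuousWithinAt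
    have hc : Measurable fun z : c.source => (⟨c z, c.map_source z.2⟩ : c.target) :=
      ((continuousOn_iff_continuous_domRestrict.1 c.continuousOn).subtype_mk _).measurable
    have hpd : ∀ i, Measurable fun y : c.target => pderiv i (f ∘ c.symm) y := fun i =>
      (measurable_fderiv_apply_const ℝ (f ∘ c.symm) (EuclideanSpace.single i 1)).comp
        measurable_subtype_coe
    have h1 : Measurable fun y : c.target => ∑ i, ∑ j, (gram c y)⁻¹ i j *
        pderiv i (f ∘ c.symm) y * pderiv j (f ∘ c.symm) y :=
      Finset.measurable_sum _ fun i _ => Finset.measurable_sum _ fun j _ =>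
        ((continuousOn_iff_continuous_domRestrict.1 (hinv i j)).measurable.mul (hpd i)).mul (hpd j)
    convert h1.comp hc using 1
    ext z
    have := gradNorm_sq_eq (chartAt_mem x) (c.map_source z.2) f
    rw [c.left_inv z.2] at this
    exact this
  intro s hs
  have : (fun x => gradNorm n f x ^ 2) ⁻¹' s = ⋃ x ∈ S, Subtype.val ''
      ((fun z : (chartAt (Coord n) x).source => gradNorm n f z ^ 2) ⁻¹' s) := by
    ext z
    obtain ⟨x, hx, hz⟩ := mem_iUnion₂.1 (hcover ▸ mem_univ z)
    simp only [mem_preimage, mem_iUnion, mem_image, Subtype.exists, exists_and_right,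
      exists_eq_right]
    exact ⟨fun h => ⟨x, hx, hz, h⟩, fun ⟨_, _, _, h⟩ => h⟩
  rw [this]
  exact MeasurableSet.biUnion hS fun x _ =>
    (chartAt (Coord n) x).open_source.measurableSet.subtype_image (hloc x hs)

end Gradient

end

end Riem

/-! ### The Gauss lemma for coordinates whose rays are geodesics -/

namespace CoordMetric

noncomputable section

variable {n : ℕ} {G : Coord n → Matrix (Fin n) (Fin n) ℝ} {S : Set (Coord n)}

theorem hasDerivAt_ray {f : Coord n → ℝ} {v : Coord n} {s : ℝ}
    (hf : DifferentiableAt ℝ f (s • v)) :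
    HasDerivAt (fun r : ℝ => f (r • v)) (∑ k, v k * pderiv k f (s • v)) s := by
  have h1 : HasDerivAt (fun r : ℝ => r • v) v s := by
    simpa using (hasDerivAt_id s).smul_const v
  rw [← GaussianAverage.fderiv_apply_eq_sum]
  exact hf.hasFDerivAt.comp_hasDerivAt s h1

/-- The geodesic equation of a ray, with the index lowered. -/
theorem lower_geodesic {y v : Coord n} (hdet : (G y).det ≠ 0)
    (h : ∀ k, ∑ i, ∑ j, christoffel G k i j y * v i * v j = 0) (l : Fin n) :
    ∑ i, ∑ j, pderiv l (fun z => G z i j) y * v i * v j =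
      2 * ∑ i, ∑ j, pderiv i (fun z => G z j l) y * v i * v j := by
  set B : Fin n → ℝ := fun l => ∑ i, ∑ j, (pderiv i (fun z => G z j l) y +
    pderiv j (fun z => G z i l) y - pderiv l (fun z => G z i j) y) * v i * v j with hB
  have h1 : (G y)⁻¹.mulVec B = 0 := by
    ext k
    have := h k
    simp only [christoffel] at this
    simp only [Matrix.mulVec, dotProduct, Pi.zero_apply, hB]
    rw [← mul_right_inj' (a := (1 / 2 : ℝ)) (by norm_num), mul_zero, ← this]
    simp only [Finset.mul_sum, Finset.sum_mul]
    rw [← Finset.sum_comm_cycle]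
    exact Finset.sum_congr rfl fun i _ => Finset.sum_congr rfl fun j _ =>
      Finset.sum_congr rfl fun l _ => by ring
  have h2 : B = 0 := by
    have := congrArg (fun w => (G y).mulVec w) h1
    simpa [Matrix.mulVec_mulVec, Matrix.mul_nonsing_inv _ hdet.isUnit] using this
  have h3 := congrFun h2 l
  simp only [hB, Pi.zero_apply, sub_mul, add_mul, Finset.sum_sub_distrib,
    Finset.sum_add_distrib] at h3
  have h4 : ∑ i, ∑ j, pderiv j (fun z => G z i l) y * v i * v j =
      ∑ i, ∑ j, pderiv i (fun z => G z j l) y * v i * v j := by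
    rw [Finset.sum_comm]
    exact Finset.sum_congr rfl fun i _ => Finset.sum_congr rfl fun j _ => by ring
  rw [h4] at h3
  linarith

/-- **Gauss lemma**: if the coordinate rays are geodesics, then `g_ij(y) y^j = y^i`. -/
theorem gauss_of_geodesic (hS : IsOpen S) (hstar : StarConvex ℝ 0 S)
    (hsm : ∀ y ∈ S, ∀ i j, DifferentiableAt ℝ (fun z => G z i j) y)
    (hsymm : ∀ y i j, G y i j = G y j i) (hdet : ∀ y ∈ S, (G y).det ≠ 0) (h0 : G 0 = 1)
    (hgeo : ∀ v ∈ S, ∀ s ∈ Icc (0 : ℝ) 1, ∀ k,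
      ∑ i, ∑ j, christoffel G k i j (s • v) * v i * v j = 0)
    {y : Coord n} (hy : y ∈ S) (i : Fin n) : ∑ j, G y i j * y j = y i := by
  have hmem : ∀ v ∈ S, ∀ s ∈ Icc (0 : ℝ) 1, s • v ∈ S := fun v hv s hs =>
    hstar.smul_mem hv hs.1 hs.2
  have hE : ∀ v ∈ S, ∀ s ∈ Icc (0 : ℝ) 1, ∀ l,
      ∑ i, ∑ j, pderiv l (fun z => G z i j) (s • v) * v i * v j =
        2 * ∑ i, ∑ j, pderiv i (fun z => G z j l) (s • v) * v i * v j := fun v hv s hs =>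
    lower_geodesic (hdet _ (hmem v hv s hs)) (hgeo v hv s hs)
  -- Rays have constant speed: `G(v)(v, v)` equals its value `|v|²` for the Euclidean metric at the
  -- origin.
  have hQ : ∀ v ∈ S, ∑ i, ∑ j, G v i j * v i * v j = ∑ i, v i * v i := by
    intro v hv
    have hder : ∀ s ∈ Icc (0 : ℝ) 1,
        HasDerivAt (fun r : ℝ => ∑ i, ∑ j, G (r • v) i j * v i * v j) 0 s := by
      intro s hs
      have h1 := HasDerivAt.fun_sum fun i (_ : i ∈ Finset.univ) =>
        HasDerivAt.fun_sum fun j (_ : j ∈ Finset.univ) =>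
          ((hasDerivAt_ray (v := v) (hsm _ (hmem v hv s hs) i j)).mul_const (v i)).mul_const (v j)
      refine h1.congr_deriv ?_
      -- Contracted with `v`, the lowered geodesic equation equates the radial derivative of `G(v,
      -- v)` with twice itself, so it vanishes.
      have h2 : ∀ l, _ := fun l => congrArg (fun x => v l * x) (hE v hv s hs l)
      have h3 := Finset.sum_congr rfl fun l (_ : l ∈ Finset.univ) => h2 l
      simp only [Finset.mul_sum, Finset.sum_mul] at h3 ⊢
      have h4 : ∑ l, ∑ i, ∑ j, v l * (2 * (pderiv i (fun z => G z j l) (s • v) * v i * v j)) =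
          2 * ∑ l, ∑ i, ∑ j, v l * (pderiv l (fun z => G z i j) (s • v) * v i * v j) := by
        rw [Finset.sum_comm]
        simp only [Finset.mul_sum]
        refine Finset.sum_congr rfl fun i _ => ?_
        rw [Finset.sum_comm]
        exact Finset.sum_congr rfl fun j _ => Finset.sum_congr rfl fun l _ => by ring
      rw [h4] at h3
      rw [Finset.sum_comm_cycle]
      have h5 : ∑ l, ∑ i, ∑ j, v l * (pderiv l (fun z => G z i j) (s • v) * v i * v j) = 0 := by
        linarith
      rw [← h5]
      exact Finset.sum_congr rfl fun i _ => Finset.sum_congr rfl fun j _ =>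
        Finset.sum_congr rfl fun l _ => by ring
    have := constant_of_has_deriv_right_zero
      (fun s hs => (hder s hs).continuousAt.continuousWithinAt)
      (fun s hs => (hder s (Ico_subset_Icc_self hs)).hasDerivWithinAt) 1 (by simp)
    simpa [h0, Matrix.one_apply] using this
  -- The identity `G(v)(v, v) = |v|²` is differentiated in the direction `l`.
  have hD : ∀ v ∈ S, ∀ l, ∑ i, ∑ j, pderiv l (fun z => G z i j) v * v i * v j +
      2 * ∑ j, G v l j * v j = 2 * v l := by
    intro v hv l
    have hline : ∀ f : Coord n → ℝ, DifferentiableAt ℝ f v →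
        HasDerivAt (fun t : ℝ => f (v + t • EuclideanSpace.single l 1)) (pderiv l f v) 0 :=
      fun f hf => hasDerivAt_line_of_differentiableAt hf _
    have hcoord : ∀ i : Fin n, HasDerivAt
        (fun t : ℝ => (v + t • EuclideanSpace.single l (1 : ℝ)) i) (if i = l then 1 else 0) 0 := by
      intro i
      have : HasDerivAt (fun t : ℝ => v i + t * (if i = l then 1 else 0))
          (1 * if i = l then 1 else 0) 0 :=
        ((hasDerivAt_id (0 : ℝ)).mul_const _).const_add _
      simpa [Pi.single_apply] using this
    have h1 := HasDerivAt.fun_sum fun i (_ : i ∈ Finset.univ) =>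
        HasDerivAt.fun_sum fun j (_ : j ∈ Finset.univ) =>
          ((hline _ (hsm v hv i j)).fun_mul (hcoord i)).fun_mul (hcoord j)
    have h2 := HasDerivAt.fun_sum fun i (_ : i ∈ Finset.univ) => (hcoord i).fun_mul (hcoord i)
    have h3 : ∀ᶠ t : ℝ in 𝓝 0, v + t • EuclideanSpace.single l (1 : ℝ) ∈ S := by
      have hc : ContinuousAt (fun t : ℝ => v + t • EuclideanSpace.single l (1 : ℝ)) 0 := by
        fun_prop
      refine hc.eventually_mem (hS.mem_nhds ?_)
      simpa using hv
    have h4 := (h2.congr_of_eventuallyEq (h3.mono fun t ht => hQ _ ht)).unique h1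
    simp only [zero_smul, add_zero] at h4
    have h5 : ∑ i, ∑ j, ((pderiv l (fun z => G z i j) v * v i +
        G v i j * (if i = l then 1 else 0)) * v j + G v i j * v i * (if j = l then 1 else 0)) =
        ∑ i, ∑ j, pderiv l (fun z => G z i j) v * v i * v j + ∑ j, G v l j * v j +
          ∑ i, G v i l * v i := by
      simp only [add_mul, Finset.sum_add_distrib]
      simp
    rw [h5] at h4
    have h6 : ∑ i, G v i l * v i = ∑ j, G v l j * v j :=
      Finset.sum_congr rfl fun j _ => by rw [hsymm v j l]
    rw [h6] at h4
    have h7 : ∑ i, ((if i = l then (1 : ℝ) else 0) * v i + v i * (if i = l then 1 else 0)) =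
        2 * v l := by
      simp only [Finset.sum_add_distrib]
      simp
      ring
    rw [h7] at h4
    linarith
  -- By `hD` at `s y` and the geodesic equation, the quantity `r (G(r y) y - y)` is constant along
  -- the ray, and it vanishes at `r = 0`. The case `s = 0` is separate because the argument divides
  -- by `s`.
  have hder : ∀ s ∈ Icc (0 : ℝ) 1,
      HasDerivAt (fun r : ℝ => r * ∑ j, G (r • y) i j * y j - r * y i) 0 s := by
    intro s hs
    have h1 := HasDerivAt.fun_sum fun j (_ : j ∈ Finset.univ) =>
      (hasDerivAt_ray (v := y) (hsm _ (hmem y hy s hs) i j)).mul_const (y j)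
    have h2 := ((hasDerivAt_id s).fun_mul h1).fun_sub ((hasDerivAt_id s).mul_const (y i))
    refine h2.congr_deriv ?_
    simp only [id_eq, one_mul]
    have h3 := hD _ (hmem y hy s hs) i
    have h4 := hE y hy s hs i
    have h5 : ∑ j, (∑ k, y k * pderiv k (fun z => G z i j) (s • y)) * y j =
        ∑ k, ∑ j, pderiv k (fun z => G z j i) (s • y) * y k * y j := by
      simp only [Finset.sum_mul]
      rw [Finset.sum_comm]
      refine Finset.sum_congr rfl fun k _ => Finset.sum_congr rfl fun j _ => ?_
      simp only [hsymm _ i j]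
      ring
    rw [h5]
    have h6 : ∑ k, ∑ j, pderiv i (fun z => G z k j) (s • y) * (s • y) k * (s • y) j =
        s ^ 2 * ∑ k, ∑ j, pderiv i (fun z => G z k j) (s • y) * y k * y j := by
      simp only [Finset.mul_sum, PiLp.smul_apply, smul_eq_mul]
      exact Finset.sum_congr rfl fun k _ => Finset.sum_congr rfl fun j _ => by ring
    have h7 : ∑ j, G (s • y) i j * (s • y) j = s * ∑ j, G (s • y) i j * y j := by
      simp only [Finset.mul_sum, PiLp.smul_apply, smul_eq_mul]
      exact Finset.sum_congr rfl fun j _ => by ring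
    rw [h6, h7, h4, PiLp.smul_apply, smul_eq_mul] at h3
    rcases eq_or_ne s 0 with rfl | hs0
    · simp [h0, Matrix.one_apply]
    · apply mul_left_cancel₀ (mul_ne_zero two_ne_zero hs0)
      linear_combination h3
  have := constant_of_has_deriv_right_zero
    (fun s hs => (hder s hs).continuousAt.continuousWithinAt)
    (fun s hs => (hder s (Ico_subset_Icc_self hs)).hasDerivWithinAt) 1 (by simp)
  simp only [one_smul, one_mul, zero_mul, sub_self] at this
  linarith

end

end CoordMetric

/-! ### Distance to the centre of a normal chart -/

namespace Riem

noncomputable section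

open CoordMetric

variable {n : ℕ} {M : Type*} [MetricSpace M] [ChartedSpace (Coord n) M]
  [RiemannianBundle (fun x : M => TangentSpace (𝓡 n) x)] [IsManifold (𝓡 n) ∞ M]
  {e : OpenPartialHomeomorph M (Coord n)} {p : M}

theorem norm_sq_eq_innerAt (x : M) (v : TangentSpace (𝓡 n) x) : ‖v‖ ^ 2 = innerAt x v v :=
  (real_inner_self_eq_norm_sq v).symm

theorem innerAt_mul_innerAt_le (x : M) (v w : Coord n) :
    innerAt x v w ^ 2 ≤ innerAt x v v * innerAt x w w := by
  rw [sq]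
  exact real_inner_mul_inner_self_le (F := TangentSpace (𝓡 n) x) v w

theorem contMDiffOn_symm_segment (he : e ∈ IsManifold.maximalAtlas (𝓡 n) ∞ M) {y v : Coord n}
    (hmem : ∀ s ∈ Icc (0 : ℝ) 1, y + s • v ∈ e.target) :
    ContMDiffOn 𝓘(ℝ, ℝ) (𝓡 n) 1 (fun s : ℝ => e.symm (y + s • v)) (Icc 0 1) := by
  have h1 : ContMDiffOn (𝓡 n) (𝓡 n) 1 e.symm e.target :=
    (contMDiffOn_symm_of_mem_maximalAtlas he).of_le (by simp)
  refine h1.comp (ContMDiff.contMDiffOn ?_) hmem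
  rw [contMDiff_iff_contDiff]
  fun_prop

variable [IsRiemannianManifold (𝓡 n) M]

/-- The coordinate segment from `y` to `y + v` competes in the definition of the distance, and its
speed is at most `L`. -/
theorem dist_symm_le_of_met_le (he : e ∈ IsManifold.maximalAtlas (𝓡 n) ∞ M) {y v : Coord n}
    (hmem : ∀ s ∈ Icc (0 : ℝ) 1, y + s • v ∈ e.target) {L : ℝ} (hL : 0 ≤ L)
    (hmet : ∀ s ∈ Icc (0 : ℝ) 1, met (gram e) (y + s • v) v v ≤ L ^ 2) :
    dist (e.symm y) (e.symm (y + v)) ≤ L := by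
  have h1 : edist (e.symm y) (e.symm (y + v)) ≤ ENNReal.ofReal L := by
    rw [IsRiemannianManifold.out (I := 𝓡 n)]
    refine (Manifold.riemannianEDist_le_pathELength (contMDiffOn_symm_segment he hmem) (by simp)
      (by simp) zero_le_one).trans ?_
    rw [Manifold.pathELength_eq_lintegral_mfderiv_Icc]
    calc _ ≤ ∫⁻ _ in Icc (0 : ℝ) 1, ENNReal.ofReal L := by
          refine setLIntegral_mono' measurableSet_Icc fun s hs => ?_
          have hd : MDifferentiableAt 𝓘(ℝ, ℝ) (𝓡 n) (fun s : ℝ => y + s • v) s := by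
            rw [mdifferentiableAt_iff_differentiableAt]
            fun_prop
          have h2 := mfderiv_comp s (mdifferentiableAt_symm he (hmem s hs)) hd
          have h3 : mfderiv 𝓘(ℝ, ℝ) (𝓡 n) (fun s : ℝ => e.symm (y + s • v)) s 1 =
              dsymm e (y + s • v) v := by
            refine (DFunLike.congr_fun h2 (1 : ℝ)).trans ?_
            rw [mfderiv_eq_fderiv]
            have h4 : fderiv ℝ (fun s : ℝ => y + s • v) s 1 = v := by
              have : HasDerivAt (fun s : ℝ => y + s • v) v s := by
                simpa using ((hasDerivAt_id s).smul_const v).const_add y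
              rw [fderiv_apply_one_eq_deriv, this.deriv]
            exact congrArg (dsymm e (y + s • v)) h4
          have h5 := norm_sq_eq_innerAt (e.symm (y + s • v))
            (mfderiv 𝓘(ℝ, ℝ) (𝓡 n) (fun s : ℝ => e.symm (y + s • v)) s 1)
          rw [← ofReal_norm]
          refine ENNReal.ofReal_le_ofReal (abs_le_of_sq_le_sq' ?_ hL).2
          refine le_of_eq_of_le ?_ (hmet s hs)
          rw [met_gram]
          refine h5.trans ?_
          exact congrArg (fun w => innerAt (e.symm (y + s • v)) w w) h3
      _ = ENNReal.ofReal L := by simp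
  rwa [edist_dist, ENNReal.ofReal_le_ofReal_iff hL] at h1

theorem IsNormalChart.zero_mem (he : IsNormalChart e p) : (0 : Coord n) ∈ e.target := by
  rw [← he.map_center]
  exact e.map_source he.mem_source

theorem IsNormalChart.symm_zero (he : IsNormalChart e p) : e.symm 0 = p := by
  rw [← he.map_center]
  exact e.left_inv he.mem_source

variable [IsContMDiffRiemannianBundle (𝓡 n) ∞ (Coord n) (fun x : M => TangentSpace (𝓡 n) x)]

/-- A function with local Lipschitz constant `L` at `x` has gradient of length at most `L`. -/
theorem norm_differential_le {f : M → ℝ} {x : M} (hf : MDifferentiableAt (𝓡 n) 𝓘(ℝ, ℝ) f x)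
    {L : ℝ} (hL : 0 ≤ L) (hlip : ∀ᶠ z in 𝓝 x, |f z - f x| ≤ L * dist x z) :
    ‖differential n f x‖ ≤ L := by
  obtain ⟨c, hc, hx⟩ : ∃ c ∈ IsManifold.maximalAtlas (𝓡 n) ∞ M, x ∈ c.source :=
    ⟨_, chartAt_mem x, mem_chart_source _ x⟩
  obtain ⟨y, hy, rfl⟩ : ∃ y ∈ c.target, c.symm y = x := ⟨c x, c.map_source hx, c.left_inv hx⟩
  refine ContinuousLinearMap.opNorm_le_bound _ hL fun w => ?_
  refine le_of_forall_gt_imp_ge_of_dense fun A hA => ?_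
  -- A little room above `‖w‖` makes the strict inequality `met v v < B²` persist near `y`, while `L
  -- * B` does not exceed the arbitrary `A > L * ‖w‖`.
  have hL' : ∃ B, ‖w‖ < B ∧ L * B ≤ A := by
    rcases hL.eq_or_lt with rfl | hL0
    · exact ⟨‖w‖ + 1, by linarith, by simp at hA ⊢; exact hA.le⟩
    · refine ⟨A / L, ?_, (mul_div_cancel₀ _ hL0.ne').le⟩
      rw [lt_div_iff₀ hL0]
      linarith
  obtain ⟨B, hwB, hBA⟩ := hL'
  refine le_trans ?_ hBA
  have hB : 0 < B := (norm_nonneg w).trans_lt hwB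
  set v := dchart c (c.symm y) w with hv
  have hw : dsymm c y v = w := dsymm_dchart hc hy w
  have hmet0 : met (gram c) y v v < B ^ 2 := by
    have h1 := norm_sq_eq_innerAt (c.symm y) w
    rw [met_gram, hw, ← h1]
    exact pow_lt_pow_left₀ hwB (norm_nonneg _) two_ne_zero
  have hcont : ContinuousAt (fun z => met (gram c) z v v) y := by
    simp only [met, bil_apply]
    have : ∀ i j, ContinuousAt (fun z => gram c z i j) y := fun i j =>
      (contDiffAt_gram hc hy i j).continuousAt
    fun_prop
  obtain ⟨r, hr, hball⟩ := Metric.nhds_basis_ball.mem_iff.1 (Filter.inter_mem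
    (c.open_target.mem_nhds hy) (hcont.eventually (gt_mem_nhds hmet0)))
  have hline : HasDerivAt (fun s : ℝ => (f ∘ c.symm) (y + s • v))
      (fderiv ℝ (f ∘ c.symm) y v) 0 :=
    hasDerivAt_line_of_differentiableAt ((mdifferentiableAt_comp_symm_iff hc hy).2 hf) v
  have hcurve : ContinuousAt (fun s : ℝ => c.symm (y + s • v)) 0 := by
    have h1 : ContinuousAt c.symm (y + (0 : ℝ) • v) := by
      rw [zero_smul, add_zero]
      exact c.continuousAt_symm hy
    exact ContinuousAt.comp (f := fun s : ℝ => y + s • v) h1 (by fun_prop)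
  have hcurve' : Tendsto (fun s : ℝ => c.symm (y + s • v)) (𝓝 0) (𝓝 (c.symm y)) := by
    simpa [ContinuousAt] using hcurve
  have hsmall : ∀ᶠ s : ℝ in 𝓝 0, ‖s • v‖ < r := by
    have : ContinuousAt (fun s : ℝ => ‖s • v‖) 0 := by fun_prop
    exact this.eventually (gt_mem_nhds (by simpa using hr))
  have hbd := hline.le_of_lip' (C := L * B) (by positivity) (by
    filter_upwards [hcurve'.eventually hlip, hsmall] with s h1 h2
    have hin : ∀ q ∈ Icc (0 : ℝ) 1, y + q • s • v ∈ Metric.ball y r := by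
      intro q hq
      rw [mem_ball_iff_norm, add_sub_cancel_left, norm_smul, Real.norm_of_nonneg hq.1]
      exact (mul_le_of_le_one_left (norm_nonneg _) hq.2).trans_lt h2
    have h3 := dist_symm_le_of_met_le hc (y := y) (v := s • v) (L := |s| * B)
      (fun q hq => (hball (hin q hq)).1) (by positivity) (fun q hq => by
        rw [map_smul, map_smul, LinearMap.smul_apply, smul_eq_mul, smul_eq_mul, ← mul_assoc,
          mul_pow, sq_abs, ← sq]
        exact mul_le_mul_of_nonneg_left (hball (hin q hq)).2.le (sq_nonneg s))
    simp only [Function.comp_apply, zero_smul, add_zero, sub_zero, Real.norm_eq_abs]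
    calc _ ≤ L * dist (c.symm y) (c.symm (y + s • v)) := h1
      _ ≤ L * (|s| * B) := mul_le_mul_of_nonneg_left h3 hL
      _ = L * B * |s| := by ring)
  rw [← differential_dsymm hc hy hf, hw] at hbd
  exact hbd

theorem IsNormalChart.gauss (he : IsNormalChart e p) {y : Coord n} (hy : y ∈ e.target)
    (i : Fin n) : ∑ j, gram e y i j * y j = y i := by
  refine gauss_of_geodesic e.open_target he.starConvex
    (fun z hz i j => (contDiffAt_gram he.mem_maximalAtlas hz i j).differentiableAt (by simp))
    (fun z i j => gram_symm z i j) (fun z hz => (gram_det_pos he.mem_maximalAtlas hz).ne')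
    he.orthonormal (fun v hv s hs k => ?_) hy i
  have h1 := he.geodesic v hv s hs k
  have h2 : ∀ i : Fin n, deriv (fun r : ℝ => (r • v) i) = fun _ => v i := by
    intro i
    ext r
    simp
  simpa [h2] using h1

theorem IsNormalChart.met_left (he : IsNormalChart e p) {y : Coord n} (hy : y ∈ e.target)
    (w : Coord n) : met (gram e) y y w = inner ℝ y w := by
  rw [met, bil_apply, Finset.sum_comm, PiLp.inner_apply]
  refine Finset.sum_congr rfl fun j _ => ?_
  have := he.gauss hy j
  simp only [RCLike.inner_apply, conj_trivial]
  conv_rhs => rw [← this]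
  rw [Finset.mul_sum]
  exact Finset.sum_congr rfl fun i _ => by rw [gram_symm y j i]; ring

theorem IsNormalChart.dist_symm_le (he : IsNormalChart e p) {y : Coord n} (hy : y ∈ e.target) :
    dist p (e.symm y) ≤ ‖y‖ := by
  have hmem : ∀ s ∈ Icc (0 : ℝ) 1, s • y ∈ e.target := fun s hs =>
    he.starConvex.smul_mem hy hs.1 hs.2
  have := dist_symm_le_of_met_le he.mem_maximalAtlas (y := 0) (v := y) (L := ‖y‖)
    (fun s hs => by simpa using hmem s hs) (norm_nonneg _) (fun s hs => by
      rw [zero_add, ← real_inner_self_eq_norm_sq]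
      rcases eq_or_ne s 0 with rfl | hs0
      · rw [zero_smul, met, he.orthonormal, bil_apply, PiLp.inner_apply]
        simp [Matrix.one_apply, sq]
      · have h1 := he.met_left (hmem s hs) y
        rw [map_smul, LinearMap.smul_apply, real_inner_smul_left, smul_eq_mul] at h1
        exact (mul_left_cancel₀ hs0 h1).le)
  rwa [he.symm_zero, zero_add] at this

/-- A curve that starts at the centre is at least as long as the coordinate radius of its end. -/
theorem IsNormalChart.norm_le_pathELength (he : IsNormalChart e p) {γ : ℝ → M}
    (hγ : ContMDiff 𝓘(ℝ, ℝ) (𝓡 n) 1 γ) (h0 : γ 0 = p) {b : ℝ} (hb : 0 ≤ b)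
    (hmem : ∀ s ∈ Icc 0 b, γ s ∈ e.source) :
    ENNReal.ofReal ‖e (γ b)‖ ≤ Manifold.pathELength (𝓡 n) γ 0 b := by
  set c : ℝ → Coord n := fun s => e (γ s) with hc
  have hU : IsOpen (γ ⁻¹' e.source) := e.open_source.preimage hγ.continuous
  have hcd : ContDiffOn ℝ 1 c (γ ⁻¹' e.source) := by
    intro s hs
    have h1 : ContMDiffAt (𝓡 n) (𝓡 n) 1 e (γ s) :=
      (contMDiffAt_of_mem_maximalAtlas he.mem_maximalAtlas hs).of_le (by simp)
    have h2 := h1.comp s hγ.contMDiffAt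
    rw [contMDiffAt_iff_contDiffAt] at h2
    exact h2.contDiffWithinAt
  have hder : ∀ s ∈ γ ⁻¹' e.source, HasDerivAt c (deriv c s) s := fun s hs =>
    ((hcd.differentiableOn one_ne_zero).differentiableAt (hU.mem_nhds hs)).hasDerivAt
  have hdc : ContinuousOn (deriv c) (γ ⁻¹' e.source) :=
    hcd.continuousOn_deriv_of_isOpen hU le_rfl
  -- Cauchy–Schwarz for the metric against the position vector: by the Gauss lemma `g(c, c') = ⟨c,
  -- c'⟩` and `g(c, c) = |c|²`, so the radial speed is at most the speed of `γ`.
  have hnorm : ∀ s ∈ γ ⁻¹' e.source, inner ℝ (c s) (deriv c s) ^ 2 ≤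
      ‖c s‖ ^ 2 * ‖mfderiv 𝓘(ℝ, ℝ) (𝓡 n) γ s 1‖ ^ 2 := by
    intro s hs
    have hcs : c s ∈ e.target := e.map_source hs
    have hsymm : e.symm (c s) = γ s := e.left_inv hs
    have h1 := mfderiv_comp s (mdifferentiableAt_chart he.mem_maximalAtlas hs)
      (hγ.contMDiffAt.mdifferentiableAt one_ne_zero)
    rw [mfderiv_eq_fderiv] at h1
    have h2 : deriv c s = dchart e (γ s) (mfderiv 𝓘(ℝ, ℝ) (𝓡 n) γ s 1) := by
      rw [← fderiv_apply_one_eq_deriv]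
      exact DFunLike.congr_fun h1 (1 : ℝ)
    have h3 : dsymm e (c s) (deriv c s) = mfderiv 𝓘(ℝ, ℝ) (𝓡 n) γ s 1 := by
      have := dsymm_dchart he.mem_maximalAtlas hcs (mfderiv 𝓘(ℝ, ℝ) (𝓡 n) γ s 1)
      rw [hsymm] at this
      rw [h2]
      exact this
    have h4 := innerAt_mul_innerAt_le (e.symm (c s)) (dsymm e (c s) (c s))
      (dsymm e (c s) (deriv c s))
    rw [← met_gram, ← met_gram, he.met_left hcs, he.met_left hcs,
      real_inner_self_eq_norm_sq, hsymm, h3] at h4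
    rw [norm_sq_eq_innerAt (γ s)]
    exact h4
  -- The norm is not differentiable at the centre, so it is replaced by `√(ε² + |c|²)`, whose
  -- derivative is still bounded by the speed.
  have hkey : ∀ ε > 0, ENNReal.ofReal (‖c b‖ - ε) ≤ Manifold.pathELength (𝓡 n) γ 0 b := by
    intro ε hε
    have hpos : ∀ s, 0 < ε ^ 2 + ‖c s‖ ^ 2 := fun s => by positivity
    have hf : ∀ s ∈ Icc 0 b, HasDerivAt (fun s => Real.sqrt (ε ^ 2 + ‖c s‖ ^ 2))
        (2 * inner ℝ (c s) (deriv c s) / (2 * Real.sqrt (ε ^ 2 + ‖c s‖ ^ 2))) s := fun s hs =>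
      ((hder s (hmem s hs)).norm_sq.const_add (ε ^ 2)).sqrt (hpos s).ne'
    have hcc : ContinuousOn c (Icc 0 b) := hcd.continuousOn.mono hmem
    have hint : IntervalIntegrable (fun s => 2 * inner ℝ (c s) (deriv c s) /
        (2 * Real.sqrt (ε ^ 2 + ‖c s‖ ^ 2))) volume 0 b := by
      refine ContinuousOn.intervalIntegrable ?_
      rw [uIcc_of_le hb]
      refine ContinuousOn.div (continuousOn_const.mul (hcc.inner (hdc.mono hmem)))
        (continuousOn_const.mul (continuousOn_const.add (hcc.norm.pow 2)).sqrt) fun s _ => ?_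
      have := Real.sqrt_pos.2 (hpos s)
      positivity
    have hftc := intervalIntegral.integral_eq_sub_of_hasDerivAt
      (fun s hs => hf s (by rwa [uIcc_of_le hb] at hs)) hint
    have hc0 : c 0 = 0 := by rw [hc]; simp only [h0, he.map_center]
    have hsq : Real.sqrt (ε ^ 2 + ‖c 0‖ ^ 2) = ε := by
      rw [hc0, norm_zero, zero_pow two_ne_zero, add_zero, Real.sqrt_sq hε.le]
    rw [hsq] at hftc
    have hge : ‖c b‖ ≤ Real.sqrt (ε ^ 2 + ‖c b‖ ^ 2) :=
      Real.le_sqrt_of_sq_le (by linarith [sq_nonneg ε])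
    calc ENNReal.ofReal (‖c b‖ - ε) ≤ ENNReal.ofReal (Real.sqrt (ε ^ 2 + ‖c b‖ ^ 2) - ε) :=
          ENNReal.ofReal_le_ofReal (by linarith)
      _ ≤ ‖Real.sqrt (ε ^ 2 + ‖c b‖ ^ 2) - ε‖ₑ := by
          rw [← ofReal_norm]
          exact ENNReal.ofReal_le_ofReal (le_abs_self _)
      _ ≤ ∫⁻ s in Ioc 0 b, ‖2 * inner ℝ (c s) (deriv c s) /
            (2 * Real.sqrt (ε ^ 2 + ‖c s‖ ^ 2))‖ₑ := by
          rw [← hftc, intervalIntegral.integral_of_le hb]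
          exact enorm_integral_le_lintegral_enorm _
      _ ≤ ∫⁻ s in Ioc 0 b, ‖mfderiv 𝓘(ℝ, ℝ) (𝓡 n) γ s 1‖ₑ := by
          refine setLIntegral_mono' measurableSet_Ioc fun s hs => ?_
          rw [← ofReal_norm, ← ofReal_norm]
          refine ENNReal.ofReal_le_ofReal (abs_le_of_sq_le_sq' ?_ (norm_nonneg _)).2
          have h1 := hnorm s (hmem s (Ioc_subset_Icc_self hs))
          rw [Real.norm_eq_abs, sq_abs, mul_div_mul_left _ _ two_ne_zero, div_pow,
            Real.sq_sqrt (hpos s).le, div_le_iff₀ (hpos s)]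
          nlinarith [sq_nonneg (ε * ‖mfderiv 𝓘(ℝ, ℝ) (𝓡 n) γ s 1‖)]
      _ ≤ Manifold.pathELength (𝓡 n) γ 0 b := by
          rw [Manifold.pathELength_eq_lintegral_mfderiv_Icc]
          exact lintegral_mono_set Ioc_subset_Icc_self
  by_cases htop : Manifold.pathELength (𝓡 n) γ 0 b = ⊤
  · rw [htop]
    exact le_top
  · rw [ENNReal.ofReal_le_iff_le_toReal htop]
    refine le_of_forall_sub_le fun ε hε => ?_
    exact (ENNReal.ofReal_le_iff_le_toReal htop).1 (hkey ε hε)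

/-- In normal coordinates the distance to the centre is the Euclidean norm. -/
theorem IsNormalChart.dist_symm_eq (he : IsNormalChart e p) {y : Coord n}
    (hy : Metric.closedBall 0 ‖y‖ ⊆ e.target) : dist p (e.symm y) = ‖y‖ := by
  have hyt : y ∈ e.target := hy (by simp)
  refine le_antisymm (he.dist_symm_le hyt) ?_
  by_contra! hlt
  have h1 : edist p (e.symm y) < ENNReal.ofReal ‖y‖ := by
    rw [edist_dist]
    exact (ENNReal.ofReal_lt_ofReal_iff_of_nonneg dist_nonneg).2 hlt
  rw [IsRiemannianManifold.out (I := 𝓡 n)] at h1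
  obtain ⟨γ, h0, hend, hγ, hlen, -, -⟩ :=
    Manifold.exists_lt_locally_constant_of_riemannianEDist_lt h1 zero_lt_one
  -- A short curve might leave the chart. Before leaving it must reach coordinate radius `‖y‖`:
  -- otherwise it would stay in the compact image of the closed ball until the first exit time, and
  -- the exit point would belong to that image, hence to the chart.
  obtain ⟨b, hb, hmem, hnorm⟩ : ∃ b ∈ Icc (0 : ℝ) 1, (∀ s ∈ Icc 0 b, γ s ∈ e.source) ∧
      ‖y‖ ≤ ‖e (γ b)‖ := by
    by_cases hall : ∀ s ∈ Icc (0 : ℝ) 1, γ s ∈ e.source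
    · exact ⟨1, by simp, hall, by rw [hend, e.right_inv hyt]⟩
    push Not at hall
    set A : Set ℝ := Icc 0 1 ∩ (γ ⁻¹' e.source)ᶜ with hA
    have hAne : A.Nonempty := hall
    have hAc : IsCompact A :=
      isCompact_Icc.inter_right (e.open_source.preimage hγ.continuous).isClosed_compl
    have hs0 : sInf A ∈ A := hAc.sInf_mem hAne
    set b := sInf A
    have hbelow : ∀ s ∈ Ico 0 b, γ s ∈ e.source := by
      intro s hs
      by_contra hns
      exact absurd (csInf_le hAc.bddBelow ⟨⟨hs.1, hs.2.le.trans hs0.1.2⟩, hns⟩) (not_le.2 hs.2)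
    by_contra! hcon
    have hb0 : 0 < b := by
      refine hs0.1.1.lt_of_ne fun h => hs0.2 ?_
      rw [mem_preimage, ← h, h0]
      exact he.mem_source
    have hC : IsClosed (e.symm '' Metric.closedBall 0 ‖y‖) :=
      ((isCompact_closedBall _ _).image_of_continuousOn (e.continuousOn_symm.mono hy)).isClosed
    have hin : ∀ s ∈ Ico 0 b, γ s ∈ e.symm '' Metric.closedBall 0 ‖y‖ := by
      intro s hs
      have h2 := hcon s ⟨hs.1, hs.2.le.trans hs0.1.2⟩ fun q hq =>
        hbelow q ⟨hq.1, hq.2.trans_lt hs.2⟩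
      exact ⟨e (γ s), by simpa using h2.le, e.left_inv (hbelow s hs)⟩
    have hcl : b ∈ closure (Ico 0 b) := by
      rw [closure_Ico hb0.ne]
      exact ⟨hb0.le, le_rfl⟩
    have h3 := hC.closure_subset_iff.2 (image_subset_iff.2 hin)
      (image_closure_subset_closure_image hγ.continuous ⟨b, hcl, rfl⟩)
    obtain ⟨z, hz, hzb⟩ := h3
    exact hs0.2 (show γ b ∈ e.source from hzb ▸ e.map_target (hy hz))
  have h2 := he.norm_le_pathELength hγ h0 hb.1 hmem
  have h3 : Manifold.pathELength (𝓡 n) γ 0 b ≤ Manifold.pathELength (𝓡 n) γ 0 1 :=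
    Manifold.pathELength_mono le_rfl hb.2
  exact absurd ((ENNReal.ofReal_le_ofReal hnorm).trans (h2.trans h3)) (not_le.2 hlen)

end

end Riem

namespace GaussianAverage

noncomputable section

open CoordMetric

variable {n : ℕ}

/-! ### Laplacians of products at the origin -/

theorem flatLaplacian_mul_zero {f g : Coord n → ℝ} (hf : ContDiff ℝ ∞ f) (hg : ContDiff ℝ ∞ g) :
    flatLaplacian (fun y => f y * g y) 0 = f 0 * flatLaplacian g 0 +
      2 * ∑ i, pderiv i f 0 * pderiv i g 0 + g 0 * flatLaplacian f 0 := by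
  set F : smoothFun n := ⟨f, mem_smoothFun.2 hf⟩
  set H : smoothFun n := ⟨g, mem_smoothFun.2 hg⟩
  have h1 : flatLaplacian (fun y => f y * g y) 0 = ∑ i, evalZero n (dfun i (dfun i (F * H))) := rfl
  have h2 : flatLaplacian f 0 = ∑ i, evalZero n (dfun i (dfun i F)) := rfl
  have h3 : flatLaplacian g 0 = ∑ i, evalZero n (dfun i (dfun i H)) := rfl
  have h4 : ∀ i, pderiv i f 0 = evalZero n (dfun i F) := fun i => rfl
  have h5 : ∀ i, pderiv i g 0 = evalZero n (dfun i H) := fun i => rfl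
  have h6 : f 0 = evalZero n F := rfl
  have h7 : g 0 = evalZero n H := rfl
  rw [h1, h2, h3, h6, h7]
  simp only [h4, h5, Derivation.leibniz, map_add, map_mul, smul_eq_mul, Finset.mul_sum]
  rw [← Finset.sum_add_distrib, ← Finset.sum_add_distrib]
  exact Finset.sum_congr rfl fun i _ => by ring

/-- The bilaplacian of the product of two functions that vanish to second order. -/
theorem bilaplacian_mul_zero {f g : Coord n → ℝ} (hf : ContDiff ℝ ∞ f) (hg : ContDiff ℝ ∞ g)
    (hf0 : f 0 = 0) (hg0 : g 0 = 0) (hf1 : ∀ i, pderiv i f 0 = 0) (hg1 : ∀ i, pderiv i g 0 = 0) :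
    flatLaplacian (flatLaplacian fun y => f y * g y) 0 =
      2 * (flatLaplacian f 0 * flatLaplacian g 0) +
        4 * ∑ i, ∑ j, pderiv i (pderiv j f) 0 * pderiv i (pderiv j g) 0 := by
  set F : smoothFun n := ⟨f, mem_smoothFun.2 hf⟩
  set H : smoothFun n := ⟨g, mem_smoothFun.2 hg⟩
  have h2 : flatLaplacian f 0 = ∑ i, evalZero n (dfun i (dfun i F)) := rfl
  have h3 : flatLaplacian g 0 = ∑ i, evalZero n (dfun i (dfun i H)) := rfl
  have h4 : ∀ i, evalZero n (dfun i F) = 0 := hf1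
  have h5 : ∀ i, evalZero n (dfun i H) = 0 := hg1
  have h6 : evalZero n F = 0 := hf0
  have h7 : evalZero n H = 0 := hg0
  have h8 : ∀ i j, pderiv i (pderiv j f) 0 = evalZero n (dfun i (dfun j F)) := fun i j => rfl
  have h9 : ∀ i j, pderiv i (pderiv j g) 0 = evalZero n (dfun i (dfun j H)) := fun i j => rfl
  refine (IsGaussMetric.flatLaplacian_flatLaplacian (F * H)).trans ?_
  rw [h2, h3]
  simp only [h8, h9, Derivation.leibniz, map_add, map_mul, smul_eq_mul, h4, h5, h6, h7, zero_mul,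
    mul_zero, add_zero, zero_add, Finset.sum_mul_sum]
  simp only [Finset.sum_add_distrib]
  have h10 : ∑ i, ∑ j, evalZero n (dfun j (dfun j F)) * evalZero n (dfun i (dfun i H)) =
      ∑ i, ∑ j, evalZero n (dfun i (dfun i F)) * evalZero n (dfun j (dfun j H)) :=
    Finset.sum_comm
  have h11 : ∑ i, ∑ j, evalZero n (dfun j (dfun j H)) * evalZero n (dfun i (dfun i F)) =
      ∑ i, ∑ j, evalZero n (dfun i (dfun i F)) * evalZero n (dfun j (dfun j H)) :=
    Finset.sum_congr rfl fun i _ => Finset.sum_congr rfl fun j _ => mul_comm _ _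
  have h12 : ∑ i, ∑ j, evalZero n (dfun i (dfun j H)) * evalZero n (dfun i (dfun j F)) =
      ∑ i, ∑ j, evalZero n (dfun i (dfun j F)) * evalZero n (dfun i (dfun j H)) :=
    Finset.sum_congr rfl fun i _ => Finset.sum_congr rfl fun j _ => mul_comm _ _
  have h13 : ∑ i, ∑ j, evalZero n (dfun i (dfun i H)) * evalZero n (dfun j (dfun j F)) =
      ∑ i, ∑ j, evalZero n (dfun i (dfun i F)) * evalZero n (dfun j (dfun j H)) := by
    rw [Finset.sum_comm]
    exact Finset.sum_congr rfl fun i _ => Finset.sum_congr rfl fun j _ => mul_comm _ _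
  simp only [h10, h11, h12, h13]
  ring

/-! ### Quadratic forms and the radial derivative -/

/-- The quadratic form of a matrix. -/
def quadForm (A : Matrix (Fin n) (Fin n) ℝ) (y : Coord n) : ℝ := ∑ i, ∑ j, A i j * y i * y j

theorem contDiff_quadForm (A : Matrix (Fin n) (Fin n) ℝ) : ContDiff ℝ ∞ (quadForm A) := by
  unfold quadForm
  fun_prop

/-- The quadratic form of a matrix as an element of the algebra of smooth functions. -/
def quadFun (A : Matrix (Fin n) (Fin n) ℝ) : smoothFun n :=
  ∑ j, (∑ i, A i j • coordFun i) * coordFun j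

theorem val_quadFun (A : Matrix (Fin n) (Fin n) ℝ) : (quadFun A).1 = quadForm A := by
  funext y
  rw [quadFun, coe_sum, quadForm, Finset.sum_comm]
  refine Finset.sum_congr rfl fun j _ => ?_
  rw [val_mul, coe_sum, Finset.sum_mul]
  exact Finset.sum_congr rfl fun i _ => rfl

theorem dfun_quadFun (A : Matrix (Fin n) (Fin n) ℝ) (l : Fin n) :
    dfun l (quadFun A) = ∑ j, (A l j + A j l) • coordFun j := by
  rw [quadFun, dfun_sum_mul_coordFun]
  simp only [map_sum, Derivation.map_smul, dfun_coordFun, add_smul, Finset.sum_add_distrib]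
  congr 1
  refine Finset.sum_congr rfl fun j _ => ?_
  simp

theorem quadForm_zero (A : Matrix (Fin n) (Fin n) ℝ) : quadForm A 0 = 0 := by simp [quadForm]

theorem pderiv_quadForm (A : Matrix (Fin n) (Fin n) ℝ) (l : Fin n) (y : Coord n) :
    pderiv l (quadForm A) y = ∑ j, (A l j + A j l) * y j := by
  rw [← val_quadFun, ← val_dfun, dfun_quadFun, coe_sum]
  rfl

theorem pderiv_quadForm_zero (A : Matrix (Fin n) (Fin n) ℝ) (l : Fin n) :
    pderiv l (quadForm A) 0 = 0 := by simp [pderiv_quadForm]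

theorem pderiv_pderiv_quadForm (A : Matrix (Fin n) (Fin n) ℝ) (k l : Fin n) :
    pderiv k (pderiv l (quadForm A)) 0 = A l k + A k l := by
  rw [← val_quadFun, ← val_dfun, ← val_dfun, dfun_quadFun, ← evalZero_apply]
  simp [dfun_coordFun, Derivation.map_smul, ← apply_ite]

theorem flatLaplacian_quadForm (A : Matrix (Fin n) (Fin n) ℝ) :
    flatLaplacian (quadForm A) 0 = 2 * A.trace := by
  simp only [flatLaplacian, pderiv_pderiv_quadForm, Matrix.trace, Matrix.diag, Finset.mul_sum]
  exact Finset.sum_congr rfl fun i _ => by ring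

theorem abs_quadForm_le (A : Matrix (Fin n) (Fin n) ℝ) (y : Coord n) :
    |quadForm A y| ≤ (∑ i, ∑ j, |A i j|) * ‖y‖ ^ 2 := by
  unfold quadForm
  rw [Finset.sum_mul]
  refine (Finset.abs_sum_le_sum_abs _ _).trans (Finset.sum_le_sum fun i _ => ?_)
  rw [Finset.sum_mul]
  refine (Finset.abs_sum_le_sum_abs _ _).trans (Finset.sum_le_sum fun j _ => ?_)
  rw [abs_mul, abs_mul, mul_assoc, sq]
  refine mul_le_mul_of_nonneg_left ?_ (abs_nonneg _)
  exact mul_le_mul (PiLp.norm_apply_le y i) (PiLp.norm_apply_le y j) (abs_nonneg _)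
    (norm_nonneg _)

/-- The radial derivative `y · ∂f`. -/
def radial (f : Coord n → ℝ) (y : Coord n) : ℝ := ∑ i, y i * pderiv i f y

theorem contDiff_radial {f : Coord n → ℝ} (hf : ContDiff ℝ ∞ f) : ContDiff ℝ ∞ (radial f) :=
  ContDiff.sum fun i _ => ContDiff.mul (by fun_prop) (contDiff_pderiv hf i)

theorem hasCompactSupport_radial {f : Coord n → ℝ} (hc : HasCompactSupport f) :
    HasCompactSupport (radial f) := by
  refine hc.mono' fun x hx => ?_
  by_contra h
  apply hx
  refine Finset.sum_eq_zero fun i _ => ?_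
  have h1 : tsupport (pderiv i f) ⊆ tsupport f := tsupport_fderiv_apply_subset ℝ _
  rw [image_eq_zero_of_notMem_tsupport fun h' => h (h1 h'), mul_zero]

/-- The radial derivative as an operation on the algebra of smooth functions. -/
def radialFun (f : smoothFun n) : smoothFun n := ∑ i, dfun i f * coordFun i

theorem val_radialFun (f : smoothFun n) : (radialFun f).1 = radial f.1 := by
  funext y
  rw [radialFun, coe_sum, radial]
  exact Finset.sum_congr rfl fun i _ => mul_comm _ _

/-- The commutator `[∂_l, y·∂]` is `∂_l`. Hence a derivative of order `m` of the radial derivative,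
taken at the origin, is `m` times the same derivative of `f`. -/
theorem dfun_radialFun (l : Fin n) (f : smoothFun n) :
    dfun l (radialFun f) = dfun l f + radialFun (dfun l f) := by
  rw [radialFun, dfun_sum_mul_coordFun, radialFun, add_comm]
  simp only [dfun_comm l]

theorem evalZero_radialFun (f : smoothFun n) : evalZero n (radialFun f) = 0 :=
  evalZero_sum_mul_coordFun _

theorem radial_zero (f : Coord n → ℝ) : radial f 0 = 0 := by simp [radial]

theorem radial_eq_radialFun {f : Coord n → ℝ} (hf : ContDiff ℝ ∞ f) :
    radial f = (radialFun ⟨f, mem_smoothFun.2 hf⟩).1 :=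
  (val_radialFun (⟨f, mem_smoothFun.2 hf⟩ : smoothFun n)).symm

theorem pderiv_radial_zero {f : Coord n → ℝ} (hf : ContDiff ℝ ∞ f) (l : Fin n) :
    pderiv l (radial f) 0 = pderiv l f 0 := by
  rw [radial_eq_radialFun hf, ← val_dfun, ← evalZero_apply, dfun_radialFun, map_add,
    evalZero_radialFun, add_zero]
  rfl

theorem pderiv_pderiv_radial_zero {f : Coord n → ℝ} (hf : ContDiff ℝ ∞ f) (k l : Fin n) :
    pderiv k (pderiv l (radial f)) 0 = 2 * pderiv k (pderiv l f) 0 := by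
  rw [radial_eq_radialFun hf, ← val_dfun, ← val_dfun, ← evalZero_apply, dfun_radialFun, map_add,
    dfun_radialFun, map_add, map_add, evalZero_radialFun, add_zero, two_mul]
  rfl

theorem flatLaplacian_radial_zero {f : Coord n → ℝ} (hf : ContDiff ℝ ∞ f) :
    flatLaplacian (radial f) 0 = 2 * flatLaplacian f 0 := by
  simp only [flatLaplacian, pderiv_pderiv_radial_zero hf, Finset.mul_sum]

theorem bilaplacian_radial_zero {f : Coord n → ℝ} (hf : ContDiff ℝ ∞ f) :
    flatLaplacian (flatLaplacian (radial f)) 0 = 4 * flatLaplacian (flatLaplacian f) 0 := by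
  have h1 := IsGaussMetric.flatLaplacian_flatLaplacian (⟨f, mem_smoothFun.2 hf⟩ : smoothFun n)
  rw [radial_eq_radialFun hf, IsGaussMetric.flatLaplacian_flatLaplacian, h1]
  simp only [dfun_radialFun, map_add, evalZero_radialFun, add_zero, Finset.mul_sum]
  exact Finset.sum_congr rfl fun i _ => Finset.sum_congr rfl fun j _ => by ring

end

end GaussianAverage

/-! ### Amplitudes and the linear algebra of their Gaussian averages -/

namespace GaussianAverage

noncomputable section

open CoordMetric

variable {n : ℕ}

/-- The average of `F` with respect to the heat kernel. -/
def avg (t : ℝ) (F : Coord n → ℝ) : ℝ := ∫ y, heatKernel t y * F y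

theorem integrable_heatKernel_mul {t : ℝ} (ht : 0 < t) {F : Coord n → ℝ} (hF : Measurable F)
    {C : ℝ} (hC : ∀ y, |F y| ≤ C) : Integrable fun y => heatKernel t y * F y := by
  rw [integrable_heatKernel_mul_iff ht]
  have hm : Measurable fun z : Coord n => F (√t • z) := hF.comp (measurable_const_smul _)
  refine (integrable_heatKernel_one.mul_const C).mono'
    ((continuous_heatKernel 1).measurable.mul hm).aestronglyMeasurable
    (Eventually.of_forall fun z => ?_)
  rw [norm_mul, Real.norm_of_nonneg (heatKernel_nonneg one_pos z)]
  exact mul_le_mul_of_nonneg_left (hC _) (heatKernel_nonneg one_pos z)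

theorem integrable_heatKernel_mul_of_compact {t : ℝ} (ht : 0 < t) {f : Coord n → ℝ}
    (hf : Continuous f) (hc : HasCompactSupport f) :
    Integrable fun y => heatKernel t y * f y := by
  obtain ⟨C, hC⟩ := hc.exists_bound_of_continuous hf
  exact integrable_heatKernel_mul ht hf.measurable hC

theorem integrable_heatKernel_mul_mul {t : ℝ} (ht : 0 < t) {f F : Coord n → ℝ}
    (hf : Continuous f) (hc : HasCompactSupport f) (hF : Measurable F) {C : ℝ}
    (hC : ∀ y, |F y| ≤ C) : Integrable fun y => heatKernel t y * (f y * F y) := by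
  obtain ⟨D, hD⟩ := hc.exists_bound_of_continuous hf
  refine integrable_heatKernel_mul ht (hf.measurable.mul hF) (C := D * C) fun y => ?_
  rw [abs_mul]
  exact mul_le_mul (hD y) (hC y) (abs_nonneg _) ((norm_nonneg _).trans (hD y))

theorem avg_add {t : ℝ} {F F' : Coord n → ℝ} (hF : Integrable fun y => heatKernel t y * F y)
    (hF' : Integrable fun y => heatKernel t y * F' y) :
    avg t (fun y => F y + F' y) = avg t F + avg t F' := by
  simp only [avg, mul_add]
  exact integral_add hF hF'

theorem avg_sub {t : ℝ} {F F' : Coord n → ℝ} (hF : Integrable fun y => heatKernel t y * F y)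
    (hF' : Integrable fun y => heatKernel t y * F' y) :
    avg t (fun y => F y - F' y) = avg t F - avg t F' := by
  simp only [avg, mul_sub]
  exact integral_sub hF hF'

theorem avg_const_mul (t c : ℝ) (F : Coord n → ℝ) : avg t (fun y => c * F y) = c * avg t F := by
  simp only [avg, ← integral_const_mul]
  exact integral_congr_ae (Eventually.of_forall fun y => by ring)

/-- The quadratic remainder of `x log x` at `1`. -/
theorem abs_mul_log_sub_le {x : ℝ} (h1 : 1 / 2 ≤ x) (h2 : x ≤ 3 / 2) :
    |x * Real.log x - (x - 1) - 1 / 2 * (x - 1) ^ 2| ≤ 4 * |x - 1| ^ 3 := by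
  have hz : |1 - x| ≤ 1 / 2 := abs_le.2 ⟨by linarith, by linarith⟩
  -- Second-order Taylor bound for `log (1 - z)` at `z = 1 - x`.
  have h3 := Real.abs_log_sub_add_sum_range_le (x := 1 - x) (by linarith) 2
  have h4 : |1 - x| ^ (2 + 1) / (1 - |1 - x|) ≤ 2 * |x - 1| ^ 3 := by
    rw [div_le_iff₀ (by linarith), abs_sub_comm]
    rw [abs_sub_comm] at hz
    change |x - 1| ^ 3 ≤ _
    nlinarith [mul_nonneg (pow_nonneg (abs_nonneg (x - 1)) 3) (sub_nonneg.2 hz)]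
  have h5 := h3.trans h4
  simp only [Finset.sum_range_succ, Finset.sum_range_zero, sub_sub_cancel] at h5
  norm_num at h5
  set w := x - 1 with hw
  set L := 1 - x + (1 - x) ^ 2 / 2 + Real.log x with hL
  have h6 : x * Real.log x - w - 1 / 2 * w ^ 2 = x * L - 1 / 2 * w ^ 3 := by
    rw [hL, hw]; ring
  rw [h6]
  calc |x * L - 1 / 2 * w ^ 3| ≤ |x * L| + |1 / 2 * w ^ 3| := abs_sub _ _
    _ = x * |L| + 1 / 2 * |w| ^ 3 := by
        rw [abs_mul, abs_mul, abs_of_nonneg (by linarith : (0 : ℝ) ≤ x), abs_pow]; norm_num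
    _ ≤ 3 / 2 * (2 * |w| ^ 3) + 1 / 2 * |w| ^ 3 := by
        gcongr
    _ ≤ 4 * |w| ^ 3 := by nlinarith [pow_nonneg (abs_nonneg w) 3]

/-- The data of an amplitude `θ` with `θ = 1 + a(y, y) + α t + o(|y|² + t)` and squared gradient
`P = 4 |a y|² + o(|y|² + t)`, together with a cut off density `k`. -/
structure IsAmplitude (k : Coord n → ℝ) (θ P : ℝ → Coord n → ℝ) (a : Matrix (Fin n) (Fin n) ℝ)
    (α C : ℝ) : Prop where
  smooth : ContDiff ℝ ∞ k
  compact : HasCompactSupport k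
  one : k 0 = 1
  crit : ∀ i, pderiv i k 0 = 0
  diff : ∀ᶠ t in 𝓝[>] 0, Differentiable ℝ (θ t)
  lower : ∀ᶠ t in 𝓝[>] 0, ∀ y, 1 / 2 ≤ θ t y
  upper : ∀ᶠ t in 𝓝[>] 0, ∀ y, θ t y ≤ 3 / 2
  fderiv_le : ∀ᶠ t in 𝓝[>] 0, ∀ y, ‖fderiv ℝ (θ t) y‖ ≤ C
  measurable : ∀ᶠ t in 𝓝[>] 0, Measurable (P t)
  bounded : ∀ᶠ t in 𝓝[>] 0, ∀ y, |P t y| ≤ C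
  expansion : (fun q : Coord n × ℝ => θ q.2 q.1 - (1 + quadForm a q.1 + α * q.2))
    =o[𝓝 0 ×ˢ 𝓝[>] 0] fun q => ‖q.1‖ ^ 2 + q.2
  grad_expansion : (fun q : Coord n × ℝ => P q.2 q.1 - 4 * quadForm (a * a) q.1)
    =o[𝓝 0 ×ˢ 𝓝[>] 0] fun q => ‖q.1‖ ^ 2 + q.2

theorem eventually_pos_snd : ∀ᶠ q in 𝓝 (0 : Coord n) ×ˢ 𝓝[>] (0 : ℝ), 0 < q.2 :=
  (eventually_mem_nhdsWithin (s := Ioi (0 : ℝ))).prod_inr _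

theorem isBigO_quadForm (A : Matrix (Fin n) (Fin n) ℝ) :
    (fun q : Coord n × ℝ => quadForm A q.1) =O[𝓝 0 ×ˢ 𝓝[>] 0] fun q => ‖q.1‖ ^ 2 + q.2 := by
  refine IsBigO.of_bound (∑ i, ∑ j, |A i j|) (eventually_pos_snd.mono fun q hq => ?_)
  rw [Real.norm_eq_abs, Real.norm_of_nonneg (by positivity)]
  refine (abs_quadForm_le A q.1).trans ?_
  gcongr
  linarith

theorem isBigO_time : (fun q : Coord n × ℝ => q.2) =O[𝓝 0 ×ˢ 𝓝[>] 0] fun q => ‖q.1‖ ^ 2 + q.2 := by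
  refine IsBigO.of_bound 1 (eventually_pos_snd.mono fun q hq => ?_)
  rw [Real.norm_of_nonneg hq.le, Real.norm_of_nonneg (by positivity)]
  nlinarith [sq_nonneg ‖q.1‖]

theorem isBigO_one_of_continuous {f : Coord n → ℝ} (hf : Continuous f) :
    (fun q : Coord n × ℝ => f q.1) =O[𝓝 0 ×ˢ 𝓝[>] 0] fun _ => (1 : ℝ) :=
  (hf.continuousAt.tendsto.comp tendsto_fst).isBigO_one ℝ

namespace IsAmplitude

variable {k : Coord n → ℝ} {θ P : ℝ → Coord n → ℝ} {a : Matrix (Fin n) (Fin n) ℝ} {α C : ℝ}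

theorem isBigO_sub_one (h : IsAmplitude k θ P a α C) :
    (fun q : Coord n × ℝ => θ q.2 q.1 - 1) =O[𝓝 0 ×ˢ 𝓝[>] 0] fun q => ‖q.1‖ ^ 2 + q.2 := by
  have := (h.expansion.isBigO.add (isBigO_quadForm a)).add (isBigO_time.const_mul_left α)
  exact this.congr_left fun q => by ring

/-- The expansion of `θ` is only local. This global polynomial bound, uniform in `t`, is the growth
hypothesis of `integral_heatKernel_isLittleO`. -/
theorem remainder_le (h : IsAmplitude k θ P a α C) : ∀ᶠ t in 𝓝[>] (0 : ℝ), ∀ y,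
    |θ t y - (1 + quadForm a y + α * t)| ≤ (1 + ∑ i, ∑ j, |a i j| + |α|) * (1 + ‖y‖ ^ 2) := by
  have ht1 : ∀ᶠ t in 𝓝[>] (0 : ℝ), t < 1 :=
    eventually_nhdsWithin_of_eventually_nhds (gt_mem_nhds one_pos)
  filter_upwards [h.lower, h.upper, ht1, self_mem_nhdsWithin] with t h1 h2 h3 h4 y
  have h4 : 0 < t := h4
  have h5 : |θ t y - 1| ≤ 1 := abs_le.2 ⟨by linarith [h1 y], by linarith [h2 y]⟩
  have h6 : |α * t| ≤ |α| := by
    rw [abs_mul, abs_of_pos h4]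
    exact mul_le_of_le_one_right (abs_nonneg _) h3.le
  have h7 := abs_quadForm_le a y
  have h8 : 0 ≤ ∑ i, ∑ j, |a i j| := Finset.sum_nonneg fun i _ => Finset.sum_nonneg fun j _ =>
    abs_nonneg _
  calc _ = |(θ t y - 1) - quadForm a y - α * t| := by ring_nf
    _ ≤ |θ t y - 1| + |quadForm a y| + |α * t| :=
        (abs_sub _ _).trans (add_le_add_left (abs_sub _ _) _)
    _ ≤ 1 + (∑ i, ∑ j, |a i j|) * ‖y‖ ^ 2 + |α| := by linarith
    _ ≤ _ := by nlinarith [sq_nonneg ‖y‖, abs_nonneg α]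

theorem measurable_theta (h : IsAmplitude k θ P a α C) :
    ∀ᶠ t in 𝓝[>] (0 : ℝ), Measurable (θ t) :=
  h.diff.mono fun _ ht => ht.continuous.measurable

theorem abs_theta_le (h : IsAmplitude k θ P a α C) :
    ∀ᶠ t in 𝓝[>] (0 : ℝ), ∀ y, |θ t y| ≤ 3 / 2 := by
  filter_upwards [h.lower, h.upper] with t h1 h2 y
  exact abs_le.2 ⟨by linarith [h1 y], h2 y⟩

/-- Averages of `f θ` up to `O(t)`-terms, with the exact error. -/
theorem avg_mul_theta (h : IsAmplitude k θ P a α C) {f : Coord n → ℝ} (hf : ContDiff ℝ ∞ f)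
    (hc : HasCompactSupport f) : ∀ᶠ t in 𝓝[>] (0 : ℝ),
    avg t (fun y => f y * θ t y) = avg t f + avg t (fun y => f y * quadForm a y) +
      α * t * avg t f + avg t (fun y => f y * (θ t y - (1 + quadForm a y + α * t))) := by
  filter_upwards [h.measurable_theta, h.abs_theta_le, self_mem_nhdsWithin] with t h1 h2 ht
  have ht : 0 < t := ht
  have hfi := integrable_heatKernel_mul_of_compact ht hf.continuous hc
  have hq : Integrable fun y => heatKernel t y * (f y * quadForm a y) :=
    integrable_heatKernel_mul_of_compact ht (hf.mul (contDiff_quadForm a)).continuous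
      (hc.mul_right)
  have hθ := integrable_heatKernel_mul_mul ht hf.continuous hc h1 h2
  have h3 : avg t (fun y => f y * (θ t y - (1 + quadForm a y + α * t))) =
      avg t (fun y => f y * θ t y - (f y + f y * quadForm a y + α * t * f y)) := by
    congr 1; ext y; ring
  have hft : Integrable fun y => heatKernel t y * (α * t * f y) :=
    (hfi.const_mul (α * t)).congr (Eventually.of_forall fun y => by ring)
  have h4 : Integrable fun y => heatKernel t y * (f y + f y * quadForm a y) :=
    (hfi.add hq).congr (Eventually.of_forall fun y => by simp; ring)
  have h5 : Integrable fun y => heatKernel t y * (f y + f y * quadForm a y + α * t * f y) :=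
    (h4.add hft).congr (Eventually.of_forall fun y => by simp; ring)
  rw [h3, avg_sub hθ h5, avg_add h4 hft, avg_add hfi hq, avg_const_mul]
  ring

end IsAmplitude

end

end GaussianAverage

/-! ### Second-order expansions of the individual averages -/

namespace GaussianAverage

noncomputable section

open CoordMetric

variable {n : ℕ}

theorem pderiv_mul_zero {f g : Coord n → ℝ} (hf : ContDiff ℝ ∞ f) (hg : ContDiff ℝ ∞ g)
    (hg0 : g 0 = 0) (hg1 : ∀ i, pderiv i g 0 = 0) (i : Fin n) :
    pderiv i (fun y => f y * g y) 0 = 0 := by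
  set F : smoothFun n := ⟨f, mem_smoothFun.2 hf⟩
  set H : smoothFun n := ⟨g, mem_smoothFun.2 hg⟩
  have h1 : pderiv i (fun y => f y * g y) 0 = evalZero n (dfun i (F * H)) := rfl
  have h5 : ∀ i, evalZero n (dfun i H) = 0 := hg1
  have h7 : evalZero n H = 0 := hg0
  rw [h1]
  simp only [Derivation.leibniz, map_add, map_mul, smul_eq_mul, h5, h7, zero_mul, mul_zero,
    add_zero]

theorem pderiv_pderiv_mul_zero {f g : Coord n → ℝ} (hf : ContDiff ℝ ∞ f) (hg : ContDiff ℝ ∞ g)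
    (hg0 : g 0 = 0) (hg1 : ∀ i, pderiv i g 0 = 0) (i j : Fin n) :
    pderiv i (pderiv j fun y => f y * g y) 0 = f 0 * pderiv i (pderiv j g) 0 := by
  set F : smoothFun n := ⟨f, mem_smoothFun.2 hf⟩
  set H : smoothFun n := ⟨g, mem_smoothFun.2 hg⟩
  have h1 : pderiv i (pderiv j fun y => f y * g y) 0 = evalZero n (dfun i (dfun j (F * H))) := rfl
  have h2 : pderiv i (pderiv j g) 0 = evalZero n (dfun i (dfun j H)) := rfl
  have h3 : f 0 = evalZero n F := rfl
  have h5 : ∀ i, evalZero n (dfun i H) = 0 := hg1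
  have h7 : evalZero n H = 0 := hg0
  rw [h1, h2, h3]
  simp only [Derivation.leibniz, map_add, map_mul, smul_eq_mul, h5, h7, zero_mul, mul_zero,
    add_zero]

theorem flatLaplacian_mul_zero' {f g : Coord n → ℝ} (hf : ContDiff ℝ ∞ f) (hg : ContDiff ℝ ∞ g)
    (hg0 : g 0 = 0) (hg1 : ∀ i, pderiv i g 0 = 0) :
    flatLaplacian (fun y => f y * g y) 0 = f 0 * flatLaplacian g 0 := by
  rw [flatLaplacian_mul_zero hf hg]
  simp [hg0, hg1]

/-- The average of a product with a quadratic form. -/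
theorem avg_mul_quadForm {f : Coord n → ℝ} (hf : ContDiff ℝ ∞ f) (hc : HasCompactSupport f)
    (A : Matrix (Fin n) (Fin n) ℝ) :
    (fun t => avg t (fun y => f y * quadForm A y) - t * (f 0 * (2 * A.trace)))
      =o[𝓝[>] 0] fun t => t ^ 1 := by
  have h := integral_heatKernel_first_order (hf.mul (contDiff_quadForm A)) (hc.mul_right)
  refine h.congr_left fun t => ?_
  rw [flatLaplacian_mul_zero' hf (contDiff_quadForm A) (quadForm_zero A) (pderiv_quadForm_zero A),
    flatLaplacian_quadForm, quadForm_zero]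
  simp [avg]

theorem tendsto_avg {f : Coord n → ℝ} (hf : ContDiff ℝ ∞ f) (hc : HasCompactSupport f) :
    Tendsto (fun t => avg t f) (𝓝[>] 0) (𝓝 (f 0)) := by
  refine (tendsto_integral_heatKernel hf hc).congr' ?_
  filter_upwards [self_mem_nhdsWithin] with t ht
  exact (integral_heatKernel_scale ht f).symm

theorem time_mul_avg {f : Coord n → ℝ} (hf : ContDiff ℝ ∞ f) (hc : HasCompactSupport f) :
    (fun t => t * avg t f - t * f 0) =o[𝓝[>] 0] fun t => t ^ 1 := by
  have h1 : (fun t => avg t f - f 0) =o[𝓝[>] 0] fun _ => (1 : ℝ) := by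
    rw [isLittleO_one_iff]
    simpa using (tendsto_avg hf hc).sub_const (f 0)
  have h2 := (isBigO_refl (fun t : ℝ => t) (𝓝[>] 0)).mul_isLittleO h1
  exact (h2.congr_left fun t => by ring).congr_right fun t => by ring

theorem time_mul {F : ℝ → ℝ} {k : ℕ} (h : F =o[𝓝[>] 0] fun t => t ^ k) :
    (fun t => t * F t) =o[𝓝[>] 0] fun t : ℝ => t ^ (k + 1) :=
  ((isBigO_refl (fun t : ℝ => t) (𝓝[>] 0)).mul_isLittleO h).congr_right fun t => by ring

/-- Because `k` is critical at the origin, `dk(y) = O(|y|)`, and its value on `y` is `O(|y|²)`. This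
extra factor is why the remainder `o(|y|² + t)` of `θ` affects the energy only by `o(t²)`. -/
theorem isBigO_radial {k : Coord n → ℝ} (hk : ContDiff ℝ ∞ k) (h1 : ∀ i, pderiv i k 0 = 0) :
    (fun q : Coord n × ℝ => radial k q.1) =O[𝓝 0 ×ˢ 𝓝[>] 0] fun q => ‖q.1‖ ^ 2 + q.2 := by
  have h0 : fderiv ℝ k 0 = 0 := by
    ext v
    rw [fderiv_apply_eq_sum]
    simp [h1]
  have h2 : DifferentiableAt ℝ (fderiv ℝ k) 0 :=
    (hk.fderiv_right (m := ∞) (by simp)).differentiable (by simp) 0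
  have h3 := h2.hasFDerivAt.isBigO_sub
  simp only [h0, sub_zero] at h3
  have h4 : (radial k) =O[𝓝 0] fun y => ‖y‖ ^ 2 := by
    have h5 : (fun y => fderiv ℝ k y y) =O[𝓝 0] fun y => ‖y‖ * ‖y‖ := by
      refine (IsBigO.of_bound 1 (Eventually.of_forall fun y => ?_)).trans
        (h3.norm_norm.mul (isBigO_refl (fun y => ‖y‖) _))
      rw [one_mul, norm_mul, norm_norm, norm_norm]
      exact (fderiv ℝ k y).le_opNorm y
    refine (h5.congr_left fun y => ?_).congr_right fun y => (sq _).symm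
    rw [fderiv_apply_eq_sum]
    rfl
  refine (h4.comp_tendsto tendsto_fst).trans (IsBigO.of_bound 1
    (eventually_pos_snd.mono fun q hq => ?_))
  simp only [Function.comp_apply]
  rw [one_mul, Real.norm_of_nonneg (by positivity), Real.norm_of_nonneg (by positivity)]
  linarith

namespace IsAmplitude

variable {k : Coord n → ℝ} {θ P : ℝ → Coord n → ℝ} {a : Matrix (Fin n) (Fin n) ℝ} {α C : ℝ}

/-- A factor `f` of order `m` in `|y|² + t` improves the averaged remainder of `θ` from `o(t)` to
`o(t ^ (m + 1))`. The case `m = 0` serves the masses, the case `m = 1` serves `radial k`. -/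
theorem avg_remainder (h : IsAmplitude k θ P a α C) {f : Coord n → ℝ} (hf : Continuous f)
    (hc : HasCompactSupport f) {m : ℕ}
    (hm : (fun q : Coord n × ℝ => f q.1) =O[𝓝 0 ×ˢ 𝓝[>] 0] fun q => (‖q.1‖ ^ 2 + q.2) ^ m) :
    (fun t => avg t fun y => f y * (θ t y - (1 + quadForm a y + α * t)))
      =o[𝓝[>] 0] fun t => t ^ (m + 1) := by
  obtain ⟨D, hD⟩ := hc.exists_bound_of_continuous hf
  refine integral_heatKernel_isLittleO (N := 2)
    (C := D * (1 + ∑ i, ∑ j, |a i j| + |α|)) ?_ ?_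
  · exact (hm.mul_isLittleO h.expansion).congr_right fun q => by ring
  · filter_upwards [h.remainder_le] with t ht y
    rw [abs_mul, mul_assoc]
    exact mul_le_mul (hD y) (ht y) (abs_nonneg _) ((norm_nonneg _).trans (hD y))

/-- First order expansion of the averages of `f θ`. -/
theorem avg_first_order (h : IsAmplitude k θ P a α C) {f : Coord n → ℝ} (hf : ContDiff ℝ ∞ f)
    (hc : HasCompactSupport f) :
    (fun t => avg t (fun y => f y * θ t y) -
      (f 0 + t * (flatLaplacian f 0 + f 0 * (2 * a.trace + α)))) =o[𝓝[>] 0] fun t => t ^ 1 := by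
  have h1 := integral_heatKernel_first_order hf hc
  have h2 := avg_mul_quadForm hf hc a
  have h3 := (time_mul_avg hf hc).const_mul_left α
  have h4 := h.avg_remainder hf.continuous hc (m := 0)
    (by simpa using isBigO_one_of_continuous hf.continuous)
  refine (((h1.add h2).add h3).add h4).congr' ?_ EventuallyEq.rfl
  filter_upwards [h.avg_mul_theta hf hc] with t ht
  rw [ht]
  simp only [avg]
  ring

/-- At the origin `radial k` vanishes together with its gradient, and its Hessian and bilaplacian
are `2` and `4` times those of `k`. Its product with `a(y, y)` has order four, so only the Hessians
of the two factors contribute. -/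
theorem avg_radial (h : IsAmplitude k θ P a α C) (ha : a.IsSymm) :
    (fun t => avg t (fun y => radial k y * θ t y) - (2 * t * flatLaplacian k 0 +
      t ^ 2 * (2 * flatLaplacian (flatLaplacian k) 0 + 4 * flatLaplacian k 0 * a.trace +
        8 * ∑ i, ∑ j, pderiv i (pderiv j k) 0 * a i j + 2 * α * flatLaplacian k 0)))
      =o[𝓝[>] 0] fun t => t ^ 2 := by
  have hf := contDiff_radial h.smooth
  have hc := hasCompactSupport_radial h.compact
  have hf1 : ∀ i, pderiv i (radial k) 0 = 0 := fun i => by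
    rw [pderiv_radial_zero h.smooth, h.crit]
  have h1 := integral_heatKernel_second_order hf hc
  have h2 := integral_heatKernel_second_order (hf.mul (contDiff_quadForm a))
    (hc.mul_right (f' := quadForm a))
  have h3 := (time_mul (integral_heatKernel_first_order hf hc)).const_mul_left α
  have h4 := h.avg_remainder hf.continuous hc (m := 1)
    (by simpa using isBigO_radial h.smooth h.crit)
  refine (((h1.add h2).add h3).add h4).congr' ?_ EventuallyEq.rfl
  filter_upwards [h.avg_mul_theta hf hc] with t ht
  rw [ht, flatLaplacian_mul_zero' hf (contDiff_quadForm a) (quadForm_zero a)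
    (pderiv_quadForm_zero a), bilaplacian_mul_zero hf (contDiff_quadForm a) (radial_zero k)
    (quadForm_zero a) hf1 (pderiv_quadForm_zero a), flatLaplacian_quadForm,
    flatLaplacian_radial_zero h.smooth, bilaplacian_radial_zero h.smooth, radial_zero]
  have h5 : ∑ i, ∑ j, pderiv i (pderiv j (radial k)) 0 * pderiv i (pderiv j (quadForm a)) 0 =
      4 * ∑ i, ∑ j, pderiv i (pderiv j k) 0 * a i j := by
    simp only [Finset.mul_sum, pderiv_pderiv_radial_zero h.smooth, pderiv_pderiv_quadForm]
    refine Finset.sum_congr rfl fun i _ => Finset.sum_congr rfl fun j _ => ?_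
    rw [ha.apply i j]
    ring
  rw [h5]
  simp only [avg]
  ring

/-- The prefactor `t` raises the order, so only the leading part `4 |a y|²` of `P` counts; its
average is `8 t tr(a²)` to first order. -/
theorem avg_grad (h : IsAmplitude k θ P a α C) :
    (fun t => avg t (fun y => k y * (t * P t y)) - 8 * t ^ 2 * (a * a).trace)
      =o[𝓝[>] 0] fun t => t ^ 2 := by
  obtain ⟨D, hD⟩ := h.compact.exists_bound_of_continuous h.smooth.continuous
  have h1 : (fun t => avg t fun y => k y * (t * (P t y - 4 * quadForm (a * a) y)))
      =o[𝓝[>] 0] fun t => t ^ 2 := by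
    refine integral_heatKernel_isLittleO (N := 2)
      (C := D * (|C| + 4 * ∑ i, ∑ j, |(a * a) i j|)) ?_ ?_
    · have := (isBigO_one_of_continuous h.smooth.continuous).mul_isLittleO
        (isBigO_time.mul_isLittleO h.grad_expansion)
      exact this.congr_right fun q => by ring
    · have ht1 : ∀ᶠ t in 𝓝[>] (0 : ℝ), t < 1 :=
        eventually_nhdsWithin_of_eventually_nhds (gt_mem_nhds one_pos)
      filter_upwards [h.bounded, ht1, self_mem_nhdsWithin] with t h2 h3 h4 y
      have h4 : 0 < t := h4
      rw [abs_mul, abs_mul, mul_assoc, abs_of_pos h4]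
      refine mul_le_mul (hD y) ?_ (by positivity) ((norm_nonneg _).trans (hD y))
      have h5 := abs_quadForm_le (a * a) y
      have h6 : |P t y - 4 * quadForm (a * a) y| ≤ |P t y| + 4 * |quadForm (a * a) y| :=
        (abs_sub _ _).trans_eq (by rw [abs_mul]; norm_num)
      have h7 : 0 ≤ ∑ i, ∑ j, |(a * a) i j| := Finset.sum_nonneg fun i _ =>
        Finset.sum_nonneg fun j _ => abs_nonneg _
      have h8 := (h2 y).trans (le_abs_self C)
      calc t * |P t y - 4 * quadForm (a * a) y| ≤ 1 * |P t y - 4 * quadForm (a * a) y| := by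
            gcongr
        _ ≤ |C| + 4 * ((∑ i, ∑ j, |(a * a) i j|) * ‖y‖ ^ 2) := by linarith
        _ ≤ _ := by nlinarith [sq_nonneg ‖y‖, abs_nonneg C]
  have h2 := (time_mul (avg_mul_quadForm h.smooth h.compact (a * a))).const_mul_left 4
  refine (h1.add h2).congr' ?_ EventuallyEq.rfl
  filter_upwards [h.measurable, h.bounded, self_mem_nhdsWithin] with t h3 h4 ht
  have ht : 0 < t := ht
  have h5 := (integrable_heatKernel_mul_mul ht h.smooth.continuous h.compact h3 h4).const_mul t
  have h6 := (integrable_heatKernel_mul_of_compact ht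
    (h.smooth.mul (contDiff_quadForm (a * a))).continuous
      (h.compact.mul_right (f' := quadForm (a * a)))).const_mul (4 * t)
  have h7 : avg t (fun y => k y * (t * (P t y - 4 * quadForm (a * a) y))) =
      avg t (fun y => k y * (t * P t y)) - 4 * t * avg t (fun y => k y * quadForm (a * a) y) := by
    rw [← avg_const_mul, ← avg_sub]
    · congr 1; ext y; ring
    · exact h5.congr (Eventually.of_forall fun y => by ring)
    · exact h6.congr (Eventually.of_forall fun y => by simp; ring)
  rw [h7, h.one]
  ring

/-- Here `x log x = (x - 1) + (x - 1)²/2 + O(|x - 1|³)`. The linear part is kept unexpanded, because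
it cancels later against the mass. In the quadratic part `θ - 1` is replaced by `a(y, y) + α t`, and
the average of its square is `t²` times the bracket, up to `o(t²)`. -/
theorem avg_log (h : IsAmplitude k θ P a α C) (ha : a.IsSymm) :
    (fun t => avg t (fun y => k y * (θ t y * Real.log (θ t y))) -
      (avg t (fun y => k y * θ t y) - avg t k + 1 / 2 * t ^ 2 * (4 * a.trace ^ 2 +
        8 * (a * a).trace + 4 * α * a.trace + α ^ 2))) =o[𝓝[>] 0] fun t => t ^ 2 := by
  obtain ⟨D, hD⟩ := h.compact.exists_bound_of_continuous h.smooth.continuous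
  have hq := contDiff_quadForm a
  have hkq := h.smooth.mul hq
  have hkqc : HasCompactSupport fun y => k y * quadForm a y := h.compact.mul_right
  have hkqqc : HasCompactSupport fun y => k y * quadForm a y * quadForm a y := hkqc.mul_right
  set R : ℝ → Coord n → ℝ := fun t y => θ t y * Real.log (θ t y) - (θ t y - 1) -
    1 / 2 * (quadForm a y + α * t) ^ 2 with hR
  have hRo : (fun q : Coord n × ℝ => R q.2 q.1) =o[𝓝 0 ×ˢ 𝓝[>] 0]
      fun q => (‖q.1‖ ^ 2 + q.2) ^ 2 := by
    have h1 : (fun q : Coord n × ℝ => θ q.2 q.1 * Real.log (θ q.2 q.1) - (θ q.2 q.1 - 1) -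
        1 / 2 * (θ q.2 q.1 - 1) ^ 2) =O[𝓝 0 ×ˢ 𝓝[>] 0] fun q => (‖q.1‖ ^ 2 + q.2) ^ 3 := by
      refine (IsBigO.of_bound 4 ?_).trans (h.isBigO_sub_one.pow 3)
      filter_upwards [h.lower.prod_inr (𝓝 0), h.upper.prod_inr (𝓝 0)] with q h1 h2
      rw [norm_pow, Real.norm_eq_abs, Real.norm_eq_abs]
      exact abs_mul_log_sub_le (h1 q.1) (h2 q.1)
    have h2 : (fun q : Coord n × ℝ => (‖q.1‖ ^ 2 + q.2) ^ 3) =o[𝓝 0 ×ˢ 𝓝[>] 0]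
        fun q => (‖q.1‖ ^ 2 + q.2) ^ 2 := by
      have h3 : Tendsto (fun q : Coord n × ℝ => ‖q.1‖ ^ 2 + q.2) (𝓝 0 ×ˢ 𝓝[>] 0) (𝓝 0) := by
        have h4 : Tendsto (fun q : Coord n × ℝ => ‖q.1‖ ^ 2 + q.2) (𝓝 (0, 0)) (𝓝 0) := by
          have : Continuous fun q : Coord n × ℝ => ‖q.1‖ ^ 2 + q.2 := by fun_prop
          simpa using this.tendsto (0, 0)
        refine h4.mono_left ?_
        rw [nhds_prod_eq]
        exact Filter.prod_mono le_rfl nhdsWithin_le_nhds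
      have h5 : (fun q : Coord n × ℝ => ‖q.1‖ ^ 2 + q.2) =o[𝓝 0 ×ˢ 𝓝[>] 0] fun _ => (1 : ℝ) :=
        (isLittleO_one_iff ℝ).2 h3
      have h6 := h5.mul_isBigO (isBigO_refl
        (fun q : Coord n × ℝ => (‖q.1‖ ^ 2 + q.2) ^ 2) (𝓝 0 ×ˢ 𝓝[>] 0))
      exact (h6.congr_left fun q => by ring).congr_right fun q => by ring
    have h3 : (fun q : Coord n × ℝ => (θ q.2 q.1 - 1) + (quadForm a q.1 + α * q.2))
        =O[𝓝 0 ×ˢ 𝓝[>] 0] fun q => ‖q.1‖ ^ 2 + q.2 :=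
      h.isBigO_sub_one.add ((isBigO_quadForm a).add (isBigO_time.const_mul_left α))
    have h4 := (h.expansion.mul_isBigO h3).const_mul_left (1 / 2)
    refine ((h1.trans_isLittleO h2).add (h4.congr_right fun q => (sq _).symm)).congr_left
      fun q => ?_
    rw [hR]
    ring
  have h1 : (fun t => avg t fun y => k y * R t y) =o[𝓝[>] 0] fun t => t ^ 2 := by
    refine integral_heatKernel_isLittleO (N := 4)
      (C := D * (4 + 2 * ((∑ i, ∑ j, |a i j|) + |α|) ^ 2)) ?_ ?_
    · have := (isBigO_one_of_continuous h.smooth.continuous).mul_isLittleO hRo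
      exact this.congr_right fun q => by ring
    · have ht1 : ∀ᶠ t in 𝓝[>] (0 : ℝ), t < 1 :=
        eventually_nhdsWithin_of_eventually_nhds (gt_mem_nhds one_pos)
      filter_upwards [h.lower, h.upper, ht1, self_mem_nhdsWithin] with t h2 h3 h4 h5 y
      have h5 : 0 < t := h5
      rw [abs_mul, mul_assoc]
      refine mul_le_mul (hD y) ?_ (abs_nonneg _) ((norm_nonneg _).trans (hD y))
      set S := (∑ i, ∑ j, |a i j|) with hS
      have hS0 : 0 ≤ S := Finset.sum_nonneg fun i _ => Finset.sum_nonneg fun j _ => abs_nonneg _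
      have h6 := abs_mul_log_sub_le (h2 y) (h3 y)
      have h7 : |θ t y - 1| ≤ 1 / 2 := abs_le.2 ⟨by linarith [h2 y], by linarith [h3 y]⟩
      have h8 : |θ t y - 1| ^ 3 ≤ (1 / 2) ^ 3 := pow_le_pow_left₀ (abs_nonneg _) h7 3
      have h9 : (θ t y - 1) ^ 2 ≤ (1 / 2) ^ 2 := by
        rw [← sq_abs]; exact pow_le_pow_left₀ (abs_nonneg _) h7 2
      have h10 : |quadForm a y + α * t| ≤ (S + |α|) * (1 + ‖y‖ ^ 2) := by
        have h11 := abs_quadForm_le a y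
        have h12 : |α * t| ≤ |α| := by
          rw [abs_mul, abs_of_pos h5]
          exact mul_le_of_le_one_right (abs_nonneg _) h4.le
        have h13 := abs_add_le (quadForm a y) (α * t)
        have : 0 ≤ |α| * ‖y‖ ^ 2 := by positivity
        nlinarith
      have h14 : (quadForm a y + α * t) ^ 2 ≤ (S + |α|) ^ 2 * (2 * (1 + ‖y‖ ^ 4)) := by
        rw [← sq_abs]
        refine (pow_le_pow_left₀ (abs_nonneg _) h10 2).trans ?_
        rw [mul_pow]
        refine mul_le_mul_of_nonneg_left ?_ (sq_nonneg _)
        nlinarith [sq_nonneg (‖y‖ ^ 2 - 1)]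
      have h15 : |R t y| ≤ 1 + (S + |α|) ^ 2 * (1 + ‖y‖ ^ 4) := by
        rw [hR]
        have h16 := abs_le.1 h6
        refine abs_le.2 ⟨?_, ?_⟩ <;> nlinarith [sq_nonneg (θ t y - 1),
          sq_nonneg (quadForm a y + α * t), sq_nonneg (S + |α|), pow_nonneg (norm_nonneg y) 4]
      refine h15.trans ?_
      have h17 : 0 ≤ (S + |α|) ^ 2 * (1 + ‖y‖ ^ 4) := by positivity
      nlinarith [pow_nonneg (norm_nonneg y) 4]
  have h2 := (integral_heatKernel_second_order (hkq.mul hq) hkqqc).const_mul_left (1 / 2)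
  have h3 := (time_mul (avg_mul_quadForm h.smooth h.compact a)).const_mul_left α
  have h4 := (time_mul (time_mul_avg h.smooth h.compact)).const_mul_left (1 / 2 * α ^ 2)
  refine (((h1.add h2).add h3).add h4).congr' ?_ EventuallyEq.rfl
  filter_upwards [h.measurable_theta, h.abs_theta_le, h.lower, h.upper, self_mem_nhdsWithin]
    with t hm hb hl hu ht
  have ht : 0 < t := ht
  have i1 := integrable_heatKernel_mul_of_compact ht h.smooth.continuous h.compact
  have i2 := integrable_heatKernel_mul_mul ht h.smooth.continuous h.compact hm hb
  have i3 := integrable_heatKernel_mul_of_compact ht hkq.continuous hkqc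
  have i4 := integrable_heatKernel_mul_of_compact ht (hkq.mul hq).continuous hkqqc
  have i5 : Integrable fun y => heatKernel t y * (k y * (θ t y * Real.log (θ t y))) := by
    refine integrable_heatKernel_mul_mul ht h.smooth.continuous h.compact
      (hm.mul hm.log) (C := 3 / 2 * (3 / 2)) fun y => ?_
    rw [abs_mul]
    refine mul_le_mul (hb y) ?_ (abs_nonneg _) (by norm_num)
    have l1 := Real.log_le_sub_one_of_pos (by linarith [hl y] : 0 < θ t y)
    have l2 := Real.one_sub_inv_le_log_of_pos (by linarith [hl y] : 0 < θ t y)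
    have l3 : (θ t y)⁻¹ ≤ 2 := by
      rw [inv_le_comm₀ (by linarith [hl y]) (by norm_num)]
      linarith [hl y]
    exact abs_le.2 ⟨by linarith, by linarith [hu y]⟩
  have hsplit : avg t (fun y => k y * R t y) =
      avg t (fun y => k y * (θ t y * Real.log (θ t y))) - avg t (fun y => k y * θ t y) + avg t k -
      1 / 2 * avg t (fun y => k y * quadForm a y * quadForm a y) -
      α * t * avg t (fun y => k y * quadForm a y) - 1 / 2 * α ^ 2 * t ^ 2 * avg t k := by
    simp only [avg, ← integral_const_mul]
    rw [← integral_sub' i5 i2, ← integral_add' (i5.sub i2) i1,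
      ← integral_sub' ((i5.sub i2).add i1) (i4.const_mul _),
      ← integral_sub' (((i5.sub i2).add i1).sub (i4.const_mul _)) (i3.const_mul _),
      ← integral_sub' ((((i5.sub i2).add i1).sub (i4.const_mul _)).sub (i3.const_mul _))
        (i1.const_mul _)]
    refine integral_congr_ae (Eventually.of_forall fun y => ?_)
    simp only [hR, Pi.sub_apply, Pi.add_apply]
    ring
  have hz : (k 0 * quadForm a 0) = 0 := by rw [quadForm_zero, mul_zero]
  have hb1 := pderiv_mul_zero h.smooth hq (quadForm_zero a) (pderiv_quadForm_zero a)
  rw [hsplit, flatLaplacian_mul_zero' hkq hq (quadForm_zero a) (pderiv_quadForm_zero a),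
    bilaplacian_mul_zero hkq hq hz (quadForm_zero a) hb1 (pderiv_quadForm_zero a),
    flatLaplacian_mul_zero' h.smooth hq (quadForm_zero a) (pderiv_quadForm_zero a), hz,
    flatLaplacian_quadForm, h.one]
  have h5 : ∑ i, ∑ j, pderiv i (pderiv j fun y => k y * quadForm a y) 0 *
      pderiv i (pderiv j (quadForm a)) 0 = 4 * (a * a).trace := by
    simp only [pderiv_pderiv_mul_zero h.smooth hq (quadForm_zero a) (pderiv_quadForm_zero a),
      pderiv_pderiv_quadForm, h.one, Matrix.trace, Matrix.diag, Matrix.mul_apply, Finset.mul_sum]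
    refine Finset.sum_congr rfl fun i _ => Finset.sum_congr rfl fun j _ => ?_
    rw [ha.apply i j]
    ring
  rw [h5]
  simp only [avg]
  ring

end IsAmplitude

end

end GaussianAverage

/-! ### Integration by parts and the expansion of the localized energy -/

namespace GaussianAverage

noncomputable section

open CoordMetric

variable {n : ℕ}

/-- Integration by parts against the heat kernel. -/
theorem avg_coord_mul {t : ℝ} (ht : 0 < t) {K u : Coord n → ℝ} (hK : ContDiff ℝ ∞ K)
    (hc : HasCompactSupport K) (hu : Differentiable ℝ u) {B C : ℝ} (hB : ∀ y, |u y| ≤ B)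
    (hC : ∀ y, ‖fderiv ℝ u y‖ ≤ C) (i : Fin n) :
    avg t (fun y => y i / (2 * t) * (K y * u y)) =
      avg t (fun y => pderiv i K y * u y) + avg t (fun y => K y * pderiv i u y) := by
  have hder : ∀ z : Coord n, fderiv ℝ (heatKernel t) z (EuclideanSpace.single i 1) =
      -(heatKernel t z * (z i / (2 * t))) := by
    intro z
    rw [(hasFDerivAt_heatKernel t z).fderiv]
    simp [EuclideanSpace.inner_single_right]
    ring
  have hKd : Differentiable ℝ K := hK.differentiable (by simp)
  have hprod : ∀ z, fderiv ℝ (fun y => K y * u y) z (EuclideanSpace.single i 1) =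
      pderiv i K z * u z + K z * pderiv i u z := by
    intro z
    have h1 := ((hKd z).hasFDerivAt.mul (hu z).hasFDerivAt).fderiv
    change fderiv ℝ (K * u) z _ = _
    rw [h1]
    simp [pderiv]
    ring
  have hmeas : Measurable (pderiv i u) := measurable_fderiv_apply_const ℝ u _
  have hbd : ∀ y, |pderiv i u y| ≤ C := fun y => by
    refine ((fderiv ℝ u y).le_opNorm _).trans ?_
    simpa using hC y
  have i1 := integrable_heatKernel_mul_mul ht (contDiff_pderiv hK i).continuous
    (hasCompactSupport_pderiv hc i) hu.continuous.measurable hB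
  have i2 := integrable_heatKernel_mul_mul ht hK.continuous hc hmeas hbd
  have i3 := integrable_heatKernel_mul_mul ht hK.continuous hc hu.continuous.measurable hB
  have i4 : Integrable fun y => heatKernel t y * ((y i / (2 * t) * K y) * u y) :=
    integrable_heatKernel_mul_mul ht (by have := hK.continuous; fun_prop)
      (HasCompactSupport.mul_left (f := fun y : Coord n => y i / (2 * t)) hc)
      hu.continuous.measurable hB
  have key := integral_mul_fderiv_eq_neg_fderiv_mul_of_integrable (μ := volume)
    (f := fun y => K y * u y) (g := heatKernel t) (v := EuclideanSpace.single i (1 : ℝ)) ?_ ?_ ?_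
    (fun y _ => (hKd y).mul (hu y)) (fun y _ => (hasFDerivAt_heatKernel t y).differentiableAt)
  · simp only [hder, hprod] at key
    rw [← avg_add i1 i2]
    have e1 : ∀ y : Coord n, K y * u y * -(heatKernel t y * (y i / (2 * t))) =
        -(heatKernel t y * (y i / (2 * t) * (K y * u y))) := fun y => by ring
    simp only [e1, integral_neg, neg_inj] at key
    simp only [avg]
    rw [key]
    exact integral_congr_ae (Eventually.of_forall fun y => mul_comm _ _)
  · simp only [hprod]
    exact (i1.add i2).congr (Eventually.of_forall fun y => by simp; ring)
  · simp only [hder]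
    exact i4.neg.congr (Eventually.of_forall fun y => by simp; ring)
  · exact i3.congr (Eventually.of_forall fun y => by simp; ring)

theorem pderiv_coord_mul {k : Coord n → ℝ} (hk : ContDiff ℝ ∞ k) (i : Fin n) (y : Coord n) :
    pderiv i (fun z => z i * k z) y = k y + y i * pderiv i k y := by
  have h1 : pderiv i (fun z => z i * k z) =
      (dfun i (coordFun i * (⟨k, mem_smoothFun.2 hk⟩ : smoothFun n))).1 := rfl
  rw [h1, Derivation.leibniz, dfun_coordFun]
  simp only [if_true, smul_eq_mul, mul_one, val_add, val_mul]
  rw [add_comm]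
  rfl

/-- Integration by parts for the radial derivative. -/
theorem avg_radial_parts {t : ℝ} (ht : 0 < t) {k u : Coord n → ℝ} (hk : ContDiff ℝ ∞ k)
    (hc : HasCompactSupport k) (hu : Differentiable ℝ u) {B C : ℝ} (hB : ∀ y, |u y| ≤ B)
    (hC : ∀ y, ‖fderiv ℝ u y‖ ≤ C) :
    avg t (fun y => k y * (-fderiv ℝ u y y + u y * ‖y‖ ^ 2 / (2 * t) - n * u y)) =
      avg t (fun y => radial k y * u y) := by
  have hK : ∀ i : Fin n, ContDiff ℝ ∞ fun y : Coord n => y i * k y := fun i =>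
    ContDiff.mul (by fun_prop) hk
  have hKc : ∀ i : Fin n, HasCompactSupport fun y : Coord n => y i * k y := fun i =>
    HasCompactSupport.mul_left (f := fun y : Coord n => y i) hc
  have hmu := hu.continuous.measurable
  have hmeas : ∀ i, Measurable (pderiv i u) := fun i => measurable_fderiv_apply_const ℝ u _
  have hbd : ∀ i y, |pderiv i u y| ≤ C := fun i y => by
    refine ((fderiv ℝ u y).le_opNorm _).trans ?_
    simpa using hC y
  have i1 : ∀ i, Integrable fun y : Coord n =>
      heatKernel t y * (y i / (2 * t) * (y i * k y * u y)) := fun i =>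
    (integrable_heatKernel_mul_mul ht (f := fun y : Coord n => y i / (2 * t) * (y i * k y))
      (by have := hk.continuous; fun_prop)
      (HasCompactSupport.mul_left (f := fun y : Coord n => y i / (2 * t)) (hKc i)) hmu hB).congr
      (Eventually.of_forall fun y => by ring)
  have i2 : ∀ i : Fin n, Integrable fun y => heatKernel t y * (y i * k y * pderiv i u y) :=
    fun i => integrable_heatKernel_mul_mul ht (hK i).continuous (hKc i) (hmeas i) (hbd i)
  have i3 := integrable_heatKernel_mul_mul ht hk.continuous hc hmu hB
  have i4 : ∀ i : Fin n, Integrable fun y : Coord n =>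
      heatKernel t y * (y i * pderiv i k y * u y) := fun i =>
    integrable_heatKernel_mul_mul ht (f := fun y : Coord n => y i * pderiv i k y)
      (by have := (contDiff_pderiv hk i).continuous; fun_prop)
      (HasCompactSupport.mul_left (f := fun y : Coord n => y i)
        (hasCompactSupport_pderiv hc i)) hmu hB
  -- Integration by parts is applied with the weight `y i * k`. Its derivative `k + y i ∂_i k`
  -- yields, after summation over `i`, both the term with `n` and the radial derivative of `k`.
  have key : ∀ i : Fin n, avg t (fun y => y i * pderiv i k y * u y) =
      avg t (fun y => y i / (2 * t) * (y i * k y * u y)) - avg t (fun y => k y * u y) -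
        avg t (fun y => y i * k y * pderiv i u y) := by
    intro i
    have h1 := avg_coord_mul ht (hK i) (hKc i) hu hB hC i
    have h2 : avg t (fun y => pderiv i (fun z => z i * k z) y * u y) =
        avg t (fun y => k y * u y) + avg t (fun y => y i * pderiv i k y * u y) := by
      rw [← avg_add i3 (i4 i)]
      congr 1
      ext y
      rw [pderiv_coord_mul hk]
      ring
    rw [h1, h2]
    ring
  have hL : avg t (fun y => radial k y * u y) =
      ∑ i, avg t (fun y => y i * pderiv i k y * u y) := by
    simp only [avg]
    rw [← integral_finsetSum _ fun i _ => i4 i]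
    simp only [radial, Finset.sum_mul, Finset.mul_sum]
  have e1 : ∀ i : Fin n, (∫ y : Coord n, heatKernel t y * (y i / (2 * t) * (y i * k y * u y))) -
      (∫ y, heatKernel t y * (k y * u y)) - ∫ y, heatKernel t y * (y i * k y * pderiv i u y) =
      ∫ y : Coord n, heatKernel t y * (y i / (2 * t) * (y i * k y * u y)) -
        heatKernel t y * (k y * u y) - heatKernel t y * (y i * k y * pderiv i u y) := by
    intro i
    rw [← integral_sub' (i1 i) i3, ← integral_sub' ((i1 i).sub i3) (i2 i)]
    rfl
  have i5 : ∀ i : Fin n, Integrable fun y : Coord n =>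
      heatKernel t y * (y i / (2 * t) * (y i * k y * u y)) - heatKernel t y * (k y * u y) -
        heatKernel t y * (y i * k y * pderiv i u y) := fun i => ((i1 i).sub i3).sub (i2 i)
  rw [hL, Finset.sum_congr rfl fun i _ => (key i).trans (e1 i), avg,
    ← integral_finsetSum _ fun i _ => i5 i]
  refine integral_congr_ae (Eventually.of_forall fun y => ?_)
  beta_reduce
  rw [fderiv_apply_eq_sum, EuclideanSpace.norm_sq_eq]
  simp only [Finset.sum_sub_distrib, Finset.sum_const, Finset.card_univ, Fintype.card_fin,
    nsmul_eq_mul, Real.norm_eq_abs, sq_abs]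
  have e2 : ∑ i, heatKernel t y * (y i / (2 * t) * (y i * k y * u y)) =
      heatKernel t y * (k y * (u y * (∑ i, y i ^ 2) / (2 * t))) := by
    simp only [Finset.mul_sum, Finset.sum_div]
    exact Finset.sum_congr rfl fun i _ => by ring
  have e3 : ∑ i, heatKernel t y * (y i * k y * pderiv i u y) =
      heatKernel t y * (k y * ∑ i, y i * pderiv i u y) := by
    simp only [Finset.mul_sum]
    exact Finset.sum_congr rfl fun i _ => by ring
  rw [e2, e3]
  ring

/-- If `m = 1 + c t + o(t)`, then `m log m = (m - 1) + c² t² / 2 + o(t²)`. -/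
theorem mul_log_expansion {m : ℝ → ℝ} {c : ℝ}
    (hm : (fun t => m t - (1 + t * c)) =o[𝓝[>] 0] fun t => t ^ 1) :
    (fun t => m t * Real.log (m t) - (m t - 1) - 1 / 2 * c ^ 2 * t ^ 2)
      =o[𝓝[>] 0] fun t => t ^ 2 := by
  have hm1 : (fun t => m t - (1 + t * c)) =o[𝓝[>] 0] fun t => t := by simpa using hm
  have hid : (fun t : ℝ => t) =O[𝓝[>] 0] fun t => t := isBigO_refl _ _
  have h1 : (fun t => m t - 1) =O[𝓝[>] 0] fun t => t :=
    (hm1.isBigO.add (hid.const_mul_left c)).congr_left fun t => by ring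
  have ht0 : Tendsto (fun t : ℝ => t) (𝓝[>] 0) (𝓝 0) := nhdsWithin_le_nhds
  have h2 : Tendsto (fun t => m t - 1) (𝓝[>] 0) (𝓝 0) := h1.trans_tendsto ht0
  have h3 : ∀ᶠ t in 𝓝[>] 0, |m t - 1| < 1 / 2 :=
    (h2.abs.eventually (gt_mem_nhds (by norm_num : |(0 : ℝ)| < 1 / 2)))
  have h4 : (fun t => m t * Real.log (m t) - (m t - 1) - 1 / 2 * (m t - 1) ^ 2)
      =O[𝓝[>] 0] fun t => t ^ 3 := by
    refine (IsBigO.of_bound 4 ?_).trans (h1.pow 3)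
    filter_upwards [h3] with t ht
    rw [norm_pow, Real.norm_eq_abs, Real.norm_eq_abs]
    have := abs_lt.1 ht
    exact abs_mul_log_sub_le (by linarith) (by linarith)
  have h5 : (fun t : ℝ => t ^ 3) =o[𝓝[>] 0] fun t => t ^ 2 :=
    (isLittleO_pow_pow (by norm_num : 2 < 3)).mono nhdsWithin_le_nhds
  have h6 := (hm1.mul_isBigO (h1.add (hid.const_mul_left c))).const_mul_left (1 / 2)
  refine ((h4.trans_isLittleO h5).add (h6.congr_right fun t => (sq t).symm)).congr_left
    fun t => ?_
  ring

namespace IsAmplitude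

variable {k : Coord n → ℝ} {θ P : ℝ → Coord n → ℝ} {a : Matrix (Fin n) (Fin n) ℝ} {α C : ℝ}

/-- The expansion of the localized functional. -/
theorem energy_expansion (h : IsAmplitude k θ P a α C) (ha : a.IsSymm) :
    (fun t => avg t (fun y => k y * (t * P t y - fderiv ℝ (θ t) y y +
        θ t y * ‖y‖ ^ 2 / (2 * t) - n * θ t y - θ t y * Real.log (θ t y))) +
      (avg t (fun y => k y * θ t y) - 1) - (3 * t * flatLaplacian k 0 +
      t ^ 2 * (5 / 2 * flatLaplacian (flatLaplacian k) 0 + 4 * flatLaplacian k 0 * a.trace +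
        8 * ∑ i, ∑ j, pderiv i (pderiv j k) 0 * a i j + 2 * α * flatLaplacian k 0 +
        4 * (a * a).trace - 2 * a.trace ^ 2 - 2 * α * a.trace - 1 / 2 * α ^ 2)))
      =o[𝓝[>] 0] fun t => t ^ 2 := by
  have h1 := h.avg_grad
  have h2 := h.avg_radial ha
  have h3 := h.avg_log ha
  have h4 := integral_heatKernel_second_order h.smooth h.compact
  -- The logarithmic term subtracts `avg (k θ) - avg k`; adding `avg (k θ) - 1` leaves `avg k - 1`.
  -- No second-order information on `θ` in `|y|² + t` is therefore needed.
  refine (((h1.add h2).sub h3).add h4).congr' ?_ EventuallyEq.rfl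
  filter_upwards [h.measurable_theta, h.abs_theta_le, h.lower, h.upper, h.diff, h.fderiv_le,
    h.measurable, h.bounded, self_mem_nhdsWithin] with t hm hb hl hu hd hf hPm hPb ht
  have ht : 0 < t := ht
  have hparts := avg_radial_parts ht h.smooth h.compact hd hb hf
  have i1 : Integrable fun y => heatKernel t y * (k y * (t * P t y)) :=
    ((integrable_heatKernel_mul_mul ht h.smooth.continuous h.compact hPm hPb).const_mul t).congr
      (Eventually.of_forall fun y => by simp; ring)
  have i5 : Integrable fun y => heatKernel t y * (k y * (θ t y * Real.log (θ t y))) := by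
    refine integrable_heatKernel_mul_mul ht h.smooth.continuous h.compact
      (hm.mul hm.log) (C := 3 / 2 * (3 / 2)) fun y => ?_
    rw [abs_mul]
    refine mul_le_mul (hb y) ?_ (abs_nonneg _) (by norm_num)
    have l1 := Real.log_le_sub_one_of_pos (by linarith [hl y] : 0 < θ t y)
    have l2 := Real.one_sub_inv_le_log_of_pos (by linarith [hl y] : 0 < θ t y)
    have l3 : (θ t y)⁻¹ ≤ 2 := by
      rw [inv_le_comm₀ (by linarith [hl y]) (by norm_num)]
      linarith [hl y]
    exact abs_le.2 ⟨by linarith, by linarith [hu y]⟩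
  have i3 := integrable_heatKernel_mul_mul ht h.smooth.continuous h.compact hm hb
  have i6 : Integrable fun y => heatKernel t y * (k y * (-fderiv ℝ (θ t) y y +
      θ t y * ‖y‖ ^ 2 / (2 * t) - n * θ t y)) := by
    have j1 : Integrable fun y => heatKernel t y * ∑ i, (y i * k y) * pderiv i (θ t) y := by
      simp only [Finset.mul_sum]
      refine integrable_finsetSum _ fun i _ => ?_
      refine integrable_heatKernel_mul_mul ht (f := fun y : Coord n => y i * k y)
        (by have := h.smooth.continuous; fun_prop)
        (HasCompactSupport.mul_left (f := fun y : Coord n => y i) h.compact)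
        (measurable_fderiv_apply_const ℝ (θ t) _) (C := C) fun y => ?_
      refine ((fderiv ℝ (θ t) y).le_opNorm _).trans ?_
      simpa using hf y
    have j2 : Integrable fun y => heatKernel t y * ((‖y‖ ^ 2 / (2 * t) * k y) * θ t y) :=
      integrable_heatKernel_mul_mul ht (by have := h.smooth.continuous; fun_prop)
        (HasCompactSupport.mul_left (f := fun y : Coord n => ‖y‖ ^ 2 / (2 * t)) h.compact) hm hb
    refine ((j2.sub j1).sub (i3.const_mul (n : ℝ))).congr (Eventually.of_forall fun y => ?_)
    simp only [Pi.sub_apply]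
    have : ∑ i, (y i * k y) * pderiv i (θ t) y = k y * fderiv ℝ (θ t) y y := by
      rw [fderiv_apply_eq_sum, Finset.mul_sum]
      exact Finset.sum_congr rfl fun i _ => by ring
    rw [this]
    ring
  have hsplit : avg t (fun y => k y * (t * P t y - fderiv ℝ (θ t) y y +
      θ t y * ‖y‖ ^ 2 / (2 * t) - n * θ t y - θ t y * Real.log (θ t y))) =
      avg t (fun y => k y * (t * P t y)) + avg t (fun y => radial k y * θ t y) -
        avg t (fun y => k y * (θ t y * Real.log (θ t y))) := by
    rw [← hparts]
    simp only [avg]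
    rw [← integral_add' i1 i6, ← integral_sub' (i1.add i6) i5]
    refine integral_congr_ae (Eventually.of_forall fun y => ?_)
    simp only [Pi.sub_apply, Pi.add_apply]
    ring
  rw [hsplit, h.one]
  simp only [avg]
  ring

end IsAmplitude

end

end GaussianAverage

/-! ### Extension of the metric from a normal chart to `ℝⁿ` -/

namespace Riem

noncomputable section

open CoordMetric GaussianAverage

variable {n : ℕ} {M : Type*} [MetricSpace M] [ChartedSpace (Coord n) M]
  [RiemannianBundle (fun x : M => TangentSpace (𝓡 n) x)] [IsManifold (𝓡 n) ∞ M]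
  [IsContMDiffRiemannianBundle (𝓡 n) ∞ (Coord n) (fun x : M => TangentSpace (𝓡 n) x)]
  [IsRiemannianManifold (𝓡 n) M]
  {e : OpenPartialHomeomorph M (Coord n)} {p : M}

/-- The metric in normal coordinates agrees near the centre with a globally defined one. -/
theorem IsNormalChart.exists_isGaussMetric (he : IsNormalChart e p) {N : Set (Coord n)}
    (hN : N ∈ 𝓝 0) : ∃ G, IsGaussMetric G ∧ ∃ r > 0, Metric.closedBall 0 r ⊆ e.target ∩ N ∧
      ∀ y ∈ Metric.ball 0 r, G y = gram e y := by
  obtain ⟨R, hR, hball⟩ := Metric.nhds_basis_closedBall.mem_iff.1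
    (Filter.inter_mem (e.open_target.mem_nhds he.zero_mem) hN)
  -- Interpolation with the Euclidean metric: convex combinations of positive definite matrices stay
  -- positive definite, and near the centre the metric is unchanged.
  let χ : ContDiffBump (0 : Coord n) := ⟨R / 2, R, by positivity, by linarith⟩
  have hsub : Metric.closedBall (0 : Coord n) R ⊆ e.target := hball.trans inter_subset_left
  set G : Coord n → Matrix (Fin n) (Fin n) ℝ := fun y => χ y • gram e y + (1 - χ y) • 1 with hG
  have hGin : ∀ y ∈ Metric.ball (0 : Coord n) (R / 2), G y = gram e y := by
    intro y hy
    have : χ y = 1 := χ.one_of_mem_closedBall (Metric.ball_subset_closedBall hy)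
    simp [hG, this]
  refine ⟨G, ⟨fun i j => ?_, fun y i j => ?_, fun y => ?_, ?_, ?_⟩, R / 2, by positivity,
    (Metric.closedBall_subset_closedBall (by linarith)).trans hball, hGin⟩
  · refine contDiff_iff_contDiffAt.2 fun y => ?_
    have hχ : ContDiffAt ℝ ∞ χ y := χ.contDiffAt
    by_cases hy : y ∈ e.target
    · simp only [hG, Matrix.add_apply, Matrix.smul_apply, smul_eq_mul]
      exact (hχ.mul (contDiffAt_gram he.mem_maximalAtlas hy i j)).add
        ((contDiffAt_const.sub hχ).mul contDiffAt_const)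
    · have hy' : y ∉ Metric.closedBall (0 : Coord n) R := fun h => hy (hsub h)
      refine (contDiffAt_const (c := (1 : Matrix (Fin n) (Fin n) ℝ) i j)).congr_of_eventuallyEq ?_
      filter_upwards [Metric.isClosed_closedBall.isOpen_compl.mem_nhds hy'] with z hz
      have hz' : χ z = 0 := by
        refine χ.zero_of_le_dist ?_
        simp only [mem_compl_iff, Metric.mem_closedBall, not_le] at hz
        exact hz.le
      simp [hG, hz']
  · simp only [hG, Matrix.add_apply, Matrix.smul_apply, gram_symm y i j, Matrix.one_apply,
      eq_comm (a := i)]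
  · have h0 : 0 ≤ χ y := χ.nonneg
    have h1 : χ y ≤ 1 := χ.le_one
    refine Matrix.PosDef.det_pos ?_
    by_cases hy : y ∈ e.target
    · have hg := gram_posDef he.mem_maximalAtlas hy
      rcases h0.eq_or_lt with h0 | h0
      · simp only [hG, ← h0, zero_smul, sub_zero, one_smul, zero_add]
        exact Matrix.PosDef.one
      · exact (hg.smul h0).add_posSemidef (Matrix.PosSemidef.one.smul (by linarith))
    · have hz' : χ y = 0 := by
        refine χ.zero_of_le_dist ?_
        have hy' : y ∉ Metric.closedBall (0 : Coord n) R := fun h => hy (hsub h)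
        simp only [Metric.mem_closedBall, not_le] at hy'
        exact hy'.le
      simp only [hG, hz', zero_smul, sub_zero, one_smul, zero_add]
      exact Matrix.PosDef.one
  · rw [hGin 0 (by simpa using hR), he.orthonormal]
  · filter_upwards [Metric.ball_mem_nhds (0 : Coord n) (by positivity : 0 < R / 2),
      e.open_target.mem_nhds he.zero_mem] with y hy hyt i
    rw [hGin y hy]
    exact he.gauss hyt i

end

end Riem

/-! ### Jet of the cut-off density at the origin -/

namespace CoordMetric

noncomputable section

open GaussianAverage

variable {n : ℕ} {G : Coord n → Matrix (Fin n) (Fin n) ℝ} {k : Coord n → ℝ}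

theorem IsGaussMetric.contDiff_density (h : IsGaussMetric G) :
    ContDiff ℝ ∞ fun y => √(G y).det :=
  contDiff_iff_contDiffAt.2 fun y =>
    (contDiffAt_det fun i j => (h.smooth i j).contDiffAt).sqrt (h.det_pos y).ne'

theorem IsGaussMetric.cutoff_zero (h : IsGaussMetric G) (hk : k =ᶠ[𝓝 0] fun y => √(G y).det) :
    k 0 = 1 := by
  rw [hk.eq_of_nhds]
  simp [h.zero]

theorem IsGaussMetric.pderiv_cutoff (h : IsGaussMetric G) (hk : k =ᶠ[𝓝 0] fun y => √(G y).det)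
    (i : Fin n) : pderiv i k 0 = 0 := by
  rw [(pderiv_congr hk i).eq_of_nhds, h.pderiv_density_zero]

theorem IsGaussMetric.pderiv_pderiv_cutoff (h : IsGaussMetric G)
    (hk : k =ᶠ[𝓝 0] fun y => √(G y).det)
    (i j : Fin n) :
    pderiv i (pderiv j k) 0 = -(1 / 3) * ricci G i j 0 := by
  rw [(pderiv_congr (pderiv_congr hk j) i).eq_of_nhds, h.pderiv_pderiv_density_zero]

theorem IsGaussMetric.flatLaplacian_cutoff (h : IsGaussMetric G)
    (hk : k =ᶠ[𝓝 0] fun y => √(G y).det) :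
    flatLaplacian k 0 = -(1 / 3) * scalar G 0 := by
  simp only [flatLaplacian, h.pderiv_pderiv_cutoff hk, h.scalar_zero, Finset.mul_sum]

theorem IsGaussMetric.bilaplacian_cutoff (h : IsGaussMetric G)
    (hk : k =ᶠ[𝓝 0] fun y => √(G y).det) :
    flatLaplacian (flatLaplacian k) 0 =
    2 / 5 * (-laplace G (scalar G) 0 + 5 / 18 * scalar G 0 ^ 2 - 1 / 6 * riemannNormSq G 0 +
      4 / 9 * ∑ i, ∑ j, ricci G i j 0 ^ 2) := by
  rw [(flatLaplacian_congr (flatLaplacian_congr hk)).eq_of_nhds, h.bilaplacian_density_zero]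

end

end CoordMetric

/-! ### Peano expansions and their derivatives -/

namespace CoordMetric

noncomputable section

open GaussianAverage

variable {n : ℕ}

/-- A function that is `o(|y|²)` and twice differentiable at the origin has derivative `o(|y|)`. -/
theorem fderiv_isLittleO_of_isLittleO_sq {f : Coord n → ℝ}
    (hf : ∀ᶠ y in 𝓝 0, DifferentiableAt ℝ f y) (hf' : DifferentiableAt ℝ (fderiv ℝ f) 0)
    (ho : f =o[𝓝 0] fun y => ‖y‖ ^ 2) : fderiv ℝ f =o[𝓝 0] fun y => y := by
  have hf0 : f 0 = 0 := by
    have := ho.isBigO.eq_zero_imp.self_of_nhds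
    simpa using this
  have h0 : fderiv ℝ f 0 = 0 := by
    have : HasFDerivAt f (0 : Coord n →L[ℝ] ℝ) 0 := by
      refine HasFDerivAt.of_isLittleO ?_
      simp only [hf0, sub_zero, zero_apply]
      refine ho.trans_isBigO ?_
      have h1 : (fun y : Coord n => ‖y‖ * ‖y‖) =O[𝓝 0] fun y => 1 * ‖y‖ := by
        refine IsBigO.mul ?_ (isBigO_refl _ _)
        exact (continuous_norm.tendsto (0 : Coord n)).isBigO_one ℝ
      refine (h1.congr_left fun y => (sq _).symm).trans ?_
      simpa using (isBigO_refl (fun y : Coord n => y) (𝓝 0)).norm_left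
    exact this.fderiv
  set B := fderiv ℝ (fderiv ℝ f) 0 with hB
  have hBd : HasFDerivAt (fderiv ℝ f) B 0 := hf'.hasFDerivAt
  have hsymm : ∀ v w, B v w = B w v := fun v w =>
    second_derivative_symmetric_of_eventually (f := f) (hf.mono fun y hy => hy.hasFDerivAt) hBd v w
  -- L'Hôpital's rule for `f(s v) / s²` gives the limit `B(v, v) / 2`, which is zero because `f =
  -- o(|y|²)`. Symmetry of the second derivative and polarization then give `B = 0`.
  have hdiag : ∀ v, B v v = 0 := by
    intro v
    have hray : Tendsto (fun s : ℝ => s • v) (𝓝[>] 0) (𝓝 0) := by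
      have : Continuous fun s : ℝ => s • v := by fun_prop
      exact (by simpa using this.tendsto 0 : Tendsto (fun s : ℝ => s • v) (𝓝 0) (𝓝 0)).mono_left
        nhdsWithin_le_nhds
    have hd : ∀ᶠ s in 𝓝[>] (0 : ℝ), HasDerivAt (fun s : ℝ => f (s • v))
        (fderiv ℝ f (s • v) v) s := by
      filter_upwards [hray.eventually hf] with s hs
      have h1 : HasDerivAt (fun r : ℝ => r • v) v s := by
        simpa using (hasDerivAt_id s).smul_const v
      exact hs.hasFDerivAt.comp_hasDerivAt s h1
    have hg : ∀ᶠ s in 𝓝[>] (0 : ℝ), HasDerivAt (fun s : ℝ => s ^ 2) (2 * s) s :=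
      Eventually.of_forall fun s => by simpa using hasDerivAt_pow 2 s
    have hg0 : ∀ᶠ s in 𝓝[>] (0 : ℝ), 2 * s ≠ 0 := by
      filter_upwards [self_mem_nhdsWithin] with s hs
      have : (0 : ℝ) < s := hs
      positivity
    have hlim0 : Tendsto (fun s : ℝ => f (s • v)) (𝓝[>] 0) (𝓝 0) := by
      have := hf.self_of_nhds.continuousAt.tendsto.comp hray
      rwa [hf0] at this
    have hlim1 : Tendsto (fun s : ℝ => s ^ 2) (𝓝[>] 0) (𝓝 0) := by
      have : Continuous fun s : ℝ => s ^ 2 := by fun_prop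
      exact (by simpa using this.tendsto 0 : Tendsto (fun s : ℝ => s ^ 2) (𝓝 0) (𝓝 0)).mono_left
        nhdsWithin_le_nhds
    have hline : HasDerivAt (fun s : ℝ => fderiv ℝ f (s • v) v) (B v v) 0 := by
      have h1 := hasDerivAt_line_of_differentiableAt hf' v
      have h2 := h1.clm_apply (hasDerivAt_const (0 : ℝ) v)
      simpa using h2
    have hslope : Tendsto (fun s : ℝ => fderiv ℝ f (s • v) v / (2 * s)) (𝓝[>] 0)
        (𝓝 (B v v / 2)) := by
      have h1 := hline.tendsto_slope_zero_right
      simp only [zero_add, zero_smul, h0, zero_apply, sub_zero,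
        smul_eq_mul] at h1
      refine (h1.div_const 2).congr fun s => ?_
      field_simp
    have h2 := HasDerivAt.lhopital_zero_nhdsGT hd hg hg0 hlim0 hlim1 hslope
    have h3 : Tendsto (fun s : ℝ => f (s • v) / s ^ 2) (𝓝[>] 0) (𝓝 0) := by
      have h4 := ho.comp_tendsto hray
      have h5 : (fun s : ℝ => f (s • v)) =o[𝓝[>] 0] fun s => s ^ 2 := by
        refine h4.trans_isBigO (IsBigO.of_bound (‖v‖ ^ 2) (Eventually.of_forall fun s => ?_))
        simp only [Function.comp_apply, norm_smul, mul_pow, norm_mul, norm_pow, norm_norm]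
        rw [mul_comm]
      exact h5.tendsto_div_nhds_zero
    have := tendsto_nhds_unique h2 h3
    linarith
  have hB0 : B = 0 := by
    ext v w
    have h1 := hdiag (v + w)
    simp only [map_add, add_apply, hdiag] at h1
    have h2 := hsymm v w
    simp only [zero_apply]
    linarith
  have h1 := hBd.isLittleO
  rw [hB0, h0] at h1
  simpa using h1

theorem TimesDifferentiableAt.eventually_differentiableAt {m : ℕ} {f : Coord n → ℝ} {y : Coord n}
    (h : TimesDifferentiableAt m f y) (hm : 1 < m) : ∀ᶠ z in 𝓝 y, DifferentiableAt ℝ f z := by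
  filter_upwards [h.1 0 (by omega)] with z hz
  rw [iteratedFDeriv_zero_eq_comp] at hz
  exact (LinearIsometryEquiv.comp_differentiableAt_iff _).1 hz

theorem TimesDifferentiableAt.differentiableAt_fderiv {m : ℕ} {f : Coord n → ℝ} {y : Coord n}
    (h : TimesDifferentiableAt m f y) (hm : 1 < m) : DifferentiableAt ℝ (fderiv ℝ f) y := by
  have h1 := h.2 1 hm
  have h2 : fderiv ℝ f = continuousMultilinearCurryFin1 ℝ (Coord n) ℝ ∘ iteratedFDeriv ℝ 1 f := by
    ext z v
    simp
  rw [h2]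
  exact (LinearIsometryEquiv.comp_differentiableAt_iff _).2 h1

theorem TimesDifferentiableAt.continuousAt {m : ℕ} {f : Coord n → ℝ} {y : Coord n}
    (h : TimesDifferentiableAt m f y) (hm : 1 < m) : ContinuousAt f y :=
  (h.eventually_differentiableAt hm).self_of_nhds.continuousAt

theorem norm_le_sum_apply (L : Coord n →L[ℝ] ℝ) :
    ‖L‖ ≤ ∑ i, |L (EuclideanSpace.single i 1)| := by
  refine L.opNorm_le_bound (Finset.sum_nonneg fun i _ => abs_nonneg _) fun v => ?_
  have h1 : L v = ∑ i, v i * L (EuclideanSpace.single i 1) := by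
    have : v = ∑ i, v i • EuclideanSpace.single i (1 : ℝ) := by
      simpa using ((EuclideanSpace.basisFun (Fin n) ℝ).sum_repr v).symm
    conv_lhs => rw [this]
    simp
  rw [h1, Finset.sum_mul]
  refine (Finset.abs_sum_le_sum_abs _ _).trans (Finset.sum_le_sum fun i _ => ?_)
  rw [abs_mul, mul_comm]
  exact mul_le_mul_of_nonneg_left (PiLp.norm_apply_le v i) (abs_nonneg _)

/-- If `φ = 1 + a(y, y) + o(|y|²)` is twice differentiable at the origin, then
`∂_i φ = 2 (a y)_i + o(|y|)`. -/
theorem pderiv_expansion {f : Coord n → ℝ} {a : Matrix (Fin n) (Fin n) ℝ} (ha : a.IsSymm)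
    (hf : ∀ᶠ y in 𝓝 0, DifferentiableAt ℝ f y) (hf' : DifferentiableAt ℝ (fderiv ℝ f) 0)
    (ho : (fun y => f y - (1 + quadForm a y)) =o[𝓝 0] fun y => ‖y‖ ^ 2) (i : Fin n) :
    (fun y => pderiv i f y - 2 * ∑ j, a i j * y j) =o[𝓝 0] fun y => y := by
  have hq : ContDiff ℝ ∞ fun y => 1 + quadForm a y := contDiff_const.add (contDiff_quadForm a)
  have hqd : Differentiable ℝ fun y => 1 + quadForm a y := hq.differentiable (by simp)
  have heq : ∀ᶠ y in 𝓝 (0 : Coord n), fderiv ℝ (fun y => f y - (1 + quadForm a y)) y =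
      fderiv ℝ f y - fderiv ℝ (fun y => 1 + quadForm a y) y :=
    hf.mono fun y hy => fderiv_fun_sub hy (hqd y)
  have h1 := fderiv_isLittleO_of_isLittleO_sq
    (f := fun y => f y - (1 + quadForm a y)) (hf.mono fun y hy => hy.sub (hqd y))
    ((hf'.sub ((hq.fderiv_right (m := ∞) (by simp)).differentiable (by simp) 0)).congr_of_eventuallyEq
      heq) ho
  refine (IsBigO.of_bound 1 ?_).trans_isLittleO h1
  filter_upwards [heq] with y hy
  rw [one_mul, hy]
  have h2 : pderiv i f y - 2 * ∑ j, a i j * y j =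
      (fderiv ℝ f y - fderiv ℝ (fun y => 1 + quadForm a y) y) (EuclideanSpace.single i 1) := by
    have h3 : fderiv ℝ (fun y => 1 + quadForm a y) y (EuclideanSpace.single i 1) =
        ∑ j, (a i j + a j i) * y j := by
      rw [← pderiv_quadForm, fderiv_const_add, pderiv]
    rw [sub_apply, h3, pderiv, Finset.mul_sum]
    congr 1
    refine Finset.sum_congr rfl fun j _ => ?_
    rw [ha.apply i j]
    ring
  rw [h2]
  refine (ContinuousLinearMap.le_opNorm _ _).trans ?_
  simp

end

end CoordMetric

/-! ### Gaussian tails and the gradient of the test function away from `p` -/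

namespace Riem

noncomputable section

open CoordMetric GaussianAverage

/-- The Gaussian `e^{-d²/(8t)}` is Lipschitz as a function of `d`. -/
theorem abs_exp_sub_exp_le {t δ D a b : ℝ} (ht : 0 < t) (hδ : 0 ≤ δ) (ha : δ ≤ a) (hb : δ ≤ b)
    (haD : a ≤ D) (hbD : b ≤ D) :
    |Real.exp (-(a ^ 2 / (8 * t))) - Real.exp (-(b ^ 2 / (8 * t)))| ≤
      Real.exp (-(δ ^ 2 / (8 * t))) * (D / (4 * t)) * |a - b| := by
  wlog hab : a ≤ b generalizing a b
  · rw [abs_sub_comm, abs_sub_comm a b]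
    exact this hb ha hbD haD (le_of_not_ge hab)
  have h1 : Real.exp (-(b ^ 2 / (8 * t))) ≤ Real.exp (-(a ^ 2 / (8 * t))) := by
    apply Real.exp_le_exp.2
    have : a ^ 2 ≤ b ^ 2 := pow_le_pow_left₀ (hδ.trans ha) hab 2
    gcongr
  have h2 : 1 - (b ^ 2 - a ^ 2) / (8 * t) ≤ Real.exp (-((b ^ 2 - a ^ 2) / (8 * t))) := by
    have := Real.add_one_le_exp (-((b ^ 2 - a ^ 2) / (8 * t)))
    linarith
  have h3 : Real.exp (-(b ^ 2 / (8 * t))) =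
      Real.exp (-(a ^ 2 / (8 * t))) * Real.exp (-((b ^ 2 - a ^ 2) / (8 * t))) := by
    rw [← Real.exp_add]
    congr 1
    ring
  have h4 : Real.exp (-(a ^ 2 / (8 * t))) ≤ Real.exp (-(δ ^ 2 / (8 * t))) := by
    apply Real.exp_le_exp.2
    have : δ ^ 2 ≤ a ^ 2 := pow_le_pow_left₀ hδ ha 2
    gcongr
  have h5 : (b ^ 2 - a ^ 2) / (8 * t) ≤ D / (4 * t) * (b - a) := by
    rw [div_mul_eq_mul_div, div_le_div_iff₀ (by positivity) (by positivity)]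
    have h6 : b ^ 2 - a ^ 2 ≤ 2 * (D * (b - a)) := by nlinarith
    nlinarith
  rw [abs_of_nonneg (sub_nonneg.2 h1), abs_sub_comm, abs_of_nonneg (sub_nonneg.2 hab), h3,
    mul_assoc]
  calc _ = Real.exp (-(a ^ 2 / (8 * t))) * (1 - Real.exp (-((b ^ 2 - a ^ 2) / (8 * t)))) := by ring
    _ ≤ Real.exp (-(a ^ 2 / (8 * t))) * (D / (4 * t) * (b - a)) := by gcongr; linarith
    _ ≤ _ := by
        refine mul_le_mul_of_nonneg_right h4 ?_
        have : 0 ≤ D := (hδ.trans ha).trans haD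
        have : 0 ≤ b - a := sub_nonneg.2 hab
        positivity

/-- A Gaussian tail. -/
def tail (n : ℕ) (c t : ℝ) : ℝ :=
  (4 * Real.pi * t) ^ (-(n : ℝ) / 2) * Real.exp (-(c / t)) * (1 + 1 / t) ^ 2

theorem tail_nonneg (n : ℕ) (c : ℝ) {t : ℝ} (ht : 0 < t) : 0 ≤ tail n c t := by
  unfold tail
  positivity

/-- For small `t` the prefactors are at most `4 t ^ (-(n + 2))`, and the exponential absorbs them
together with any `t ^ (-m)`. The square of `1 + 1 / t` in the tail leaves room for the powers of `1
/ t` in the squared gradient and in the logarithm of the Gaussian. -/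
theorem tail_isLittleO (n : ℕ) {c : ℝ} (hc : 0 < c) (m : ℕ) :
    tail n c =o[𝓝[>] 0] fun t => t ^ m := by
  have h1 : Tendsto (fun t : ℝ => c * t⁻¹) (𝓝[>] 0) atTop :=
    tendsto_inv_nhdsGT_zero.const_mul_atTop hc
  have h2 := (Real.tendsto_pow_mul_exp_neg_atTop_nhds_zero (n + 2 + m)).comp h1
  have h3 : (fun t : ℝ => (t⁻¹) ^ (n + 2 + m) * Real.exp (-(c / t))) =o[𝓝[>] 0]
      fun _ => (1 : ℝ) := by
    rw [isLittleO_one_iff]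
    have h4 := h2.const_mul ((c ^ (n + 2 + m))⁻¹)
    rw [mul_zero] at h4
    refine h4.congr fun t => ?_
    simp only [Function.comp_apply, mul_pow]
    have : c ^ (n + 2 + m) ≠ 0 := by positivity
    field_simp
  have h5 := h3.mul_isBigO (isBigO_refl (fun t : ℝ => t ^ m) (𝓝[>] 0))
  refine (IsBigO.of_bound 4 ?_).trans_isLittleO (h5.congr_right fun t => one_mul _)
  have ht1 : ∀ᶠ t in 𝓝[>] (0 : ℝ), t < 1 :=
    eventually_nhdsWithin_of_eventually_nhds (gt_mem_nhds one_pos)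
  filter_upwards [ht1, self_mem_nhdsWithin] with t ht1 ht
  have ht : 0 < t := ht
  rw [Real.norm_of_nonneg (tail_nonneg n c ht), Real.norm_of_nonneg (by positivity)]
  have hinv : 1 ≤ t⁻¹ := (one_le_inv₀ ht).2 ht1.le
  have h6 : (4 * Real.pi * t) ^ (-(n : ℝ) / 2) ≤ (t⁻¹) ^ n := by
    have h7 : (4 * Real.pi * t) ^ (-(n : ℝ) / 2) ≤ t ^ (-(n : ℝ) / 2) := by
      refine Real.rpow_le_rpow_of_nonpos ht ?_ ?_
      · nlinarith [Real.pi_gt_three]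
      · have : (0 : ℝ) ≤ n := n.cast_nonneg
        linarith
    refine h7.trans ?_
    rw [← Real.rpow_natCast, Real.inv_rpow ht.le, ← Real.rpow_neg ht.le]
    refine Real.rpow_le_rpow_of_exponent_ge ht ht1.le ?_
    have : (0 : ℝ) ≤ n := n.cast_nonneg
    linarith
  have h8 : (1 + 1 / t) ^ 2 ≤ 4 * (t⁻¹) ^ 2 := by
    rw [one_div]
    nlinarith
  have h9 : (t⁻¹) ^ (n + 2 + m) * t ^ m = (t⁻¹) ^ n * (t⁻¹) ^ 2 := by
    rw [pow_add, pow_add, mul_assoc, ← mul_pow, inv_mul_cancel₀ ht.ne', one_pow, mul_one]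
  calc tail n c t ≤ (t⁻¹) ^ n * Real.exp (-(c / t)) * (4 * (t⁻¹) ^ 2) := by
        unfold tail
        gcongr
    _ = 4 * ((t⁻¹) ^ n * (t⁻¹) ^ 2 * Real.exp (-(c / t))) := by ring
    _ = _ := by rw [← h9]; ring

variable {n : ℕ} {M : Type*} [MetricSpace M] {p : M} {η : M → ℝ → ℝ}

/-- The Gaussian `(4πt)^{-n/2} e^{-d(p,x)²/(4t)}`. -/
def gaussian (n : ℕ) (p : M) (t : ℝ) (x : M) : ℝ :=
  (4 * Real.pi * t) ^ (-(n : ℝ) / 2) * Real.exp (-(dist p x ^ 2 / (4 * t)))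

theorem gaussian_pos {t : ℝ} (ht : 0 < t) (x : M) : 0 < gaussian n p t x := by
  unfold gaussian
  positivity

theorem testFunction_sq {t : ℝ} (ht : 0 < t) (x : M) :
    testFunction n p η t x ^ 2 = gaussian n p t x * η x t ^ 2 := by
  have h1 : ((4 * Real.pi * t) ^ (-(n : ℝ) / 4)) ^ 2 = (4 * Real.pi * t) ^ (-(n : ℝ) / 2) := by
    rw [← Real.rpow_natCast, ← Real.rpow_mul (by positivity)]
    congr 1
    push_cast
    ring
  have h2 : Real.exp (-(dist p x ^ 2 / (8 * t))) ^ 2 = Real.exp (-(dist p x ^ 2 / (4 * t))) := by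
    rw [← Real.exp_nat_mul]
    congr 1
    push_cast
    field_simp
    ring
  rw [testFunction, gaussian, mul_pow, mul_pow, h1, h2]

theorem log_gaussian {t : ℝ} (ht : 0 < t) (x : M) : Real.log (gaussian n p t x) =
    -(n : ℝ) / 2 * Real.log (4 * Real.pi * t) - dist p x ^ 2 / (4 * t) := by
  rw [gaussian, Real.log_mul (by positivity) (by positivity), Real.log_exp,
    Real.log_rpow (by positivity)]
  ring

/-- The logarithm of the Gaussian contributes `-(n/2) log (4πt)`, removed by the added term, and
`-d²/(4t)`. Where `η` vanishes both sides are zero. -/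
theorem entropy_density {t : ℝ} (ht : 0 < t) (x : M) :
    testFunction n p η t x ^ 2 * Real.log (testFunction n p η t x ^ 2) +
      n / 2 * Real.log (4 * Real.pi * t) * testFunction n p η t x ^ 2 =
    gaussian n p t x * (η x t ^ 2 * Real.log (η x t ^ 2) -
      dist p x ^ 2 / (4 * t) * η x t ^ 2) := by
  rw [testFunction_sq ht]
  rcases eq_or_ne (η x t ^ 2) 0 with h0 | h0
  · rw [h0]
    simp
  · rw [Real.log_mul (gaussian_pos ht x).ne' h0, log_gaussian ht]
    ring

theorem gaussian_le {t δ : ℝ} (ht : 0 < t) (hδ : 0 ≤ δ) {x : M} (hx : δ ≤ dist p x) :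
    gaussian n p t x ≤ (4 * Real.pi * t) ^ (-(n : ℝ) / 2) * Real.exp (-(δ ^ 2 / (4 * t))) := by
  unfold gaussian
  gcongr

theorem continuous_testFunction {t : ℝ} (hη : Continuous fun x => η x t) :
    Continuous (testFunction n p η t) := by
  unfold testFunction
  fun_prop

variable [ChartedSpace (Coord n) M]
  [RiemannianBundle (fun x : M => TangentSpace (𝓡 n) x)] [IsManifold (𝓡 n) ∞ M]

theorem gradNorm_eq_zero_of_eventuallyEq {f : M → ℝ} {x : M} (h : f =ᶠ[𝓝 x] fun _ => 0) :
    gradNorm n f x = 0 := by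
  have h1 : differential n f x = 0 := by
    rw [differential, h.mfderiv_eq]
    exact mfderiv_const
  rw [gradNorm, h1]
  exact norm_zero (E := TangentSpace (𝓡 n) x →L[ℝ] ℝ)

theorem gradNorm_eq_zero_of_not_mdifferentiableAt {f : M → ℝ} {x : M}
    (h : ¬MDifferentiableAt (𝓡 n) 𝓘(ℝ, ℝ) f x) : gradNorm n f x = 0 := by
  have h1 : differential n f x = 0 := mfderiv_zero_of_not_mdifferentiableAt h
  rw [gradNorm, h1]
  exact norm_zero (E := TangentSpace (𝓡 n) x →L[ℝ] ℝ)

variable [IsRiemannianManifold (𝓡 n) M]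
  [IsContMDiffRiemannianBundle (𝓡 n) ∞ (Coord n) (fun x : M => TangentSpace (𝓡 n) x)]

/-- The gradient of the test function. -/
theorem gradNorm_testFunction_le {t C δ D : ℝ} (ht : 0 < t) (hδ : 0 ≤ δ) {x : M}
    (hη : MDifferentiableAt (𝓡 n) 𝓘(ℝ, ℝ) (fun x => η x t) x) (hC : ∀ z, |η z t| ≤ C)
    (hC' : gradNorm n (fun z => η z t) x ≤ C) (hnear : ∀ᶠ z in 𝓝 x, δ ≤ dist p z)
    (hfar : ∀ᶠ z in 𝓝 x, dist p z ≤ D) :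
    gradNorm n (testFunction n p η t) x ≤ (4 * Real.pi * t) ^ (-(n : ℝ) / 4) *
      Real.exp (-(δ ^ 2 / (8 * t))) * C * (D / (4 * t) + 1) := by
  have hC0 : 0 ≤ C := (abs_nonneg _).trans (hC x)
  have hD0 : 0 ≤ D := dist_nonneg.trans hfar.self_of_nhds
  set c := (4 * Real.pi * t) ^ (-(n : ℝ) / 4) with hc
  have hc0 : 0 ≤ c := by positivity
  -- Far from `p` the distance, and with it the test function, need not be differentiable; at such
  -- points the gradient is zero by convention.
  by_cases hu : MDifferentiableAt (𝓡 n) 𝓘(ℝ, ℝ) (testFunction n p η t) x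
  swap
  · rw [gradNorm_eq_zero_of_not_mdifferentiableAt hu]
    positivity
  set F : M → ℝ := fun z => Real.exp (-(dist p z ^ 2 / (8 * t))) with hF
  set b := c * F x with hb
  have hb0 : 0 ≤ b := by positivity
  -- Subtract `η` times the Gaussian frozen at `x`. The increments of `w` from `x` are `η` times
  -- increments of the Gaussian, so `w` has a Lipschitz bound at `x`, and its differential is
  -- controlled without differentiating the distance.
  set w : M → ℝ := fun z => testFunction n p η t z - b * η z t with hw
  have hηb : MDifferentiableAt (𝓡 n) 𝓘(ℝ, ℝ) (fun z => b * η z t) x := by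
    have := hη.const_smul b
    exact this
  have hwd : MDifferentiableAt (𝓡 n) 𝓘(ℝ, ℝ) w x := hu.sub hηb
  have hFx : F x ≤ Real.exp (-(δ ^ 2 / (8 * t))) := by
    apply Real.exp_le_exp.2
    have : δ ^ 2 ≤ dist p x ^ 2 := pow_le_pow_left₀ hδ hnear.self_of_nhds 2
    gcongr
  have hw' : ‖differential n w x‖ ≤
      c * (Real.exp (-(δ ^ 2 / (8 * t))) * (D / (4 * t))) * C := by
    refine norm_differential_le hwd (by positivity) ?_
    filter_upwards [hnear, hfar] with z h1 h2
    have h3 := abs_exp_sub_exp_le ht hδ h1 hnear.self_of_nhds h2 hfar.self_of_nhds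
    have h4 : |dist p z - dist p x| ≤ dist x z := by
      rw [dist_comm p z, dist_comm p x, dist_comm x z]
      exact abs_dist_sub_le z x p
    have h5 : w z - w x = c * (F z - F x) * η z t := by
      simp only [hw, hb, hF, testFunction, ← hc]
      ring
    rw [h5, abs_mul, abs_mul, abs_of_nonneg hc0]
    calc _ ≤ c * (Real.exp (-(δ ^ 2 / (8 * t))) * (D / (4 * t)) * dist x z) * C := by
          have h6 : |F z - F x| ≤ Real.exp (-(δ ^ 2 / (8 * t))) * (D / (4 * t)) * dist x z :=
            h3.trans (mul_le_mul_of_nonneg_left h4 (by positivity))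
          gcongr
          exact hC z
      _ = _ := by ring
  have hsplit : differential n (testFunction n p η t) x =
      differential n w x + b • differential n (fun z => η z t) x := by
    have h1 : HasMFDerivAt (𝓡 n) 𝓘(ℝ, ℝ) w x (differential n w x) := hwd.hasMFDerivAt
    have h2 : HasMFDerivAt (𝓡 n) 𝓘(ℝ, ℝ) (fun z => η z t) x (differential n (fun z => η z t) x) :=
      hη.hasMFDerivAt
    have h3 := (h1.add (h2.const_smul b)).mfderiv
    have h4 : w + b • (fun z => η z t) = testFunction n p η t := by
      ext z
      simp [hw]
    rw [h4] at h3
    exact h3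
  rw [gradNorm, hsplit]
  refine (norm_add_le (E := TangentSpace (𝓡 n) x →L[ℝ] ℝ) _ _).trans ?_
  have h6 : ‖b • differential n (fun z => η z t) x‖ ≤ b * C := by
    refine ContinuousLinearMap.opNorm_le_bound _ (by positivity) fun v => ?_
    have h7 := (differential n (fun z => η z t) x).le_opNorm v
    have h8 : ‖(b • differential n (fun z => η z t) x) v‖ =
        b * ‖differential n (fun z => η z t) x v‖ := by
      change ‖b * _‖ = _
      rw [norm_mul, Real.norm_of_nonneg hb0]
      rfl
    rw [h8, mul_assoc b C]
    refine mul_le_mul_of_nonneg_left (h7.trans ?_) hb0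
    exact mul_le_mul_of_nonneg_right hC' (norm_nonneg v)
  calc _ ≤ c * (Real.exp (-(δ ^ 2 / (8 * t))) * (D / (4 * t))) * C +
        c * Real.exp (-(δ ^ 2 / (8 * t))) * C := by
        refine add_le_add hw' (h6.trans ?_)
        rw [hb]
        gcongr
    _ = _ := by ring

end

end Riem

/-! ### Integrability and localization of the energy to a chart -/

namespace Riem

noncomputable section

open CoordMetric GaussianAverage

theorem integrable_of_bounded_on_compact {X : Type*} [TopologicalSpace X] [T2Space X]
    [MeasurableSpace X] [BorelSpace X] {μ : Measure X} [IsLocallyFiniteMeasure μ] {K : Set X}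
    (hK : IsCompact K) {f : X → ℝ} (hf : Measurable f) (hf0 : ∀ x, x ∉ K → f x = 0) {B : ℝ}
    (hB : ∀ x ∈ K, |f x| ≤ B) : Integrable f μ := by
  have h1 : IntegrableOn f K μ := Measure.integrableOn_of_bounded hK.measure_lt_top.ne
    hf.aestronglyMeasurable (M := B)
    ((ae_restrict_mem hK.isClosed.measurableSet).mono fun x hx => hB x hx)
  refine (integrableOn_iff_integrable_of_support_subset fun x hx => ?_).1 h1
  by_contra h
  exact hx (hf0 x h)

theorem gradNorm_nonneg {n : ℕ} {M : Type*} [TopologicalSpace M] [ChartedSpace (Coord n) M]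
    [RiemannianBundle (fun x : M => TangentSpace (𝓡 n) x)] [IsManifold (𝓡 n) ∞ M]
    (f : M → ℝ) (x : M) : 0 ≤ gradNorm n f x :=
  norm_nonneg (E := TangentSpace (𝓡 n) x →L[ℝ] ℝ) _

section Localization

variable {n : ℕ} {M : Type*} [TopologicalSpace M] [T2Space M] [ChartedSpace (Coord n) M]
  [RiemannianBundle (fun x : M => TangentSpace (𝓡 n) x)] [IsManifold (𝓡 n) ∞ M]
  {e : OpenPartialHomeomorph M (Coord n)} [MeasurableSpace M] [BorelSpace M]
  [IsContMDiffRiemannianBundle (𝓡 n) ∞ (Coord n) (fun x : M => TangentSpace (𝓡 n) x)]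

/-- An integral over `M` is approximated by a cut-off integral in a chart. -/
theorem abs_integral_sub_chart_le (he : e ∈ IsManifold.maximalAtlas (𝓡 n) ∞ M) {p : M}
    {K : Set M} (hK : IsCompact K) {f : M → ℝ} (hf : Measurable f)
    (hint : Integrable f (volumeMeasure n M)) (hf0 : ∀ x, x ∉ K → f x = 0)
    {χ : Coord n → ℝ} (hχ : Continuous χ) (hχ0 : ∀ y, 0 ≤ χ y) (hχ1 : ∀ y, χ y ≤ 1) {r ρ : ℝ}
    (hr : Metric.ball 0 r ⊆ e.target) (hχr : ∀ y, y ∉ Metric.ball 0 r → χ y = 0)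
    (hrp : ∀ y ∈ Metric.ball 0 r, e.symm y ∈ (chartAt (Coord n) p).source) (hρ : ρ ≤ r)
    (hχρ : ∀ y ∈ Metric.ball 0 ρ, χ y = 1) {ε : ℝ} (hε0 : 0 ≤ ε)
    (hε : ∀ x ∈ K, x ∉ e.symm '' Metric.ball 0 ρ → |f x| ≤ ε) :
    |(∫ x, f x ∂volumeMeasure n M) - ∫ y, χ y * density e y * f (e.symm y)| ≤
      ε * (volumeMeasure n M).real K := by
  classical
  have := volumeMeasure_isLocallyFinite (n := n) (M := M)
  set μ := volumeMeasure n M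
  set N := e.source ∩ e ⁻¹' Metric.ball 0 r with hN
  have hNo : IsOpen N := e.isOpen_inter_preimage Metric.isOpen_ball
  -- The cutoff `χ` transplanted to `M`. The difference of the two integrals is that of `(1 - w) f`
  -- over `K`, and `w = 1` on the image of the inner ball.
  set w : M → ℝ := N.piecewise (χ ∘ e) (fun _ => 0) with hw
  have hwm : Measurable w := by
    refine ContinuousOn.measurable_piecewise ?_ continuousOn_const hNo.measurableSet
    exact hχ.comp_continuousOn (e.continuousOn.mono inter_subset_left)
  have hw0 : ∀ x, 0 ≤ w x := fun x => by
    by_cases hx : x ∈ N <;> simp [hw, hx, hχ0]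
  have hw1 : ∀ x, w x ≤ 1 := fun x => by
    by_cases hx : x ∈ N <;> simp [hw, hx, hχ1]
  have hwf : Integrable (fun x => w x * f x) μ := by
    refine hint.bdd_mul hwm.aestronglyMeasurable (c := 1) (Eventually.of_forall fun x => ?_)
    rw [Real.norm_of_nonneg (hw0 x)]
    exact hw1 x
  have htar : e.target ∩ e.symm ⁻¹' N = Metric.ball 0 r := by
    ext y
    constructor
    · rintro ⟨hy, hyN⟩
      have := hyN.2
      rwa [mem_preimage, e.right_inv hy] at this
    · intro hy
      refine ⟨hr hy, e.map_target (hr hy), ?_⟩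
      rwa [mem_preimage, e.right_inv (hr hy)]
  have hmain : ∫ x, w x * f x ∂μ = ∫ y, χ y * density e y * f (e.symm y) := by
    have h1 : ∫ x in N, w x * f x ∂μ = ∫ x, w x * f x ∂μ :=
      setIntegral_eq_integral_of_forall_compl_eq_zero fun x hx => by simp [hw, hx]
    have hNp : N ⊆ (chartAt (Coord n) p).source := fun x hx => by
      have := hrp (e x) hx.2
      rwa [e.left_inv hx.1] at this
    rw [← h1, setIntegral_volumeMeasure he hNo.measurableSet inter_subset_left hNp
      (f := fun x => w x * f x) (hwm.mul hf),
      htar]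
    rw [← setIntegral_eq_integral_of_forall_compl_eq_zero (s := Metric.ball (0 : Coord n) r)
      (f := fun y => χ y * density e y * f (e.symm y))]
    · refine setIntegral_congr_fun measurableSet_ball fun y hy => ?_
      have hyN : e.symm y ∈ N := (htar.symm ▸ hy : y ∈ e.target ∩ e.symm ⁻¹' N).2
      simp only [hw, piecewise_eq_of_mem _ _ _ hyN, Function.comp_apply, e.right_inv (hr hy)]
      ring
    · intro y hy
      rw [hχr y hy]
      simp
  rw [← hmain, ← integral_sub hint hwf]
  have h2 : ∫ x in K, (f x - w x * f x) ∂μ = ∫ x, (f x - w x * f x) ∂μ :=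
    setIntegral_eq_integral_of_forall_compl_eq_zero fun x hx => by simp [hf0 x hx]
  rw [← h2, ← Real.norm_eq_abs]
  refine norm_setIntegral_le_of_norm_le_const hK.measure_lt_top fun x hx => ?_
  by_cases hxρ : x ∈ e.symm '' Metric.ball 0 ρ
  · obtain ⟨y, hy, rfl⟩ := hxρ
    have hyr : y ∈ Metric.ball 0 r := Metric.ball_subset_ball hρ hy
    have hyN : e.symm y ∈ N := (htar.symm ▸ hyr : y ∈ e.target ∩ e.symm ⁻¹' N).2
    have : w (e.symm y) = 1 := by
      simp only [hw, piecewise_eq_of_mem _ _ _ hyN, Function.comp_apply, e.right_inv (hr hyr),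
        hχρ y hy]
    rw [this]
    simpa using hε0
  · have h3 : f x - w x * f x = (1 - w x) * f x := by ring
    rw [h3, norm_mul, Real.norm_of_nonneg (sub_nonneg.2 (hw1 x)), Real.norm_eq_abs]
    calc _ ≤ 1 * ε := mul_le_mul (by linarith [hw0 x]) (hε x hx hxρ) (abs_nonneg _) zero_le_one
      _ = ε := one_mul _

end Localization

variable {n : ℕ} {M : Type*} [MetricSpace M] {p : M} {η : M → ℝ → ℝ}
  [ChartedSpace (Coord n) M]
  [RiemannianBundle (fun x : M => TangentSpace (𝓡 n) x)] [IsManifold (𝓡 n) ∞ M]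
  [IsRiemannianManifold (𝓡 n) M]
  [IsContMDiffRiemannianBundle (𝓡 n) ∞ (Coord n) (fun x : M => TangentSpace (𝓡 n) x)]

/-- The logarithmic Sobolev energy density of the test function. -/
def energyDensity (n : ℕ) {M : Type*} [MetricSpace M] [ChartedSpace (Coord n) M]
    [RiemannianBundle (fun x : M => TangentSpace (𝓡 n) x)] [IsManifold (𝓡 n) ∞ M]
    (p : M) (η : M → ℝ → ℝ) (t : ℝ) (x : M) : ℝ :=
  4 * t * gradNorm n (testFunction n p η t) x ^ 2 -
    (testFunction n p η t x ^ 2 * Real.log (testFunction n p η t x ^ 2) +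
      n / 2 * Real.log (4 * Real.pi * t) * testFunction n p η t x ^ 2) -
    n * testFunction n p η t x ^ 2

/-- A uniformly bounded family of differentiable functions with support in a compact set. -/
structure IsCutoff (n : ℕ) {M : Type*} [MetricSpace M] [ChartedSpace (Coord n) M]
    [RiemannianBundle (fun x : M => TangentSpace (𝓡 n) x)] [IsManifold (𝓡 n) ∞ M]
    (η : M → ℝ → ℝ) (T : ℝ) (K : Set M) (C : ℝ) : Prop where
  compact : IsCompact K
  zero : ∀ t ∈ Ioo 0 T, ∀ x, x ∉ K → η x t = 0
  diff : ∀ t ∈ Ioo 0 T, MDifferentiable (𝓡 n) 𝓘(ℝ, ℝ) fun x => η x t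
  bound : ∀ t ∈ Ioo 0 T, ∀ x, |η x t| ≤ C
  grad_bound : ∀ t ∈ Ioo 0 T, ∀ x, gradNorm n (fun y => η y t) x ≤ C

namespace IsCutoff

variable {T : ℝ} {K : Set M} {C : ℝ}

theorem continuous_testFunction (h : IsCutoff n η T K C) {t : ℝ} (ht : t ∈ Ioo 0 T) :
    Continuous (testFunction n p η t) :=
  Riem.continuous_testFunction (h.diff t ht).continuous

theorem testFunction_eq_zero (h : IsCutoff n η T K C) {t : ℝ} (ht : t ∈ Ioo 0 T) {x : M}
    (hx : x ∉ K) : testFunction n p η t x = 0 := by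
  rw [testFunction, h.zero t ht x hx, mul_zero]

theorem gradNorm_testFunction_eq_zero (h : IsCutoff n η T K C) {t : ℝ} (ht : t ∈ Ioo 0 T) {x : M}
    (hx : x ∉ K) : gradNorm n (testFunction n p η t) x = 0 :=
  gradNorm_eq_zero_of_eventuallyEq
    (eventually_of_mem (h.compact.isClosed.isOpen_compl.mem_nhds hx)
      fun _ hz => h.testFunction_eq_zero ht hz)

theorem energyDensity_eq_zero (h : IsCutoff n η T K C) {t : ℝ} (ht : t ∈ Ioo 0 T) {x : M}
    (hx : x ∉ K) : energyDensity n p η t x = 0 := by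
  simp [energyDensity, h.testFunction_eq_zero ht hx, h.gradNorm_testFunction_eq_zero ht hx]

theorem exists_dist_le (h : IsCutoff n η T K C) (p : M) :
    ∃ D : ℝ, 0 ≤ D ∧ ∀ x ∈ K, dist p x ≤ D := by
  obtain ⟨D, hD⟩ := h.compact.isBounded.subset_closedBall p
  refine ⟨max D 0, le_max_right _ _, fun x hx => ?_⟩
  have := hD hx
  rw [Metric.mem_closedBall, dist_comm] at this
  exact this.trans (le_max_left _ _)

/-- The gradient of the test function at a point at distance `≥ 2δ` from `p`. -/
theorem gradNorm_testFunction_le (h : IsCutoff n η T K C) {D : ℝ}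
    (hD : ∀ x ∈ K, dist p x ≤ D) {t : ℝ} (ht : t ∈ Ioo 0 T) {δ : ℝ} (hδ : 0 ≤ δ) {x : M}
    (hx : x ∈ K) (hδx : δ = 0 ∨ 2 * δ ≤ dist p x) :
    gradNorm n (testFunction n p η t) x ≤ (4 * Real.pi * t) ^ (-(n : ℝ) / 4) *
      Real.exp (-(δ ^ 2 / (8 * t))) * C * ((D + 1) / (4 * t) + 1) := by
  have hc : ContinuousAt (fun z => dist p z) x := by fun_prop
  refine Riem.gradNorm_testFunction_le ht.1 hδ (h.diff t ht x) (h.bound t ht)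
    (h.grad_bound t ht x) ?_ ?_
  · rcases hδ.eq_or_lt with h0 | h0
    · exact Eventually.of_forall fun z => h0 ▸ dist_nonneg
    · have h1 : δ < dist p x := by
        rcases hδx with h2 | h2 <;> linarith
      exact (hc.eventually (lt_mem_nhds h1)).mono fun _ hz => le_of_lt hz
  · exact (hc.eventually (gt_mem_nhds ((hD x hx).trans_lt (lt_add_one D)))).mono
      fun _ hz => le_of_lt hz

theorem nonneg (h : IsCutoff n η T K C) (p : M) {t : ℝ} (ht : t ∈ Ioo 0 T) : 0 ≤ C :=
  (abs_nonneg _).trans (h.bound t ht p)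

/-- Away from `p` all the integrands are dominated by a Gaussian tail. -/
theorem exists_tail_bound (h : IsCutoff n η T K C) (p : M) {δ : ℝ} (hδ : 0 ≤ δ) :
    ∃ A : ℝ, 0 ≤ A ∧ ∀ t ∈ Ioo 0 T, ∀ x ∈ K, δ ≤ dist p x →
      |testFunction n p η t x ^ 2| ≤ A * tail n (δ ^ 2 / 16) t ∧
      |scalarCurvature n x * testFunction n p η t x ^ 2| ≤ A * tail n (δ ^ 2 / 16) t ∧
      |energyDensity n p η t x| ≤ A * tail n (δ ^ 2 / 16) t := by
  obtain ⟨D, hD0, hD⟩ := h.exists_dist_le p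
  obtain ⟨S, hS⟩ := h.compact.exists_bound_of_continuousOn
    (continuous_scalarCurvature (n := n) (M := M)).continuousOn
  obtain ⟨B, hB⟩ := (isCompact_Icc (a := (0 : ℝ)) (b := C ^ 2)).exists_bound_of_continuousOn
    Real.continuous_mul_log.continuousOn
  have hS' : ∀ x ∈ K, |scalarCurvature n x| ≤ |S| := fun x hx => (hS x hx).trans (le_abs_self S)
  have hn : (0 : ℝ) ≤ n := n.cast_nonneg
  -- One summand each for the mass, the scalar curvature, the gradient, the entropy and the term `n
  -- u²`. All are nonnegative, so the sum serves the three bounds at once.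
  refine ⟨C ^ 2 + |S| * C ^ 2 + 4 * |T| * (C * (D + 1)) ^ 2 + (|B| + D ^ 2 * C ^ 2) + n * C ^ 2,
    by positivity, fun t ht x hx hδx => ?_⟩
  have ht0 : 0 < t := ht.1
  have hC0 := h.nonneg p ht
  set c := (4 * Real.pi * t) ^ (-(n : ℝ) / 2) with hc
  have hc0 : 0 ≤ c := by positivity
  set E := Real.exp (-(δ ^ 2 / 16 / t)) with hE
  have hE0 : 0 ≤ E := (Real.exp_pos _).le
  have hτ : tail n (δ ^ 2 / 16) t = c * E * (1 + 1 / t) ^ 2 := rfl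
  have ht1 : 0 ≤ 1 / t := by positivity
  have hgE : gaussian n p t x ≤ c * E := by
    refine (gaussian_le ht0 hδ hδx).trans (mul_le_mul_of_nonneg_left ?_ hc0)
    apply Real.exp_le_exp.2
    rw [div_div]
    have : δ ^ 2 / (16 * t) ≤ δ ^ 2 / (4 * t) := by
      gcongr
      norm_num
    linarith
  have hg0 := (gaussian_pos (n := n) (p := p) ht0 x).le
  have hcE : 0 ≤ c * E := by positivity
  have hcEτ : c * E ≤ tail n (δ ^ 2 / 16) t := by
    rw [hτ]
    exact le_mul_of_one_le_right hcE (by nlinarith)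
  have hτ0 : 0 ≤ tail n (δ ^ 2 / 16) t := hcE.trans hcEτ
  have hη2 : η x t ^ 2 ≤ C ^ 2 := sq_le_sq' (by linarith [neg_abs_le (η x t), h.bound t ht x])
    ((le_abs_self _).trans (h.bound t ht x))
  have hη0 : 0 ≤ η x t ^ 2 := sq_nonneg _
  have hu2 : testFunction n p η t x ^ 2 ≤ C ^ 2 * tail n (δ ^ 2 / 16) t := by
    rw [testFunction_sq ht0, mul_comm]
    exact mul_le_mul hη2 (hgE.trans hcEτ) hg0 (by positivity)
  have hu0 : 0 ≤ testFunction n p η t x ^ 2 := sq_nonneg _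
  have hgrad : 4 * t * gradNorm n (testFunction n p η t) x ^ 2 ≤
      4 * |T| * (C * (D + 1)) ^ 2 * tail n (δ ^ 2 / 16) t := by
    -- The gradient estimate needs a whole neighbourhood at positive distance from `p`, hence `δ /
    -- 2`. Squaring turns `(δ / 2)² / (8t)` into `δ² / (16t)`, the exponent of the tail.
    have h1 := h.gradNorm_testFunction_le hD ht (δ := δ / 2) (by positivity) hx
      (Or.inr (by linarith))
    have h0 : 0 ≤ gradNorm n (testFunction n p η t) x := gradNorm_nonneg _ _
    have h2 := pow_le_pow_left₀ h0 h1 2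
    have h3 : ((4 * Real.pi * t) ^ (-(n : ℝ) / 4)) ^ 2 = c := by
      rw [hc, ← Real.rpow_natCast, ← Real.rpow_mul (by positivity)]
      congr 1
      push_cast
      ring
    have h4 : Real.exp (-((δ / 2) ^ 2 / (8 * t))) ^ 2 = E := by
      rw [hE, ← Real.exp_nat_mul]
      congr 1
      push_cast
      field_simp
      ring
    rw [mul_pow, mul_pow, mul_pow, h3, h4] at h2
    have h5 : ((D + 1) / (4 * t) + 1) ^ 2 ≤ ((D + 1) * (1 + 1 / t)) ^ 2 := by
      refine pow_le_pow_left₀ (by positivity) ?_ 2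
      have : (D + 1) / (4 * t) ≤ (D + 1) * (1 / t) := by
        rw [mul_one_div]
        gcongr
        linarith
      nlinarith
    calc _ ≤ 4 * |T| * (c * E * C ^ 2 * ((D + 1) * (1 + 1 / t)) ^ 2) := by
          have : t ≤ |T| := ht.2.le.trans (le_abs_self T)
          gcongr
          exact h2.trans (mul_le_mul_of_nonneg_left h5 (by positivity))
      _ = _ := by rw [hτ]; ring
  have hent : |gaussian n p t x * (η x t ^ 2 * Real.log (η x t ^ 2) -
      dist p x ^ 2 / (4 * t) * η x t ^ 2)| ≤
      (|B| + D ^ 2 * C ^ 2) * tail n (δ ^ 2 / 16) t := by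
    rw [abs_mul, abs_of_nonneg hg0]
    have h1 : |η x t ^ 2 * Real.log (η x t ^ 2)| ≤ |B| :=
      (hB _ ⟨hη0, hη2⟩).trans (le_abs_self B)
    have h2 : dist p x ^ 2 / (4 * t) * η x t ^ 2 ≤ D ^ 2 * (1 / t) * C ^ 2 := by
      have h4 : dist p x ^ 2 / (4 * t) ≤ D ^ 2 * (1 / t) := by
        rw [mul_one_div]
        have := hD x hx
        gcongr
        linarith
      exact mul_le_mul h4 hη2 hη0 (by positivity)
    have h3 : 0 ≤ dist p x ^ 2 / (4 * t) * η x t ^ 2 := by positivity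
    calc _ ≤ c * E * (|B| + D ^ 2 * (1 / t) * C ^ 2) := by
          refine mul_le_mul hgE ((abs_sub _ _).trans ?_) (abs_nonneg _) hcE
          rw [abs_of_nonneg h3]
          exact add_le_add h1 h2
      _ ≤ c * E * ((|B| + D ^ 2 * C ^ 2) * (1 + 1 / t) ^ 2) := by
          refine mul_le_mul_of_nonneg_left ?_ hcE
          have h5 : 1 ≤ (1 + 1 / t) ^ 2 := by nlinarith
          have h6 : 1 / t ≤ (1 + 1 / t) ^ 2 := by nlinarith
          have h7 : 0 ≤ D ^ 2 * C ^ 2 := by positivity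
          nlinarith [abs_nonneg B, mul_le_mul_of_nonneg_left h6 h7,
            mul_le_mul_of_nonneg_left h5 (abs_nonneg B)]
      _ = _ := by rw [hτ]; ring
  set τ := tail n (δ ^ 2 / 16) t
  have e1 : 0 ≤ C ^ 2 * τ := by positivity
  have e2 : 0 ≤ |S| * C ^ 2 * τ := by positivity
  have e3 : 0 ≤ 4 * |T| * (C * (D + 1)) ^ 2 * τ := by positivity
  have e4 : 0 ≤ (|B| + D ^ 2 * C ^ 2) * τ := by positivity
  have e5 : 0 ≤ n * C ^ 2 * τ := by positivity
  refine ⟨?_, ?_, ?_⟩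
  · rw [abs_of_nonneg hu0]
    linarith
  · rw [abs_mul, abs_of_nonneg hu0]
    have := mul_le_mul (hS' x hx) hu2 hu0 (abs_nonneg S)
    linarith
  · rw [energyDensity, entropy_density ht0]
    have h0 : 0 ≤ 4 * t * gradNorm n (testFunction n p η t) x ^ 2 := by positivity
    have h1 := mul_le_mul_of_nonneg_left hu2 hn
    have h2 : 0 ≤ n * testFunction n p η t x ^ 2 := by positivity
    refine (abs_sub _ _).trans ((add_le_add_left (abs_sub _ _) _).trans ?_)
    rw [abs_of_nonneg h0, abs_of_nonneg h2]
    refine (add_le_add (add_le_add hgrad hent) h1).trans ?_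
    clear_value τ
    linarith only [e1, e2]

variable [SecondCountableTopology M] [MeasurableSpace M] [BorelSpace M]

theorem integrable_testFunction_sq (h : IsCutoff n η T K C) {t : ℝ} (ht : t ∈ Ioo 0 T) :
    Integrable (fun x => testFunction n p η t x ^ 2) (volumeMeasure n M) := by
  have := volumeMeasure_isLocallyFinite (n := n) (M := M)
  have hc : Continuous fun x => testFunction n p η t x ^ 2 := (h.continuous_testFunction ht).pow 2
  obtain ⟨B, hB⟩ := h.compact.exists_bound_of_continuousOn hc.continuousOn
  exact integrable_of_bounded_on_compact h.compact hc.measurable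
    (fun x hx => by simp [h.testFunction_eq_zero ht hx]) hB

theorem integrable_entropy (h : IsCutoff n η T K C) {t : ℝ} (ht : t ∈ Ioo 0 T) :
    Integrable (fun x => testFunction n p η t x ^ 2 * Real.log (testFunction n p η t x ^ 2))
      (volumeMeasure n M) := by
  have := volumeMeasure_isLocallyFinite (n := n) (M := M)
  have hc : Continuous fun x =>
      testFunction n p η t x ^ 2 * Real.log (testFunction n p η t x ^ 2) :=
    Real.continuous_mul_log.comp ((h.continuous_testFunction ht).pow 2)
  obtain ⟨B, hB⟩ := h.compact.exists_bound_of_continuousOn hc.continuousOn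
  exact integrable_of_bounded_on_compact h.compact hc.measurable
    (fun x hx => by simp [h.testFunction_eq_zero ht hx]) hB

theorem integrable_scalarCurvature (h : IsCutoff n η T K C) {t : ℝ} (ht : t ∈ Ioo 0 T) :
    Integrable (fun x => scalarCurvature n x * testFunction n p η t x ^ 2)
      (volumeMeasure n M) := by
  have := volumeMeasure_isLocallyFinite (n := n) (M := M)
  have hc : Continuous fun x => scalarCurvature n x * testFunction n p η t x ^ 2 :=
    continuous_scalarCurvature.mul ((h.continuous_testFunction ht).pow 2)
  obtain ⟨B, hB⟩ := h.compact.exists_bound_of_continuousOn hc.continuousOn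
  exact integrable_of_bounded_on_compact h.compact hc.measurable
    (fun x hx => by simp [h.testFunction_eq_zero ht hx]) hB

/-- The gradient need not be continuous, but it is measurable and, for fixed `t`, bounded on `K` by
the case `δ = 0` of the gradient estimate. -/
theorem integrable_gradNorm_sq (h : IsCutoff n η T K C) {t : ℝ} (ht : t ∈ Ioo 0 T) :
    Integrable (fun x => gradNorm n (testFunction n p η t) x ^ 2) (volumeMeasure n M) := by
  have := volumeMeasure_isLocallyFinite (n := n) (M := M)
  obtain ⟨D, hD0, hD⟩ := h.exists_dist_le p
  refine integrable_of_bounded_on_compact h.compact (measurable_gradNorm_sq _)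
    (fun x hx => by simp [h.gradNorm_testFunction_eq_zero ht hx])
    (B := ((4 * Real.pi * t) ^ (-(n : ℝ) / 4) * Real.exp (-(0 ^ 2 / (8 * t))) * C *
      ((D + 1) / (4 * t) + 1)) ^ 2) fun x hx => ?_
  rw [abs_of_nonneg (sq_nonneg _)]
  exact pow_le_pow_left₀ (gradNorm_nonneg _ _)
    (h.gradNorm_testFunction_le hD ht le_rfl hx (Or.inl rfl)) 2

theorem hasFiniteEnergy (h : IsCutoff n η T K C) (V : Set M) {t : ℝ} (ht : t ∈ Ioo 0 T) :
    HasFiniteEnergy n V (testFunction n p η t) where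
  grad := (h.integrable_gradNorm_sq ht).integrableOn
  entropy := (h.integrable_entropy ht).integrableOn
  mass := (h.integrable_testFunction_sq ht).integrableOn
  scalar := (h.integrable_scalarCurvature ht).integrableOn

theorem measurable_energyDensity (h : IsCutoff n η T K C) {t : ℝ} (ht : t ∈ Ioo 0 T) :
    Measurable (energyDensity n p η t) := by
  have h1 := (h.continuous_testFunction (p := p) ht).measurable
  have h2 := measurable_gradNorm_sq (n := n) (testFunction n p η t)
  unfold energyDensity
  fun_prop

theorem integrable_energyDensity (h : IsCutoff n η T K C) {t : ℝ} (ht : t ∈ Ioo 0 T) :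
    Integrable (energyDensity n p η t) (volumeMeasure n M) :=
  (((h.integrable_gradNorm_sq ht).const_mul (4 * t)).sub ((h.integrable_entropy ht).add
    ((h.integrable_testFunction_sq ht).const_mul _))).sub
    ((h.integrable_testFunction_sq ht).const_mul _)

/-- Since `u` and its gradient vanish off `K ⊆ V`, the set `V` plays no further role. The linear
combination of integrals becomes the total energy, and only the nonlinear term in the mass remains
outside. -/
theorem logSobolev_eq (h : IsCutoff n η T K C) {V : Set M} (hKV : K ⊆ V) {t : ℝ}
    (ht : t ∈ Ioo 0 T) : logSobolev n V (testFunction n p η t) t =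
      (∫ x, energyDensity n p η t x ∂volumeMeasure n M) +
        (∫ x, testFunction n p η t x ^ 2 ∂volumeMeasure n M) *
          Real.log (∫ x, testFunction n p η t x ^ 2 ∂volumeMeasure n M) := by
  have hKV' : ∀ x, x ∉ V → x ∉ K := fun x hx hxK => hx (hKV hxK)
  have h1 := h.integrable_gradNorm_sq (p := p) ht
  have h2 := h.integrable_entropy (p := p) ht
  have h3 := h.integrable_testFunction_sq (p := p) ht
  have h4 : Integrable (fun x =>
      testFunction n p η t x ^ 2 * Real.log (testFunction n p η t x ^ 2) +
        n / 2 * Real.log (4 * Real.pi * t) * testFunction n p η t x ^ 2) (volumeMeasure n M) :=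
    h2.add (h3.const_mul _)
  have h5 : Integrable (fun x => 4 * t * gradNorm n (testFunction n p η t) x ^ 2 -
      (testFunction n p η t x ^ 2 * Real.log (testFunction n p η t x ^ 2) +
        n / 2 * Real.log (4 * Real.pi * t) * testFunction n p η t x ^ 2)) (volumeMeasure n M) :=
    (h1.const_mul _).sub h4
  unfold energyDensity
  rw [integral_sub h5 (h3.const_mul _), integral_sub (h1.const_mul _) h4,
    integral_add h2 (h3.const_mul _),
    integral_const_mul, integral_const_mul, integral_const_mul, logSobolev,
    setIntegral_eq_integral_of_forall_compl_eq_zero fun x hx => by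
      simp [h.gradNorm_testFunction_eq_zero ht (hKV' x hx)],
    setIntegral_eq_integral_of_forall_compl_eq_zero fun x hx => by
      simp [h.testFunction_eq_zero ht (hKV' x hx)],
    setIntegral_eq_integral_of_forall_compl_eq_zero fun x hx => by
      simp [h.testFunction_eq_zero ht (hKV' x hx)]]
  ring

theorem perelmanW_eq (h : IsCutoff n η T K C) {V : Set M} (hKV : K ⊆ V) {t : ℝ}
    (ht : t ∈ Ioo 0 T) : perelmanW n V (testFunction n p η t) t =
      logSobolev n V (testFunction n p η t) t +
        t * ∫ x, scalarCurvature n x * testFunction n p η t x ^ 2 ∂volumeMeasure n M := by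
  have hKV' : ∀ x, x ∉ V → x ∉ K := fun x hx hxK => hx (hKV hxK)
  rw [perelmanW, setIntegral_eq_integral_of_forall_compl_eq_zero fun x hx => by
      simp [h.testFunction_eq_zero ht (hKV' x hx)]]

/-- The localization of the integrals of the test function to a chart at `p`. -/
theorem localization (h : IsCutoff n η T K C) {e : OpenPartialHomeomorph M (Coord n)}
    (he : IsNormalChart e p) (hT : 0 < T) {χ : Coord n → ℝ} (hχ : Continuous χ)
    (hχ0 : ∀ y, 0 ≤ χ y) (hχ1 : ∀ y, χ y ≤ 1) {r ρ : ℝ}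
    (hr : Metric.ball 0 r ⊆ e.target) (hχr : ∀ y, y ∉ Metric.ball 0 r → χ y = 0)
    (hrp : ∀ y ∈ Metric.ball 0 r, e.symm y ∈ (chartAt (Coord n) p).source) (hρ0 : 0 < ρ)
    (hρ : ρ ≤ r) (hχρ : ∀ y ∈ Metric.ball 0 ρ, χ y = 1) (m : ℕ) :
    ((fun t => (∫ x, testFunction n p η t x ^ 2 ∂volumeMeasure n M) -
      ∫ y, χ y * density e y * testFunction n p η t (e.symm y) ^ 2) =o[𝓝[>] 0] fun t => t ^ m) ∧
    ((fun t => (∫ x, scalarCurvature n x * testFunction n p η t x ^ 2 ∂volumeMeasure n M) -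
      ∫ y, χ y * density e y * (scalarCurvature n (e.symm y) * testFunction n p η t (e.symm y) ^ 2))
        =o[𝓝[>] 0] fun t => t ^ m) ∧
    ((fun t => (∫ x, energyDensity n p η t x ∂volumeMeasure n M) -
      ∫ y, χ y * density e y * energyDensity n p η t (e.symm y)) =o[𝓝[>] 0] fun t => t ^ m) := by
  have hmem : e.symm '' Metric.ball 0 ρ ∈ 𝓝 p := by
    have h1 := e.symm.image_mem_nhds (x := 0) he.zero_mem (Metric.ball_mem_nhds 0 hρ0)
    rwa [he.symm_zero] at h1
  obtain ⟨δ, hδ, hball⟩ := Metric.mem_nhds_iff.1 hmem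
  -- The image of the inner ball is a neighbourhood of `p`, so it contains a metric ball; all points
  -- outside the image are in the region of the tail estimate.
  have hfar : ∀ x, x ∉ e.symm '' Metric.ball 0 ρ → δ ≤ dist p x := fun x hx => by
    by_contra hlt
    refine hx (hball ?_)
    rw [Metric.mem_ball, dist_comm]
    exact not_le.1 hlt
  obtain ⟨A, hA0, hA⟩ := h.exists_tail_bound p hδ.le
  have key : ∀ f : ℝ → M → ℝ, (∀ t ∈ Ioo 0 T, Measurable (f t)) →
      (∀ t ∈ Ioo 0 T, Integrable (f t) (volumeMeasure n M)) →
      (∀ t ∈ Ioo 0 T, ∀ x, x ∉ K → f t x = 0) →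
      (∀ t ∈ Ioo 0 T, ∀ x ∈ K, δ ≤ dist p x → |f t x| ≤ A * tail n (δ ^ 2 / 16) t) →
      (fun t => (∫ x, f t x ∂volumeMeasure n M) - ∫ y, χ y * density e y * f t (e.symm y))
        =o[𝓝[>] 0] fun t => t ^ m := by
    intro f h1 h2 h3 h4
    refine (IsBigO.of_bound (A * (volumeMeasure n M).real K) ?_).trans_isLittleO
      (tail_isLittleO n (c := δ ^ 2 / 16) (by positivity) m)
    filter_upwards [Ioo_mem_nhdsGT hT] with t ht
    have hτ := tail_nonneg n (δ ^ 2 / 16) ht.1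
    rw [Real.norm_eq_abs, Real.norm_of_nonneg hτ]
    refine (abs_integral_sub_chart_le he.mem_maximalAtlas h.compact (h1 t ht) (h2 t ht) (h3 t ht)
      hχ hχ0 hχ1 hr hχr hrp hρ hχρ (mul_nonneg hA0 hτ)
      fun x hx hx' => h4 t ht x hx (hfar x hx')).trans (le_of_eq (by ring))
  refine ⟨key _ (fun t ht => ((h.continuous_testFunction ht).pow 2).measurable)
    (fun t ht => h.integrable_testFunction_sq ht)
    (fun t ht x hx => by simp [h.testFunction_eq_zero ht hx])
    fun t ht x hx hδx => (hA t ht x hx hδx).1,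
    key (fun t x => scalarCurvature n x * testFunction n p η t x ^ 2)
      (fun t ht => (continuous_scalarCurvature.mul
        ((h.continuous_testFunction ht).pow 2)).measurable)
      (fun t ht => h.integrable_scalarCurvature ht)
      (fun t ht x hx => by simp [h.testFunction_eq_zero ht hx])
      fun t ht x hx hδx => (hA t ht x hx hδx).2.1,
    key _ (fun t ht => h.measurable_energyDensity ht) (fun t ht => h.integrable_energyDensity ht)
      (fun t ht x hx => h.energyDensity_eq_zero ht hx)
      fun t ht x hx hδx => (hA t ht x hx hδx).2.2⟩

end IsCutoff

end

end Riem

/-! ### Parabolic scaling in `(y, t)` -/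

namespace GaussianAverage

noncomputable section

open CoordMetric

variable {n : ℕ}

theorem isBigO_norm_sqrt : (fun q : Coord n × ℝ => q.1) =O[𝓝 0 ×ˢ 𝓝[>] 0]
    fun q => √(‖q.1‖ ^ 2 + q.2) := by
  refine IsBigO.of_bound 1 (eventually_pos_snd.mono fun q hq => ?_)
  rw [Real.norm_of_nonneg (Real.sqrt_nonneg _), one_mul]
  exact Real.le_sqrt_of_sq_le (by linarith)

/-- With `y` of weight one and `t` of weight two, the `O(t)` error in the gradient hypothesis is
negligible at the scale `√(|y|² + t)` of a first derivative. -/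
theorem isLittleO_time_sqrt : (fun q : Coord n × ℝ => q.2) =o[𝓝 0 ×ˢ 𝓝[>] 0]
    fun q => √(‖q.1‖ ^ 2 + q.2) := by
  have h1 : (fun q : Coord n × ℝ => √q.2) =o[𝓝 0 ×ˢ 𝓝[>] 0] fun _ => (1 : ℝ) := by
    rw [isLittleO_one_iff]
    have h2 : Tendsto (fun t : ℝ => √t) (𝓝[>] 0) (𝓝 0) := by
      have := Real.continuous_sqrt.tendsto 0
      rw [Real.sqrt_zero] at this
      exact this.mono_left nhdsWithin_le_nhds
    exact h2.comp tendsto_snd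
  have h3 : (fun q : Coord n × ℝ => √q.2) =O[𝓝 0 ×ˢ 𝓝[>] 0] fun q => √(‖q.1‖ ^ 2 + q.2) := by
    refine IsBigO.of_bound 1 (eventually_pos_snd.mono fun q hq => ?_)
    rw [Real.norm_of_nonneg (Real.sqrt_nonneg _), Real.norm_of_nonneg (Real.sqrt_nonneg _), one_mul]
    exact Real.sqrt_le_sqrt (by nlinarith [sq_nonneg ‖q.1‖])
  refine (h1.mul_isBigO h3).congr' (eventually_pos_snd.mono fun q hq => ?_)
    (Eventually.of_forall fun q => one_mul _)
  exact Real.mul_self_sqrt hq.le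

theorem isLittleO_time_sq : (fun q : Coord n × ℝ => q.2 ^ 2) =o[𝓝 0 ×ˢ 𝓝[>] 0]
    fun q => ‖q.1‖ ^ 2 + q.2 := by
  have h1 : (fun q : Coord n × ℝ => q.2) =o[𝓝 0 ×ˢ 𝓝[>] 0] fun _ => (1 : ℝ) := by
    rw [isLittleO_one_iff]
    exact (tendsto_nhdsWithin_of_tendsto_nhds tendsto_id).comp tendsto_snd
  refine (h1.mul_isBigO isBigO_time).congr (fun q => (sq _).symm) fun q => one_mul _

theorem isBigO_norm_sq : (fun q : Coord n × ℝ => ‖q.1‖ ^ 2) =O[𝓝 0 ×ˢ 𝓝[>] 0]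
    fun q => ‖q.1‖ ^ 2 + q.2 := by
  refine IsBigO.of_bound 1 (eventually_pos_snd.mono fun q hq => ?_)
  rw [Real.norm_of_nonneg (by positivity), Real.norm_of_nonneg (by positivity)]
  linarith

theorem quadForm_mul_self {a : Matrix (Fin n) (Fin n) ℝ} (ha : a.IsSymm) (y : Coord n) :
    quadForm (a * a) y = ∑ i, (∑ j, a i j * y j) ^ 2 := by
  have h1 : ∀ k, (∑ j, a k j * y j) ^ 2 = ∑ i, ∑ j, a i k * a k j * y i * y j := fun k => by
    rw [sq, Finset.sum_mul_sum]
    refine Finset.sum_congr rfl fun i _ => Finset.sum_congr rfl fun j _ => ?_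
    rw [ha.apply k i]
    ring
  simp only [h1, quadForm, Matrix.mul_apply, Finset.sum_mul]
  rw [Finset.sum_comm]
  conv_lhs => enter [2, j]; rw [Finset.sum_comm]
  rw [Finset.sum_comm]
  refine Finset.sum_congr rfl fun k _ => ?_
  rw [Finset.sum_comm]

end

end GaussianAverage

/-! ### The hypotheses on `η` in normal coordinates -/

namespace Riem

noncomputable section

open CoordMetric GaussianAverage

variable {n : ℕ} {M : Type*} [MetricSpace M] [ChartedSpace (Coord n) M]
  [RiemannianBundle (fun x : M => TangentSpace (𝓡 n) x)] [IsManifold (𝓡 n) ∞ M]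
  {e : OpenPartialHomeomorph M (Coord n)} {p : M}

theorem norm_coordVector_sq (y : Coord n) (i : Fin n) : ‖coordVector e y i‖ ^ 2 = gram e y i i :=
  (real_inner_self_eq_norm_sq (coordVector e y i)).symm

theorem abs_functional_coordVector_le (y : Coord n) (i : Fin n)
    (l : TangentSpace (𝓡 n) (e.symm y) →L[ℝ] ℝ) :
    |l (coordVector e y i)| ≤ ‖l‖ * √(gram e y i i) := by
  rw [← norm_coordVector_sq, Real.sqrt_sq (norm_nonneg _)]
  exact l.le_opNorm _

theorem differential_coordVector (he : e ∈ IsManifold.maximalAtlas (𝓡 n) ∞ M) {y : Coord n}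
    (hy : y ∈ e.target) {f : M → ℝ} (hf : MDifferentiableAt (𝓡 n) 𝓘(ℝ, ℝ) f (e.symm y))
    (i : Fin n) : differential n f (e.symm y) (coordVector e y i) = pderiv i (f ∘ e.symm) y :=
  differential_dsymm he hy hf _

theorem abs_pderiv_le (he : e ∈ IsManifold.maximalAtlas (𝓡 n) ∞ M) {y : Coord n}
    (hy : y ∈ e.target) {f : M → ℝ} (hf : MDifferentiableAt (𝓡 n) 𝓘(ℝ, ℝ) f (e.symm y))
    (i : Fin n) : |pderiv i (f ∘ e.symm) y| ≤ gradNorm n f (e.symm y) * √(gram e y i i) := by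
  rw [← differential_coordVector he hy hf]
  exact abs_functional_coordVector_le y i _

theorem abs_pderiv_sub_le (he : e ∈ IsManifold.maximalAtlas (𝓡 n) ∞ M) {y : Coord n}
    (hy : y ∈ e.target) {f g : M → ℝ} (hf : MDifferentiableAt (𝓡 n) 𝓘(ℝ, ℝ) f (e.symm y))
    (hg : MDifferentiableAt (𝓡 n) 𝓘(ℝ, ℝ) g (e.symm y)) (i : Fin n) :
    |pderiv i (f ∘ e.symm) y - pderiv i (g ∘ e.symm) y| ≤
      ‖differential n f (e.symm y) - differential n g (e.symm y)‖ * √(gram e y i i) := by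
  rw [← differential_coordVector he hy hf, ← differential_coordVector he hy hg]
  exact abs_functional_coordVector_le y i
    (differential n f (e.symm y) - differential n g (e.symm y))

variable [IsContMDiffRiemannianBundle (𝓡 n) ∞ (Coord n) (fun x : M => TangentSpace (𝓡 n) x)]
  [IsRiemannianManifold (𝓡 n) M]

theorem IsNormalChart.tendsto_symm (he : IsNormalChart e p) : Tendsto e.symm (𝓝 0) (𝓝 p) := by
  have := (e.symm.continuousAt (x := 0) he.zero_mem).tendsto
  rwa [he.symm_zero] at this

theorem IsNormalChart.eventually_mem_target (he : IsNormalChart e p) :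
    ∀ᶠ y in 𝓝 0, y ∈ e.target := e.open_target.mem_nhds he.zero_mem

theorem IsNormalChart.eventually_dist_symm_eq (he : IsNormalChart e p) :
    ∀ᶠ y in 𝓝 0, dist p (e.symm y) = ‖y‖ := by
  obtain ⟨r, hr, hball⟩ := Metric.nhds_basis_closedBall.mem_iff.1
    (e.open_target.mem_nhds he.zero_mem)
  filter_upwards [Metric.ball_mem_nhds (0 : Coord n) hr] with y hy
  refine he.dist_symm_eq ((Metric.closedBall_subset_closedBall ?_).trans hball)
  simpa using (Metric.mem_ball.1 hy).le

/-- The expansion `η² = φ₀ + φ₁ t + φ₂ t² + o(t²)`, `∇η² = ∇φ₀ + O(t)` at `p`, with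
`φ₀ = 1 + a_ij x^i x^j + o(d²)`. -/
structure IsExpansion (e : OpenPartialHomeomorph M (Coord n)) (p : M) (η : M → ℝ → ℝ)
    (φ₀ φ₁ φ₂ : M → ℝ) (a : Matrix (Fin n) (Fin n) ℝ) : Prop where
  expansion : (fun q : M × ℝ => η q.1 q.2 ^ 2 - (φ₀ q.1 + φ₁ q.1 * q.2 + φ₂ q.1 * q.2 ^ 2))
      =o[𝓝 p ×ˢ 𝓝[>] 0] fun q => q.2 ^ 2
  grad : (fun q : M × ℝ =>
        ‖differential n (fun y => η y q.2 ^ 2) q.1 - differential n φ₀ q.1‖)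
      =O[𝓝 p ×ˢ 𝓝[>] 0] fun q => q.2
  diff₀ : TimesDifferentiableAt 4 (φ₀ ∘ e.symm) 0
  diff₁ : TimesDifferentiableAt 2 (φ₁ ∘ e.symm) 0
  cont₂ : ContinuousAt φ₂ p
  isSymm : a.IsSymm
  quadratic : (fun x => φ₀ x - (1 + ∑ i, ∑ j, a i j * e x i * e x j))
      =o[𝓝 p] fun x => dist p x ^ 2

namespace IsExpansion

variable {η : M → ℝ → ℝ} {φ₀ φ₁ φ₂ : M → ℝ} {a : Matrix (Fin n) (Fin n) ℝ}

theorem tendsto_prod (he : IsNormalChart e p) :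
    Tendsto (fun q : Coord n × ℝ => (e.symm q.1, q.2)) (𝓝 0 ×ˢ 𝓝[>] 0) (𝓝 p ×ˢ 𝓝[>] 0) :=
  (he.tendsto_symm.comp tendsto_fst).prodMk tendsto_snd

theorem quadratic_chart (h : IsExpansion e p η φ₀ φ₁ φ₂ a) (he : IsNormalChart e p) :
    (fun y => (φ₀ ∘ e.symm) y - (1 + quadForm a y)) =o[𝓝 0] fun y => ‖y‖ ^ 2 := by
  refine (h.quadratic.comp_tendsto he.tendsto_symm).congr' ?_ ?_
  · filter_upwards [e.open_target.mem_nhds he.zero_mem] with y hy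
    simp only [Function.comp_apply, e.right_inv hy, quadForm]
  · filter_upwards [he.eventually_dist_symm_eq] with y hy
    simp only [Function.comp_apply, hy]

/-- The expansion of `η²` in normal coordinates. -/
theorem chart (h : IsExpansion e p η φ₀ φ₁ φ₂ a) (he : IsNormalChart e p) :
    (fun q : Coord n × ℝ => η (e.symm q.1) q.2 ^ 2 - (1 + quadForm a q.1 + φ₁ p * q.2))
      =o[𝓝 0 ×ˢ 𝓝[>] 0] fun q => ‖q.1‖ ^ 2 + q.2 := by
  have h1 := (h.expansion.comp_tendsto (tendsto_prod he)).trans_isBigO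
    (isLittleO_time_sq (n := n)).isBigO
  have h2 := ((h.quadratic_chart he).comp_tendsto
    (tendsto_fst (f := 𝓝 (0 : Coord n)) (g := 𝓝[>] (0 : ℝ)))).trans_isBigO isBigO_norm_sq
  have h3 : (fun q : Coord n × ℝ => (φ₁ (e.symm q.1) - φ₁ p) * q.2) =o[𝓝 0 ×ˢ 𝓝[>] 0]
      fun q => ‖q.1‖ ^ 2 + q.2 := by
    have h4 : Tendsto (fun y => φ₁ (e.symm y) - φ₁ p) (𝓝 0) (𝓝 0) := by
      have h5 := (h.diff₁.continuousAt (by norm_num)).tendsto.sub_const (φ₁ p)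
      simp only [Function.comp_apply, he.symm_zero, sub_self] at h5
      exact h5
    have h6 : (fun q : Coord n × ℝ => φ₁ (e.symm q.1) - φ₁ p) =o[𝓝 0 ×ˢ 𝓝[>] 0]
        fun _ => (1 : ℝ) := (isLittleO_one_iff ℝ).2 (h4.comp tendsto_fst)
    exact (h6.mul_isBigO isBigO_time).congr_right fun q => one_mul _
  have h7 : (fun q : Coord n × ℝ => φ₂ (e.symm q.1) * q.2 ^ 2) =o[𝓝 0 ×ˢ 𝓝[>] 0]
      fun q => ‖q.1‖ ^ 2 + q.2 := by
    have h8 : (fun q : Coord n × ℝ => φ₂ (e.symm q.1)) =O[𝓝 0 ×ˢ 𝓝[>] 0] fun _ => (1 : ℝ) :=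
      ((h.cont₂.tendsto.comp he.tendsto_symm).comp tendsto_fst).isBigO_one ℝ
    exact (h8.mul_isLittleO isLittleO_time_sq).congr_right fun q => one_mul _
  refine (((h1.add h2).add h3).add h7).congr_left fun q => ?_
  simp only [Function.comp_apply]
  ring

theorem tendsto_one (h : IsExpansion e p η φ₀ φ₁ φ₂ a) (he : IsNormalChart e p) :
    Tendsto (fun q : Coord n × ℝ => η (e.symm q.1) q.2 ^ 2) (𝓝 0 ×ˢ 𝓝[>] 0) (𝓝 1) := by
  have hs : Tendsto (fun q : Coord n × ℝ => ‖q.1‖ ^ 2 + q.2) (𝓝 0 ×ˢ 𝓝[>] 0) (𝓝 0) := by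
    have h1 : Tendsto (fun y : Coord n => ‖y‖ ^ 2) (𝓝 0) (𝓝 0) := by
      have : Continuous fun y : Coord n => ‖y‖ ^ 2 := by fun_prop
      simpa using this.tendsto 0
    simpa using (h1.comp tendsto_fst).add
      ((tendsto_nhdsWithin_of_tendsto_nhds (a := (0 : ℝ)) (s := Ioi 0) tendsto_id).comp tendsto_snd)
  have h1 := (h.chart he).isBigO.trans_tendsto hs
  have h2 := (isBigO_quadForm (n := n) a).trans_tendsto hs
  have h3 := (isBigO_time (n := n)).trans_tendsto hs
  have h4 := ((h1.add h2).add (h3.const_mul (φ₁ p))).add_const 1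
  simp only [add_zero, mul_zero, zero_add] at h4
  refine h4.congr fun q => ?_
  ring

/-- The expansion of the first derivatives of `η²` in normal coordinates. -/
theorem pderiv_chart (h : IsExpansion e p η φ₀ φ₁ φ₂ a) (he : IsNormalChart e p)
    (hη : ∀ᶠ t in 𝓝[>] 0, MDifferentiable (𝓡 n) 𝓘(ℝ, ℝ) fun x => η x t) (i : Fin n) :
    (fun q : Coord n × ℝ => pderiv i (fun y => η (e.symm y) q.2 ^ 2) q.1 -
      2 * ∑ j, a i j * q.1 j) =o[𝓝 0 ×ˢ 𝓝[>] 0] fun q => √(‖q.1‖ ^ 2 + q.2) := by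
  have hd := h.diff₀.eventually_differentiableAt (by norm_num)
  have h1 := pderiv_expansion h.isSymm hd (h.diff₀.differentiableAt_fderiv (by norm_num))
    (h.quadratic_chart he) i
  have h2 := (h1.comp_tendsto
    (tendsto_fst (f := 𝓝 (0 : Coord n)) (g := 𝓝[>] (0 : ℝ)))).trans_isBigO isBigO_norm_sqrt
  have h3 : (fun q : Coord n × ℝ => pderiv i (fun y => η (e.symm y) q.2 ^ 2) q.1 -
      pderiv i (φ₀ ∘ e.symm) q.1) =O[𝓝 0 ×ˢ 𝓝[>] 0] fun q => q.2 := by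
    have h4 := h.grad.comp_tendsto (tendsto_prod he)
    have h5 : (fun q : Coord n × ℝ => √(gram e q.1 i i)) =O[𝓝 0 ×ˢ 𝓝[>] 0] fun _ => (1 : ℝ) := by
      have h6 : ContinuousAt (fun y => √(gram e y i i)) 0 :=
        (contDiffAt_gram he.mem_maximalAtlas he.zero_mem i i).continuousAt.sqrt
      exact (h6.tendsto.comp tendsto_fst).isBigO_one ℝ
    refine (IsBigO.of_bound 1 ?_).trans ((h4.mul h5).congr_right fun q => mul_one _)
    filter_upwards [hd.prod_inl (𝓝[>] (0 : ℝ)), hη.prod_inr (𝓝 (0 : Coord n)),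
      he.eventually_mem_target.prod_inl (𝓝[>] (0 : ℝ))] with q hq1 hq2 hq3
    have hsq : MDifferentiableAt (𝓡 n) 𝓘(ℝ, ℝ) (fun x => η x q.2 ^ 2) (e.symm q.1) := by
      rw [← mdifferentiableAt_comp_symm_iff he.mem_maximalAtlas hq3]
      exact ((mdifferentiableAt_comp_symm_iff he.mem_maximalAtlas hq3).2 (hq2 _)).pow 2
    have h7 := abs_pderiv_sub_le he.mem_maximalAtlas hq3 hsq
      ((mdifferentiableAt_comp_symm_iff he.mem_maximalAtlas hq3).1 hq1) i
    rw [one_mul, Real.norm_eq_abs]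
    exact h7.trans (le_abs_self _)
  refine ((h3.trans_isLittleO isLittleO_time_sqrt).add h2).congr_left fun q => ?_
  simp only [Function.comp_apply]
  ring

/-- Each derivative of `η²` is replaced by its linear part `2 (a y)_i`, and the inverse metric by
its value `δ_ij` at the centre. The derivatives are `O(√(|y|² + t))` with errors of smaller order,
so every replacement costs only `o(|y|² + t)`. -/
theorem sum_inv_chart (h : IsExpansion e p η φ₀ φ₁ φ₂ a) (he : IsNormalChart e p)
    (hη : ∀ᶠ t in 𝓝[>] 0, MDifferentiable (𝓡 n) 𝓘(ℝ, ℝ) fun x => η x t) :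
    (fun q : Coord n × ℝ => (∑ i, ∑ j, (gram e q.1)⁻¹ i j *
      pderiv i (fun y => η (e.symm y) q.2 ^ 2) q.1 * pderiv j (fun y => η (e.symm y) q.2 ^ 2) q.1) -
      4 * quadForm (a * a) q.1) =o[𝓝 0 ×ˢ 𝓝[>] 0] fun q => ‖q.1‖ ^ 2 + q.2 := by
  set σ : Coord n × ℝ → ℝ := fun q => √(‖q.1‖ ^ 2 + q.2) with hσ
  set X : Fin n → Coord n × ℝ → ℝ := fun i q => pderiv i (fun y => η (e.symm y) q.2 ^ 2) q.1
    with hX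
  set A : Fin n → Coord n × ℝ → ℝ := fun i q => 2 * ∑ j, a i j * q.1 j with hA
  have hXA : ∀ i, (fun q => X i q - A i q) =o[𝓝 0 ×ˢ 𝓝[>] 0] σ := fun i => h.pderiv_chart he hη i
  have hAO : ∀ i, A i =O[𝓝 0 ×ˢ 𝓝[>] 0] σ := fun i => by
    refine IsBigO.const_mul_left (IsBigO.fun_sum fun j _ => IsBigO.const_mul_left ?_ _) _
    refine (IsBigO.of_bound 1 (Eventually.of_forall fun q => ?_)).trans isBigO_norm_sqrt
    rw [one_mul]
    exact PiLp.norm_apply_le q.1 j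
  have hXO : ∀ i, X i =O[𝓝 0 ×ˢ 𝓝[>] 0] σ := fun i =>
    ((hXA i).isBigO.add (hAO i)).congr_left fun q => sub_add_cancel _ _
  have hσσ : (fun q => σ q * σ q) =O[𝓝 0 ×ˢ 𝓝[>] 0] fun q : Coord n × ℝ => ‖q.1‖ ^ 2 + q.2 := by
    refine (isBigO_refl _ _).congr' (eventually_pos_snd.mono fun q hq => ?_) EventuallyEq.rfl
    exact (Real.mul_self_sqrt (by positivity)).symm
  have hterm : ∀ i j, (fun q : Coord n × ℝ => (gram e q.1)⁻¹ i j * X i q * X j q -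
      (1 : Matrix (Fin n) (Fin n) ℝ) i j * (A i q * A j q)) =o[𝓝 0 ×ˢ 𝓝[>] 0]
        fun q => ‖q.1‖ ^ 2 + q.2 := fun i j => by
    have hc : ContinuousAt (fun y => (gram e y)⁻¹ i j) 0 :=
      (contDiffAt_inv_apply (fun i j => contDiffAt_gram he.mem_maximalAtlas he.zero_mem i j)
        (gram_det_pos he.mem_maximalAtlas he.zero_mem).ne' i j).continuousAt
    have h1 : Tendsto (fun y => (gram e y)⁻¹ i j) (𝓝 0) (𝓝 ((1 : Matrix (Fin n) (Fin n) ℝ) i j)) := by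
      have := hc.tendsto
      rwa [he.orthonormal, inv_one] at this
    have h2 : (fun q : Coord n × ℝ => (gram e q.1)⁻¹ i j) =O[𝓝 0 ×ˢ 𝓝[>] 0] fun _ => (1 : ℝ) :=
      (h1.comp tendsto_fst).isBigO_one ℝ
    have h3 : (fun q : Coord n × ℝ => (gram e q.1)⁻¹ i j - (1 : Matrix (Fin n) (Fin n) ℝ) i j)
        =o[𝓝 0 ×ˢ 𝓝[>] 0] fun _ => (1 : ℝ) := by
      rw [isLittleO_one_iff]
      have := (h1.comp (tendsto_fst (f := 𝓝 (0 : Coord n)) (g := 𝓝[>] (0 : ℝ)))).sub_const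
        ((1 : Matrix (Fin n) (Fin n) ℝ) i j)
      rwa [sub_self] at this
    have h4 := (h2.mul_isLittleO ((hXO i).mul_isLittleO (hXA j))).congr_right fun q => one_mul _
    have h5 := (h2.mul_isLittleO ((hXA i).mul_isBigO (hAO j))).congr_right fun q => one_mul _
    have h6 := (h3.mul_isBigO ((hAO i).mul (hAO j))).congr_right fun q => one_mul _
    refine (((h4.add h5).add h6).trans_isBigO hσσ).congr_left fun q => ?_
    ring
  refine (IsLittleO.fun_sum (s := Finset.univ) fun i _ =>
    IsLittleO.fun_sum (s := Finset.univ) fun j _ => hterm i j).congr_left fun q => ?_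
  simp only [Finset.sum_sub_distrib]
  congr 1
  rw [quadForm_mul_self h.isSymm, Finset.mul_sum]
  refine Finset.sum_congr rfl fun i _ => ?_
  rw [Finset.sum_eq_single i (fun j _ hj => by rw [Matrix.one_apply_ne hj.symm, zero_mul])
    (by simp)]
  simp only [Matrix.one_apply_eq, hA]
  ring

theorem sum_inv_sq_eq {f : Coord n → ℝ} {y : Coord n} (hf : DifferentiableAt ℝ f y)
    (B : Matrix (Fin n) (Fin n) ℝ) :
    ∑ i, ∑ j, B i j * pderiv i (fun z => f z ^ 2) y * pderiv j (fun z => f z ^ 2) y =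
      4 * f y ^ 2 * ∑ i, ∑ j, B i j * pderiv i f y * pderiv j f y := by
  have h1 : ∀ i, pderiv i (fun z => f z ^ 2) y = 2 * f y * pderiv i f y := fun i => by
    simp [pderiv, fderiv_fun_pow 2 hf]
  simp only [h1, Finset.mul_sum]
  refine Finset.sum_congr rfl fun i _ => Finset.sum_congr rfl fun j _ => ?_
  ring

/-- The expansion of `4 |∇η|²` in normal coordinates. -/
theorem gradNorm_chart (h : IsExpansion e p η φ₀ φ₁ φ₂ a) (he : IsNormalChart e p)
    (hη : ∀ᶠ t in 𝓝[>] 0, MDifferentiable (𝓡 n) 𝓘(ℝ, ℝ) fun x => η x t) :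
    (fun q : Coord n × ℝ => 4 * gradNorm n (fun x => η x q.2) (e.symm q.1) ^ 2 -
      4 * quadForm (a * a) q.1) =o[𝓝 0 ×ˢ 𝓝[>] 0] fun q => ‖q.1‖ ^ 2 + q.2 := by
  set P : Coord n × ℝ → ℝ := fun q => 4 * gradNorm n (fun x => η x q.2) (e.symm q.1) ^ 2
  set θ : Coord n × ℝ → ℝ := fun q => η (e.symm q.1) q.2 ^ 2
  -- Since `|∇η²|² = 4 η² |∇η|²`, the expansion is first obtained for `P θ`. As `θ → 1`, the factor
  -- is removed once `θ > 1/2` has shown that `P` itself is `O(|y|² + t)`.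
  have h1 : (fun q => P q * θ q - 4 * quadForm (a * a) q.1) =o[𝓝 0 ×ˢ 𝓝[>] 0]
      fun q => ‖q.1‖ ^ 2 + q.2 := by
    refine (h.sum_inv_chart he hη).congr' ?_ EventuallyEq.rfl
    filter_upwards [hη.prod_inr (𝓝 (0 : Coord n)),
      he.eventually_mem_target.prod_inl (𝓝[>] (0 : ℝ))] with q hq2 hq3
    have hf : DifferentiableAt ℝ (fun y => η (e.symm y) q.2) q.1 :=
      (mdifferentiableAt_comp_symm_iff he.mem_maximalAtlas hq3 (f := fun x => η x q.2)).2 (hq2 _)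
    simp only [P, θ, gradNorm_sq_eq he.mem_maximalAtlas hq3]
    rw [sum_inv_sq_eq hf]
    simp only [Function.comp_def]
    ring
  have h2 : (fun q => P q * θ q) =O[𝓝 0 ×ˢ 𝓝[>] 0] fun q => ‖q.1‖ ^ 2 + q.2 :=
    (h1.isBigO.add ((isBigO_quadForm (a * a)).const_mul_left 4)).congr_left fun q =>
      sub_add_cancel _ _
  have hθ : ∀ᶠ q in 𝓝 (0 : Coord n) ×ˢ 𝓝[>] (0 : ℝ), 1 / 2 < θ q :=
    (h.tendsto_one he).eventually (lt_mem_nhds (by norm_num))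
  have h3 : P =O[𝓝 0 ×ˢ 𝓝[>] 0] fun q => ‖q.1‖ ^ 2 + q.2 := by
    refine (IsBigO.of_bound 2 ?_).trans h2
    filter_upwards [hθ] with q hq
    have hP : 0 ≤ P q := by positivity
    rw [Real.norm_of_nonneg hP, Real.norm_of_nonneg (by positivity)]
    nlinarith
  have h4 : (fun q => 1 - θ q) =o[𝓝 0 ×ˢ 𝓝[>] 0] fun _ => (1 : ℝ) := by
    rw [isLittleO_one_iff]
    have := (h.tendsto_one he).const_sub 1
    rwa [sub_self] at this
  have h5 := (h3.mul_isLittleO h4).congr_right fun q => mul_one _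
  refine (h1.add h5).congr_left fun q => ?_
  ring

end IsExpansion

end

end Riem

/-! ### The energy density in normal coordinates -/

namespace Riem

noncomputable section

open CoordMetric GaussianAverage

section Calculus

variable {n : ℕ}

/-- `B` fixes `y`, so the cross terms and the radial square are Euclidean. With `B` the inverse
metric this is how the Gauss lemma enters `|∇u|²`. -/
theorem sum_inv_sub_mul_self {B : Matrix (Fin n) (Fin n) ℝ} (hB : ∀ i j, B i j = B j i)
    {y : Coord n} (hy : ∀ i, ∑ j, B i j * y j = y i) (d : Fin n → ℝ) (E s : ℝ) :
    ∑ i, ∑ j, B i j * (E * (d i - y i * s)) * (E * (d j - y j * s)) =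
      E ^ 2 * ((∑ i, ∑ j, B i j * d i * d j) - 2 * s * ∑ i, d i * y i + s ^ 2 * ‖y‖ ^ 2) := by
  have h1 : ∑ i, ∑ j, B i j * d i * y j = ∑ i, d i * y i := by
    refine Finset.sum_congr rfl fun i _ => ?_
    rw [← hy i, Finset.mul_sum]
    exact Finset.sum_congr rfl fun j _ => by ring
  have h2 : ∑ i, ∑ j, B i j * y i * d j = ∑ i, d i * y i := by
    rw [Finset.sum_comm, ← h1]
    exact Finset.sum_congr rfl fun i _ => Finset.sum_congr rfl fun j _ => by rw [hB j i]; ring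
  have h3 : ∑ i, ∑ j, B i j * y i * y j = ‖y‖ ^ 2 := by
    rw [EuclideanSpace.norm_sq_eq]
    refine Finset.sum_congr rfl fun i _ => ?_
    rw [Real.norm_eq_abs, sq_abs, sq]
    nth_rw 3 [← hy i]
    rw [Finset.mul_sum]
    exact Finset.sum_congr rfl fun j _ => by ring
  have h4 : ∀ i j, B i j * (E * (d i - y i * s)) * (E * (d j - y j * s)) =
      E ^ 2 * (B i j * d i * d j) - E ^ 2 * s * (B i j * d i * y j) -
        E ^ 2 * s * (B i j * y i * d j) + E ^ 2 * s ^ 2 * (B i j * y i * y j) := fun i j => by ring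
  simp only [h4, Finset.sum_add_distrib, Finset.sum_sub_distrib, ← Finset.mul_sum]
  rw [h1, h2, h3]
  ring

theorem pderiv_gaussian_mul {ζ : Coord n → ℝ} {y : Coord n} (hζ : DifferentiableAt ℝ ζ y)
    (c t : ℝ) (i : Fin n) :
    pderiv i (fun z => c * Real.exp (-(‖z‖ ^ 2 / (8 * t))) * ζ z) y =
      c * Real.exp (-(‖y‖ ^ 2 / (8 * t))) * (pderiv i ζ y - y i * (ζ y / (4 * t))) := by
  have h1 : HasFDerivAt (fun z : Coord n => -(‖z‖ ^ 2 / (8 * t)))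
      (-((8 * t)⁻¹ • (2 • innerSL ℝ y))) y := by
    have := ((hasStrictFDerivAt_norm_sq y).hasFDerivAt.mul_const ((8 * t)⁻¹)).fun_neg
    simpa only [div_eq_mul_inv] using this
  have h2 := ((h1.exp.const_mul c).fun_mul hζ.hasFDerivAt).fderiv
  rw [pderiv, pderiv]
  rw [h2]
  have h3 : innerSL ℝ y (EuclideanSpace.single i (1 : ℝ)) = y i := by
    simp [innerSL_apply_apply, EuclideanSpace.inner_single_right]
  simp only [add_apply, smul_apply, neg_apply, smul_eq_mul, h3, nsmul_eq_mul]
  ring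

theorem sum_pderiv_mul (f : Coord n → ℝ) (y : Coord n) :
    ∑ i, pderiv i f y * y i = fderiv ℝ f y y := by
  have h1 : ∀ L : Coord n →L[ℝ] ℝ, ∑ i, L (EuclideanSpace.single i 1) * y i = L y := fun L => by
    conv_rhs => rw [← (EuclideanSpace.basisFun (Fin n) ℝ).sum_repr y]
    simp [map_sum, mul_comm]
  exact h1 (fderiv ℝ f y)

end Calculus

variable {n : ℕ} {M : Type*} [MetricSpace M] [ChartedSpace (Coord n) M]
  [RiemannianBundle (fun x : M => TangentSpace (𝓡 n) x)] [IsManifold (𝓡 n) ∞ M]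
  [IsContMDiffRiemannianBundle (𝓡 n) ∞ (Coord n) (fun x : M => TangentSpace (𝓡 n) x)]
  [IsRiemannianManifold (𝓡 n) M]
  {e : OpenPartialHomeomorph M (Coord n)} {p : M} {η : M → ℝ → ℝ}

theorem IsNormalChart.inv_gauss (he : IsNormalChart e p) {y : Coord n} (hy : y ∈ e.target)
    (i : Fin n) : ∑ j, (gram e y)⁻¹ i j * y j = y i := by
  have h1 : (gram e y).mulVec y = y := by
    ext j
    exact he.gauss hy j
  have h2 : ((gram e y)⁻¹).mulVec y = y := by
    conv_lhs => rw [← h1]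
    rw [Matrix.mulVec_mulVec, Matrix.nonsing_inv_mul _
      (gram_det_pos he.mem_maximalAtlas hy).ne'.isUnit, Matrix.one_mulVec]
  exact congrFun h2 i

theorem inv_gram_symm (y : Coord n) (i j : Fin n) : (gram e y)⁻¹ i j = (gram e y)⁻¹ j i := by
  have h1 : (gram e y).IsSymm := by
    ext i j
    exact gram_symm y j i
  have h2 : ((gram e y)⁻¹).IsSymm := by
    rw [Matrix.IsSymm, Matrix.transpose_nonsing_inv, h1]
  exact (h2.apply i j).symm

theorem IsNormalChart.gaussian_symm (he : IsNormalChart e p) {r : ℝ}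
    (hr : Metric.ball 0 r ⊆ e.target) {y : Coord n} (hy : y ∈ Metric.ball 0 r) (t : ℝ) :
    gaussian n p t (e.symm y) = heatKernel t y := by
  have : Metric.closedBall 0 ‖y‖ ⊆ e.target := by
    refine (Metric.closedBall_subset_ball ?_).trans hr
    simpa using hy
  rw [gaussian, he.dist_symm_eq this, heatKernel]

/-- The energy density of the test function in normal coordinates. -/
theorem IsNormalChart.energyDensity_symm (he : IsNormalChart e p) {r : ℝ}
    (hr : Metric.ball 0 r ⊆ e.target) {y : Coord n} (hy : y ∈ Metric.ball 0 r) {t : ℝ}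
    (ht : 0 < t) (hη : MDifferentiable (𝓡 n) 𝓘(ℝ, ℝ) fun x => η x t) :
    energyDensity n p η t (e.symm y) = heatKernel t y *
      (t * (4 * gradNorm n (fun x => η x t) (e.symm y) ^ 2) -
        fderiv ℝ (fun z => η (e.symm z) t ^ 2) y y + η (e.symm y) t ^ 2 * ‖y‖ ^ 2 / (2 * t) -
        n * η (e.symm y) t ^ 2 - η (e.symm y) t ^ 2 * Real.log (η (e.symm y) t ^ 2)) := by
  have hdist : ∀ z ∈ Metric.ball (0 : Coord n) r, dist p (e.symm z) = ‖z‖ := fun z hz => by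
    refine he.dist_symm_eq ((Metric.closedBall_subset_ball ?_).trans hr)
    simpa using hz
  have hyt := hr hy
  set ζ : Coord n → ℝ := (fun x => η x t) ∘ e.symm with hζ
  have hζd : DifferentiableAt ℝ ζ y :=
    (mdifferentiableAt_comp_symm_iff he.mem_maximalAtlas hyt).2 (hη _)
  set c := (4 * Real.pi * t) ^ (-(n : ℝ) / 4) with hc
  set E := c * Real.exp (-(‖y‖ ^ 2 / (8 * t))) with hE
  have hE2 : E ^ 2 = heatKernel t y := by
    have h1 := testFunction_sq (n := n) (p := p) (η := fun _ _ => 1) ht (e.symm y)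
    rw [testFunction, he.gaussian_symm hr hy, hdist y hy] at h1
    simpa using h1
  have hU : testFunction n p η t ∘ e.symm =ᶠ[𝓝 y]
      fun z => c * Real.exp (-(‖z‖ ^ 2 / (8 * t))) * ζ z := by
    filter_upwards [Metric.isOpen_ball.mem_nhds hy] with z hz
    simp only [Function.comp_apply, testFunction, hdist z hz, hζ, hc]
  have hgrad : gradNorm n (testFunction n p η t) (e.symm y) ^ 2 = heatKernel t y *
      (gradNorm n (fun x => η x t) (e.symm y) ^ 2 - 2 * (ζ y / (4 * t)) * fderiv ℝ ζ y y +
        (ζ y / (4 * t)) ^ 2 * ‖y‖ ^ 2) := by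
    rw [gradNorm_sq_eq he.mem_maximalAtlas hyt, gradNorm_sq_eq he.mem_maximalAtlas hyt, ← hE2,
      ← sum_pderiv_mul, ← sum_inv_sub_mul_self (inv_gram_symm y) (he.inv_gauss hyt)]
    have h2 : ∀ i, pderiv i (testFunction n p η t ∘ e.symm) y =
        E * (pderiv i ζ y - y i * (ζ y / (4 * t))) := fun i => by
      rw [(pderiv_congr hU i).self_of_nhds, pderiv_gaussian_mul hζd]
    simp only [h2, hζ]
  have hsq : fderiv ℝ (fun z => η (e.symm z) t ^ 2) y y = 2 * ζ y * fderiv ℝ ζ y y := by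
    change fderiv ℝ (fun z => ζ z ^ 2) y y = _
    simp [fderiv_fun_pow 2 hζd]
  have hζy : η (e.symm y) t = ζ y := rfl
  -- The squared gradient and the logarithm of the Gaussian each contribute `θ|y|²/(4t)`; together
  -- they give the `θ|y|²/(2t)` needed for the integration by parts.
  rw [energyDensity, entropy_density ht, testFunction_sq ht, he.gaussian_symm hr hy, hgrad, hsq,
    hdist y hy, hζy]
  field_simp
  ring

end

end Riem

/-! ### From the test function to an amplitude on `ℝⁿ` -/

namespace Riem

noncomputable section

open CoordMetric GaussianAverage

variable {n : ℕ} {M : Type*} [MetricSpace M] [ChartedSpace (Coord n) M]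
  [RiemannianBundle (fun x : M => TangentSpace (𝓡 n) x)] [IsManifold (𝓡 n) ∞ M]
  [IsContMDiffRiemannianBundle (𝓡 n) ∞ (Coord n) (fun x : M => TangentSpace (𝓡 n) x)]
  [IsRiemannianManifold (𝓡 n) M]
  {e : OpenPartialHomeomorph M (Coord n)} {p : M} {η : M → ℝ → ℝ}

/-- The function `η²` in a chart, glued with the constant `1` by means of a cutoff function. -/
def amplitude (e : OpenPartialHomeomorph M (Coord n)) (η : M → ℝ → ℝ) (χ : Coord n → ℝ) (t : ℝ)
    (y : Coord n) : ℝ :=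
  1 + χ y * (η (e.symm y) t ^ 2 - 1)

section Amplitude

variable {χ : Coord n → ℝ} {r : ℝ} {t : ℝ}

theorem fderiv_amplitude_of_mem (he : e ∈ IsManifold.maximalAtlas (𝓡 n) ∞ M)
    (hχ : Differentiable ℝ χ) (hη : MDifferentiable (𝓡 n) 𝓘(ℝ, ℝ) fun x => η x t) {y : Coord n}
    (hy : y ∈ e.target) :
    HasFDerivAt (amplitude e η χ t) (χ y • ((2 * η (e.symm y) t) •
      fderiv ℝ ((fun x => η x t) ∘ e.symm) y) + (η (e.symm y) t ^ 2 - 1) • fderiv ℝ χ y) y := by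
  have h1 : HasFDerivAt ((fun x => η x t) ∘ e.symm) (fderiv ℝ ((fun x => η x t) ∘ e.symm) y) y :=
    ((mdifferentiableAt_comp_symm_iff he hy).2 (hη _)).hasFDerivAt
  have h2 : HasFDerivAt (fun z => η (e.symm z) t ^ 2 - 1) ((2 * η (e.symm y) t) •
      fderiv ℝ ((fun x => η x t) ∘ e.symm) y) y := by
    have h3 := (h1.fun_mul h1).sub_const 1
    simp only [Function.comp_apply, ← sq, ← two_smul ℝ, smul_smul] at h3
    exact h3
  exact ((hχ y).hasFDerivAt.fun_mul h2).const_add 1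

theorem amplitude_eventuallyEq_one (hχ0 : tsupport χ ⊆ e.target) {y : Coord n}
    (hy : y ∉ e.target) : amplitude e η χ t =ᶠ[𝓝 y] fun _ => 1 := by
  have hy' : y ∈ (tsupport χ)ᶜ := fun h => hy (hχ0 h)
  filter_upwards [(isClosed_tsupport χ).isOpen_compl.mem_nhds hy'] with z hz
  simp [amplitude, image_eq_zero_of_notMem_tsupport hz]

theorem differentiable_amplitude (he : e ∈ IsManifold.maximalAtlas (𝓡 n) ∞ M)
    (hχ : Differentiable ℝ χ) (hχ0 : tsupport χ ⊆ e.target)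
    (hη : MDifferentiable (𝓡 n) 𝓘(ℝ, ℝ) fun x => η x t) :
    Differentiable ℝ (amplitude e η χ t) := fun y => by
  by_cases hy : y ∈ e.target
  · exact (fderiv_amplitude_of_mem he hχ hη hy).differentiableAt
  · exact (differentiableAt_const 1).congr_of_eventuallyEq (amplitude_eventuallyEq_one hχ0 hy)

theorem abs_amplitude_sub_one_le (hχ0 : ∀ y, 0 ≤ χ y) (hχ1 : ∀ y, χ y ≤ 1) {S : Set (Coord n)}
    (hχS : ∀ y, y ∉ S → χ y = 0) (hS : ∀ y ∈ S, |η (e.symm y) t ^ 2 - 1| ≤ 1 / 2) (y : Coord n) :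
    |amplitude e η χ t y - 1| ≤ 1 / 2 := by
  rw [amplitude, add_sub_cancel_left]
  by_cases hy : y ∈ S
  · rw [abs_mul, abs_of_nonneg (hχ0 y)]
    exact (mul_le_of_le_one_left (abs_nonneg _) (hχ1 y)).trans (hS y hy)
  · rw [hχS y hy]
    norm_num

theorem norm_fderiv_amplitude_le (he : e ∈ IsManifold.maximalAtlas (𝓡 n) ∞ M)
    (hχ : Differentiable ℝ χ) (hχ0 : ∀ y, 0 ≤ χ y) (hχ1 : ∀ y, χ y ≤ 1)
    (hχe : tsupport χ ⊆ e.target) (hη : MDifferentiable (𝓡 n) 𝓘(ℝ, ℝ) fun x => η x t)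
    {C B B' : ℝ} (hC : ∀ x, |η x t| ≤ C) (hC' : ∀ x, gradNorm n (fun y => η y t) x ≤ C)
    (hS : ∀ y ∈ tsupport χ, |η (e.symm y) t ^ 2 - 1| ≤ 1 / 2)
    (hB : ∀ y ∈ tsupport χ, ∑ i, √(gram e y i i) ≤ B) (hB0 : 0 ≤ B)
    (hB' : ∀ y, ‖fderiv ℝ χ y‖ ≤ B') (y : Coord n) :
    ‖fderiv ℝ (amplitude e η χ t) y‖ ≤ 2 * C * (C * B) + 1 / 2 * B' := by
  have hB'0 : 0 ≤ B' := (norm_nonneg _).trans (hB' y)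
  have hC0 : 0 ≤ C := (abs_nonneg _).trans (hC (e.symm y))
  by_cases hy : y ∈ tsupport χ
  · rw [(fderiv_amplitude_of_mem he hχ hη (hχe hy)).fderiv]
    have hζ : ‖fderiv ℝ ((fun x => η x t) ∘ e.symm) y‖ ≤ C * B := by
      refine (norm_le_sum_apply _).trans ?_
      calc _ ≤ ∑ i, C * √(gram e y i i) := by
            refine Finset.sum_le_sum fun i _ => ?_
            exact (abs_pderiv_le he (hχe hy) (hη _) i).trans
              (mul_le_mul_of_nonneg_right (hC' _) (Real.sqrt_nonneg _))
        _ ≤ C * B := by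
            rw [← Finset.mul_sum]
            exact mul_le_mul_of_nonneg_left (hB y hy) hC0
    refine (norm_add_le _ _).trans (add_le_add ?_ ?_)
    · rw [norm_smul, norm_smul, Real.norm_of_nonneg (hχ0 y), Real.norm_eq_abs, abs_mul, abs_two]
      refine (mul_le_of_le_one_left (by positivity) (hχ1 y)).trans ?_
      gcongr
      exact hC _
    · rw [norm_smul]
      exact mul_le_mul (hS y hy) (hB' y) (norm_nonneg _) (by norm_num)
  · have h1 : amplitude e η χ t =ᶠ[𝓝 y] fun _ => 1 := by
      filter_upwards [(isClosed_tsupport χ).isOpen_compl.mem_nhds hy] with z hz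
      simp [amplitude, image_eq_zero_of_notMem_tsupport hz]
    rw [h1.fderiv_eq]
    simp only [fderiv_fun_const, Pi.zero_apply, norm_zero]
    positivity

end Amplitude

variable {φ₀ φ₁ φ₂ : M → ℝ} {a : Matrix (Fin n) (Fin n) ℝ} {T : ℝ} {K : Set M} {C : ℝ}
  [SecondCountableTopology M] [MeasurableSpace M] [BorelSpace M]

/-- The test function determines an amplitude in normal coordinates. -/
theorem IsExpansion.exists_isAmplitude (h : IsExpansion e p η φ₀ φ₁ φ₂ a)
    (hη : IsCutoff n η T K C) (hT : 0 < T) (he : IsNormalChart e p) :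
    ∃ G, IsGaussMetric G ∧ ∃ r > 0, Metric.ball 0 r ⊆ e.target ∧
      (∀ y ∈ Metric.ball 0 r, G y = gram e y) ∧
      (∀ y ∈ Metric.ball 0 r, e.symm y ∈ (chartAt (Coord n) p).source) ∧
      ∃ χ : ContDiffBump (0 : Coord n), χ.rOut = r ∧ ∃ θ P C',
        IsAmplitude (fun y => χ y * √(G y).det) θ P a (φ₁ p) C' ∧
        ∀ t, ∀ y ∈ Metric.ball 0 r, θ t y = η (e.symm y) t ^ 2 ∧
          P t y = 4 * gradNorm n (fun x => η x t) (e.symm y) ^ 2 := by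
  classical
  have hnear : ∀ᶠ q in 𝓝 (0 : Coord n) ×ˢ 𝓝[>] (0 : ℝ),
      |η (e.symm q.1) q.2 ^ 2 - 1| ≤ 1 / 2 := by
    have h1 := ((h.tendsto_one he).sub_const 1).abs
    simp only [sub_self, abs_zero] at h1
    exact (h1.eventually (gt_mem_nhds (by norm_num : (0 : ℝ) < 1 / 2))).mono fun _ hq => le_of_lt hq
  obtain ⟨pa, hpa, pb, hpb, hpab⟩ := eventually_prod_iff.1 hnear
  have hsource : ∀ᶠ y in 𝓝 0, e.symm y ∈ (chartAt (Coord n) p).source :=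
    he.tendsto_symm.eventually (chart_source_mem_nhds (Coord n) p)
  obtain ⟨G, hG, R, hR, hRe, hGe⟩ := he.exists_isGaussMetric (hpa.and hsource)
  have hball : Metric.ball (0 : Coord n) (R / 2) ⊆ Metric.ball 0 R :=
    Metric.ball_subset_ball (by linarith)
  have hmem : ∀ y ∈ Metric.ball (0 : Coord n) R, y ∈ e.target ∧ pa y ∧
      e.symm y ∈ (chartAt (Coord n) p).source := fun y hy => hRe (Metric.ball_subset_closedBall hy)
  -- Two cutoffs are used: `χ` localizes the density, while `ψ`, equal to one wherever `χ` is
  -- nonzero, glues `η²` to the constant one. Thus `θ` is globally defined and, for small `t`, lies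
  -- in `[1/2, 3/2]`, yet agrees with `η²` under every integral.
  let χ : ContDiffBump (0 : Coord n) := ⟨R / 4, R / 2, by positivity, by linarith⟩
  let ψ : ContDiffBump (0 : Coord n) := ⟨R / 2, 3 * R / 4, by positivity, by linarith⟩
  have hψd : Differentiable ℝ ψ := (ψ.contDiff (n := 1)).differentiable (by norm_num)
  have hψt : tsupport ψ ⊆ Metric.ball 0 R := by
    rw [ψ.tsupport_eq]
    exact Metric.closedBall_subset_ball (by change 3 * R / 4 < R; linarith)
  have hψe : tsupport ψ ⊆ e.target := fun y hy => (hmem y (hψt hy)).1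
  have hψ1 : ∀ y ∈ Metric.ball (0 : Coord n) (R / 2), ψ y = 1 := fun y hy =>
    ψ.one_of_mem_closedBall (Metric.ball_subset_closedBall hy)
  have hψ0 : ∀ y, 0 ≤ ψ y := fun y => ψ.nonneg
  have hψle : ∀ y, ψ y ≤ 1 := fun y => ψ.le_one
  obtain ⟨B, hB⟩ := (isCompact_closedBall (0 : Coord n) R).exists_bound_of_continuousOn
    (f := fun y => ∑ i, √(gram e y i i)) (continuousOn_finsetSum _ fun i _ y hy =>
      (contDiffAt_gram he.mem_maximalAtlas (hRe hy).1 i i).continuousAt.sqrt.continuousWithinAt)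
  obtain ⟨B', hB'⟩ := (ψ.hasCompactSupport.fderiv ℝ).exists_bound_of_continuous
    ((ψ.contDiff (n := 1)).continuous_fderiv (by norm_num))
  -- A measurable extension of the inverse chart, which makes `P` measurable and bounded on all of
  -- `ℝⁿ`; its values outside the small ball never reach an integral.
  set s : Coord n → M := (Metric.ball 0 R).piecewise e.symm fun _ => p with hs
  have hsm : Measurable s := ContinuousOn.measurable_piecewise
    (e.continuousOn_symm.mono fun y hy => (hmem y hy).1) continuousOn_const measurableSet_ball
  have hsy : ∀ y ∈ Metric.ball (0 : Coord n) R, s y = e.symm y := fun y hy =>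
    piecewise_eq_of_mem _ _ _ hy
  have hT' : ∀ᶠ t in 𝓝[>] (0 : ℝ), t ∈ Ioo 0 T := Ioo_mem_nhdsGT hT
  have hC0 : 0 ≤ C := hη.nonneg p (t := T / 2) ⟨by positivity, by linarith⟩
  have hB0 : 0 ≤ B := (norm_nonneg _).trans (hB 0 (by simp [hR.le]))
  have hB'0 : 0 ≤ B' := (norm_nonneg _).trans (hB' 0)
  have hk : (fun y => χ y * √(G y).det) =ᶠ[𝓝 0] fun y => √(G y).det := by
    filter_upwards [χ.eventuallyEq_one] with y hy
    rw [hy, Pi.one_apply, one_mul]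
  have hnear0 : ∀ᶠ y in 𝓝 (0 : Coord n), y ∈ Metric.ball (0 : Coord n) (R / 2) :=
    Metric.ball_mem_nhds 0 (by positivity)
  have hθ : ∀ t, ∀ y ∈ Metric.ball (0 : Coord n) (R / 2),
      amplitude e η ψ t y = η (e.symm y) t ^ 2 := fun t y hy => by
    rw [amplitude, hψ1 y hy]
    ring
  refine ⟨G, hG, R / 2, by positivity, fun y hy => (hmem y (hball hy)).1,
    fun y hy => hGe y (hball hy), fun y hy => (hmem y (hball hy)).2.2, χ, rfl,
    amplitude e η ψ, fun t y => 4 * gradNorm n (fun x => η x t) (s y) ^ 2,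
    2 * C * (C * B) + 1 / 2 * B' + 4 * C ^ 2, ?_,
    fun t y hy => ⟨hθ t y hy, by simp only [hsy y (hball hy)]⟩⟩
  have habs : ∀ᶠ t in 𝓝[>] (0 : ℝ), ∀ y, |amplitude e η ψ t y - 1| ≤ 1 / 2 := by
    filter_upwards [hpb] with t ht
    refine abs_amplitude_sub_one_le hψ0 hψle (S := tsupport ψ)
      (fun y hy => image_eq_zero_of_notMem_tsupport hy) fun y hy => ?_
    exact hpab (hmem y (hψt hy)).2.1 ht
  exact
  { smooth := χ.contDiff.mul hG.contDiff_density
    compact := χ.hasCompactSupport.mul_right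
    one := hG.cutoff_zero hk
    crit := hG.pderiv_cutoff hk
    diff := by
      filter_upwards [hT'] with t ht
      exact differentiable_amplitude he.mem_maximalAtlas hψd hψe (hη.diff t ht)
    lower := by
      filter_upwards [habs] with t ht y
      linarith [(abs_le.1 (ht y)).1]
    upper := by
      filter_upwards [habs] with t ht y
      linarith [(abs_le.1 (ht y)).2]
    fderiv_le := by
      filter_upwards [hT', hpb] with t ht htb y
      refine (norm_fderiv_amplitude_le he.mem_maximalAtlas hψd hψ0 hψle hψe (hη.diff t ht)
        (hη.bound t ht) (hη.grad_bound t ht) (fun y hy => hpab (hmem y (hψt hy)).2.1 htb)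
        (fun y hy => (le_abs_self _).trans (hB y (Metric.ball_subset_closedBall (hψt hy)))) hB0
        hB' y).trans ?_
      nlinarith [sq_nonneg C]
    measurable := by
      filter_upwards with t
      exact ((measurable_gradNorm_sq _).comp hsm).const_mul 4
    bounded := by
      filter_upwards [hT'] with t ht y
      have h1 := pow_le_pow_left₀ (gradNorm_nonneg _ _) (hη.grad_bound t ht (s y)) 2
      rw [abs_of_nonneg (by positivity)]
      have : 0 ≤ 2 * C * (C * B) := by positivity
      linarith
    expansion := by
      refine (h.chart he).congr' ?_ EventuallyEq.rfl
      filter_upwards [hnear0.prod_inl (𝓝[>] (0 : ℝ))] with q hq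
      rw [hθ q.2 q.1 hq]
    grad_expansion := by
      refine (h.gradNorm_chart he (hT'.mono fun t ht => hη.diff t ht)).congr' ?_ EventuallyEq.rfl
      filter_upwards [hnear0.prod_inl (𝓝[>] (0 : ℝ))] with q hq
      rw [hsy q.1 (hball hq)] }

end

end Riem

/-! ### Assembly of the expansions -/

namespace Riem

noncomputable section

open CoordMetric GaussianAverage

variable {n : ℕ} {M : Type*} [MetricSpace M] [ChartedSpace (Coord n) M]
  [RiemannianBundle (fun x : M => TangentSpace (𝓡 n) x)] [IsManifold (𝓡 n) ∞ M]
  [IsContMDiffRiemannianBundle (𝓡 n) ∞ (Coord n) (fun x : M => TangentSpace (𝓡 n) x)]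
  [IsRiemannianManifold (𝓡 n) M]
  {e : OpenPartialHomeomorph M (Coord n)} {p : M} {η : M → ℝ → ℝ}
  {φ₀ φ₁ φ₂ : M → ℝ} {a : Matrix (Fin n) (Fin n) ℝ} {T : ℝ} {K : Set M} {C : ℝ}
  [SecondCountableTopology M] [MeasurableSpace M] [BorelSpace M]

/-- The integral of a function on the chart domain against a cutoff of the Riemannian density is a
Gaussian average. -/
theorem integral_cutoff_eq_avg {G : Coord n → Matrix (Fin n) (Fin n) ℝ} {r : ℝ}
    (hG : ∀ y ∈ Metric.ball 0 r, G y = gram e y) {χ : Coord n → ℝ}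
    (hχ : ∀ y, y ∉ Metric.ball 0 r → χ y = 0) {f : M → ℝ} {F : Coord n → ℝ} {t : ℝ}
    (hf : ∀ y ∈ Metric.ball 0 r, f (e.symm y) = heatKernel t y * F y) :
    ∫ y, χ y * density e y * f (e.symm y) = avg t fun y => χ y * √(G y).det * F y := by
  refine integral_congr_ae (Eventually.of_forall fun y => ?_)
  by_cases hy : y ∈ Metric.ball 0 r
  · simp only [density, hG y hy, hf y hy]
    ring
  · simp only [hχ y hy, zero_mul, mul_zero]

/-- The expansions of the energy, the total mass and the total scalar curvature of the test
function. -/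
theorem IsExpansion.integral_expansion (h : IsExpansion e p η φ₀ φ₁ φ₂ a)
    (hη : IsCutoff n η T K C) (hT : 0 < T) (he : IsNormalChart e p) :
    ((fun t => (∫ x, testFunction n p η t x ^ 2 ∂volumeMeasure n M) -
      (1 + t * (-(1 / 3) * scalarCurvature n p + 2 * a.trace + φ₁ p))) =o[𝓝[>] 0]
        fun t => t ^ 1) ∧
    ((fun t => (∫ x, scalarCurvature n x * testFunction n p η t x ^ 2 ∂volumeMeasure n M) -
      (scalarCurvature n p + t * (laplacian n (scalarCurvature n) p -
        1 / 3 * scalarCurvature n p ^ 2 + scalarCurvature n p * (2 * a.trace + φ₁ p))))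
        =o[𝓝[>] 0] fun t => t ^ 1) ∧
    ((fun t => (∫ x, energyDensity n p η t x ∂volumeMeasure n M) +
      ((∫ x, testFunction n p η t x ^ 2 ∂volumeMeasure n M) - 1) -
      (-scalarCurvature n p * t + t ^ 2 * (-laplacian n (scalarCurvature n) p +
        5 / 18 * scalarCurvature n p ^ 2 - 1 / 6 * curvatureNormSq n p +
        4 / 9 * ∑ i, ∑ j, ricci (gram e) i j 0 ^ 2 - 4 / 3 * scalarCurvature n p * a.trace -
        8 / 3 * ∑ i, ∑ j, ricci (gram e) i j 0 * a i j - 2 / 3 * φ₁ p * scalarCurvature n p +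
        4 * (a * a).trace - 2 * a.trace ^ 2 - 2 * φ₁ p * a.trace - 1 / 2 * φ₁ p ^ 2)))
        =o[𝓝[>] 0] fun t => t ^ 2) := by
  obtain ⟨G, hG, r, hr, hre, hGe, hrp, χ, hχr, θ, P, C', hamp, hθP⟩ :=
    h.exists_isAmplitude hη hT he
  set k : Coord n → ℝ := fun y => χ y * √(G y).det with hkdef
  have hk : k =ᶠ[𝓝 0] fun y => √(G y).det := by
    filter_upwards [χ.eventuallyEq_one] with y hy
    rw [hkdef]
    simp only
    rw [hy, Pi.one_apply, one_mul]
  have hχ0 : ∀ y, y ∉ Metric.ball 0 r → χ y = 0 := fun y hy => by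
    refine χ.zero_of_le_dist ?_
    rw [hχr]
    exact not_lt.1 hy
  have hGgram : G =ᶠ[𝓝 0] gram e := by
    filter_upwards [Metric.ball_mem_nhds (0 : Coord n) hr] with y hy using hGe y hy
  have hmax := he.mem_maximalAtlas
  have hS : scalar G 0 = scalarCurvature n p := by
    rw [(scalar_congr hGgram).eq_of_nhds, ← scalarCurvature_eq hmax he.zero_mem, he.symm_zero]
  have hRm : riemannNormSq G 0 = curvatureNormSq n p := by
    rw [riemannNormSq_congr hGgram, ← curvatureNormSq_eq hmax he.zero_mem, he.symm_zero]
  have hΔ : laplace G (scalar G) 0 = laplacian n (scalarCurvature n) p := by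
    rw [laplace_congr hGgram (scalar_congr hGgram),
      ← laplacian_scalarCurvature_eq hmax he.zero_mem, he.symm_zero]
  have hRc : ∀ i j, ricci G i j 0 = ricci (gram e) i j 0 := fun i j =>
    (ricci_congr hGgram i j).eq_of_nhds
  have hSsmooth : ContDiff ℝ ∞ (scalar G) := contDiff_iff_contDiffAt.2 fun y =>
    contDiffAt_scalar (fun i j => (hG.smooth i j).contDiffAt) (hG.det_pos y).ne'
  -- Localization errors are smaller than any power of `t`. Order one suffices for the mass and the
  -- total scalar curvature; order two is needed for the energy, and for the mass that accompanies
  -- it in `energy_expansion`.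
  obtain ⟨hlm, hls, -⟩ := hη.localization he hT χ.continuous (fun y => χ.nonneg)
    (fun y => χ.le_one) hre hχ0 hrp χ.rIn_pos (hχr ▸ χ.rIn_lt_rOut.le)
    (fun y hy => χ.one_of_mem_closedBall (Metric.ball_subset_closedBall hy)) 1
  obtain ⟨hlm2, -, hle⟩ := hη.localization he hT χ.continuous (fun y => χ.nonneg)
    (fun y => χ.le_one) hre hχ0 hrp χ.rIn_pos (hχr ▸ χ.rIn_lt_rOut.le)
    (fun y hy => χ.one_of_mem_closedBall (Metric.ball_subset_closedBall hy)) 2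
  have hmass : ∀ t ∈ Ioo 0 T, ∫ y, χ y * density e y * testFunction n p η t (e.symm y) ^ 2 =
      avg t fun y => k y * θ t y := fun t ht =>
    integral_cutoff_eq_avg hGe hχ0 (f := fun x => testFunction n p η t x ^ 2) fun y hy => by
      rw [testFunction_sq ht.1, he.gaussian_symm hre hy, (hθP t y hy).1]
  have hscal : ∀ t ∈ Ioo 0 T, ∫ y, χ y * density e y *
      (scalarCurvature n (e.symm y) * testFunction n p η t (e.symm y) ^ 2) =
      avg t fun y => k y * scalar G y * θ t y := fun t ht => by
    rw [integral_cutoff_eq_avg hGe hχ0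
      (f := fun x => scalarCurvature n x * testFunction n p η t x ^ 2)
      (F := fun y => scalar G y * θ t y) (t := t)]
    · simp only [hkdef, mul_assoc]
    · intro y hy
      have h1 : G =ᶠ[𝓝 y] gram e := by
        filter_upwards [Metric.isOpen_ball.mem_nhds hy] with z hz using hGe z hz
      rw [testFunction_sq ht.1, he.gaussian_symm hre hy, (hθP t y hy).1,
        scalarCurvature_eq hmax (hre hy), (scalar_congr h1).eq_of_nhds]
      ring
  have henergy : ∀ t ∈ Ioo 0 T, ∫ y, χ y * density e y * energyDensity n p η t (e.symm y) =
      avg t fun y => k y * (t * P t y - fderiv ℝ (θ t) y y +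
        θ t y * ‖y‖ ^ 2 / (2 * t) - n * θ t y - θ t y * Real.log (θ t y)) := fun t ht =>
    integral_cutoff_eq_avg hGe hχ0 fun y hy => by
      have h1 : θ t =ᶠ[𝓝 y] fun z => η (e.symm z) t ^ 2 := by
        filter_upwards [Metric.isOpen_ball.mem_nhds hy] with z hz using (hθP t z hz).1
      rw [he.energyDensity_symm hre hy ht.1 (hη.diff t ht), (hθP t y hy).1, (hθP t y hy).2,
        h1.fderiv_eq]
  have hk0 : k 0 = 1 := hG.cutoff_zero hk
  have hΔk := hG.flatLaplacian_cutoff hk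
  refine ⟨?_, ?_, ?_⟩
  · refine (hlm.add (hamp.avg_first_order hamp.smooth hamp.compact)).congr' ?_ EventuallyEq.rfl
    filter_upwards [Ioo_mem_nhdsGT hT] with t ht
    rw [hmass t ht, hΔk, hk0, hS]
    ring
  · have hkS : HasCompactSupport fun y => k y * scalar G y := hamp.compact.mul_right
    refine (hls.add (hamp.avg_first_order (hamp.smooth.mul hSsmooth) hkS)).congr' ?_
      EventuallyEq.rfl
    filter_upwards [Ioo_mem_nhdsGT hT] with t ht
    rw [hscal t ht, flatLaplacian_mul_zero hamp.smooth hSsmooth, ← hG.laplace_zero (scalar G), hΔ,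
      hΔk, hk0, hS]
    simp only [hamp.crit, zero_mul, Finset.sum_const_zero]
    ring
  -- In `energy_expansion`, `3 t Δk(0)` becomes `-Sc t`, and `5/2 Δ²k(0)` supplies `-ΔSc + 5/18 Sc²
  -- - |Rm|²/6 + 4/9 |Rc|²`.
  · refine ((hle.add hlm2).add (hamp.energy_expansion h.isSymm)).congr' ?_ EventuallyEq.rfl
    filter_upwards [Ioo_mem_nhdsGT hT] with t ht
    have h1 : ∑ i, ∑ j, pderiv i (pderiv j k) 0 * a i j =
        -(1 / 3) * ∑ i, ∑ j, ricci (gram e) i j 0 * a i j := by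
      simp only [hG.pderiv_pderiv_cutoff hk, hRc, mul_assoc, Finset.mul_sum]
    rw [henergy t ht, hmass t ht, h1, hG.bilaplacian_cutoff hk, hΔk, hS, hRm, hΔ]
    simp only [hRc]
    ring

theorem trace_mul_self_of_isSymm (ha : a.IsSymm) : (a * a).trace = ∑ i, ∑ j, a i j ^ 2 := by
  simp only [Matrix.trace, Matrix.diag, Matrix.mul_apply]
  refine Finset.sum_congr rfl fun i _ => Finset.sum_congr rfl fun j _ => ?_
  rw [ha.apply i j, sq]

theorem sum_sub_ricci_sq (a R : Fin n → Fin n → ℝ) : ∑ i, ∑ j, (a i j - 1 / 3 * R i j) ^ 2 =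
    (∑ i, ∑ j, a i j ^ 2) - 2 / 3 * (∑ i, ∑ j, R i j * a i j) +
      1 / 9 * ∑ i, ∑ j, R i j ^ 2 := by
  simp only [Finset.mul_sum, ← Finset.sum_add_distrib, ← Finset.sum_sub_distrib]
  exact Finset.sum_congr rfl fun i _ => Finset.sum_congr rfl fun j _ => by ring

end

end Riem

theorem theorem2p1 {n : ℕ} {M : Type*} [MetricSpace M] [SecondCountableTopology M]
    [MeasurableSpace M] [BorelSpace M] [ChartedSpace (Coord n) M] [IsManifold (𝓡 n) ∞ M]
    [RiemannianBundle (fun x : M => TangentSpace (𝓡 n) x)]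
    [IsContMDiffRiemannianBundle (𝓡 n) ∞ (Coord n) (fun x : M => TangentSpace (𝓡 n) x)]
    [IsRiemannianManifold (𝓡 n) M]
    (p : M) (V : Set M) (hV : V ∈ 𝓝 p)
    -- normal coordinates at `p`
    (e : OpenPartialHomeomorph M (Coord n)) (he : Riem.IsNormalChart e p)
    -- for `0 < t < T`, `η(·, t)` is a differentiable function supported in the compact set `K ⊆ V`,
    -- and `|η|`, `|∇η|` are bounded uniformly in `t`
    (η : M → ℝ → ℝ) (T : ℝ) (hT : 0 < T) (K : Set M) (hK : IsCompact K) (hKV : K ⊆ V)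
    (hsupp : ∀ t ∈ Ioo 0 T, ∀ x, x ∉ K → η x t = 0)
    (hdiff : ∀ t ∈ Ioo 0 T, MDifferentiable (𝓡 n) 𝓘(ℝ, ℝ) fun x => η x t)
    (C : ℝ) (hbound : ∀ t ∈ Ioo 0 T, ∀ x, |η x t| ≤ C)
    (hbound' : ∀ t ∈ Ioo 0 T, ∀ x, Riem.gradNorm n (fun y => η y t) x ≤ C)
    -- `η² = φ₀ + φ₁ t + φ₂ t² + o(t²)` and `∇η² = ∇φ₀ + O(t)` as `(x, t) → (p, 0)`, `t > 0`
    (φ₀ φ₁ φ₂ : M → ℝ)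
    (hexp : (fun q : M × ℝ => η q.1 q.2 ^ 2 - (φ₀ q.1 + φ₁ q.1 * q.2 + φ₂ q.1 * q.2 ^ 2))
      =o[𝓝 p ×ˢ 𝓝[>] 0] fun q => q.2 ^ 2)
    (hgrad : (fun q : M × ℝ =>
        ‖Riem.differential n (fun y => η y q.2 ^ 2) q.1 - Riem.differential n φ₀ q.1‖)
      =O[𝓝 p ×ˢ 𝓝[>] 0] fun q => q.2)
    -- regularity at `p`
    (hφ₀ : CoordMetric.TimesDifferentiableAt 4 (φ₀ ∘ e.symm) 0)
    (hφ₁ : CoordMetric.TimesDifferentiableAt 2 (φ₁ ∘ e.symm) 0)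
    (hφ₂ : ContinuousAt φ₂ p)
    -- `φ₀ = 1 + a_ij x^i x^j + o(d²)`
    (a : Matrix (Fin n) (Fin n) ℝ) (ha : a.IsSymm)
    (ha₀ : (fun x => φ₀ x - (1 + ∑ i, ∑ j, a i j * e x i * e x j))
      =o[𝓝 p] fun x => dist p x ^ 2) :
    (∀ᶠ t in 𝓝[>] (0 : ℝ), Riem.HasFiniteEnergy n V (Riem.testFunction n p η t)) ∧
    (fun t : ℝ => Riem.logSobolev n V (Riem.testFunction n p η t) t -
        (-Riem.scalarCurvature n p * t -
          (Riem.laplacian n (Riem.scalarCurvature n) p - 1 / 3 * Riem.scalarCurvature n p ^ 2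
            + 2 * a.trace * Riem.scalarCurvature n p + φ₁ p * Riem.scalarCurvature n p
            + 1 / 6 * Riem.curvatureNormSq n p
            - 4 * ∑ i, ∑ j, (a i j - 1 / 3 * CoordMetric.ricci (Riem.gram e) i j 0) ^ 2) * t ^ 2))
      =o[𝓝[>] 0] (fun t => t ^ 2) ∧
    (fun t : ℝ => Riem.perelmanW n V (Riem.testFunction n p η t) t -
        (-(1 / 6 * Riem.curvatureNormSq n p
            - 4 * ∑ i, ∑ j, (a i j - 1 / 3 * CoordMetric.ricci (Riem.gram e) i j 0) ^ 2) * t ^ 2))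
      =o[𝓝[>] 0] (fun t => t ^ 2) := by
  have hη : Riem.IsCutoff n η T K C := ⟨hK, hsupp, hdiff, hbound, hbound'⟩
  have h : Riem.IsExpansion e p η φ₀ φ₁ φ₂ a := ⟨hexp, hgrad, hφ₀, hφ₁, hφ₂, ha, ha₀⟩
  obtain ⟨hm, hs, hE⟩ := h.integral_expansion hη hT he
  have hlog := GaussianAverage.mul_log_expansion (c := -(1 / 3) * Riem.scalarCurvature n p +
    2 * a.trace + φ₁ p) hm
  have hsum := Riem.sum_sub_ricci_sq a fun i j => CoordMetric.ricci (Riem.gram e) i j 0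
  have hL : (fun t : ℝ => Riem.logSobolev n V (Riem.testFunction n p η t) t -
        (-Riem.scalarCurvature n p * t -
          (Riem.laplacian n (Riem.scalarCurvature n) p - 1 / 3 * Riem.scalarCurvature n p ^ 2
            + 2 * a.trace * Riem.scalarCurvature n p + φ₁ p * Riem.scalarCurvature n p
            + 1 / 6 * Riem.curvatureNormSq n p
            - 4 * ∑ i, ∑ j, (a i j - 1 / 3 * CoordMetric.ricci (Riem.gram e) i j 0) ^ 2) * t ^ 2))
      =o[𝓝[>] 0] (fun t => t ^ 2) := by
    -- With `m` the total mass, `m - 1` cancels between the energy and `m log m`. The quadratic term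
    -- `(-Sc/3 + 2 tr a + α)²/2` removes `(tr a)²`, `α tr a` and `α²`, and `hsum` collects the Ricci
    -- terms into a square.
    refine (hE.add hlog).congr' ?_ EventuallyEq.rfl
    filter_upwards [Ioo_mem_nhdsGT hT] with t ht
    rw [hη.logSobolev_eq hKV ht, hsum, Riem.trace_mul_self_of_isSymm ha]
    ring
  refine ⟨?_, hL, ?_⟩
  · filter_upwards [Ioo_mem_nhdsGT hT] with t ht using hη.hasFiniteEnergy V ht
  -- Multiplied by `t`, the first-order expansion of the total scalar curvature cancels every term
  -- of `𝓛` that contains `Sc` or `ΔSc`.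
  · have hts := ((isBigO_refl (fun t : ℝ => t) (𝓝[>] 0)).mul_isLittleO hs).congr_right
      (g₂ := fun t : ℝ => t ^ 2) fun t => by ring
    refine (hL.add hts).congr' ?_ EventuallyEq.rfl
    filter_upwards [Ioo_mem_nhdsGT hT] with t ht
    rw [hη.perelmanW_eq hKV ht]
    ring
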